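/- Let $P$ be a finite non-empty set of points in the Euclidean plane, in general position (no three of its points are collinear). A geometric graph on $P$ is a simple graph with vertex set $P$ whose edges are drawn as straight line segments; it is non-crossing if any two edges without a common endpoint are disjoint as closed segments. A vertex of a geometric graph is pointed if two consecutive edges in the cyclic order around it span an angle larger than $\pi$; vertices of degree $0$ or $1$ also count as pointed (the free angle there being $2\pi$). The faces of a non-crossing geometric graph are the connected components of the complement of its points and edges. A pseudo-triangle is the interior of a simple polygon with exactly three corners, where a corner is a vertex whose interior angle is strictly smaller than $\pi$. A non-crossing geometric graph on $P$ is a pseudo-triangulation of $P$ if it is connected, its points, edges and bounded faces together cover exactly the convex hull of $P$, and every bounded face is a pseudo-triangle bounded by a cycle of the graph. **Theorem.** Let $T$ be a non-crossing geometric graph on $P$. Then $T$ is a pseudo-triangulation of $P$ if and only if its edge set is maximal (with respect to inclusion) among the edge sets of the non-crossing geometric graphs with vertex set $P$ that have the same set of pointed vertices as $T$. -/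

import Mathlib

namespace PseudoTriang

/-- The Euclidean plane. -/
abbrev Plane : Type := EuclideanSpace ℝ (Fin 2)

/-- The polar angle (in `(-π, π]`) of a nonzero vector of the plane. -/
noncomputable def direction (x : Plane) : ℝ := Complex.arg ⟨x 0, x 1⟩

/-- The counterclockwise angle, normalized to lie in `(0, 2π]`, through which the ray from `v`
to `a` has to be turned around `v` until it reaches the ray from `v` to `b`. It is `2π` when the
two rays coincide. -/
noncomputable def ccwAngle (v a b : Plane) : ℝ :=
  toIocMod Real.two_pi_pos 0 (direction (b - v) - direction (a - v))

/-- `C` is a connected component of the set `U`. -/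
def IsComponent (C U : Set Plane) : Prop := ∃ x ∈ U, C = connectedComponentIn U x

/-! ### Simple polygons and pseudo-triangles

A closed polygon is given by the cyclic sequence `w : ZMod k → Plane` of its vertices. -/

/-- The boundary curve of a closed polygon: the union of its edges. -/
def polygonBoundary {k : ℕ} (w : ZMod k → Plane) : Set Plane :=
  ⋃ i, segment ℝ (w i) (w (i + 1))

/-- A simple polygon: a straight-line drawing of a cycle on `k ≥ 3` distinct vertices, in which
two consecutive edges meet in their common vertex only and other pairs of edges are disjoint. -/
structure IsSimplePolygon {k : ℕ} (w : ZMod k → Plane) : Prop where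
  three_le : 3 ≤ k
  injective : Function.Injective w
  consecutive : ∀ i,
    segment ℝ (w i) (w (i + 1)) ∩ segment ℝ (w (i + 1)) (w (i + 1 + 1)) = {w (i + 1)}
  nonconsecutive : ∀ i j, i ≠ j → j ≠ i + 1 → i ≠ j + 1 →
    Disjoint (segment ℝ (w i) (w (i + 1))) (segment ℝ (w j) (w (j + 1)))

/-- `R` is the (open) interior region of the polygon `w`: the bounded component of the complement
of the boundary curve. -/
def IsInteriorOf {k : ℕ} (R : Set Plane) (w : ZMod k → Plane) : Prop :=
  IsComponent R (polygonBoundary w)ᶜ ∧ Bornology.IsBounded R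

/-- The vertex `w i` is a corner (a convex vertex) of the region `R` bounded by the polygon `w`:
the angle at `w i` between its two incident edges that faces `R` is strictly smaller than `π`.
That is, near `w i`, the open convex angular sector spanned by the two edges lies in `R`.
(At a straight vertex that "sector" is contained in the boundary, and at a reflex vertex
it lies outside `R`.) -/
def IsCorner {k : ℕ} (R : Set Plane) (w : ZMod k → Plane) (i : ZMod k) : Prop :=
  ∃ ε > (0 : ℝ), ∀ s t : ℝ, 0 < s → s < ε → 0 < t → t < ε →
    w i + s • (w (i + 1) - w i) + t • (w (i - 1) - w i) ∈ R

/-- `R` is a pseudo-triangle with boundary polygon `w`: the interior of a simple polygon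
that has exactly three corners. -/
def IsPseudoTriangle {k : ℕ} (R : Set Plane) (w : ZMod k → Plane) : Prop :=
  IsSimplePolygon w ∧ IsInteriorOf R w ∧ {i | IsCorner R w i}.ncard = 3

/-! ### Geometric graphs

A geometric graph is a graph `G` on `V` with the map `p : V → Plane` placing its vertices; edges
are drawn as straight line segments. -/

variable {V : Type*}

/-- No three of the points `p v` are collinear. -/
def GeneralPosition (p : V → Plane) : Prop :=
  ∀ a b c : V, a ≠ b → a ≠ c → b ≠ c → ¬ Collinear ℝ {p a, p b, p c}

/-- Any two edges without a common endpoint are drawn as disjoint closed segments. -/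
def IsNonCrossing (p : V → Plane) (G : SimpleGraph V) : Prop :=
  ∀ i j k l : V, G.Adj i j → G.Adj k l → i ≠ k → i ≠ l → j ≠ k → j ≠ l →
    Disjoint (segment ℝ (p i) (p j)) (segment ℝ (p k) (p l))

/-- A vertex `v` is pointed if some edge `va` and the edge `vb` following it in the
counterclockwise cyclic order around `v` span an angle larger than `π`. If `v` has degree one,
then `a = b` and the angle is `2π`; an isolated vertex, around which the whole angle `2π`
is free, is pointed too. -/
def IsPointed (p : V → Plane) (G : SimpleGraph V) (v : V) : Prop :=
  (∀ a, ¬ G.Adj v a) ∨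
    ∃ a b, G.Adj v a ∧ G.Adj v b ∧
      (∀ c, G.Adj v c → ccwAngle (p v) (p a) (p b) ≤ ccwAngle (p v) (p a) (p c)) ∧
      Real.pi < ccwAngle (p v) (p a) (p b)

/-- The subset of the plane covered by the vertices and edges. -/
def drawing (p : V → Plane) (G : SimpleGraph V) : Set Plane :=
  Set.range p ∪ ⋃ (i : V) (j : V) (_ : G.Adj i j), segment ℝ (p i) (p j)

/-- A bounded face: a bounded component of the complement of the vertices and edges. -/
def IsBoundedFace (p : V → Plane) (G : SimpleGraph V) (F : Set Plane) : Prop :=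
  IsComponent F (drawing p G)ᶜ ∧ Bornology.IsBounded F

/-- `G` is a pseudo-triangulation of the point set `p(V)`: a connected non-crossing geometric
graph that subdivides the convex hull of the point set, and each of whose bounded faces is a
pseudo-triangle, bounded by a cycle of `G`. -/
structure IsPseudoTriangulation (p : V → Plane) (G : SimpleGraph V) : Prop where
  nonCrossing : IsNonCrossing p G
  connected : G.Connected
  covers : drawing p G ∪ ⋃₀ {F | IsBoundedFace p G F} = convexHull ℝ (Set.range p)
  faces : ∀ F, IsBoundedFace p G F →
    ∃ (k : ℕ) (c : ZMod k → V), (∀ i, G.Adj (c i) (c (i + 1))) ∧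
      IsPseudoTriangle F (fun i => p (c i))

end PseudoTriang

/-! Call a segment between two of the points visible if it is disjoint from every edge that avoids
its two ends (`FreeSeg`).

A pseudo-triangulation is maximal by counting corners. An added edge that keeps the set of pointed
vertices is a chord of an empty pseudo-triangle and splits its boundary polygon into two polygons.
Each of these has at least three corners, so together they have at least six. Away from the ends of
the chord, a corner of a part is a corner of the pseudo-triangle and belongs to only one part. At an
end, both parts can have a corner only if the pseudo-triangle has one: at a reflex end the vertex
was pointed, its free angle lying inside the face, and a chord with convex angles on both sides
would destroy this. So the parts have at most 3 + 2 corners, a contradiction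
(`IsCyc.not_adj_inside`).

The converse rests on a statement about connected saturated graphs, those in which a visible segment
is an edge as soon as its addition leaves each pointed end pointed. Such a graph contains the convex
hull polygon, which can be cut along paths of inner edges until no two vertices of a boundary cycle
are joined inside it (`IsCyc.dissected`). Each final cycle is an empty pseudo-triangle by a geodesic
argument (`no_convex_separation`). Consider walks from angular sector to angular sector of a face
along visible segments. A bend by an angle below π can be shortened by a chain of visible segments
inside the triangle that it spans (`Pocket.exists_walk`). Hence a shortest walk between two convex
sectors bends only in reflex sectors. Each of its segments could be added without harming
pointedness: at a bend because all edges and both segments lie in an open half-plane, at the two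
ends because a segment into a convex sector stays within any half-plane that contains the edges. By
saturation the segments are edges, so the walk follows the boundary of the face and passes no convex
sector on its way. Two convex sectors that are separated by convex sectors in both directions along
the boundary therefore cannot exist, which leaves three corners and no inner edges.

A maximal graph `T` is not known to be connected, so saturation is reached indirectly. Among the
connected non-crossing graphs containing `T`, take one with the largest number of pointed vertices
and, among those, a maximal one, `G`. It is saturated. Its dissection also shows that, with at least
three points, it stays connected when any vertex is deleted. If a vertex `q` were pointed in `T` but
not in `G`, one could delete the edges of `G` at `q` that are not in `T` (keeping one if `q` is
isolated in `T`); the graph would stay connected and gain a pointed vertex. So `G` and `T` have the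
same pointed vertices, and `G = T` by maximality of `T`.

The topology of polygons is handled by winding numbers, defined as sums of signed angles. They are
locally constant off the polygon, jump by one turn across an edge, vanish outside the convex hull
and add up when a cycle is split along a path. -/

open Filter Topology
namespace PseudoTriang

/-! ### Orientation and angles -/

/-- Twice the signed area of the triangle `abc`. -/
noncomputable def cr (a b c : Plane) : ℝ := (b 0 - a 0) * (c 1 - a 1) - (b 1 - a 1) * (c 0 - a 0)

/-- The scalar product of `b - a` and `c - a`. -/
noncomputable def dt (a b c : Plane) : ℝ := (b 0 - a 0) * (c 0 - a 0) + (b 1 - a 1) * (c 1 - a 1)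

/-- The identification of the plane with `ℂ`. -/
noncomputable def toC (x : Plane) : ℂ := ⟨x 0, x 1⟩

lemma Plane.ext {a b : Plane} (h0 : a 0 = b 0) (h1 : a 1 = b 1) : a = b := by
  ext i; fin_cases i <;> assumption

lemma cr_swap (a b c : Plane) : cr a c b = -cr a b c := by unfold cr; ring
lemma cr_rot (a b c : Plane) : cr b c a = cr a b c := by unfold cr; ring
lemma cr_swap' (a b c : Plane) : cr b a c = -cr a b c := by unfold cr; ring
@[simp] lemma cr_self_left (a c : Plane) : cr a a c = 0 := by unfold cr; ring
@[simp] lemma cr_self_right (a b : Plane) : cr a b b = 0 := by unfold cr; ring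
@[simp] lemma cr_self_mid (a b : Plane) : cr a b a = 0 := by unfold cr; ring

lemma dt_self_pos {a b : Plane} (h : a ≠ b) : 0 < dt a b b := by
  unfold dt
  by_contra hc
  have h0 : b 0 - a 0 = 0 := by nlinarith [mul_self_nonneg (b 0 - a 0), mul_self_nonneg (b 1 - a 1)]
  have h1 : b 1 - a 1 = 0 := by nlinarith [mul_self_nonneg (b 0 - a 0), mul_self_nonneg (b 1 - a 1)]
  exact h (Plane.ext (by linarith) (by linarith))

lemma collinear_of_cr_eq_zero {a b c : Plane} (h : cr a b c = 0) : Collinear ℝ {a, b, c} := by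
  by_cases hab : a = b
  · subst hab; simpa using collinear_pair ℝ a c
  rw [collinear_iff_of_mem (p₀ := a) (by simp)]
  refine ⟨b - a, ?_⟩
  have hp := dt_self_pos hab
  simp only [Set.mem_insert_iff, Set.mem_singleton_iff, forall_eq_or_imp, forall_eq, vadd_eq_add]
  refine ⟨⟨0, by simp⟩, ⟨1, by simp⟩, dt a b c / dt a b b, ?_⟩
  unfold cr at h
  apply Plane.ext
  · simp only [PiLp.add_apply, PiLp.smul_apply, PiLp.sub_apply, smul_eq_mul]
    rw [← sub_eq_zero]; field_simp; unfold dt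
    linear_combination (-(b 1 - a 1)) * h
  · simp only [PiLp.add_apply, PiLp.smul_apply, PiLp.sub_apply, smul_eq_mul]
    rw [← sub_eq_zero]; field_simp; unfold dt
    linear_combination ((b 0 - a 0)) * h

lemma GeneralPosition.cr_ne {V : Type*} {p : V → Plane} (h : GeneralPosition p) {a b c : V}
    (hab : a ≠ b) (hac : a ≠ c) (hbc : b ≠ c) : cr (p a) (p b) (p c) ≠ 0 :=
  fun h0 => h a b c hab hac hbc (collinear_of_cr_eq_zero h0)

lemma toC_eq_zero {x : Plane} : toC x = 0 ↔ x = 0 := by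
  constructor
  · intro h
    have h0 := congrArg Complex.re h
    have h1 := congrArg Complex.im h
    exact Plane.ext (by simpa [toC] using h0) (by simpa [toC] using h1)
  · rintro rfl; apply Complex.ext <;> simp [toC]

lemma norm_toC_sub_pos {a v : Plane} (h : a ≠ v) : 0 < ‖toC (a - v)‖ := by
  rw [norm_pos_iff]; intro h'; exact h (sub_eq_zero.1 (toC_eq_zero.1 h'))

lemma ccwAngle_pos (v a b : Plane) : 0 < ccwAngle v a b :=
  (toIocMod_mem_Ioc Real.two_pi_pos 0 _).1

lemma ccwAngle_le (v a b : Plane) : ccwAngle v a b ≤ 2 * Real.pi := by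
  have := (toIocMod_mem_Ioc Real.two_pi_pos 0 (direction (b - v) - direction (a - v))).2
  simpa [ccwAngle] using this

lemma ccwAngle_spec (v a b : Plane) :
    ∃ z : ℤ, direction (b - v) - direction (a - v) = ccwAngle v a b + z * (2 * Real.pi) := by
  have := ((toIocMod_eq_iff Real.two_pi_pos (a := 0) (b := direction (b - v) - direction (a - v))
    (c := ccwAngle v a b)).1 rfl).2
  simpa using this

/-- Together with `ccwAngle_cos`, this turns comparisons of angles with `π` and `2π` into sign
conditions on the polynomials `cr` and `dt`. -/
lemma ccwAngle_sin (v a b : Plane) :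
    ‖toC (a - v)‖ * ‖toC (b - v)‖ * Real.sin (ccwAngle v a b) = cr v a b := by
  obtain ⟨z, hz⟩ := ccwAngle_spec v a b
  have : ccwAngle v a b = direction (b - v) - direction (a - v) - z * (2 * Real.pi) := by linarith
  rw [this, Real.sin_sub_int_mul_two_pi, Real.sin_sub]
  have ha := Complex.norm_mul_cos_arg (toC (a - v))
  have ha' := Complex.norm_mul_sin_arg (toC (a - v))
  have hb := Complex.norm_mul_cos_arg (toC (b - v))
  have hb' := Complex.norm_mul_sin_arg (toC (b - v))
  simp only [direction]
  change _ * _ * (Real.sin (toC (b - v)).arg * Real.cos (toC (a - v)).arg -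
    Real.cos (toC (b - v)).arg * Real.sin (toC (a - v)).arg) = _
  have e : ‖toC (a - v)‖ * ‖toC (b - v)‖ * (Real.sin (toC (b - v)).arg * Real.cos (toC (a - v)).arg -
    Real.cos (toC (b - v)).arg * Real.sin (toC (a - v)).arg) =
    (‖toC (a - v)‖ * Real.cos (toC (a - v)).arg) * (‖toC (b - v)‖ * Real.sin (toC (b - v)).arg) -
    (‖toC (a - v)‖ * Real.sin (toC (a - v)).arg) * (‖toC (b - v)‖ * Real.cos (toC (b - v)).arg) := by ring
  rw [e, ha, ha', hb, hb']
  simp [toC, cr]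

lemma ccwAngle_cos (v a b : Plane) :
    ‖toC (a - v)‖ * ‖toC (b - v)‖ * Real.cos (ccwAngle v a b) = dt v a b := by
  obtain ⟨z, hz⟩ := ccwAngle_spec v a b
  have : ccwAngle v a b = direction (b - v) - direction (a - v) - z * (2 * Real.pi) := by linarith
  rw [this, Real.cos_sub_int_mul_two_pi, Real.cos_sub]
  have ha := Complex.norm_mul_cos_arg (toC (a - v))
  have ha' := Complex.norm_mul_sin_arg (toC (a - v))
  have hb := Complex.norm_mul_cos_arg (toC (b - v))
  have hb' := Complex.norm_mul_sin_arg (toC (b - v))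
  simp only [direction]
  change _ * _ * (Real.cos (toC (b - v)).arg * Real.cos (toC (a - v)).arg +
    Real.sin (toC (b - v)).arg * Real.sin (toC (a - v)).arg) = _
  have e : ‖toC (a - v)‖ * ‖toC (b - v)‖ * (Real.cos (toC (b - v)).arg * Real.cos (toC (a - v)).arg +
    Real.sin (toC (b - v)).arg * Real.sin (toC (a - v)).arg) =
    (‖toC (a - v)‖ * Real.cos (toC (a - v)).arg) * (‖toC (b - v)‖ * Real.cos (toC (b - v)).arg) +
    (‖toC (a - v)‖ * Real.sin (toC (a - v)).arg) * (‖toC (b - v)‖ * Real.sin (toC (b - v)).arg) := by ring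
  rw [e, ha, ha', hb, hb']
  simp [toC, dt]

/-- Both sides agree modulo `2π` and all angles lie in `(0, 2π]`, so the difference is zero or one
full turn. Excluding one of the two cases is the way cyclic orders are compared throughout. -/
lemma ccwAngle_add (v a b c : Plane) : ccwAngle v a b + ccwAngle v b c = ccwAngle v a c ∨
    ccwAngle v a b + ccwAngle v b c = ccwAngle v a c + 2 * Real.pi := by
  obtain ⟨z1, h1⟩ := ccwAngle_spec v a b
  obtain ⟨z2, h2⟩ := ccwAngle_spec v b c
  obtain ⟨z3, h3⟩ := ccwAngle_spec v a c
  have hpi := Real.pi_pos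
  have e : ccwAngle v a b + ccwAngle v b c - ccwAngle v a c = ((z3 - z1 - z2 : ℤ) : ℝ) * (2 * Real.pi) := by
    push_cast; linarith
  have l1 := ccwAngle_pos v a b
  have l2 := ccwAngle_pos v b c
  have l3 := ccwAngle_pos v a c
  have u1 := ccwAngle_le v a b
  have u2 := ccwAngle_le v b c
  have u3 := ccwAngle_le v a c
  set m : ℤ := z3 - z1 - z2
  have hm1 : m < 2 := by
    by_contra h
    have : (2 : ℝ) ≤ m := by exact_mod_cast not_lt.1 h
    nlinarith
  have hm2 : -1 < m := by
    by_contra h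
    have : (m : ℝ) ≤ -1 := by exact_mod_cast not_lt.1 h
    nlinarith
  have : m = 0 ∨ m = 1 := by omega
  rcases this with h | h
  · left; rw [h] at e; push_cast at e; linarith
  · right; rw [h] at e; push_cast at e; linarith

lemma ccwAngle_self (v a : Plane) : ccwAngle v a a = 2 * Real.pi := by
  unfold ccwAngle; rw [sub_self, toIocMod_apply_left]; ring

section signs
variable {v a b : Plane} (ha : a ≠ v) (hb : b ≠ v)
include ha hb

lemma ccwAngle_factor_pos : 0 < ‖toC (a - v)‖ * ‖toC (b - v)‖ :=
  mul_pos (norm_toC_sub_pos ha) (norm_toC_sub_pos hb)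

lemma ccwAngle_lt_pi_iff : ccwAngle v a b < Real.pi ↔ 0 < cr v a b := by
  have hf := ccwAngle_factor_pos ha hb
  have hs := ccwAngle_sin v a b
  have l := ccwAngle_pos v a b
  have u := ccwAngle_le v a b
  constructor
  · intro h
    rw [← hs]; exact mul_pos hf (Real.sin_pos_of_pos_of_lt_pi l h)
  · intro h
    by_contra hc
    have : Real.sin (ccwAngle v a b) ≤ 0 := by
      have := Real.sin_nonneg_of_nonneg_of_le_pi (x := ccwAngle v a b - Real.pi) (by linarith) (by linarith)
      rw [Real.sin_sub_pi] at this; linarith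
    nlinarith

lemma pi_lt_ccwAngle_of_neg (h : cr v a b < 0) : Real.pi < ccwAngle v a b := by
  have hf := ccwAngle_factor_pos ha hb
  have hs := ccwAngle_sin v a b
  have l := ccwAngle_pos v a b
  by_contra hc
  have := Real.sin_nonneg_of_nonneg_of_le_pi l.le (not_lt.1 hc)
  nlinarith

lemma cr_neg_of_pi_lt (h : Real.pi < ccwAngle v a b) (h' : ccwAngle v a b < 2 * Real.pi) :
    cr v a b < 0 := by
  have hf := ccwAngle_factor_pos ha hb
  rw [← ccwAngle_sin v a b]
  have := Real.sin_pos_of_pos_of_lt_pi (x := ccwAngle v a b - Real.pi) (by linarith) (by linarith)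
  rw [Real.sin_sub_pi] at this
  nlinarith

lemma ccwAngle_eq_two_pi_iff : ccwAngle v a b = 2 * Real.pi ↔ cr v a b = 0 ∧ 0 < dt v a b := by
  have hf := ccwAngle_factor_pos ha hb
  constructor
  · intro h
    rw [← ccwAngle_sin v a b, ← ccwAngle_cos v a b, h]
    exact ⟨by simp, by simpa using hf⟩
  · rintro ⟨h1, h2⟩
    rw [← ccwAngle_sin v a b] at h1
    rw [← ccwAngle_cos v a b] at h2
    have s0 : Real.sin (ccwAngle v a b) = 0 := by
      rcases mul_eq_zero.1 h1 with h | h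
      · exact absurd h hf.ne'
      · exact h
    have c0 : 0 < Real.cos (ccwAngle v a b) := by
      by_contra hc; nlinarith
    have c1 : Real.cos (ccwAngle v a b) = 1 := by
      have := Real.sin_sq_add_cos_sq (ccwAngle v a b)
      rw [s0] at this; nlinarith
    obtain ⟨n, hn⟩ := (Real.cos_eq_one_iff _).1 c1
    have l := ccwAngle_pos v a b
    have u := ccwAngle_le v a b
    have hpi := Real.pi_pos
    have n1 : 0 < n := by
      by_contra h
      have : (n : ℝ) ≤ 0 := by exact_mod_cast not_lt.1 h
      nlinarith
    have n2 : n < 2 := by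
      by_contra h
      have : (2 : ℝ) ≤ n := by exact_mod_cast not_lt.1 h
      nlinarith
    have : n = 1 := by omega
    rw [this] at hn; push_cast at hn; linarith

lemma ccwAngle_eq_pi (h : ccwAngle v a b = Real.pi) : cr v a b = 0 ∧ dt v a b < 0 := by
  have hf := ccwAngle_factor_pos ha hb
  rw [← ccwAngle_sin v a b, ← ccwAngle_cos v a b, h]
  exact ⟨by simp, by simpa using hf⟩

end signs

section angles
variable {V : Type*} {p : V → Plane} (hp : Function.Injective p) (hgp : GeneralPosition p)
include hp hgp

lemma ccwAngle_lt_two_pi {v a b : V} (ha : a ≠ v) (hb : b ≠ v) (hab : a ≠ b) :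
    ccwAngle (p v) (p a) (p b) < 2 * Real.pi := by
  refine lt_of_le_of_ne (ccwAngle_le _ _ _) fun h => ?_
  exact hgp.cr_ne ha.symm hb.symm hab ((ccwAngle_eq_two_pi_iff (hp.ne ha) (hp.ne hb)).1 h).1

lemma ccwAngle_ne_pi {v a b : V} (ha : a ≠ v) (hb : b ≠ v) :
    ccwAngle (p v) (p a) (p b) ≠ Real.pi := by
  intro h
  by_cases hab : a = b
  · subst hab; rw [ccwAngle_self] at h; linarith [Real.pi_pos]
  · exact hgp.cr_ne ha.symm hb.symm hab (ccwAngle_eq_pi (hp.ne ha) (hp.ne hb) h).1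

end angles

/-! ### Pointed vertices and half-planes -/

/-- All points `c` of `S` lie strictly on one side of some line through `v`. -/
def InHalfPlane (v : Plane) (S : Set Plane) : Prop :=
  ∃ n m : ℝ, ∀ c ∈ S, 0 < n * (c 0 - v 0) + m * (c 1 - v 1)

lemma InHalfPlane.mono {v : Plane} {S S' : Set Plane} (h : InHalfPlane v S) (hs : S' ⊆ S) :
    InHalfPlane v S' := by
  obtain ⟨n, m, h⟩ := h
  exact ⟨n, m, fun c hc => h c (hs hc)⟩

/-- The boundary line through `v` and `b` can be rotated slightly: for small `ε > 0` the functional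
`cr v b + ε * dt v b` is positive on each of the finitely many points, including those on the ray
`vb`. -/
lemma inHalfPlane_of_left {v b : Plane} {S : Set Plane} (hS : S.Finite)
    (h : ∀ c ∈ S, 0 < cr v b c ∨ (cr v b c = 0 ∧ 0 < dt v b c)) : InHalfPlane v S := by
  have key : ∀ c ∈ S, ∀ᶠ ε in 𝓝[>] (0 : ℝ), 0 < cr v b c + ε * dt v b c := by
    intro c hc
    rcases h c hc with h | ⟨h1, h2⟩
    · have : Tendsto (fun ε : ℝ => cr v b c + ε * dt v b c) (𝓝[>] 0) (𝓝 (cr v b c + 0 * dt v b c)) := by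
        apply Tendsto.mono_left _ nhdsWithin_le_nhds
        exact Continuous.tendsto (by fun_prop) _
      rw [zero_mul, add_zero] at this
      exact this.eventually_const_lt h
    · filter_upwards [self_mem_nhdsWithin] with ε hε
      rw [h1, zero_add]; exact mul_pos hε h2
  have := (hS.eventually_all (l := 𝓝[>] (0 : ℝ))
    (p := fun c ε => 0 < cr v b c + ε * dt v b c)).2 key
  obtain ⟨ε, hε⟩ := this.exists
  refine ⟨-(b 1 - v 1) + ε * (b 0 - v 0), (b 0 - v 0) + ε * (b 1 - v 1), fun c hc => ?_⟩
  have := hε c hc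
  unfold cr dt at this
  nlinarith

/-- The half-plane identity behind all arguments with three directions in a half-plane. -/
lemma three_dir (n m : ℝ) (v a b c : Plane) :
    (n * (a 0 - v 0) + m * (a 1 - v 1)) * cr v b c + (n * (b 0 - v 0) + m * (b 1 - v 1)) * cr v c a
      + (n * (c 0 - v 0) + m * (c 1 - v 1)) * cr v a b = 0 := by
  unfold cr; ring

section pointed
variable {V : Type*} [Finite V] {p : V → Plane} (hp : Function.Injective p)
include hp

/-- Replaces the cyclic order by a linear condition, which is visibly inherited by subgraphs and can
be tested with `cr`. If the large angle ends at the edge `b`, all other edges lie within an angle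
below `π` counterclockwise from `b`. -/
lemma isPointed_iff (G : SimpleGraph V) (v : V) :
    IsPointed p G v ↔ InHalfPlane (p v) (p '' {c | G.Adj v c}) := by
  have hne : ∀ {c}, G.Adj v c → p c ≠ p v := fun h => hp.ne h.ne'
  constructor
  · rintro (h | ⟨a, b, ha, hb, hmin, hpi⟩)
    · exact ⟨0, 0, by rintro _ ⟨c, hc, rfl⟩; exact absurd hc (h c)⟩
    · apply inHalfPlane_of_left (b := p b) (Set.toFinite _)
      rintro _ ⟨c, hc, rfl⟩
      have h1 := hmin c hc
      have l := ccwAngle_le (p v) (p a) (p c)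
      have l' := ccwAngle_le (p v) (p b) (p c)
      rcases ccwAngle_add (p v) (p a) (p b) (p c) with h | h
      · left; rw [← ccwAngle_lt_pi_iff (hne hb) (hne hc)]; linarith
      · right; rw [← ccwAngle_eq_two_pi_iff (hne hb) (hne hc)]; linarith
  · rintro ⟨n, m, h⟩
    by_cases hN : ∀ a, ¬ G.Adj v a
    · exact Or.inl hN
    right
    push Not at hN
    set f : V → ℝ := fun c => n * (p c 0 - p v 0) + m * (p c 1 - p v 1) with hf
    set g : V → ℝ := fun c => -m * (p c 0 - p v 0) + n * (p c 1 - p v 1) with hg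
    have hpos : ∀ c, G.Adj v c → 0 < f c := fun c hc => h _ ⟨c, hc, rfl⟩
    have hnm : 0 < n * n + m * m := by
      obtain ⟨a, ha⟩ := hN
      have h1 := hpos a ha
      by_contra hc
      have n0 : n = 0 := by nlinarith [mul_self_nonneg n, mul_self_nonneg m]
      have m0 : m = 0 := by nlinarith [mul_self_nonneg n, mul_self_nonneg m]
      simp [hf, n0, m0] at h1
    have hcr : ∀ b c, f b * g c - g b * f c = (n * n + m * m) * cr (p v) (p b) (p c) := by
      intro b c; simp only [hf, hg]; unfold cr; ring
    have hdt : ∀ b c, f b * f c + g b * g c = (n * n + m * m) * dt (p v) (p b) (p c) := by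
      intro b c; simp only [hf, hg]; unfold dt; ring
    have hfin : {c | G.Adj v c}.Finite := Set.toFinite _
    -- All neighbours lie in `f > 0`, so the slopes `g / f` order them by angle; the free angle runs
    -- from the largest slope, at `a`, round to the smallest slope, at `b`.
    obtain ⟨b, hb, hbm⟩ := Set.exists_min_image _ (fun c => g c / f c) hfin hN
    obtain ⟨a, ha, ham⟩ := Set.exists_max_image _ (fun c => g c / f c) hfin hN
    have cmp : ∀ b c, G.Adj v b → G.Adj v c → g b / f b ≤ g c / f c →
        0 < cr (p v) (p b) (p c) ∨ (cr (p v) (p b) (p c) = 0 ∧ 0 < dt (p v) (p b) (p c)) := by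
      intro b c hb hc hle
      have fb := hpos b hb
      have fc := hpos c hc
      rw [div_le_div_iff₀ fb fc] at hle
      have e1 := hcr b c
      rcases (show 0 ≤ cr (p v) (p b) (p c) by by_contra hcc; nlinarith).lt_or_eq with h0 | h0
      · exact Or.inl h0
      · right
        refine ⟨h0.symm, ?_⟩
        rw [← h0] at e1
        have e2 := hdt b c
        have : 0 ≤ g b * g c := by
          by_contra hneg
          have h3 : (f b * g c) * (f b * g c) = f b * f c * (g b * g c) := by
            have : f b * g c = g b * f c := by linarith
            calc (f b * g c) * (f b * g c) = (f b * g c) * (g b * f c) := by rw [← this]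
              _ = _ := by ring
          nlinarith [mul_self_nonneg (f b * g c), mul_pos fb fc]
        have : 0 < (n * n + m * m) * dt (p v) (p b) (p c) := by rw [← e2]; nlinarith [mul_pos fb fc]
        exact (pos_iff_pos_of_mul_pos this).1 hnm
    have big : ∀ c, G.Adj v c → Real.pi < ccwAngle (p v) (p a) (p c) := by
      intro c hc
      rcases cmp c a hc ha (ham c hc) with h1 | ⟨h1, h2⟩
      · apply pi_lt_ccwAngle_of_neg (hne ha) (hne hc); rw [cr_swap]; linarith
      · have : ccwAngle (p v) (p a) (p c) = 2 * Real.pi := by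
          rw [ccwAngle_eq_two_pi_iff (hne ha) (hne hc)]
          refine ⟨by rw [cr_swap, h1, neg_zero], ?_⟩
          unfold dt at *; linarith
        rw [this]; linarith [Real.pi_pos]
    refine ⟨a, b, ha, hb, fun c hc => ?_, big b hb⟩
    have h1 := big b hb
    have h2 := big c hc
    have h3 := ccwAngle_pos (p v) (p b) (p c)
    rcases ccwAngle_add (p v) (p a) (p b) (p c) with h | h
    · linarith
    · rcases cmp b c hb hc (hbm c hc) with h4 | h4
      · rw [← ccwAngle_lt_pi_iff (hne hb) (hne hc)] at h4
        linarith [ccwAngle_le (p v) (p a) (p b)]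
      · rw [← ccwAngle_eq_two_pi_iff (hne hb) (hne hc)] at h4
        linarith

lemma IsPointed.anti {G H : SimpleGraph V} (hGH : G ≤ H) {v : V} (h : IsPointed p H v) :
    IsPointed p G v := by
  rw [isPointed_iff hp] at *
  exact h.mono (Set.image_mono fun c hc => hGH hc)

end pointed

end PseudoTriang
namespace PseudoTriang

/-! ### Segments -/

lemma mem_segment_iff_lineMap {a b z : Plane} :
    z ∈ segment ℝ a b ↔ ∃ t : ℝ, 0 ≤ t ∧ t ≤ 1 ∧ z = AffineMap.lineMap a b t := by
  rw [segment_eq_image_lineMap]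
  constructor
  · rintro ⟨t, ⟨h0, h1⟩, rfl⟩; exact ⟨t, h0, h1, rfl⟩
  · rintro ⟨t, h0, h1, rfl⟩; exact ⟨t, ⟨h0, h1⟩, rfl⟩

@[simp] lemma lineMap_coord (a b : Plane) (t : ℝ) (i : Fin 2) :
    (AffineMap.lineMap a b t : Plane) i = a i + t * (b i - a i) := by
  simp [AffineMap.lineMap_apply]; ring

lemma cr_lineMap (a b x y : Plane) (t : ℝ) :
    cr a b (AffineMap.lineMap x y t) = (1 - t) * cr a b x + t * cr a b y := by
  unfold cr; simp only [lineMap_coord]; ring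

lemma cr_eq_zero_of_mem_segment {a b z : Plane} (h : z ∈ segment ℝ a b) : cr a b z = 0 := by
  obtain ⟨t, -, -, rfl⟩ := mem_segment_iff_lineMap.1 h
  rw [cr_lineMap]; simp

section gp
variable {V : Type*} {p : V → Plane}

lemma GeneralPosition.eq_of_mem_segment (hgp : GeneralPosition p) {v i j : V}
    (hij : i ≠ j) (h : p v ∈ segment ℝ (p i) (p j)) : v = i ∨ v = j := by
  by_contra hc
  push Not at hc
  exact hgp.cr_ne hij (Ne.symm hc.1) (Ne.symm hc.2) (cr_eq_zero_of_mem_segment h)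

lemma GeneralPosition.eq_of_cr_eq_zero (hgp : GeneralPosition p) {v i j : V}
    (hij : i ≠ j) (h : cr (p i) (p j) (p v) = 0) : v = i ∨ v = j := by
  by_contra hc
  push Not at hc
  exact hgp.cr_ne hij (Ne.symm hc.1) (Ne.symm hc.2) h

/-- The segment between `x` and `y` does not cross any edge of `G`. -/
def FreeSeg (p : V → Plane) (G : SimpleGraph V) (x y : V) : Prop :=
  ∀ i j, G.Adj i j → i ≠ x → i ≠ y → j ≠ x → j ≠ y →
    Disjoint (segment ℝ (p i) (p j)) (segment ℝ (p x) (p y))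

lemma FreeSeg.symm {G : SimpleGraph V} {x y : V} (h : FreeSeg p G x y) : FreeSeg p G y x := by
  intro i j hij h1 h2 h3 h4
  rw [segment_symm ℝ (p y)]; exact h i j hij h2 h1 h4 h3

lemma IsNonCrossing.freeSeg {G : SimpleGraph V} (h : IsNonCrossing p G) {x y : V} (hxy : G.Adj x y) :
    FreeSeg p G x y := fun i j hij h1 h2 h3 h4 => h i j x y hij hxy h1 h2 h3 h4

lemma IsNonCrossing.anti {G H : SimpleGraph V} (hGH : G ≤ H) (h : IsNonCrossing p H) :
    IsNonCrossing p G := fun i j k l hij hkl => h i j k l (hGH hij) (hGH hkl)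

lemma IsNonCrossing.sup_edge {G : SimpleGraph V} (h : IsNonCrossing p G) {x y : V}
    (hf : FreeSeg p G x y) : IsNonCrossing p (G ⊔ SimpleGraph.edge x y) := by
  intro i j k l hij hkl h1 h2 h3 h4
  rw [SimpleGraph.sup_adj, SimpleGraph.edge_adj] at hij hkl
  have hf' := hf.symm
  rcases hij with hij | ⟨⟨rfl, rfl⟩ | ⟨rfl, rfl⟩, -⟩
  · rcases hkl with hkl | ⟨⟨rfl, rfl⟩ | ⟨rfl, rfl⟩, -⟩
    · exact h i j k l hij hkl h1 h2 h3 h4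
    · exact hf i j hij h1 h2 h3 h4
    · exact hf' i j hij h1 h2 h3 h4
  · rcases hkl with hkl | ⟨⟨rfl, rfl⟩ | ⟨rfl, rfl⟩, -⟩
    · exact (hf k l hkl h1.symm h3.symm h2.symm h4.symm).symm
    · exact absurd rfl h1
    · exact absurd rfl h2
  · rcases hkl with hkl | ⟨⟨rfl, rfl⟩ | ⟨rfl, rfl⟩, -⟩
    · exact (hf' k l hkl h1.symm h3.symm h2.symm h4.symm).symm
    · exact absurd rfl h2
    · exact absurd rfl h1

/-! ### Emptying a triangle -/

/-- The two half-open sides `(x, u]` and `[u, y)` of the positively oriented triangle `xuy`. -/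
def OnSides (x u y s : Plane) : Prop :=
  0 < cr y x s ∧ 0 ≤ cr x u s ∧ 0 ≤ cr u y s ∧ (cr x u s = 0 ∨ cr u y s = 0)

/-- The open triangle `xuy`. -/
def InOpenTri (x u y s : Plane) : Prop := 0 < cr y x s ∧ 0 < cr x u s ∧ 0 < cr u y s

/-- Edges of `G` enter the triangle `xuy` only through the side `xy`. -/
structure Pocket (p : V → Plane) (G : SimpleGraph V) (x : V) (u : Plane) (y : V) : Prop where
  pos : 0 < cr (p x) u (p y)
  edge : ∀ i j, G.Adj i j → ∀ h ∈ segment ℝ (p i) (p j), InOpenTri (p x) u (p y) h →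
    ∀ s ∈ segment ℝ (p i) (p j), ¬ OnSides (p x) u (p y) s
  vert : ∀ v, OnSides (p x) u (p y) (p v) → p v = u

/-- Intermediate value theorem for the minimum of two affine functions. It locates a point where an
edge that leaves the wedge at the apex of a pocket meets the boundary of the wedge. -/
lemma exists_first_zero {b0 b1 c0 c1 : ℝ} (hb : 0 < b0) (hc : 0 < c0) (h : b1 ≤ 0 ∨ c1 ≤ 0) :
    ∃ t : ℝ, 0 < t ∧ t ≤ 1 ∧ 0 ≤ (1 - t) * b0 + t * b1 ∧ 0 ≤ (1 - t) * c0 + t * c1 ∧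
      ((1 - t) * b0 + t * b1 = 0 ∨ (1 - t) * c0 + t * c1 = 0) := by
  have hcont : ContinuousOn (fun t : ℝ => min ((1 - t) * b0 + t * b1) ((1 - t) * c0 + t * c1))
      (Set.Icc 0 1) := by fun_prop
  have := intermediate_value_Icc' (zero_le_one' ℝ) hcont
  obtain ⟨t, ⟨ht0, ht1⟩, ht⟩ := this (show (0 : ℝ) ∈ _ by
    constructor
    · simpa using h
    · simp [hb.le, hc.le])
  simp only at ht
  have hz : (1 - t) * b0 + t * b1 = 0 ∨ (1 - t) * c0 + t * c1 = 0 := by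
    rcases min_choice ((1 - t) * b0 + t * b1) ((1 - t) * c0 + t * c1) with h | h
    · left; rw [← h, ht]
    · right; rw [← h, ht]
  refine ⟨t, lt_of_le_of_ne ht0 ?_, ht1, ht ▸ min_le_left _ _, ht ▸ min_le_right _ _, hz⟩
  rintro rfl
  rcases hz with h | h <;> simp at h <;> linarith

lemma eq_zero_of_convex_comb {r a b : ℝ} (h0 : 0 < r) (h1 : r < 1) (ha : a ≤ 0) (hb : b ≤ 0)
    (h : (1 - r) * a + r * b = 0) : a = 0 ∧ b = 0 := by
  have h2 := mul_nonneg (sub_pos.2 h1).le (neg_nonneg.2 ha)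
  have h3 := mul_nonneg h0.le (neg_nonneg.2 hb)
  have e1 : (1 - r) * a = 0 := by linarith
  have e2 : r * b = 0 := by linarith
  exact ⟨(mul_eq_zero.1 e1).resolve_left (sub_pos.2 h1).ne', (mul_eq_zero.1 e2).resolve_left h0.ne'⟩

variable [Finite V]

set_option maxHeartbeats 1000000 in
/-- Rotating the side `xu` of a pocket towards `xy`, the first vertex `z` met is visible
from `x`, the swept triangle contains no part of an edge, and what remains is again a pocket. -/
lemma Pocket.exists_first (hp : Function.Injective p) (hgp : GeneralPosition p)
    {G : SimpleGraph V} {x y : V} {u : Plane} (hP : Pocket p G x u y) :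
    ∃ z q, z ≠ x ∧ FreeSeg p G x z ∧
      (∀ i j, G.Adj i j → ∀ h ∈ segment ℝ (p i) (p j), ¬ InOpenTri (p x) u q h) ∧
      ((z = y ∧ q = p y) ∨
        (Pocket p G z q y ∧ (∃ l : ℝ, 0 < l ∧ l < 1 ∧ q = AffineMap.lineMap u (p y) l) ∧
          (∃ t : ℝ, 0 < t ∧ t < 1 ∧ p z = AffineMap.lineMap (p x) q t))) := by
  -- The numbers `cr y x s`, `cr x u s`, `cr u y s` are `D` times the barycentric coordinates of `s`
  -- at `u`, `y`, `x`.
  set D := cr (p x) u (p y) with hD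
  have hDpos : 0 < D := hP.pos
  have hsum : ∀ s, cr (p y) (p x) s + cr (p x) u s + cr u (p y) s = D := by
    intro s; rw [hD]; unfold cr; ring
  have hxy : x ≠ y := by
    rintro rfl; have := hP.pos; simp at this
  -- the candidate vertices
  set S : Set V := {v | v ≠ x ∧ p v ≠ u ∧ 0 ≤ cr (p y) (p x) (p v) ∧ 0 ≤ cr (p x) u (p v) ∧
    0 ≤ cr u (p y) (p v)} with hS
  have hyS : y ∈ S := by
    refine ⟨hxy.symm, ?_, by simp, hP.pos.le, by simp⟩
    intro h; have := hP.pos; rw [h] at this; simp at this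
  have hbpos : ∀ v ∈ S, 0 < cr (p x) u (p v) := by
    rintro v ⟨h1, h2, h3, h4, h5⟩
    refine lt_of_le_of_ne h4 fun h0 => ?_
    rcases h3.lt_or_eq with h3 | h3
    · exact h2 (hP.vert v ⟨h3, h4, h5, Or.inl h0.symm⟩)
    · have e0 : D * (p v 0 - p x 0) = 0 := by
        have : D * (p v 0 - p x 0) = cr (p y) (p x) (p v) * (u 0 - p x 0) +
          cr (p x) u (p v) * (p y 0 - p x 0) := by rw [hD]; unfold cr; ring
        rw [this, ← h0, ← h3]; ring
      have e1 : D * (p v 1 - p x 1) = 0 := by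
        have : D * (p v 1 - p x 1) = cr (p y) (p x) (p v) * (u 1 - p x 1) +
          cr (p x) u (p v) * (p y 1 - p x 1) := by rw [hD]; unfold cr; ring
        rw [this, ← h0, ← h3]; ring
      have e0' := (mul_eq_zero.1 e0).resolve_left hDpos.ne'
      have e1' := (mul_eq_zero.1 e1).resolve_left hDpos.ne'
      exact h1 (hp (Plane.ext (by linarith) (by linarith)))
  -- The ray from `x` through a vertex meets the side `uy` at the parameter given by this quotient,
  -- so the minimum is the first vertex met when the ray turns from `u` towards `y`.
  obtain ⟨z, hzS, hzmin⟩ := Set.exists_min_image S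
    (fun v => cr (p x) u (p v) / (cr (p y) (p x) (p v) + cr (p x) u (p v))) (Set.toFinite _) ⟨y, hyS⟩
  have hzb := hbpos z hzS
  obtain ⟨hzx, hzu, hza, -, hzc⟩ := hzS
  set az := cr (p y) (p x) (p z) with haz
  set bz := cr (p x) u (p z) with hbz
  set l : ℝ := bz / (az + bz) with hl
  have habpos : 0 < az + bz := by linarith
  have hl0 : 0 < l := div_pos hzb habpos
  have hl1 : l ≤ 1 := by rw [hl, div_le_one habpos]; linarith
  have hlz : l * az = (1 - l) * bz := by rw [hl]; field_simp; ring
  set q : Plane := AffineMap.lineMap u (p y) l with hq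
  -- `g` vanishes on the line `xq` and is positive on the side of `u`, which is the side already
  -- swept.
  set g : Plane → ℝ := fun s => l * cr (p y) (p x) s - (1 - l) * cr (p x) u s with hg
  have hgq : ∀ s, cr (p x) q s = - g s := by
    intro s; simp only [hg, hq]; unfold cr; simp only [lineMap_coord]; ring
  have huq : ∀ s, cr u q s = l * cr u (p y) s := by
    intro s; simp only [hq]; unfold cr; simp only [lineMap_coord]; ring
  have hgline : ∀ a b t, g (AffineMap.lineMap a b t) = (1 - t) * g a + t * g b := by
    intro a b t; simp only [hg, cr_lineMap]; ring
  have gz : g (p z) = 0 := by simp only [hg]; linarith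
  have gx : g (p x) = 0 := by simp [hg]
  have hapos : ∀ s, 0 < g s → 0 ≤ cr (p x) u s → 0 < cr (p y) (p x) s := by
    intro s h1 h2
    have : 0 < l * cr (p y) (p x) s := by
      have := mul_nonneg (sub_nonneg.2 hl1) h2
      simp only [hg] at h1; linarith
    exact (pos_iff_pos_of_mul_pos this).1 hl0
  -- vertices in the closed triangle are not on the side of `u`
  have hmin : ∀ v, 0 < cr (p x) u (p v) → 0 < cr u (p y) (p v) → ¬ 0 < g (p v) := by
    intro v h1 h2 h3
    have ha := hapos _ h3 h1.le
    have hvS : v ∈ S := by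
      refine ⟨?_, ?_, ha.le, h1.le, h2.le⟩
      · rintro rfl; simp at h1
      · intro h; rw [h] at h1; simp at h1
    have := hzmin v hvS
    change l ≤ _ at this
    rw [le_div_iff₀ (by linarith)] at this
    simp only [hg] at h3
    linarith
  -- A segment that starts in the wedge at `u` and ends in `g > 0` without touching the two pocket
  -- sides stays in the wedge. For an edge this contradicts `hmin` at its endpoint.
  have escape : ∀ h0 i : Plane, 0 < cr (p x) u h0 → 0 < cr u (p y) h0 → 0 ≤ g h0 → 0 < g i →
      (∀ s ∈ segment ℝ h0 i, ¬ OnSides (p x) u (p y) s) → 0 < cr (p x) u i ∧ 0 < cr u (p y) i := by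
    intro h0 i hb hc hg0 hgi hs
    by_contra hcon
    rw [not_and_or, not_lt, not_lt] at hcon
    obtain ⟨t, ht0, ht1, htb, htc, hz⟩ := exists_first_zero hb hc hcon
    rw [← cr_lineMap, ] at htb htc
    rw [← cr_lineMap, ← cr_lineMap] at hz
    refine hs _ (mem_segment_iff_lineMap.2 ⟨t, ht0.le, ht1, rfl⟩) ⟨hapos _ ?_ htb, htb, htc, hz⟩
    rw [hgline]
    have := mul_nonneg (sub_nonneg.2 ht1) hg0
    have := mul_pos ht0 hgi
    linarith
  have noedge : ∀ i j, G.Adj i j → ∀ h ∈ segment ℝ (p i) (p j), 0 < cr (p x) u h →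
      0 < cr u (p y) h → ¬ 0 < g h := by
    intro i j hij h hh hb hc hgh
    have hside := hP.edge i j hij h hh ⟨hapos _ hgh hb.le, hb, hc⟩
    have hi : g (p i) ≤ 0 := by
      by_contra hgi
      have := escape h (p i) hb hc hgh.le (not_le.1 hgi) (fun s hs => hside s
        ((convex_segment _ _).segment_subset hh (left_mem_segment _ _ _) hs))
      exact hmin i this.1 this.2 (not_le.1 hgi)
    have hj : g (p j) ≤ 0 := by
      by_contra hgi
      have := escape h (p j) hb hc hgh.le (not_le.1 hgi) (fun s hs => hside s
        ((convex_segment _ _).segment_subset hh (right_mem_segment _ _ _) hs))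
      exact hmin j this.1 this.2 (not_le.1 hgi)
    obtain ⟨t, ht0, ht1, rfl⟩ := mem_segment_iff_lineMap.1 hh
    rw [hgline] at hgh
    nlinarith
  -- an edge through a point of the ray `xz` inside the triangle lies on that ray
  have nearray : ∀ i j, G.Adj i j → ∀ s ∈ segment ℝ (p i) (p j), 0 < cr (p x) u s →
      0 < cr u (p y) s → g s = 0 → g (p i) ≤ 0 := by
    intro i j hij s hs hb hc hgs
    by_contra hgi
    rw [not_le] at hgi
    have key : ∀ᶠ t in 𝓝[>] (0 : ℝ), 0 < cr (p x) u (AffineMap.lineMap s (p i) t) ∧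
        0 < cr u (p y) (AffineMap.lineMap s (p i) t) := by
      simp only [cr_lineMap]
      apply Filter.Eventually.filter_mono nhdsWithin_le_nhds
      apply Filter.Eventually.and
      · have : Tendsto (fun t : ℝ => (1 - t) * cr (p x) u s + t * cr (p x) u (p i)) (𝓝 0)
          (𝓝 ((1 - 0) * cr (p x) u s + 0 * cr (p x) u (p i))) := Continuous.tendsto (by fun_prop) _
        exact this.eventually_const_lt (by linarith)
      · have : Tendsto (fun t : ℝ => (1 - t) * cr u (p y) s + t * cr u (p y) (p i)) (𝓝 0)
          (𝓝 ((1 - 0) * cr u (p y) s + 0 * cr u (p y) (p i))) := Continuous.tendsto (by fun_prop) _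
        exact this.eventually_const_lt (by linarith)
    have key2 : ∀ᶠ t in 𝓝[>] (0 : ℝ), t ∈ Set.Ioc (0 : ℝ) 1 := Ioc_mem_nhdsGT zero_lt_one
    obtain ⟨t, ⟨h1, h2⟩, h3, h4⟩ := (key.and key2).exists
    refine noedge i j hij _ ((convex_segment _ _).segment_subset hs (left_mem_segment _ _ _)
      (mem_segment_iff_lineMap.2 ⟨t, h3.le, h4, rfl⟩)) h1 h2 ?_
    rw [hgline, hgs]; nlinarith
  -- vertices on the ray
  have onray : ∀ v, g (p v) = 0 → v = x ∨ v = z := by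
    intro v hv
    apply hgp.eq_of_cr_eq_zero hzx.symm
    have : D * cr (p x) (p z) (p v) = az * cr (p x) u (p v) - bz * cr (p y) (p x) (p v) := by
      rw [hD, haz, hbz]; unfold cr; ring
    have h2 : l * (D * cr (p x) (p z) (p v)) = 0 := by
      rw [this]
      have : g (p v) = l * cr (p y) (p x) (p v) - (1 - l) * cr (p x) u (p v) := rfl
      rw [hv] at this
      calc l * (az * cr (p x) u (p v) - bz * cr (p y) (p x) (p v)) =
        (l * az) * cr (p x) u (p v) - bz * (l * cr (p y) (p x) (p v)) := by ring
        _ = 0 := by rw [hlz, show l * cr (p y) (p x) (p v) = (1 - l) * cr (p x) u (p v) by linarith]; ring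
    exact (mul_eq_zero.1 ((mul_eq_zero.1 h2).resolve_left hl0.ne')).resolve_left hDpos.ne'
  -- An edge crossing `xz` would have no end with `g > 0`, by `nearray`, yet meet the line `g = 0`.
  -- It would then have an end on that line, where the only vertices are `x` and `z`.
  have hfree : FreeSeg p G x z := by
    intro i j hij h1 h2 h3 h4
    rw [Set.disjoint_left]
    intro s hs hs'
    have hij' := hij.ne
    obtain ⟨t, ht0, ht1, hst⟩ := mem_segment_iff_lineMap.1 hs'
    have ht0' : 0 < t := by
      refine lt_of_le_of_ne ht0 ?_
      rintro rfl
      rw [AffineMap.lineMap_apply_zero] at hst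
      rw [hst] at hs
      rcases hgp.eq_of_mem_segment hij' hs with h | h
      · exact h1 h.symm
      · exact h3 h.symm
    have ht1' : t < 1 := by
      refine lt_of_le_of_ne ht1 ?_
      rintro rfl
      rw [AffineMap.lineMap_apply_one] at hst
      rw [hst] at hs
      rcases hgp.eq_of_mem_segment hij' hs with h | h
      · exact h2 h.symm
      · exact h4 h.symm
    have e1 : 0 < cr (p x) u s := by
      rw [hst, cr_lineMap]; simp; exact mul_pos ht0' hzb
    have e2 : 0 < cr u (p y) s := by
      rw [hst, cr_lineMap]
      have : cr u (p y) (p x) = D := by rw [hD, cr_rot]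
      rw [this]
      have := mul_pos (sub_pos.2 ht1') hDpos
      have := mul_nonneg ht0 hzc
      linarith
    have e3 : g s = 0 := by rw [hst, hgline, gx, gz]; ring
    have gi := nearray i j hij s hs e1 e2 e3
    have gj := nearray j i hij.symm s (by rwa [segment_symm]) e1 e2 e3
    have gi' : g (p i) ≠ 0 := fun h => by
      rcases onray i h with h | h
      · exact h1 h
      · exact h2 h
    have gj' : g (p j) ≠ 0 := fun h => by
      rcases onray j h with h | h
      · exact h3 h
      · exact h4 h
    obtain ⟨r, hr0, hr1, hsr⟩ := mem_segment_iff_lineMap.1 hs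
    rw [hsr, hgline] at e3
    rcases hr0.eq_or_lt with rfl | hr
    · simp at e3; exact gi' e3
    · rcases hr1.eq_or_lt with rfl | hr'
      · simp at e3; exact gj' e3
      · exact gi' (eq_zero_of_convex_comb hr hr' gi gj e3).1
  refine ⟨z, q, hzx, hfree, ?_, ?_⟩
  · rintro i j hij h hh ⟨h1, h2, h3⟩
    have hc : 0 < cr u (p y) h := by
      rw [huq] at h3; exact (pos_iff_pos_of_mul_pos h3).1 hl0
    refine noedge i j hij h hh h2 hc ?_
    have := hgq h
    rw [cr_swap'] at this
    linarith
  · by_cases hzy : z = y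
    · left
      refine ⟨hzy, ?_⟩
      have : az = 0 := by rw [haz, hzy]; simp
      have : l = 1 := by rw [hl, this, zero_add, div_self hzb.ne']
      rw [hq, this, AffineMap.lineMap_apply_one]
    right
    have haz' : 0 < az := by
      refine lt_of_le_of_ne hza fun h => ?_
      rcases hgp.eq_of_cr_eq_zero hxy.symm h.symm with h | h
      · exact hzy h
      · exact hzx h
    have hl1' : l < 1 := by rw [hl, div_lt_one habpos]; linarith
    have hzc' : 0 < cr u (p y) (p z) := by
      refine lt_of_le_of_ne hzc fun h => ?_
      exact hzu (hP.vert z ⟨haz', hzb.le, hzc, Or.inr h.symm⟩)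
    -- the position of `z` on `xq`
    set t : ℝ := (az + bz) / D with ht
    have ht0 : 0 < t := div_pos habpos hDpos
    have ht1 : t < 1 := by
      rw [ht, div_lt_one hDpos, ← hsum (p z)]; linarith
    have hzq : p z = AffineMap.lineMap (p x) q t := by
      have e0 : D * (p z 0 - p x 0) = az * (u 0 - p x 0) + bz * (p y 0 - p x 0) := by
        rw [hD, haz, hbz]; unfold cr; ring
      have e1 : D * (p z 1 - p x 1) = az * (u 1 - p x 1) + bz * (p y 1 - p x 1) := by
        rw [hD, haz, hbz]; unfold cr; ring
      have hb : bz = l * (az + bz) := by rw [hl]; field_simp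
      have ha : az = (1 - l) * (az + bz) := by linarith
      have hD' : az + bz = t * D := by rw [ht, div_mul_cancel₀ _ hDpos.ne']
      rw [hD'] at hb ha
      apply Plane.ext
      · simp only [lineMap_coord, hq]
        have : D * (p z 0 - p x 0) = D * (t * (u 0 + l * (p y 0 - u 0) - p x 0)) := by
          rw [e0, ha, hb]; ring
        have := mul_left_cancel₀ hDpos.ne' this
        linarith
      · simp only [lineMap_coord, hq]
        have : D * (p z 1 - p x 1) = D * (t * (u 1 + l * (p y 1 - u 1) - p x 1)) := by
          rw [e1, ha, hb]; ring
        have := mul_left_cancel₀ hDpos.ne' this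
        linarith
    have czq : ∀ s, cr (p z) q s = (1 - t) * (-g s) := by
      intro s; rw [← hgq, hzq]; unfold cr; simp only [lineMap_coord]; ring
    have cqy : ∀ s, cr q (p y) s = (1 - l) * cr u (p y) s := by
      intro s; rw [hq]; unfold cr; simp only [lineMap_coord]; ring
    have cyz : ∀ s, cr (p y) (p z) s = (1 - t) * cr (p y) (p x) s - t * cr q (p y) s := by
      intro s; rw [hzq]; unfold cr; simp only [lineMap_coord]; ring
    have h1t : 0 < 1 - t := sub_pos.2 ht1
    have h1l : 0 < 1 - l := sub_pos.2 hl1'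
    have hbfrom : ∀ s, g s ≤ 0 → 0 < cr (p y) (p x) s → 0 < cr (p x) u s := by
      intro s h1 h2
      have : 0 < (1 - l) * cr (p x) u s := by
        simp only [hg] at h1; have := mul_pos hl0 h2; linarith
      exact (pos_iff_pos_of_mul_pos this).1 h1l
    -- analysis of points on the sides of the smaller triangle
    have sides : ∀ s, OnSides (p z) q (p y) s → (OnSides (p x) u (p y) s ∧ 0 < cr (p x) u s) ∨
        (0 < cr (p x) u s ∧ 0 < cr u (p y) s ∧ g s = 0 ∧ 0 < cr (p y) (p x) s) := by
      rintro s ⟨h1, h2, h3, h4⟩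
      have hg' : g s ≤ 0 := by
        rw [czq] at h2; by_contra hcc
        nlinarith [not_le.1 hcc]
      have hc' : 0 ≤ cr u (p y) s := by
        rw [cqy] at h3; by_contra hcc
        nlinarith [not_le.1 hcc]
      have ha' : 0 < cr (p y) (p x) s := by
        rw [cyz] at h1
        have : 0 < (1 - t) * cr (p y) (p x) s := by
          have := mul_nonneg ht0.le h3; linarith
        exact (pos_iff_pos_of_mul_pos this).1 h1t
      have hb' := hbfrom s hg' ha'
      rcases hc'.eq_or_lt with h | h
      · exact Or.inl ⟨⟨ha', hb'.le, hc', Or.inr h.symm⟩, hb'⟩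
      · right
        refine ⟨hb', h, ?_, ha'⟩
        rcases h4 with h4 | h4
        · rw [czq] at h4
          have := (mul_eq_zero.1 h4).resolve_left h1t.ne'
          linarith
        · rw [cqy] at h4
          have := (mul_eq_zero.1 h4).resolve_left h1l.ne'
          linarith
    refine ⟨⟨?_, ?_, ?_⟩, ⟨l, hl0, hl1', hq⟩, ⟨t, ht0, ht1, hzq⟩⟩
    · rw [czq]
      have : g (p y) = -((1 - l) * D) := by simp [hg, hD]
      rw [this, neg_neg]
      exact mul_pos h1t (mul_pos h1l hDpos)
    · rintro i j hij h hh ⟨k1, k2, k3⟩ s hs hside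
      have hc : 0 < cr u (p y) h := by
        rw [cqy] at k3; exact (pos_iff_pos_of_mul_pos k3).1 h1l
      have ha : 0 < cr (p y) (p x) h := by
        rw [cyz] at k1
        have : 0 < (1 - t) * cr (p y) (p x) h := by
          have := mul_pos ht0 k3; linarith
        exact (pos_iff_pos_of_mul_pos this).1 h1t
      have hgh : g h ≤ 0 := by
        rw [czq] at k2; have := (pos_iff_pos_of_mul_pos k2).1 h1t; linarith
      have hb := hbfrom h hgh ha
      have hns := hP.edge i j hij h hh ⟨ha, hb, hc⟩ s hs
      rcases sides s hside with ⟨h, -⟩ | ⟨sb, sc, sg, sa⟩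
      · exact hns h
      · have gi := nearray i j hij s hs sb sc sg
        have gj := nearray j i hij.symm s (by rwa [segment_symm]) sb sc sg
        obtain ⟨r, hr0, hr1, hsr⟩ := mem_segment_iff_lineMap.1 hs
        have notz : ∀ w, s = p w → g (p w) = 0 → False := by
          intro w hw hgw
          rcases onray w hgw with h | h
          · rw [hw, h] at sa; simp at sa
          · have := hside.1; rw [hw, h] at this; simp at this
        have hr0' : 0 < r := by
          refine lt_of_le_of_ne hr0 ?_
          rintro rfl
          rw [AffineMap.lineMap_apply_zero] at hsr
          exact notz i hsr (by rw [← hsr]; exact sg)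
        have hr1' : r < 1 := by
          refine lt_of_le_of_ne hr1 ?_
          rintro rfl
          rw [AffineMap.lineMap_apply_one] at hsr
          exact notz j hsr (by rw [← hsr]; exact sg)
        have e3 := sg
        rw [hsr, hgline] at e3
        obtain ⟨gi0, gj0⟩ := eq_zero_of_convex_comb hr0' hr1' gi gj e3
        have hxz : s ∈ segment ℝ (p x) (p z) := by
          rcases onray i gi0 with rfl | rfl <;> rcases onray j gj0 with rfl | rfl
          · exact absurd rfl hij.ne
          · exact hs
          · rwa [segment_symm]
          · exact absurd rfl hij.ne
        obtain ⟨r', hr0', hr1', hsr'⟩ := mem_segment_iff_lineMap.1 hxz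
        have := hside.1
        rw [hsr', cr_lineMap] at this
        have e : cr (p y) (p z) (p x) = - az := by rw [haz, cr_swap]
        rw [e] at this; simp at this
        nlinarith
    · intro v hv
      rcases sides _ hv with ⟨h, h'⟩ | ⟨sb, sc, sg, sa⟩
      · have := hP.vert v h
        rw [this] at h'; simp at h'
      · rcases onray v sg with h | h
        · rw [h] at sa; simp at sa
        · have := hv.1; rw [h] at this; simp at this

end gp
end PseudoTriang
namespace PseudoTriang

/-! ### Chains of visible segments, and connectedness. -/

section pocket
variable {V : Type*} {p : V → Plane}

lemma OnSides.mem {x u y s : Plane} (hD : 0 < cr x u y) (h : OnSides x u y s) :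
    (s ∈ segment ℝ x u ∧ s ≠ x) ∨ (s ∈ segment ℝ u y ∧ s ≠ y) := by
  obtain ⟨ha, hb, hc, h0⟩ := h
  have hsum : cr y x s + cr x u s + cr u y s = cr x u y := by unfold cr; ring
  have e0 : cr x u y * (s 0 - x 0) = cr y x s * (u 0 - x 0) + cr x u s * (y 0 - x 0) := by
    unfold cr; ring
  have e1 : cr x u y * (s 1 - x 1) = cr y x s * (u 1 - x 1) + cr x u s * (y 1 - x 1) := by
    unfold cr; ring
  rcases h0 with h0 | h0
  · left
    refine ⟨mem_segment_iff_lineMap.2 ⟨cr y x s / cr x u y, by positivity,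
      (div_le_one hD).2 (by linarith), ?_⟩, by rintro rfl; simp at ha⟩
    rw [h0, zero_mul, add_zero] at e0 e1
    apply Plane.ext
    · rw [lineMap_coord]; field_simp; linarith
    · rw [lineMap_coord]; field_simp; linarith
  · right
    have ha' : cr y x s = cr x u y - cr x u s := by linarith
    refine ⟨mem_segment_iff_lineMap.2 ⟨cr x u s / cr x u y, by positivity,
      (div_le_one hD).2 (by linarith), ?_⟩, by rintro rfl; simp at ha⟩
    rw [ha'] at e0 e1
    apply Plane.ext
    · rw [lineMap_coord]; field_simp; linarith
    · rw [lineMap_coord]; field_simp; linarith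

/-- Edges with a common end are not collinear and meet in that end only, and edges without one are
disjoint. -/
lemma edge_unique (hgp : GeneralPosition p) {G : SimpleGraph V}
    (hG : IsNonCrossing p G) {i j k l : V} (hij : G.Adj i j) (hkl : G.Adj k l) {s : Plane}
    (h1 : s ∈ segment ℝ (p i) (p j)) (h2 : s ∈ segment ℝ (p k) (p l)) (hs : ∀ v, s ≠ p v) :
    (k = i ∧ l = j) ∨ (k = j ∧ l = i) := by
  have aux : ∀ {i j l : V}, G.Adj i j → G.Adj i l → s ∈ segment ℝ (p i) (p j) →
      s ∈ segment ℝ (p i) (p l) → l = j := by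
    intro i j l hij hil h1 h2
    obtain ⟨t, ht0, ht1, ht⟩ := mem_segment_iff_lineMap.1 h2
    have h0 := cr_eq_zero_of_mem_segment h1
    rw [ht, cr_lineMap] at h0
    simp only [cr_self_mid, mul_zero, zero_add, mul_eq_zero] at h0
    rcases h0 with rfl | h0
    · rw [AffineMap.lineMap_apply_zero] at ht; exact absurd ht (hs i)
    · rcases hgp.eq_of_cr_eq_zero hij.ne h0 with h | h
      · exact absurd h hil.ne'
      · exact h
  by_contra hcon
  have hd := hG i j k l hij hkl
  by_cases h3 : i = k
  · subst h3; exact hcon (Or.inl ⟨rfl, aux hij hkl h1 h2⟩)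
  by_cases h4 : i = l
  · subst h4; exact hcon (Or.inr ⟨aux hij hkl.symm h1 (by rwa [segment_symm]), rfl⟩)
  by_cases h5 : j = k
  · subst h5; exact hcon (Or.inr ⟨rfl, aux hij.symm hkl (by rwa [segment_symm]) h2⟩)
  by_cases h6 : j = l
  · subst h6
    exact hcon (Or.inl ⟨aux hij.symm hkl.symm (by rwa [segment_symm]) (by rwa [segment_symm]), rfl⟩)
  exact Set.disjoint_left.1 (hd h3 h4 h5 h6) h1 h2

variable [Finite V]

/-- Induction along the chain of visible segments that empties a pocket. -/
lemma Pocket.induction (hp : Function.Injective p) (hgp : GeneralPosition p)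
    {G : SimpleGraph V} {y : V} {P : V → Plane → Prop}
    (base : ∀ x u, Pocket p G x u y → FreeSeg p G x y →
      (∀ i j, G.Adj i j → ∀ h ∈ segment ℝ (p i) (p j), ¬ InOpenTri (p x) u (p y) h) → P x u)
    (step : ∀ x u z q, Pocket p G x u y → z ≠ x → FreeSeg p G x z →
      (∀ i j, G.Adj i j → ∀ h ∈ segment ℝ (p i) (p j), ¬ InOpenTri (p x) u q h) →
      Pocket p G z q y → (∃ l : ℝ, 0 < l ∧ l < 1 ∧ q = AffineMap.lineMap u (p y) l) →
      (∃ t : ℝ, 0 < t ∧ t < 1 ∧ p z = AffineMap.lineMap (p x) q t) → P z q → P x u)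
    {x : V} {u : Plane} (hP : Pocket p G x u y) : P x u := by
  -- Induction on the number of vertices in the closed triangle: the smaller pocket is contained in
  -- the larger one and no longer contains `x`.
  have main : ∀ n : ℕ, ∀ x u, Pocket p G x u y →
      {v | 0 ≤ cr (p y) (p x) (p v) ∧ 0 ≤ cr (p x) u (p v) ∧ 0 ≤ cr u (p y) (p v)}.ncard ≤ n →
      P x u := by
    intro n
    induction n with
    | zero =>
      intro x u hP hn
      rw [Nat.le_zero, Set.ncard_eq_zero] at hn
      have : x ∈ (∅ : Set V) := by
        rw [← hn]
        refine ⟨by simp, by simp, ?_⟩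
        rw [cr_rot]; exact hP.pos.le
      exact absurd this (Set.notMem_empty x)
    | succ n ih =>
      intro x u hP hn
      obtain ⟨z, q, hzx, hfree, hno, ⟨rfl, rfl⟩ | ⟨hP', hl, ht⟩⟩ := hP.exists_first hp hgp
      · exact base x u hP hfree hno
      · refine step x u z q hP hzx hfree hno hP' hl ht (ih z q hP' ?_)
        obtain ⟨l, hl0, hl1, hq⟩ := hl
        obtain ⟨t, ht0, ht1, hz⟩ := ht
        have czq : ∀ s, cr (p z) q s = (1 - t) * ((1 - l) * cr (p x) u s - l * cr (p y) (p x) s) := by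
          intro s; rw [hz, hq]; unfold cr; simp only [lineMap_coord]; ring
        have cqy : ∀ s, cr q (p y) s = (1 - l) * cr u (p y) s := by
          intro s; rw [hq]; unfold cr; simp only [lineMap_coord]; ring
        have cyz : ∀ s, cr (p y) (p z) s = (1 - t) * cr (p y) (p x) s - t * cr q (p y) s := by
          intro s; rw [hz]; unfold cr; simp only [lineMap_coord]; ring
        have h1t : 0 < 1 - t := sub_pos.2 ht1
        have h1l : 0 < 1 - l := sub_pos.2 hl1
        rw [← Nat.lt_succ_iff]
        refine lt_of_lt_of_le (Set.ncard_lt_ncard ?_ (Set.toFinite _)) hn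
        rw [Set.ssubset_iff_of_subset]
        · refine ⟨x, ⟨by simp, by simp, by rw [cr_rot]; exact hP.pos.le⟩, ?_⟩
          rintro ⟨h1, -, -⟩
          rw [cyz, cqy, cr_self_right, cr_rot (p x) u (p y), mul_zero, zero_sub] at h1
          have := mul_pos ht0 (mul_pos h1l hP.pos)
          linarith
        · rintro v ⟨h1, h2, h3⟩
          have ha : 0 ≤ cr (p y) (p x) (p v) := by
            rw [cyz] at h1
            exact nonneg_of_mul_nonneg_right (by linarith [mul_nonneg ht0.le h3]) h1t
          have hc : 0 ≤ cr u (p y) (p v) := by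
            rw [cqy] at h3; exact nonneg_of_mul_nonneg_right h3 h1l
          refine ⟨ha, ?_, hc⟩
          rw [czq] at h2
          have := nonneg_of_mul_nonneg_right h2 h1t
          exact nonneg_of_mul_nonneg_right (by linarith [mul_nonneg hl0.le ha]) h1l
  exact main _ x u hP le_rfl

/-- A noncrossing graph containing all visible segments is connected. -/
lemma connected_of_full [Nonempty V] (hp : Function.Injective p) (hgp : GeneralPosition p)
    {G : SimpleGraph V} (hG : IsNonCrossing p G)
    (hfull : ∀ x y, x ≠ y → FreeSeg p G x y → G.Adj x y) : G.Connected := by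
  have reach : ∀ {x y : V} {u : Plane}, Pocket p G x u y → G.Reachable x y := by
    intro x y u hP
    refine Pocket.induction hp hgp (P := fun x _ => G.Reachable x y) ?_ ?_ hP
    · intro x u hP hf _
      refine (hfull x y ?_ hf).reachable
      rintro rfl; have := hP.pos; simp at this
    · intro x u z q _ hzx hf _ _ _ _ ih
      exact (hfull x z hzx.symm hf).reachable.trans ih
  -- The point farthest from the origin is the strict maximum of the linear functional `f`, so it
  -- suffices to reach a higher vertex from every other one.
  obtain ⟨m, hm⟩ := Finite.exists_max (fun v : V => p v 0 * p v 0 + p v 1 * p v 1)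
  set f : Plane → ℝ := fun s => p m 0 * s 0 + p m 1 * s 1 with hf
  have fm : ∀ v, v ≠ m → f (p v) < f (p m) := by
    intro v hv
    have h1 := hm v
    have h2 := dt_self_pos (hp.ne hv)
    simp only [hf]; unfold dt at h2
    nlinarith
  have fline : ∀ a b (t : ℝ), f (AffineMap.lineMap a b t) = (1 - t) * f a + t * f b := by
    intro a b t; simp only [hf, lineMap_coord]; ring
  have up : ∀ x, x ≠ m → ∃ y, G.Reachable x y ∧ f (p x) < f (p y) := by
    intro x hx
    by_cases hfree : FreeSeg p G x m
    · exact ⟨m, (hfull x m hx hfree).reachable, fm x hx⟩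
    have hnadj : ¬ G.Adj x m := fun h => hfree (hG.freeSeg h)
    set E : Set (V × V) := {e | G.Adj e.1 e.2 ∧ e.1 ≠ x ∧ e.1 ≠ m ∧ e.2 ≠ x ∧ e.2 ≠ m} with hE
    set U : Set Plane := ⋃ e ∈ E, segment ℝ (p e.1) (p e.2) with hU
    have hUc : IsClosed U := Set.Finite.isClosed_biUnion (Set.toFinite E) fun e _ => by
      rw [segment_eq_image_lineMap]
      exact (isCompact_Icc.image (by fun_prop)).isClosed
    set K : Set ℝ := Set.Icc 0 1 ∩ (fun t : ℝ => (AffineMap.lineMap (p x) (p m) t : Plane)) ⁻¹' U with hK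
    have hKc : IsCompact K := isCompact_Icc.inter_right (hUc.preimage (by fun_prop))
    have hKne : K.Nonempty := by
      unfold FreeSeg at hfree
      push Not at hfree
      obtain ⟨i, j, hij, h1, h2, h3, h4, hd⟩ := hfree
      rw [Set.not_disjoint_iff] at hd
      obtain ⟨s, hs1, hs2⟩ := hd
      obtain ⟨t, ht0, ht1, rfl⟩ := mem_segment_iff_lineMap.1 hs2
      exact ⟨t, ⟨ht0, ht1⟩, Set.mem_biUnion (x := (i, j)) ⟨hij, h1, h2, h3, h4⟩ hs1⟩
    -- The first point, coming from `x`, at which the segment to `m` meets an edge that avoids both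
    -- `x` and `m`.
    obtain ⟨t0, ⟨⟨ht00, ht01⟩, ht0U⟩, ht0min⟩ := hKc.exists_isLeast hKne
    simp only [hU, Set.mem_preimage, Set.mem_iUnion] at ht0U
    obtain ⟨⟨i, j⟩, ⟨hij, h1, h2, h3, h4⟩, hh⟩ := ht0U
    simp only at hij h1 h2 h3 h4 hh
    set h : Plane := AffineMap.lineMap (p x) (p m) t0 with hhdef
    have hhm : h ∈ segment ℝ (p x) (p m) := mem_segment_iff_lineMap.2 ⟨t0, ht00, ht01, rfl⟩
    have hnv : ∀ v, h ≠ p v := by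
      intro v hv
      rw [hv] at hh hhm
      rcases hgp.eq_of_mem_segment hij.ne hh with rfl | rfl <;>
      rcases hgp.eq_of_mem_segment hx hhm with h | h <;> contradiction
    have ht0pos : 0 < t0 := by
      refine lt_of_le_of_ne ht00 ?_
      rintro rfl
      exact hnv x (by rw [hhdef, AffineMap.lineMap_apply_zero])
    have ht0lt : t0 < 1 := by
      refine lt_of_le_of_ne ht01 ?_
      rintro rfl
      exact hnv m (by rw [hhdef, AffineMap.lineMap_apply_one])
    -- an edge meeting the path `x h i` after `x` is the edge `ij`
    have key : ∀ i, ∀ j, G.Adj i j → i ≠ x → i ≠ m → j ≠ x → j ≠ m → h ∈ segment ℝ (p i) (p j) →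
        G.Reachable x i := by
      intro i j hij h1 h2 h3 h4 hh
      have key : ∀ k l, G.Adj k l → ∀ s ∈ segment ℝ (p k) (p l),
          ((s ∈ segment ℝ (p x) h ∧ s ≠ p x) ∨ (s ∈ segment ℝ h (p i) ∧ s ≠ p i)) →
          (∀ v, s ≠ p v) ∧ ∀ z ∈ segment ℝ (p k) (p l), cr h (p i) z = 0 := by
        intro k l hkl s hs hcase
        have same : s ∈ segment ℝ (p i) (p j) → (∀ v, s ≠ p v) →
            ∀ z ∈ segment ℝ (p k) (p l), cr h (p i) z = 0 := by
          intro h5 h6 z hz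
          have hz' : z ∈ segment ℝ (p i) (p j) := by
            rcases edge_unique hgp hG hij hkl h5 hs h6 with ⟨rfl, rfl⟩ | ⟨rfl, rfl⟩
            · exact hz
            · rwa [segment_symm]
          obtain ⟨a, -, -, rfl⟩ := mem_segment_iff_lineMap.1 hz'
          obtain ⟨b, -, -, hb⟩ := mem_segment_iff_lineMap.1 hh
          rw [hb]; unfold cr; simp only [lineMap_coord]; ring
        rcases hcase with ⟨hsx, hsne⟩ | ⟨hsi, hsne⟩
        · obtain ⟨t, ht0', ht1', hst⟩ := mem_segment_iff_lineMap.1 hsx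
          have hst' : s = AffineMap.lineMap (p x) (p m) (t * t0) := by
            rw [hst, hhdef]; apply Plane.ext <;> simp only [lineMap_coord] <;> ring
          have htt : t * t0 ≤ t0 := by nlinarith
          have hsm : s ∈ segment ℝ (p x) (p m) :=
            mem_segment_iff_lineMap.2 ⟨t * t0, by positivity, by linarith, hst'⟩
          have htpos : 0 < t := by
            refine lt_of_le_of_ne ht0' ?_
            rintro rfl
            exact hsne (by rw [hst, AffineMap.lineMap_apply_zero])
          have hsv : ∀ v, s ≠ p v := by
            intro v hv
            have hsm' := hsm
            rw [hv] at hsm'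
            rcases hgp.eq_of_mem_segment hx hsm' with rfl | rfl
            · exact hsne hv
            · have : (1 - t * t0) * (f (p x) - f (p v)) = 0 := by
                have := congrArg f hst'
                rw [hv, fline] at this; linarith
              rcases mul_eq_zero.1 this with h | h
              · linarith
              · exact (fm x hx).ne (by linarith)
          refine ⟨hsv, ?_⟩
          have hkl' : k ≠ x ∧ k ≠ m ∧ l ≠ x ∧ l ≠ m := by
            have aux : ∀ k l, G.Adj k l → s ∈ segment ℝ (p k) (p l) → k ≠ x ∧ k ≠ m := by
              intro k l hkl hs
              obtain ⟨r, hr0, hr1, hsr⟩ := mem_segment_iff_lineMap.1 hs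
              have hr : r ≠ 0 := by
                rintro rfl; exact hsv k (by rw [hsr, AffineMap.lineMap_apply_zero])
              have h0 := cr_eq_zero_of_mem_segment hsm
              rw [hsr, cr_lineMap] at h0
              constructor
              · rintro rfl
                simp only [cr_self_mid, mul_zero, zero_add, mul_eq_zero] at h0
                rcases hgp.eq_of_cr_eq_zero hx (h0.resolve_left hr) with h | h
                · exact hkl.ne' h
                · exact hnadj (h ▸ hkl)
              · rintro rfl
                simp only [cr_self_right, mul_zero, zero_add, mul_eq_zero] at h0
                rcases hgp.eq_of_cr_eq_zero hx (h0.resolve_left hr) with h | h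
                · exact hnadj (h ▸ hkl.symm)
                · exact hkl.ne' h
            have a1 := aux k l hkl hs
            have a2 := aux l k hkl.symm (by rwa [segment_symm])
            exact ⟨a1.1, a1.2, a2.1, a2.2⟩
          have hin : t * t0 ∈ K := by
            refine ⟨⟨by positivity, by linarith⟩, ?_⟩
            rw [Set.mem_preimage, ← hst']
            exact Set.mem_biUnion (x := (k, l)) ⟨hkl, hkl'⟩ hs
          have h7 := ht0min hin
          have : t = 1 := by nlinarith
          have hsh : s = h := by rw [hst, this, AffineMap.lineMap_apply_one]
          exact same (hsh ▸ hh) hsv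
        · have hsij : s ∈ segment ℝ (p i) (p j) :=
            (convex_segment _ _).segment_subset hh (left_mem_segment _ _ _) hsi
          have hsv : ∀ v, s ≠ p v := by
            intro v hv
            have hsij' := hsij
            rw [hv] at hsij'
            rcases hgp.eq_of_mem_segment hij.ne hsij' with rfl | rfl
            · exact hsne hv
            · obtain ⟨r, hr0, hr1, hr⟩ := mem_segment_iff_lineMap.1 hh
              obtain ⟨t, ht0, ht1, ht⟩ := mem_segment_iff_lineMap.1 hsi
              have : s = AffineMap.lineMap (p i) (p v) (r * (1 - t)) := by
                rw [ht, hr]; apply Plane.ext <;> simp only [lineMap_coord] <;> ring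
              rw [hv] at this
              have hne := hp.ne hij.ne
              have e : r * (1 - t) = 1 := by
                by_contra hcon
                apply hne
                have h0 := congrArg (fun s : Plane => s 0) this
                have h1 := congrArg (fun s : Plane => s 1) this
                simp only [lineMap_coord] at h0 h1
                have hcon' : 1 - r * (1 - t) ≠ 0 := fun h => hcon (by linarith)
                apply Plane.ext
                · have : (1 - r * (1 - t)) * (p i 0 - p v 0) = 0 := by linarith
                  linarith [(mul_eq_zero.1 this).resolve_left hcon']
                · have : (1 - r * (1 - t)) * (p i 1 - p v 1) = 0 := by linarith
                  linarith [(mul_eq_zero.1 this).resolve_left hcon']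
              have hr1' : r = 1 := by nlinarith
              exact hnv v (by rw [hr, hr1', AffineMap.lineMap_apply_one])
          exact ⟨hsv, same hsij hsv⟩
      -- The triangle with corners `x`, `h`, `i` is a pocket with apex `h`, in one of its two
      -- orientations: an edge touching its sides at `h` lies in the line `hi` and so does not enter
      -- the open triangle.
      have hD : cr (p x) h (p i) ≠ 0 := by
        intro h0
        have : t0 * cr (p x) (p m) (p i) = 0 := by
          rw [← h0, hhdef]; unfold cr; simp only [lineMap_coord]; ring
        rcases mul_eq_zero.1 this with h | h
        · exact ht0pos.ne' h
        · rcases hgp.eq_of_cr_eq_zero hx h with h | h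
          · exact h1 h
          · exact h2 h
      rcases lt_or_gt_of_ne hD with hneg | hpos
      · have hpos' : 0 < cr (p i) h (p x) := by
          have : cr (p i) h (p x) = - cr (p x) h (p i) := by unfold cr; ring
          linarith
        have side : ∀ s, OnSides (p i) h (p x) s →
            ((s ∈ segment ℝ (p x) h ∧ s ≠ p x) ∨ (s ∈ segment ℝ h (p i) ∧ s ≠ p i)) := by
          intro s hs
          rcases hs.mem hpos' with ⟨h5, h6⟩ | ⟨h5, h6⟩
          · right; exact ⟨by rwa [segment_symm], h6⟩
          · left; exact ⟨by rwa [segment_symm], h6⟩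
        refine (reach (x := i) (y := x) (u := h) ⟨hpos', ?_, ?_⟩).symm
        · rintro k l hkl z hz ⟨-, hz2, -⟩ s hs hside
          have := (key k l hkl s hs (side s hside)).2 z hz
          have e : cr (p i) h z = - cr h (p i) z := by unfold cr; ring
          linarith
        · intro v hv
          exfalso
          rcases side _ hv with ⟨h5, h6⟩ | ⟨h5, h6⟩
          · have := (convex_segment _ _).segment_subset (left_mem_segment ℝ _ _) hhm h5
            rcases hgp.eq_of_mem_segment hx this with h | h
            · exact h6 (by rw [h])
            · rw [h] at h5
              obtain ⟨r, hr0, hr1, hr⟩ := mem_segment_iff_lineMap.1 h5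
              have := congrArg f hr
              rw [fline, hhdef, fline] at this
              have h8 := fm x hx
              have h9 : (1 - r * t0) * (f (p m) - f (p x)) = 0 := by linarith
              rcases mul_eq_zero.1 h9 with h | h
              · nlinarith
              · linarith
          · have hsij : p v ∈ segment ℝ (p i) (p j) :=
              (convex_segment _ _).segment_subset hh (left_mem_segment _ _ _) h5
            exact (key i j hij (p v) hsij (Or.inr ⟨h5, h6⟩)).1 v rfl
      · refine reach (x := x) (y := i) (u := h) ⟨hpos, ?_, ?_⟩
        · rintro k l hkl z hz ⟨-, -, hz2⟩ s hs hside
          have := (key k l hkl s hs (hside.mem hpos)).2 z hz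
          linarith
        · intro v hv
          exfalso
          rcases hv.mem hpos with ⟨h5, h6⟩ | ⟨h5, h6⟩
          · have := (convex_segment _ _).segment_subset (left_mem_segment ℝ _ _) hhm h5
            rcases hgp.eq_of_mem_segment hx this with h | h
            · exact h6 (by rw [h])
            · rw [h] at h5
              obtain ⟨r, hr0, hr1, hr⟩ := mem_segment_iff_lineMap.1 h5
              have := congrArg f hr
              rw [fline, hhdef, fline] at this
              have h8 := fm x hx
              have h9 : (1 - r * t0) * (f (p m) - f (p x)) = 0 := by linarith
              rcases mul_eq_zero.1 h9 with h | h
              · nlinarith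
              · linarith
          · have hsij : p v ∈ segment ℝ (p i) (p j) :=
              (convex_segment _ _).segment_subset hh (left_mem_segment _ _ _) h5
            exact (key i j hij (p v) hsij (Or.inr ⟨h5, h6⟩)).1 v rfl
    have fh : f (p x) < f h := by
      rw [hhdef, fline]; nlinarith [fm x hx]
    obtain ⟨r, hr0, hr1, hr⟩ := mem_segment_iff_lineMap.1 hh
    have fr : f h = (1 - r) * f (p i) + r * f (p j) := by rw [hr, fline]
    -- One end of the edge through `h` is at least as high as `h`, which is higher than `x`; both
    -- ends are reachable.
    by_cases hcmp : f h ≤ f (p i)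
    · exact ⟨i, key i j hij h1 h2 h3 h4 hh, by linarith⟩
    · refine ⟨j, key j i hij.symm h3 h4 h1 h2 (by rwa [segment_symm]), ?_⟩
      by_contra hcon
      rw [not_le] at hcmp
      have h5 : 0 ≤ r * (f h - f (p j)) := mul_nonneg hr0 (by linarith)
      rcases hr1.eq_or_lt with rfl | hr1
      · linarith
      · have h6 := mul_pos (sub_pos.2 hr1) (sub_pos.2 hcmp)
        linarith
  have all : ∀ x, G.Reachable x m := by
    intro x
    by_contra hx
    obtain ⟨w, hw, hwmax⟩ := Set.exists_max_image {v | ¬ G.Reachable v m} (fun v => f (p v))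
      (Set.toFinite _) ⟨x, hx⟩
    have hwm : w ≠ m := by rintro rfl; exact hw (SimpleGraph.Reachable.refl _)
    obtain ⟨y, hy, hfy⟩ := up w hwm
    by_cases hym : G.Reachable y m
    · exact hw (hy.trans hym)
    · exact absurd (hwmax y hym) (not_le.2 hfy)
  exact ⟨fun a b => (all a).trans (all b).symm⟩

end pocket
end PseudoTriang
namespace PseudoTriang

/-! ### Angular sectors and walks between them. -/

section darts
variable {V : Type*} (p : V → Plane) (G : SimpleGraph V)

/-- `vb` is the last edge at `v` strictly before the direction of `w`, counterclockwise. -/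
def Before (v b : V) (w : Plane) : Prop :=
  G.Adj v b ∧ ∀ c, G.Adj v c → ccwAngle (p v) (p b) w ≤ ccwAngle (p v) (p c) w

/-- `vb` is the last edge at `v` before the direction of `w` or in that direction. -/
def UpTo (v b : V) (w : Plane) : Prop :=
  G.Adj v b ∧ ∀ c, G.Adj v c → ccwAngle (p v) w (p c) ≤ ccwAngle (p v) w (p b)

/-- A dart `(v, b)` stands for the angular sector at `v` that follows the edge `vb` counterclockwise.
This is a step from a sector to a sector along a segment `xy` that crosses no edge; if `xy`
is an edge, both sectors lie on its right side. -/
def RStep (d e : V × V) : Prop :=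
  d.1 ≠ e.1 ∧ FreeSeg p G d.1 e.1 ∧ Before p G d.1 d.2 (p e.1) ∧ UpTo p G e.1 e.2 (p d.1)

/-- Allowing both orientations makes steps reversible and lets an edge be followed on either of its
sides. -/
def AStep (d e : V × V) : Prop := RStep p G d e ∨ RStep p G e d

/-- The successor of a sector on the boundary walk of its face. -/
def FaceStep (d e : V × V) : Prop :=
  G.Adj d.1 e.1 ∧ Before p G d.1 d.2 (p e.1) ∧ e.2 = d.1

/-- The sector of the dart is convex. -/
def ConvexDart (d : V × V) : Prop :=
  ∃ a, G.Adj d.1 a ∧ Before p G d.1 d.2 (p a) ∧ ccwAngle (p d.1) (p d.2) (p a) < Real.pi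

/-- `StepWalk n s d l`: there is a walk from `s` to `d` with `n` steps and length `l`. -/
def StepWalk (s : V × V) : ℕ → V × V → ℝ → Prop
  | 0, d, l => d = s ∧ l = 0
  | n + 1, d, l => ∃ e l', StepWalk s n e l' ∧ AStep p G e d ∧ l = l' + dist (p e.1) (p d.1)

def SWalk (s d : V × V) (l : ℝ) : Prop := ∃ n, StepWalk p G s n d l

variable {p G}

lemma AStep.symm {d e : V × V} (h : AStep p G d e) : AStep p G e d := Or.symm h

lemma AStep.ne {d e : V × V} (h : AStep p G d e) : d.1 ≠ e.1 := by
  rcases h with h | h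
  · exact h.1
  · exact h.1.symm

lemma SWalk.refl (s : V × V) : SWalk p G s s 0 := ⟨0, rfl, rfl⟩

lemma SWalk.step {s d e : V × V} {l : ℝ} (h : SWalk p G s d l) (h' : AStep p G d e) :
    SWalk p G s e (l + dist (p d.1) (p e.1)) := by
  obtain ⟨n, hn⟩ := h
  exact ⟨n + 1, d, l, hn, h', rfl⟩

lemma SWalk.trans {s d e : V × V} {l l' : ℝ} (h : SWalk p G s d l) (h' : SWalk p G d e l') :
    SWalk p G s e (l + l') := by
  obtain ⟨n, hn⟩ := h'
  induction n generalizing e l' with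
  | zero => obtain ⟨rfl, rfl⟩ := hn; simpa using h
  | succ n ih =>
    obtain ⟨f, l'', h1, h2, rfl⟩ := hn
    have := (ih h1).step h2
    rwa [add_assoc] at this

lemma SWalk.single {d e : V × V} (h : AStep p G d e) : SWalk p G d e (dist (p d.1) (p e.1)) := by
  simpa using (SWalk.refl d).step h

lemma SWalk.symm {s d : V × V} {l : ℝ} (h : SWalk p G s d l) : SWalk p G d s l := by
  obtain ⟨n, hn⟩ := h
  induction n generalizing d l with
  | zero => obtain ⟨rfl, rfl⟩ := hn; exact SWalk.refl _
  | succ n ih =>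
    obtain ⟨f, l'', h1, h2, rfl⟩ := hn
    have := (SWalk.single h2.symm).trans (ih h1)
    rwa [dist_comm, add_comm] at this

lemma SWalk.tail {s d : V × V} {l : ℝ} (h : SWalk p G s d l) (hne : s ≠ d) :
    ∃ e l', SWalk p G s e l' ∧ AStep p G e d ∧ l = l' + dist (p e.1) (p d.1) := by
  obtain ⟨n, hn⟩ := h
  cases n with
  | zero => exact absurd hn.1.symm hne
  | succ n =>
    obtain ⟨e, l', h1, h2, h3⟩ := hn
    exact ⟨e, l', ⟨n, h1⟩, h2, h3⟩

/-- Distances between distinct points are bounded below, so walks no longer than a given one have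
boundedly many steps; and for each number of steps only finitely many lengths occur. -/
lemma SWalk.exists_min [Finite V] (hp : Function.Injective p) {s d : V × V} {l : ℝ}
    (h : SWalk p G s d l) : ∃ m, SWalk p G s d m ∧ ∀ l', SWalk p G s d l' → m ≤ l' := by
  have hfin : ∀ n d, {l | StepWalk p G s n d l}.Finite := by
    intro n
    induction n with
    | zero =>
      intro d
      exact (Set.finite_singleton (0 : ℝ)).subset fun l hl => hl.2
    | succ n ih =>
      intro d
      refine (Set.finite_iUnion fun e : V × V =>
        (ih e).image (fun l => l + dist (p e.1) (p d.1))).subset ?_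
      rintro l ⟨e, l', h1, h2, rfl⟩
      exact Set.mem_iUnion.2 ⟨e, l', h1, rfl⟩
  obtain ⟨m, hm, hlow⟩ : ∃ m : ℝ, 0 < m ∧ ∀ x y, x ≠ y → m ≤ dist (p x) (p y) := by
    set D : Set ℝ := (fun e : V × V => dist (p e.1) (p e.2)) '' {e | e.1 ≠ e.2}
    have hD : D.Finite := (Set.toFinite _).image _
    by_cases hne : D.Nonempty
    · obtain ⟨m, ⟨e, he, hem⟩, hmin⟩ := Set.exists_min_image D id hD hne
      refine ⟨m, ?_, fun x y hxy => hmin _ ⟨(x, y), hxy, rfl⟩⟩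
      rw [← hem]; exact dist_pos.2 (hp.ne he)
    · refine ⟨1, one_pos, fun x y hxy => ?_⟩
      exact absurd ⟨_, (x, y), hxy, rfl⟩ hne
  have hlen : ∀ n d l, StepWalk p G s n d l → n * m ≤ l := by
    intro n
    induction n with
    | zero => rintro d l ⟨-, rfl⟩; simp
    | succ n ih =>
      rintro d l ⟨e, l', h1, h2, rfl⟩
      have := ih e l' h1
      have := hlow _ _ h2.ne
      push_cast; linarith
  obtain ⟨N, hN⟩ := exists_nat_gt (l / m)
  have hS : {l' | SWalk p G s d l' ∧ l' ≤ l}.Finite := by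
    refine (Set.finite_iUnion fun n : Fin N => hfin n d).subset ?_
    rintro l' ⟨⟨n, hn⟩, hle⟩
    have h1 := hlen n d l' hn
    rw [div_lt_iff₀ hm] at hN
    have : n < N := by
      by_contra hc
      have : (N : ℝ) ≤ n := by exact_mod_cast not_lt.1 hc
      nlinarith
    exact Set.mem_iUnion.2 ⟨⟨n, this⟩, hn⟩
  obtain ⟨m', ⟨h1, h2⟩, h3⟩ := Set.exists_min_image _ id hS ⟨l, h, le_rfl⟩
  refine ⟨m', h1, fun l' hl' => ?_⟩
  by_cases hc : l' ≤ l
  · exact h3 l' ⟨hl', hc⟩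
  · exact h2.trans (not_le.1 hc).le

/-! ### Sectors and directions -/

lemma ccwAngle_lineMap {v a b : Plane} {t : ℝ} (ht : 0 < t) :
    ccwAngle v a (AffineMap.lineMap v b t) = ccwAngle v a b ∧
    ccwAngle v (AffineMap.lineMap v b t) a = ccwAngle v b a := by
  have : direction (AffineMap.lineMap v b t - v) = direction (b - v) := by
    unfold direction
    have : (⟨(AffineMap.lineMap v b t - v : Plane) 0, (AffineMap.lineMap v b t - v : Plane) 1⟩ : ℂ) =
        (t : ℂ) * ⟨(b - v) 0, (b - v) 1⟩ := by
      apply Complex.ext <;> simp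
    rw [this, Complex.arg_real_mul _ ht]
  unfold ccwAngle
  rw [this]
  exact ⟨rfl, rfl⟩

lemma exists_upTo [Finite V] {v : V} (h : ∃ c, G.Adj v c) (w : Plane) : ∃ b, UpTo p G v b w := by
  obtain ⟨b, hb, hmax⟩ := Set.exists_max_image {c | G.Adj v c} (fun c => ccwAngle (p v) w (p c))
    (Set.toFinite _) h
  exact ⟨b, hb, hmax⟩

lemma exists_before [Finite V] {v : V} (h : ∃ c, G.Adj v c) (w : Plane) : ∃ b, Before p G v b w := by
  obtain ⟨b, hb, hmax⟩ := Set.exists_min_image {c | G.Adj v c} (fun c => ccwAngle (p v) (p c) w)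
    (Set.toFinite _) h
  exact ⟨b, hb, hmax⟩

/-- If no edge points strictly between two directions, the last edge up to the first one
is the last edge before the second. -/
lemma upTo_iff_before {v b : V} {w w' : Plane}
    (h : ∀ c, G.Adj v c → ccwAngle (p v) w w' ≤ ccwAngle (p v) w (p c)) :
    UpTo p G v b w ↔ Before p G v b w' := by
  have key : ∀ c, G.Adj v c →
      ccwAngle (p v) (p c) w' = ccwAngle (p v) w w' + 2 * Real.pi - ccwAngle (p v) w (p c) := by
    intro c hc
    have h1 := h c hc
    have h2 := ccwAngle_pos (p v) (p c) w'
    rcases ccwAngle_add (p v) w (p c) w' with h | h <;> linarith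
  unfold UpTo Before
  refine and_congr_right fun hb => forall_congr' fun c => forall_congr' fun hc => ?_
  rw [key b hb, key c hc]
  constructor <;> intro h <;> linarith

/-- `UpTo` and `Before` differ only in the treatment of an edge pointing exactly towards `w`. -/
lemma upTo_iff_before_self {v b : V} {w : Plane}
    (h : ∀ c, G.Adj v c → ccwAngle (p v) w (p c) ≠ 2 * Real.pi) :
    UpTo p G v b w ↔ Before p G v b w := by
  have key : ∀ c, G.Adj v c → ccwAngle (p v) (p c) w = 2 * Real.pi - ccwAngle (p v) w (p c) := by
    intro c hc
    have h1 := lt_of_le_of_ne (ccwAngle_le _ _ _) (h c hc)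
    have h2 := ccwAngle_le (p v) (p c) w
    have h3 := ccwAngle_self (p v) w
    rcases ccwAngle_add (p v) w (p c) w with h | h <;> linarith
  unfold UpTo Before
  refine and_congr_right fun hb => forall_congr' fun c => forall_congr' fun hc => ?_
  rw [key b hb, key c hc]
  constructor <;> intro h <;> linarith

/-- Close to its corner `v` the triangle agrees with the angular sector spanned by `a` and `b`. -/
lemma exists_mem_openTri {v a b c : Plane} (hD : 0 < cr v a b) (h1 : 0 < cr v a c)
    (h2 : 0 < cr v c b) : ∃ s ∈ segment ℝ v c, InOpenTri v a b s := by
  have key : ∀ᶠ t in 𝓝[>] (0 : ℝ), 0 < cr a b (AffineMap.lineMap v c t) := by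
    simp only [cr_lineMap]
    apply Filter.Eventually.filter_mono nhdsWithin_le_nhds
    have : Tendsto (fun t : ℝ => (1 - t) * cr a b v + t * cr a b c) (𝓝 0)
      (𝓝 ((1 - 0) * cr a b v + 0 * cr a b c)) := Continuous.tendsto (by fun_prop) _
    refine this.eventually_const_lt ?_
    rw [cr_rot]; linarith
  have key2 : ∀ᶠ t in 𝓝[>] (0 : ℝ), t ∈ Set.Ioc (0 : ℝ) 1 := Ioc_mem_nhdsGT zero_lt_one
  obtain ⟨t, h3, h4, h5⟩ := (key.and key2).exists
  refine ⟨_, mem_segment_iff_lineMap.2 ⟨t, h4.le, h5, rfl⟩, ?_, ?_, h3⟩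
  · rw [cr_lineMap, cr_self_right, ← cr_rot b v c] at *
    have : cr b v c = cr v c b := cr_rot b v c |>.symm
    rw [cr_rot b v c, this, mul_zero, zero_add]; exact mul_pos h4 h2
  · rw [cr_lineMap, cr_self_mid, mul_zero, zero_add]; exact mul_pos h4 h1

lemma cr_pos_of_between {v a b c : Plane} (ha : a ≠ v) (hb : b ≠ v) (hc : c ≠ v) (hD : 0 < cr v a b)
    (h : ccwAngle v a c < ccwAngle v a b) : 0 < cr v a c ∧ 0 < cr v c b := by
  rw [← ccwAngle_lt_pi_iff ha hb] at hD
  rw [← ccwAngle_lt_pi_iff ha hc, ← ccwAngle_lt_pi_iff hc hb]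
  have h1 := ccwAngle_pos v a c
  have h2 := ccwAngle_le v c b
  refine ⟨by linarith, ?_⟩
  rcases ccwAngle_add v a c b with h | h <;> linarith

lemma between_of_cr_pos {v a b c : Plane} (ha : a ≠ v) (hb : b ≠ v) (hc : c ≠ v)
    (h1 : 0 < cr v a c) (h2 : 0 < cr v c b) : ccwAngle v a c < ccwAngle v a b := by
  rw [← ccwAngle_lt_pi_iff ha hc] at h1
  rw [← ccwAngle_lt_pi_iff hc hb] at h2
  have h3 := ccwAngle_pos v c b
  have h4 := ccwAngle_pos v a b
  rcases ccwAngle_add v a c b with h | h <;> linarith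

variable (hp : Function.Injective p)
include hp

lemma not_between {v : V} {a b : Plane} (ha : a ≠ p v) (hb : b ≠ p v) (hD : 0 < cr (p v) a b)
    (h : ∀ i j, G.Adj i j → ∀ h ∈ segment ℝ (p i) (p j), ¬ InOpenTri (p v) a b h) {c : V}
    (hc : G.Adj v c) : ccwAngle (p v) a b ≤ ccwAngle (p v) a (p c) := by
  by_contra hcon
  obtain ⟨h1, h2⟩ := cr_pos_of_between ha hb (hp.ne hc.ne') hD (not_le.1 hcon)
  obtain ⟨s, hs, hs'⟩ := exists_mem_openTri hD h1 h2
  exact h v c hc s hs hs'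

variable [Finite V] (hgp : GeneralPosition p)
include hgp

set_option maxHeartbeats 1000000 in
/-- A pocket whose apex is joined to `x` and `y` can be bypassed by a shorter walk. -/
lemma Pocket.exists_walk (hiso : ∀ v, ∃ c, G.Adj v c) {x y bx b' : V} {u : Plane}
    (hP : Pocket p G x u y) (hx : UpTo p G x bx u) (hy : Before p G y b' u) :
    ∃ l < dist (p x) u + dist u (p y), SWalk p G (x, bx) (y, b') l := by
  have ne_of : ∀ {x : V} {u : Plane}, Pocket p G x u y → u ≠ p x ∧ u ≠ p y ∧ p y ≠ p x := by
    intro x u hP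
    have := hP.pos
    refine ⟨?_, ?_, ?_⟩ <;> intro h <;> rw [h] at this <;> simp at this
  -- Along the chain the apex moves from `u` to `q` on the side towards `y`, so the condition at `y`
  -- persists, and the triangle inequality for `x`, `u`, `q` pays for each new segment.
  refine Pocket.induction hp hgp (P := fun x u => ∀ bx, UpTo p G x bx u → Before p G y b' u →
    ∃ l < dist (p x) u + dist u (p y), SWalk p G (x, bx) (y, b') l) ?_ ?_ hP bx hx hy
  · intro x u hP hfree hno bx hx hy
    obtain ⟨n1, n2, n3⟩ := ne_of hP
    refine ⟨dist (p x) (p y), ?_, ?_⟩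
    · refine lt_of_le_of_ne (dist_triangle _ _ _) fun h => ?_
      have hw := dist_add_dist_eq_iff.1 h.symm
      rw [← mem_segment_iff_wbtw] at hw
      have := cr_eq_zero_of_mem_segment hw
      rw [cr_swap] at this
      linarith [hP.pos]
    · refine SWalk.single (Or.inl ⟨?_, hfree, ?_, ?_⟩)
      · rintro rfl; exact n3 rfl
      · rw [← upTo_iff_before (w := u)]
        · exact hx
        · exact fun c hc => not_between hp n1 n3 hP.pos hno hc
      · have hD : 0 < cr (p y) (p x) u := by
          have := hP.pos
          rwa [← cr_rot, ← cr_rot] at this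
        have hno' : ∀ i j, G.Adj i j → ∀ h ∈ segment ℝ (p i) (p j), ¬ InOpenTri (p y) (p x) u h :=
          fun i j hij h hh h' => hno i j hij h hh ⟨h'.2.1, h'.2.2, h'.1⟩
        have hsec : ∀ c, G.Adj y c → ccwAngle (p y) (p x) u ≤ ccwAngle (p y) (p x) (p c) :=
          fun c hc => not_between hp n3.symm n2 hD hno' hc
        exact (upTo_iff_before hsec).2 hy
  · rintro x u z q hP hzx hfree hno hP' ⟨l, hl0, hl1, hq⟩ ⟨t, ht0, ht1, hz⟩ ih bx hx hy
    obtain ⟨n1, n2, n3⟩ := ne_of hP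
    obtain ⟨m1, m2, m3⟩ := ne_of hP'
    have hDq : 0 < cr (p x) u q := by
      rw [hq, cr_lineMap]; simp; exact mul_pos hl0 hP.pos
    have nqx : q ≠ p x := by rintro h; rw [h] at hDq; simp at hDq
    obtain ⟨bz, hbz⟩ := exists_upTo (p := p) (hiso z) q
    have hy' : Before p G y b' q := by
      have : q = AffineMap.lineMap (p y) u (1 - l) := by
        rw [hq]; apply Plane.ext <;> simp only [lineMap_coord] <;> ring
      unfold Before at hy ⊢
      rw [this]
      simpa only [(ccwAngle_lineMap (sub_pos.2 hl1)).1] using hy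
    obtain ⟨l', hl', hw⟩ := ih bz hbz hy'
    refine ⟨dist (p x) (p z) + l', ?_, ?_⟩
    · have e1 : dist (p x) (p z) + dist (p z) q = dist (p x) q :=
        dist_add_dist_of_mem_segment (mem_segment_iff_lineMap.2 ⟨t, ht0.le, ht1.le, hz⟩)
      have e2 : dist u q + dist q (p y) = dist u (p y) :=
        dist_add_dist_of_mem_segment (mem_segment_iff_lineMap.2 ⟨l, hl0.le, hl1.le, hq⟩)
      have e3 := dist_triangle (p x) u q
      linarith
    · suffices hst : RStep p G (x, bx) (z, bz) from (SWalk.single (Or.inl hst)).trans hw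
      refine ⟨hzx.symm, hfree, ?_, ?_⟩
      · have h1 : Before p G x bx q := by
          rw [← upTo_iff_before (w := u)]
          · exact hx
          · exact fun c hc => not_between hp n1 nqx hDq hno hc
        unfold Before at h1 ⊢
        rw [hz]
        simpa only [(ccwAngle_lineMap ht0).1] using h1
      · have hpi : ∀ c, G.Adj z c → Real.pi < ccwAngle (p z) (p x) (p c) := by
          intro c hc
          by_contra hcon
          have hne := ccwAngle_ne_pi hp hgp hzx.symm hc.ne'
          have hlt := lt_of_le_of_ne (not_lt.1 hcon) hne
          rw [ccwAngle_lt_pi_iff (hp.ne hzx.symm) (hp.ne hc.ne')] at hlt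
          have ez : cr (p z) (p x) (p c) = t * cr q (p x) (p c) := by
            rw [hz]; unfold cr; simp only [lineMap_coord]; ring
          have h1 : 0 < cr q (p x) (p c) := by
            rw [ez] at hlt; exact (pos_iff_pos_of_mul_pos hlt).1 ht0
          have key : ∀ᶠ r in 𝓝[>] (0 : ℝ), 0 < cr (p x) u (AffineMap.lineMap (p z) (p c) r) ∧
              0 < cr u q (AffineMap.lineMap (p z) (p c) r) := by
            simp only [cr_lineMap]
            apply Filter.Eventually.filter_mono nhdsWithin_le_nhds
            apply Filter.Eventually.and
            · have : Tendsto (fun r : ℝ => (1 - r) * cr (p x) u (p z) + r * cr (p x) u (p c)) (𝓝 0)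
                (𝓝 ((1 - 0) * cr (p x) u (p z) + 0 * cr (p x) u (p c))) :=
                Continuous.tendsto (by fun_prop) _
              refine this.eventually_const_lt ?_
              rw [hz, cr_lineMap]; simp; exact mul_pos ht0 hDq
            · have : Tendsto (fun r : ℝ => (1 - r) * cr u q (p z) + r * cr u q (p c)) (𝓝 0)
                (𝓝 ((1 - 0) * cr u q (p z) + 0 * cr u q (p c))) := Continuous.tendsto (by fun_prop) _
              refine this.eventually_const_lt ?_
              rw [hz, cr_lineMap, cr_rot]; simp; exact mul_pos (sub_pos.2 ht1) hDq
          have key2 : ∀ᶠ r in 𝓝[>] (0 : ℝ), r ∈ Set.Ioc (0 : ℝ) 1 := Ioc_mem_nhdsGT zero_lt_one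
          obtain ⟨r, ⟨h2, h3⟩, h4, h5⟩ := (key.and key2).exists
          refine hno z c hc _ (mem_segment_iff_lineMap.2 ⟨r, h4.le, h5, rfl⟩) ⟨?_, h2, h3⟩
          rw [cr_lineMap]
          have : cr q (p x) (p z) = 0 := by
            rw [hz]; unfold cr; simp only [lineMap_coord]; ring
          rw [this, mul_zero, zero_add]; exact mul_pos h4 h1
        have hxq : ccwAngle (p z) (p x) q = Real.pi := by
          have hnx : p x ≠ p z := hp.ne hzx.symm
          have c0 : cr (p z) (p x) q = 0 := by
            rw [hz]; unfold cr; simp only [lineMap_coord]; ring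
          have d0 : dt (p z) (p x) q < 0 := by
            have : dt (p z) (p x) q = -(t * (1 - t)) * dt (p x) q q := by
              rw [hz]; unfold dt; simp only [lineMap_coord]; ring
            rw [this]
            have := mul_pos (mul_pos ht0 (sub_pos.2 ht1)) (dt_self_pos nqx.symm)
            linarith
          rcases lt_trichotomy (ccwAngle (p z) (p x) q) Real.pi with h | h | h
          · rw [ccwAngle_lt_pi_iff hnx m1] at h; linarith
          · exact h
          · rcases (ccwAngle_le (p z) (p x) q).lt_or_eq with h' | h'
            · have := cr_neg_of_pi_lt hnx m1 h h'; linarith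
            · have := (ccwAngle_eq_two_pi_iff hnx m1).1 h'; linarith [this.2]
        have key : ∀ c, G.Adj z c →
            ccwAngle (p z) q (p c) = ccwAngle (p z) (p x) (p c) - Real.pi := by
          intro c hc
          have h1 := hpi c hc
          have h2 := ccwAngle_le (p z) q (p c)
          rcases ccwAngle_add (p z) (p x) q (p c) with h | h <;> linarith
        refine ⟨hbz.1, fun c hc => ?_⟩
        have := hbz.2 c hc
        rw [key c hc, key bz hbz.1] at this
        change ccwAngle (p z) (p x) (p c) ≤ ccwAngle (p z) (p x) (p bz)
        linarith

end darts
end PseudoTriang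
namespace PseudoTriang

/-! ### Shortest walks and convex sectors. -/

section darts
variable {V : Type*} {p : V → Plane} {G : SimpleGraph V}

lemma UpTo.eq_of_adj (hp : Function.Injective p) (hgp : GeneralPosition p) {v b c : V}
    (h : UpTo p G v b (p c)) (hc : G.Adj v c) : b = c := by
  by_contra hne
  have h1 := h.2 c hc
  rw [ccwAngle_self] at h1
  exact absurd (ccwAngle_lt_two_pi hp hgp hc.ne' h.1.ne' (Ne.symm hne)) (not_lt.2 h1)

lemma Before.unique (hp : Function.Injective p) (hgp : GeneralPosition p) {v b b' : V} {w : Plane}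
    (h : Before p G v b w) (h' : Before p G v b' w) : b = b' := by
  by_contra hne
  have h1 := ccwAngle_lt_two_pi hp hgp h.1.ne' h'.1.ne' hne
  have h2 := ccwAngle_pos (p v) (p b) (p b')
  have h3 := h.2 b' h'.1
  have h4 := h'.2 b h.1
  rcases ccwAngle_add (p v) (p b) (p b') w with h | h <;> linarith

lemma upTo_self {v b : V} (h : G.Adj v b) : UpTo p G v b (p b) :=
  ⟨h, fun c _ => by rw [ccwAngle_self]; exact ccwAngle_le _ _ _⟩

lemma FaceStep.rStep (hG : IsNonCrossing p G) {d e : V × V} (h : FaceStep p G d e) :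
    RStep p G d e := by
  obtain ⟨h1, h2, h3⟩ := h
  refine ⟨h1.ne, hG.freeSeg h1, h2, ?_⟩
  rw [h3]; exact upTo_self h1.symm

lemma RStep.faceStep (hp : Function.Injective p) (hgp : GeneralPosition p) {d e : V × V}
    (h : RStep p G d e) (ha : G.Adj d.1 e.1) : FaceStep p G d e :=
  ⟨ha, h.2.2.1, h.2.2.2.eq_of_adj hp hgp ha.symm⟩

lemma upTo_iff_before_of_not_adj (hp : Function.Injective p) (hgp : GeneralPosition p) {v b x : V}
    (hx : x ≠ v) (h : ¬ G.Adj v x) : UpTo p G v b (p x) ↔ Before p G v b (p x) := by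
  apply upTo_iff_before_self
  intro c hc
  refine (ccwAngle_lt_two_pi hp hgp hx hc.ne' ?_).ne
  rintro rfl; exact h hc

/-- Away from edges `Before` and `UpTo` coincide, so the asymmetry of the step disappears. -/
lemma RStep.flip (hp : Function.Injective p) (hgp : GeneralPosition p) {d e : V × V}
    (h : RStep p G d e) (ha : ¬ G.Adj d.1 e.1) : RStep p G e d := by
  obtain ⟨h1, h2, h3, h4⟩ := h
  refine ⟨h1.symm, h2.symm, ?_, ?_⟩
  · exact (upTo_iff_before_of_not_adj hp hgp h1 fun h => ha h.symm).1 h4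
  · exact (upTo_iff_before_of_not_adj hp hgp h1.symm ha).2 h3

lemma AStep.rStep_of_not_adj (hp : Function.Injective p) (hgp : GeneralPosition p) {d e : V × V}
    (h : AStep p G d e) (ha : ¬ G.Adj d.1 e.1) : RStep p G d e := by
  rcases h with h | h
  · exact h
  · exact h.flip hp hgp fun h => ha h.symm

lemma ccwAngle_add_swap (hp : Function.Injective p) (hgp : GeneralPosition p) {v a b : V}
    (ha : a ≠ v) (hb : b ≠ v) (hab : a ≠ b) :
    ccwAngle (p v) (p a) (p b) + ccwAngle (p v) (p b) (p a) = 2 * Real.pi := by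
  have h1 := ccwAngle_lt_two_pi hp hgp ha hb hab
  have h2 := ccwAngle_lt_two_pi hp hgp hb ha hab.symm
  have h3 := ccwAngle_self (p v) (p a)
  rcases ccwAngle_add (p v) (p a) (p b) (p a) with h | h <;> linarith

/-- No edge at `v` points strictly between the directions of `x` and `y`. -/
def NoEdgeBetween (p : V → Plane) (G : SimpleGraph V) (v x y : V) : Prop :=
  ∀ c, G.Adj v c → ccwAngle (p v) (p x) (p y) ≤ ccwAngle (p v) (p x) (p c)

/-- Both segments point into the sector of `d`, so in one of the two orders no edge separates them.
If it is the order from `dy` to `dx`, neither segment is an edge and both steps can be flipped. -/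
lemma RStep.noEdgeBetween (hp : Function.Injective p) (hgp : GeneralPosition p) {dx d dy : V × V}
    (hne : dx ≠ dy) (h1 : RStep p G dx d) (h2 : RStep p G d dy) :
    (RStep p G dx d ∧ RStep p G d dy ∧ NoEdgeBetween p G d.1 dx.1 dy.1) ∨
    (RStep p G dy d ∧ RStep p G d dx ∧ NoEdgeBetween p G d.1 dy.1 dx.1) := by
  by_cases hS : NoEdgeBetween p G d.1 dx.1 dy.1
  · exact Or.inl ⟨h1, h2, hS⟩
  right
  unfold NoEdgeBetween at hS
  push Not at hS
  obtain ⟨c, hc, hlt⟩ := hS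
  have hu := h1.2.2.2
  have hb := h2.2.2.1
  have a1 : ccwAngle (p d.1) (p dx.1) (p d.2) + ccwAngle (p d.1) (p d.2) (p dy.1) =
      ccwAngle (p d.1) (p dx.1) (p dy.1) := by
    have e1 : ccwAngle (p d.1) (p c) (p dy.1) < ccwAngle (p d.1) (p dx.1) (p dy.1) := by
      have e2 := ccwAngle_pos (p d.1) (p dx.1) (p c)
      have e3 := ccwAngle_le (p d.1) (p c) (p dy.1)
      rcases ccwAngle_add (p d.1) (p dx.1) (p c) (p dy.1) with h | h <;> linarith
    have e2 := hb.2 c hc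
    have e3 := ccwAngle_le (p d.1) (p dx.1) (p d.2)
    rcases ccwAngle_add (p d.1) (p dx.1) (p d.2) (p dy.1) with h | h <;> linarith
  have a2 := ccwAngle_pos (p d.1) (p d.2) (p dy.1)
  have hxN : ¬ G.Adj d.1 dx.1 := by
    intro hx
    have e1 := hu.2 _ hx
    have e2 := ccwAngle_le (p d.1) (p dx.1) (p dy.1)
    rw [ccwAngle_self] at e1; linarith
  have hyN : ¬ G.Adj d.1 dy.1 := by
    intro hy
    have e1 := hu.2 _ hy
    linarith
  have f1 := h1.flip hp hgp fun h => hxN h.symm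
  have f2 := h2.flip hp hgp hyN
  refine ⟨f2, f1, fun c hc => ?_⟩
  have hxy : dx.1 ≠ dy.1 := by
    intro h
    apply hne
    apply Prod.ext h
    have b1 := h1.2.2.1
    have b2 := f2.2.2.1
    rw [← h] at b2
    exact b1.unique hp hgp b2
  have s1 := ccwAngle_add_swap hp hgp h1.1 h2.1.symm hxy
  have s2 := ccwAngle_self (p d.1) (p dy.1)
  have s3 : ccwAngle (p d.1) (p dx.1) (p c) < ccwAngle (p d.1) (p dx.1) (p dy.1) := by
    have := hu.2 c hc; linarith
  have s4 : ccwAngle (p d.1) (p dx.1) (p c) + ccwAngle (p d.1) (p c) (p dy.1) =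
      ccwAngle (p d.1) (p dx.1) (p dy.1) := by
    have := ccwAngle_le (p d.1) (p c) (p dy.1)
    rcases ccwAngle_add (p d.1) (p dx.1) (p c) (p dy.1) with h | h <;> linarith
  have s5 := ccwAngle_pos (p d.1) (p dx.1) (p c)
  have s6 := ccwAngle_pos (p d.1) (p dx.1) (p dy.1)
  have s7 := ccwAngle_le (p d.1) (p c) (p dy.1)
  rcases ccwAngle_add (p d.1) (p dy.1) (p c) (p dy.1) with h | h <;> linarith

/-- Reduces to the oriented case. When both segments are edges and the orientations do not fit, both
are the initial edge or both the final edge of the sector of `d`, which forces `dx = dy`. -/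
lemma AStep.noEdgeBetween (hp : Function.Injective p) (hgp : GeneralPosition p) {dx d dy : V × V}
    (hne : dx ≠ dy) (h1 : AStep p G dx d) (h2 : AStep p G d dy) :
    (RStep p G dx d ∧ RStep p G d dy ∧ NoEdgeBetween p G d.1 dx.1 dy.1) ∨
    (RStep p G dy d ∧ RStep p G d dx ∧ NoEdgeBetween p G d.1 dy.1 dx.1) := by
  by_cases hx : G.Adj d.1 dx.1
  · by_cases hy : G.Adj d.1 dy.1
    · rcases h1 with h1 | h1 <;> rcases h2 with h2 | h2
      · exact h1.noEdgeBetween hp hgp hne h2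
      · exfalso
        have e1 := h1.2.2.2.eq_of_adj hp hgp hx
        have e2 := h2.2.2.2.eq_of_adj hp hgp hy
        apply hne
        have e3 : dx.1 = dy.1 := by rw [← e1, ← e2]
        refine Prod.ext e3 ?_
        have b1 := h1.2.2.1
        have b2 := h2.2.2.1
        rw [← e3] at b2
        exact b1.unique hp hgp b2
      · exfalso
        apply hne
        have e3 : dx.1 = dy.1 := by
          by_contra hxy
          have b1 := h1.2.2.1
          have b2 := h2.2.2.1
          have s1 := ccwAngle_add_swap hp hgp h1.1.symm h2.1.symm hxy
          have s2 := b1.2 _ hy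
          have s3 := b2.2 _ hx
          have s4 := ccwAngle_pos (p d.1) (p d.2) (p dx.1)
          have s5 := ccwAngle_pos (p d.1) (p d.2) (p dy.1)
          rcases ccwAngle_add (p d.1) (p d.2) (p dx.1) (p dy.1) with h | h <;>
          rcases ccwAngle_add (p d.1) (p d.2) (p dy.1) (p dx.1) with h' | h' <;> linarith
        refine Prod.ext e3 ?_
        have b1 := h1.2.2.2.eq_of_adj hp hgp hx.symm
        have b2 := h2.2.2.2.eq_of_adj hp hgp hy.symm
        rw [b1, b2]
      · exact (h2.noEdgeBetween hp hgp hne.symm h1).symm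
    · have h2' := h2.rStep_of_not_adj hp hgp hy
      rcases h1 with h1 | h1
      · exact h1.noEdgeBetween hp hgp hne h2'
      · exact ((h2'.flip hp hgp hy).noEdgeBetween hp hgp hne.symm h1).symm
  · have h1' := h1.rStep_of_not_adj hp hgp fun h => hx h.symm
    have h1'' := h1'.flip hp hgp fun h => hx h.symm
    rcases h2 with h2 | h2
    · exact h1'.noEdgeBetween hp hgp hne h2
    · exact (h2.noEdgeBetween hp hgp hne.symm h1'').symm

/-- Adding the visible segment as an edge preserves the absence of crossings, and `edge_unique`
applies to the larger graph. -/
lemma FreeSeg.eq_of_mem (hgp : GeneralPosition p) (hG : IsNonCrossing p G)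
    {x y i j : V} (hxy : x ≠ y) (hf : FreeSeg p G x y) (hij : G.Adj i j) {s : Plane}
    (hs : s ∈ segment ℝ (p x) (p y)) (hs' : s ∈ segment ℝ (p i) (p j)) (hx : s ≠ p x) (hy : s ≠ p y) :
    (i = x ∧ j = y) ∨ (i = y ∧ j = x) := by
  have hG' := hG.sup_edge hf
  have h1 : (G ⊔ SimpleGraph.edge x y).Adj x y := by
    rw [SimpleGraph.sup_adj, SimpleGraph.edge_adj]; exact Or.inr ⟨Or.inl ⟨rfl, rfl⟩, hxy⟩
  have h2 : (G ⊔ SimpleGraph.edge x y).Adj i j := Or.inl hij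
  have hv : ∀ v, s ≠ p v := by
    intro v hv
    rw [hv] at hs
    rcases hgp.eq_of_mem_segment hxy hs with rfl | rfl <;> contradiction
  rcases edge_unique hgp hG' h1 h2 hs hs' hv with h | h
  · left; exact h
  · right; exact h

/-- Seen from `u`, an empty sector that spans an angle smaller than `π` is a pocket. -/
lemma pocket_of_noEdgeBetween (hp : Function.Injective p) (hgp : GeneralPosition p)
    (hG : IsNonCrossing p G) {u x y : V} (hx : x ≠ u) (hy : y ≠ u) (hfx : FreeSeg p G u x)
    (hfy : FreeSeg p G u y) (hS : NoEdgeBetween p G u x y) (hpos : 0 < cr (p u) (p x) (p y)) :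
    Pocket p G y (p u) x := by
  have hpos' : 0 < cr (p y) (p u) (p x) := by rwa [← cr_rot, ← cr_rot] at hpos
  refine ⟨hpos', ?_, ?_⟩
  · intro i j hij h hh ⟨h1, h2, h3⟩ s hs hside
    have apex : ∀ {j}, G.Adj u j → h ∈ segment ℝ (p u) (p j) → False := by
      intro j huj hh
      obtain ⟨r, hr0, hr1, hr⟩ := mem_segment_iff_lineMap.1 hh
      rw [hr, cr_lineMap] at h2 h3
      rw [cr_self_right, mul_zero, zero_add] at h2
      rw [cr_self_mid, mul_zero, zero_add] at h3
      have h2' := pos_of_mul_pos_right h2 hr0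
      have h3' := pos_of_mul_pos_right h3 hr0
      have e : cr (p u) (p j) (p y) = cr (p y) (p u) (p j) := by unfold cr; ring
      have := between_of_cr_pos (hp.ne hx) (hp.ne hy) (hp.ne huj.ne') h3' (e ▸ h2')
      exact absurd (hS j huj) (not_le.2 this)
    have side : ∀ {z}, z ≠ u → FreeSeg p G u z → s ∈ segment ℝ (p u) (p z) → s ≠ p z →
        cr (p u) (p z) h ≠ 0 → False := by
      intro z hzu hf hsz hszne hcr
      by_cases hsu : s = p u
      · rw [hsu] at hs
        rcases hgp.eq_of_mem_segment hij.ne hs with rfl | rfl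
        · exact apex hij hh
        · exact apex hij.symm (by rwa [segment_symm])
      · rcases hf.eq_of_mem hgp hG hzu.symm hij hsz hs hsu hszne with ⟨rfl, rfl⟩ | ⟨rfl, rfl⟩
        · exact hcr (cr_eq_zero_of_mem_segment hh)
        · rw [segment_symm] at hh; exact hcr (cr_eq_zero_of_mem_segment hh)
    rcases hside.mem hpos' with ⟨h5, h6⟩ | ⟨h5, h6⟩
    · refine side hy hfy (by rwa [segment_symm]) h6 ?_
      rw [cr_swap']; linarith
    · exact side hx hfx h5 h6 h3.ne'
  · intro v hv
    rcases hv.mem hpos' with ⟨h5, h6⟩ | ⟨h5, h6⟩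
    · rcases hgp.eq_of_mem_segment hy h5 with rfl | rfl
      · exact absurd rfl h6
      · rfl
    · rcases hgp.eq_of_mem_segment hx.symm h5 with rfl | rfl
      · rfl
      · exact absurd rfl h6

/-- A bend of a walk either can be shortcut, or lies in a reflex sector of its vertex. -/
lemma shortcut_or_reflex [Finite V] (hp : Function.Injective p) (hgp : GeneralPosition p)
    (hG : IsNonCrossing p G) (hiso : ∀ v, ∃ c, G.Adj v c) {dx d dy : V × V} (hne : dx ≠ dy)
    (h1 : AStep p G dx d) (h2 : AStep p G d dy) :
    (∃ l < dist (p dx.1) (p d.1) + dist (p d.1) (p dy.1), SWalk p G dx dy l) ∨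
    (InHalfPlane (p d.1) (p '' ({c | G.Adj d.1 c} ∪ {dx.1, dy.1})) ∧ ¬ ConvexDart p G d) := by
  wlog H : RStep p G dx d ∧ RStep p G d dy ∧ NoEdgeBetween p G d.1 dx.1 dy.1 generalizing dx dy
  · have H' := (AStep.noEdgeBetween hp hgp hne h1 h2).resolve_left H
    rcases this hne.symm h2.symm h1.symm H' with ⟨l, hl, hw⟩ | h
    · left
      refine ⟨l, ?_, hw.symm⟩
      rw [dist_comm (p dx.1), dist_comm (p d.1) (p dy.1)]; linarith
    · right
      rwa [Set.pair_comm] 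
  obtain ⟨r1, r2, hS⟩ := H
  have hxu : dx.1 ≠ d.1 := r1.1
  have hyu : dy.1 ≠ d.1 := r2.1.symm
  -- Below `π` the bend is the apex of a pocket and can be bypassed; `π` is excluded by general
  -- position; above `π` the bend itself exhibits the half-plane.
  rcases lt_trichotomy (ccwAngle (p d.1) (p dx.1) (p dy.1)) Real.pi with h | h | h
  · left
    rw [ccwAngle_lt_pi_iff (hp.ne hxu) (hp.ne hyu)] at h
    have hP := pocket_of_noEdgeBetween hp hgp hG hxu hyu r1.2.1.symm r2.2.1 hS h
    obtain ⟨l, hl, hw⟩ := hP.exists_walk hp hgp hiso r2.2.2.2 r1.2.2.1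
    refine ⟨l, ?_, hw.symm⟩
    rw [dist_comm (p dx.1), dist_comm (p d.1) (p dy.1)]; linarith
  · exact absurd h (ccwAngle_ne_pi hp hgp hxu hyu)
  right
  constructor
  · refine inHalfPlane_of_left (b := p dy.1) (Set.toFinite _) ?_
    have two : ∀ c, c ≠ d.1 → ccwAngle (p d.1) (p dy.1) (p c) = 2 * Real.pi →
        0 < cr (p d.1) (p dy.1) (p c) ∨
          (cr (p d.1) (p dy.1) (p c) = 0 ∧ 0 < dt (p d.1) (p dy.1) (p c)) := fun c hc h =>
      Or.inr ((ccwAngle_eq_two_pi_iff (hp.ne hyu) (hp.ne hc)).1 h)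
    rintro _ ⟨c, hc | rfl | rfl, rfl⟩
    · have e1 := hS c hc
      have e2 := ccwAngle_le (p d.1) (p dy.1) (p c)
      have e3 := ccwAngle_le (p d.1) (p dx.1) (p c)
      rcases ccwAngle_add (p d.1) (p dx.1) (p dy.1) (p c) with h' | h'
      · left
        rw [← ccwAngle_lt_pi_iff (hp.ne hyu) (hp.ne hc.ne')]; linarith
      · exact two c hc.ne' (by linarith)
    · by_cases hxy : dx.1 = dy.1
      · exact two _ hxu (by rw [hxy, ccwAngle_self])
      · left
        rw [← ccwAngle_lt_pi_iff (hp.ne hyu) (hp.ne hxu)]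
        have := ccwAngle_add_swap hp hgp hxu hyu hxy
        linarith
    · exact two _ hyu (ccwAngle_self _ _)
  · rintro ⟨a, ha, -, hlt⟩
    have hu := r1.2.2.2
    have hb := r2.2.2.1
    have e1 := hS d.2 hu.1
    have e2 := ccwAngle_pos (p d.1) (p d.2) (p dy.1)
    have e3 := hb.2 a ha
    have e4 := ccwAngle_le (p d.1) (p a) (p dy.1)
    have e5 := ccwAngle_le (p d.1) (p dx.1) (p d.2)
    have e6 := ccwAngle_pos (p d.1) (p d.2) (p a)
    have e7 : ccwAngle (p d.1) (p dx.1) (p dy.1) ≤ ccwAngle (p d.1) (p d.2) (p dy.1) := by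
      rcases ccwAngle_add (p d.1) (p dx.1) (p d.2) (p dy.1) with h' | h' <;> linarith
    rcases ccwAngle_add (p d.1) (p d.2) (p a) (p dy.1) with h' | h' <;> linarith

/-- At a convex sector, a visible segment into the sector does not destroy pointedness. -/
lemma ConvexDart.inHalfPlane (hp : Function.Injective p) (hgp : GeneralPosition p) {d e : V × V}
    (hd : ConvexDart p G d) (h : AStep p G d e)
    (hh : InHalfPlane (p d.1) (p '' {c | G.Adj d.1 c})) :
    InHalfPlane (p d.1) (p '' ({c | G.Adj d.1 c} ∪ {e.1})) := by
  by_cases hadj : G.Adj d.1 e.1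
  · refine hh.mono (Set.image_mono ?_)
    rintro c (hc | rfl)
    · exact hc
    · exact hadj
  obtain ⟨a, ha, hba, hlt⟩ := hd
  have hb := (h.rStep_of_not_adj hp hgp hadj).2.2.1
  have hne := h.ne
  have hae : a ≠ e.1 := by rintro rfl; exact hadj ha
  have hbt : ccwAngle (p d.1) (p d.2) (p e.1) < ccwAngle (p d.1) (p d.2) (p a) := by
    have e1 := ccwAngle_lt_two_pi hp hgp ha.ne' hne.symm hae
    have e2 := hb.2 a ha
    have e3 := ccwAngle_pos (p d.1) (p d.2) (p a)
    rcases ccwAngle_add (p d.1) (p d.2) (p a) (p e.1) with h' | h' <;> linarith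
  have hD := (ccwAngle_lt_pi_iff (hp.ne hb.1.ne') (hp.ne ha.ne')).1 hlt
  obtain ⟨c1, c2⟩ := cr_pos_of_between (hp.ne hb.1.ne') (hp.ne ha.ne') (hp.ne hne.symm) hD hbt
  obtain ⟨n, m, hnm⟩ := hh
  refine ⟨n, m, ?_⟩
  rintro _ ⟨c, hc | rfl, rfl⟩
  · exact hnm _ ⟨c, hc, rfl⟩
  · have f1 := hnm _ ⟨_, hb.1, rfl⟩
    have f2 := hnm _ ⟨_, ha, rfl⟩
    have h3 := three_dir n m (p d.1) (p d.2) (p e.1) (p a)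
    rw [cr_swap (p d.1) (p d.2) (p a)] at h3
    have := mul_pos f1 c2
    have := mul_pos f2 c1
    by_contra hcon
    have := mul_nonneg (neg_nonneg.2 (not_lt.1 hcon)) hD.le
    linarith


lemma sup_edge_pointed (hp : Function.Injective p) [Finite V] {x y : V}
    (h : InHalfPlane (p x) (p '' {c | G.Adj x c}) → InHalfPlane (p x) (p '' ({c | G.Adj x c} ∪ {y})))
    (hx : IsPointed p G x) : IsPointed p (G ⊔ SimpleGraph.edge x y) x := by
  rw [isPointed_iff hp] at *
  refine (h hx).mono (Set.image_mono ?_)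
  intro c hc
  rw [Set.mem_ofPred_eq, SimpleGraph.sup_adj, SimpleGraph.edge_adj] at hc
  rcases hc with hc | ⟨⟨-, rfl⟩ | ⟨rfl, rfl⟩, -⟩
  · exact Or.inl hc
  · exact Or.inr rfl
  · exact Or.inr rfl

/-- Two convex sectors in the same face of a graph to which no edge can be added without
destroying pointedness cannot be separated, on the boundary walk of the face, by convex sectors. -/
theorem no_convex_separation [Finite V] (hp : Function.Injective p) (hgp : GeneralPosition p)
    (hG : IsNonCrossing p G) (hiso : ∀ v, ∃ c, G.Adj v c)
    (hmax : ∀ x y, x ≠ y → FreeSeg p G x y →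
      (IsPointed p G x → IsPointed p (G ⊔ SimpleGraph.edge x y) x) →
      (IsPointed p G y → IsPointed p (G ⊔ SimpleGraph.edge x y) y) → G.Adj x y)
    {s t : V × V} (hs : ConvexDart p G s) (ht : ConvexDart p G t) {L : ℝ} (hst : SWalk p G s t L)
    {X : Set (V × V)} (htX : t ∈ X) (hsX : s ∉ X)
    (hX : ∀ d ∈ X, ∀ e, FaceStep p G d e ∨ FaceStep p G e d → e ∈ X ∨ (ConvexDart p G e ∧ e ≠ s)) :
    False := by
  have hsne : s ≠ t := by rintro rfl; exact hsX htX
  obtain ⟨m, hm, hmin⟩ := hst.exists_min hp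
  have dpos : ∀ {d e : V × V}, AStep p G d e → 0 < dist (p d.1) (p e.1) := fun h =>
    dist_pos.2 (hp.ne h.ne)
  -- bends of a shortest walk
  have bend : ∀ {dx d dy : V × V} {a b : ℝ}, SWalk p G s dx a → AStep p G dx d → AStep p G d dy →
      SWalk p G dy t b → a + dist (p dx.1) (p d.1) + dist (p d.1) (p dy.1) + b = m →
      InHalfPlane (p d.1) (p '' ({c | G.Adj d.1 c} ∪ {dx.1, dy.1})) ∧ ¬ ConvexDart p G d := by
    intro dx d dy a b h1 h2 h3 h4 h5
    have hne : dx ≠ dy := by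
      rintro rfl
      have := hmin _ (h1.trans h4)
      have := dpos h2
      have := dpos h3
      linarith
    refine (shortcut_or_reflex hp hgp hG hiso hne h2 h3).resolve_left ?_
    rintro ⟨l, hl, hw⟩
    have := hmin _ ((h1.trans hw).trans h4)
    linarith
  -- The sectors of `X` that lie on some shortest walk from `s` to `t`. The one nearest to `s` along
  -- such a walk is entered from a sector `e` outside `X`.
  set S : Set (V × V) := {d | d ∈ X ∧ ∃ a b, SWalk p G s d a ∧ SWalk p G d t b ∧ a + b = m} with hS
  have hSne : S.Nonempty := ⟨t, htX, m, 0, hm, SWalk.refl _, add_zero _⟩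
  choose! f g hf hg hfg using fun d (hd : d ∈ S) => hd.2
  obtain ⟨d, hdS, hdmin⟩ := Set.exists_min_image S f (Set.toFinite _) hSne
  have hds : s ≠ d := by rintro rfl; exact hsX hdS.1
  obtain ⟨e, l', he1, he2, he3⟩ := (hf d hdS).tail hds
  have h4 := hg d hdS
  have h5 := hfg d hdS
  have hpos := dpos he2
  have het : SWalk p G e t (dist (p e.1) (p d.1) + g d) := (SWalk.single he2).trans h4
  have heX : e ∉ X := by
    intro heX
    have heS : e ∈ S := ⟨heX, l', _, he1, het, by linarith⟩
    have a1 := hdmin e heS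
    have a2 := hmin _ (he1.trans (hg e heS))
    have a3 := hfg e heS
    linarith
  -- The segment from `e` to `d` may be added: at an inner bend everything lies in a half-plane, and
  -- at `s` or `t` the sector is convex. Saturation then makes it an edge.
  have hadj : G.Adj e.1 d.1 := by
    have hfree : FreeSeg p G e.1 d.1 := by
      rcases he2 with h | h
      · exact h.2.1
      · exact h.2.1.symm
    refine hmax _ _ he2.ne hfree (sup_edge_pointed hp ?_) ?_
    · by_cases hes : s = e
      · subst hes; exact hs.inHalfPlane hp hgp he2
      · intro _
        obtain ⟨e', l'', h6, h7, h8⟩ := he1.tail hes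
        refine (bend h6 h7 he2 h4 (by linarith)).1.mono (Set.image_mono ?_)
        rintro c (hc | rfl)
        · exact Or.inl hc
        · exact Or.inr (Or.inr rfl)
    · rw [SimpleGraph.edge_comm]
      refine sup_edge_pointed hp ?_
      by_cases hdt : t = d
      · subst hdt; exact ht.inHalfPlane hp hgp he2.symm
      · intro _
        obtain ⟨e', l'', h6, h7, h8⟩ := h4.symm.tail hdt
        rw [dist_comm] at h8
        refine (bend he1 he2 h7.symm h6.symm (by linarith)).1.mono (Set.image_mono ?_)
        rintro c (hc | rfl)
        · exact Or.inl hc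
        · exact Or.inr (Or.inl rfl)
  have hface : FaceStep p G d e ∨ FaceStep p G e d := by
    rcases he2 with h | h
    · exact Or.inr (h.faceStep hp hgp hadj)
    · exact Or.inl (h.faceStep hp hgp hadj.symm)
  -- The walk enters `X` along the boundary of the face, so `e` is convex and different from `s`.
  -- But then `e` is a bend of a shortest walk, whose sector cannot be convex.
  obtain ⟨hce, hes⟩ := (hX d hdS.1 e hface).resolve_left heX
  obtain ⟨e', l'', h6, h7, h8⟩ := he1.tail (Ne.symm hes)
  exact (bend h6 h7 he2 h4 (by linarith)).2 hce

end darts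
end PseudoTriang
namespace PseudoTriang

/-! ### Winding numbers -/

/-- The signed angle in `(-π, π]` under which `ab` is seen from `z`. -/
noncomputable def ang (z a b : Plane) : ℝ := Complex.arg ⟨dt z a b, cr z a b⟩

/-- `2π` times the winding number around `z`. -/
noncomputable def wind {k : ℕ} [NeZero k] (w : ZMod k → Plane) (z : Plane) : ℝ :=
  ∑ i, ang z (w i) (w (i + 1))

/-- Puts the complex number whose argument is `ang z a b` into the slit plane, where the argument is
continuous. -/
lemma dt_pos_or_cr_ne {z a b : Plane} (h : z ∉ segment ℝ a b) : 0 < dt z a b ∨ cr z a b ≠ 0 := by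
  by_contra hc
  push Not at hc
  obtain ⟨h1, h2⟩ := hc
  by_cases hab : a = b
  · subst hab
    by_cases hza : z = a
    · exact h (hza ▸ left_mem_segment ℝ _ _)
    · exact absurd (dt_self_pos hza) (not_lt.2 h1)
  · have hN := dt_self_pos hab
    set N := dt a b b with hNdef
    set t := dt a b z / N with ht
    have htN : t * N = dt a b z := div_mul_cancel₀ _ hN.ne'
    have e0 : z 0 = a 0 + t * (b 0 - a 0) := by
      have : N * (z 0 - a 0) = dt a b z * (b 0 - a 0) - cr z a b * (b 1 - a 1) := by
        rw [hNdef]; unfold dt cr; ring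
      rw [h2, ← htN] at this
      have : N * (z 0 - a 0 - t * (b 0 - a 0)) = 0 := by linarith
      linarith [(mul_eq_zero.1 this).resolve_left hN.ne']
    have e1 : z 1 = a 1 + t * (b 1 - a 1) := by
      have : N * (z 1 - a 1) = dt a b z * (b 1 - a 1) + cr z a b * (b 0 - a 0) := by
        rw [hNdef]; unfold dt cr; ring
      rw [h2, ← htN] at this
      have : N * (z 1 - a 1 - t * (b 1 - a 1)) = 0 := by linarith
      linarith [(mul_eq_zero.1 this).resolve_left hN.ne']
    have e2 : dt z a b = - (t * (1 - t)) * N := by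
      rw [hNdef]; unfold dt; rw [e0, e1]; ring
    have e3 : 0 ≤ t * (1 - t) := by
      by_contra hc
      have := mul_pos (neg_pos.2 (not_le.1 hc)) hN
      linarith
    refine h (mem_segment_iff_lineMap.2 ⟨t, ?_, ?_, ?_⟩)
    · nlinarith
    · nlinarith
    · apply Plane.ext <;> simp [e0, e1]

lemma ang_mem_slitPlane {z a b : Plane} (h : z ∉ segment ℝ a b) :
    (⟨dt z a b, cr z a b⟩ : ℂ) ∈ Complex.slitPlane :=
  Complex.mem_slitPlane_iff.2 (dt_pos_or_cr_ne h)

lemma continuous_dtcr (a b : Plane) : Continuous fun z : Plane => (⟨dt z a b, cr z a b⟩ : ℂ) := by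
  have : (fun z : Plane => (⟨dt z a b, cr z a b⟩ : ℂ)) =
      fun z => ((dt z a b : ℝ) : ℂ) + ((cr z a b : ℝ) : ℂ) * Complex.I := by
    funext z; apply Complex.ext <;> simp
  rw [this]; unfold dt cr; fun_prop

lemma continuousAt_ang {z a b : Plane} (h : z ∉ segment ℝ a b) :
    ContinuousAt (fun z => ang z a b) z :=
  ContinuousAt.comp (g := Complex.arg) (f := fun z => (⟨dt z a b, cr z a b⟩ : ℂ))
    (Complex.continuousAt_arg (ang_mem_slitPlane h)) (continuous_dtcr a b).continuousAt

lemma ang_swap {z a b : Plane} (h : z ∉ segment ℝ a b) : ang z b a = - ang z a b := by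
  have : (⟨dt z b a, cr z b a⟩ : ℂ) = (starRingEnd ℂ) ⟨dt z a b, cr z a b⟩ := by
    apply Complex.ext
    · simp [dt]; ring
    · simp [cr]; ring
  unfold ang
  rw [this, Complex.arg_conj, if_neg]
  exact Complex.slitPlane_arg_ne_pi (ang_mem_slitPlane h)

lemma toC_mul_conj (z a b : Plane) :
    toC (b - z) * (starRingEnd ℂ) (toC (a - z)) = ⟨dt z a b, cr z a b⟩ := by
  apply Complex.ext <;> simp [toC, dt, cr] <;> ring

lemma sum_shift_sub {M : Type*} [AddCommGroup M] {k : ℕ} [NeZero k] (f : ZMod k → M) :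
    ∑ i, (f (i + 1) - f i) = 0 := by
  rw [Finset.sum_sub_distrib, sub_eq_zero]
  exact Equiv.sum_comp (Equiv.addRight (1 : ZMod k)) f

section polygon
variable {k : ℕ} [NeZero k] {w : ZMod k → Plane}

omit [NeZero k] in
lemma mem_boundary {z : Plane} : z ∈ polygonBoundary w ↔ ∃ i, z ∈ segment ℝ (w i) (w (i + 1)) := by
  simp [polygonBoundary]

omit [NeZero k] in
lemma vertex_mem_boundary (i : ZMod k) : w i ∈ polygonBoundary w :=
  mem_boundary.2 ⟨i, left_mem_segment _ _ _⟩

lemma isClosed_segment (a b : Plane) : IsClosed (segment ℝ a b) := by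
  rw [segment_eq_image_lineMap]
  exact (isCompact_Icc.image (by fun_prop)).isClosed

lemma isCompact_segment (a b : Plane) : IsCompact (segment ℝ a b) := by
  rw [segment_eq_image_lineMap]
  exact isCompact_Icc.image (by fun_prop)

lemma isClosed_boundary : IsClosed (polygonBoundary w) :=
  isClosed_iUnion_of_finite fun _ => isClosed_segment _ _

/-- Modulo `2π` every summand is a difference of two polar angles, and these differences telescope
around the cycle. -/
lemma wind_eq {z : Plane} (hz : z ∉ polygonBoundary w) : ∃ n : ℤ, wind w z = 2 * Real.pi * n := by
  have h : ((wind w z : ℝ) : Real.Angle) = ((0 : ℝ) : Real.Angle) := by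
    have e : ((wind w z : ℝ) : Real.Angle) = ∑ i, ((ang z (w i) (w (i + 1)) : ℝ) : Real.Angle) := by
      unfold wind; exact map_sum Real.Angle.coeHom _ _
    have hne : ∀ i, toC (w i - z) ≠ 0 := by
      intro i h
      rw [toC_eq_zero, sub_eq_zero] at h
      exact hz (h ▸ vertex_mem_boundary i)
    rw [e, Real.Angle.coe_zero, ← sum_shift_sub fun i => ((Complex.arg (toC (w i - z)) : ℝ) : Real.Angle)]
    refine Finset.sum_congr rfl fun i _ => ?_
    unfold ang
    rw [← toC_mul_conj, Complex.arg_mul_coe_angle (hne _) (by simpa using hne i),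
      Complex.arg_conj_coe_angle, ← sub_eq_add_neg]
  obtain ⟨n, hn⟩ := Real.Angle.angle_eq_iff_two_pi_dvd_sub.1 h
  exact ⟨n, by linarith⟩

/-- A continuous function with values in a discrete set is constant on a preconnected set. -/
lemma wind_const {S : Set Plane} (hS : IsPreconnected S) (hSU : S ⊆ (polygonBoundary w)ᶜ) {x y : Plane}
    (hx : x ∈ S) (hy : y ∈ S) : wind w x = wind w y := by
  have hd : IsDiscrete (Set.range fun n : ℤ => (n : ℝ)) := by
    rw [isDiscrete_iff_discreteTopology]
    exact Int.isClosedEmbedding_coe_real.isEmbedding.toHomeomorph.discreteTopology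
  have hcont : ContinuousOn (fun z => wind w z / (2 * Real.pi)) S := by
    refine ContinuousOn.div_const (fun z hz => ContinuousAt.continuousWithinAt ?_) _
    unfold wind
    refine tendsto_finsetSum _ fun i _ => continuousAt_ang fun h => ?_
    exact hSU hz (mem_boundary.2 ⟨i, h⟩)
  have h2 : (2 * Real.pi) ≠ 0 := by positivity
  have := hS.constant_of_mapsTo hd hcont (fun z hz => by
    obtain ⟨n, hn⟩ := wind_eq (hSU hz)
    refine ⟨n, ?_⟩
    simp only; rw [hn]; field_simp) hx hy
  field_simp at this
  exact this

/-- After a rotation (and scaling) by the number `c` all directions from `z` have arguments strictly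
between `-π/2` and `π/2`. The summands are then honest differences of real angles, without a
correction by `2π`, and telescope to zero. -/
lemma wind_eq_zero {z : Plane} (h : InHalfPlane z (Set.range w)) :
    z ∉ polygonBoundary w ∧ wind w z = 0 := by
  obtain ⟨n, m, h⟩ := h
  have h' : ∀ i, 0 < n * (w i 0 - z 0) + m * (w i 1 - z 1) := fun i => h _ ⟨i, rfl⟩
  constructor
  · intro hz
    obtain ⟨i, hi⟩ := mem_boundary.1 hz
    obtain ⟨t, ht0, ht1, rfl⟩ := mem_segment_iff_lineMap.1 hi
    have e1 := h' i
    have e2 := h' (i + 1)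
    simp only [lineMap_coord] at e1 e2
    have e3 := mul_nonneg ht0 e2.le
    rcases ht1.eq_or_lt with rfl | ht1
    · ring_nf at e2; exact lt_irrefl _ e2
    · have := mul_pos (sub_pos.2 ht1) e1
      nlinarith
  · set c : ℂ := ⟨n, -m⟩
    have hre : ∀ i, 0 < (c * toC (w i - z)).re := by
      intro i
      have := h' i
      simp [c, toC]; linarith
    have harg : ∀ i, |Complex.arg (c * toC (w i - z))| < Real.pi / 2 := fun i =>
      Complex.abs_arg_lt_pi_div_two_iff.2 (Or.inl (hre i))
    have hne : ∀ i, c * toC (w i - z) ≠ 0 := by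
      intro i h0; have := hre i; rw [h0] at this; simp at this
    have hc : c ≠ 0 := by
      rintro hc; have := hre 0; rw [hc] at this; simp at this
    unfold wind
    rw [← sum_shift_sub fun i => Complex.arg (c * toC (w i - z))]
    refine Finset.sum_congr rfl fun i _ => ?_
    have h1 := abs_lt.1 (harg i)
    have h2 := abs_lt.1 (harg (i + 1))
    have hconj : Complex.arg ((starRingEnd ℂ) (c * toC (w i - z))) = -Complex.arg (c * toC (w i - z)) := by
      rw [Complex.arg_conj, if_neg]
      intro h; linarith [Real.pi_pos]
    have hmul := Complex.arg_mul (hne (i + 1)) (y := (starRingEnd ℂ) (c * toC (w i - z)))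
      (by rw [Ne, map_eq_zero]; exact hne i) (by rw [hconj]; constructor <;> linarith)
    rw [hconj] at hmul
    have e : c * toC (w (i + 1) - z) * (starRingEnd ℂ) (c * toC (w i - z)) =
        ((Complex.normSq c : ℝ) : ℂ) * ⟨dt z (w i) (w (i + 1)), cr z (w i) (w (i + 1))⟩ := by
      rw [← toC_mul_conj, map_mul, Complex.normSq_eq_conj_mul_self]; ring
    rw [e, Complex.arg_real_mul _ (Complex.normSq_pos.2 hc)] at hmul
    unfold ang
    rw [hmul]; ring

end polygon

/-! ### The two sides of a segment -/

/-- The point at signed distance proportional to `δ` to the left of the midpoint of `ab`. -/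
noncomputable def beside (a b : Plane) (δ : ℝ) : Plane :=
  !₂[(a 0 + b 0) / 2 - δ * (b 1 - a 1), (a 1 + b 1) / 2 + δ * (b 0 - a 0)]

lemma beside_zero_mem (a b : Plane) : beside a b 0 = AffineMap.lineMap a b (1 / 2 : ℝ) := by
  apply Plane.ext <;> simp [beside] <;> ring

lemma continuous_beside (a b : Plane) : Continuous (beside a b) := by
  refine (PiLp.continuous_toLp 2 _).comp (continuous_pi fun i => ?_)
  fin_cases i <;> simp <;> fun_prop

lemma cr_beside (a b : Plane) (δ : ℝ) : cr a b (beside a b δ) = δ * dt a b b := by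
  simp [cr, dt, beside]; ring

lemma tendsto_beside (a b : Plane) : Tendsto (beside a b) (𝓝[>] 0) (𝓝 (beside a b 0)) :=
  ((continuous_beside a b).tendsto 0).mono_left nhdsWithin_le_nhds

lemma tendsto_beside_neg (a b : Plane) :
    Tendsto (fun δ => beside a b (-δ)) (𝓝[>] 0) (𝓝 (beside a b 0)) := by
  have : Tendsto (fun δ => beside a b (-δ)) (𝓝 0) (𝓝 (beside a b (-0))) :=
    Continuous.tendsto ((continuous_beside a b).comp continuous_neg) 0
  rw [neg_zero] at this
  exact this.mono_left nhdsWithin_le_nhds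

/-- On the segment the argument meets its branch cut, and the two one-sided limits differ by `2π`.
This is the source of the jump of the winding number. -/
lemma tendsto_ang_beside {a b : Plane} (hab : a ≠ b) :
    Tendsto (fun δ => ang (beside a b δ) a b) (𝓝[>] 0) (𝓝 Real.pi) ∧
    Tendsto (fun δ => ang (beside a b (-δ)) a b) (𝓝[>] 0) (𝓝 (-Real.pi)) := by
  have hN := dt_self_pos hab
  have ecr : ∀ δ, cr (beside a b δ) a b = δ * dt a b b := fun δ => by
    rw [← cr_beside, ← cr_rot]
  have edt : dt (beside a b 0) a b < 0 := by
    have : dt (beside a b 0) a b = - (dt a b b / 4) := by simp [dt, beside]; ring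
    linarith
  have him : (⟨dt (beside a b 0) a b, cr (beside a b 0) a b⟩ : ℂ).im = 0 := by simp [ecr]
  have hc := continuous_dtcr a b
  constructor
  · have h1 := Complex.continuousWithinAt_arg_of_re_neg_of_im_zero
      (z := ⟨dt (beside a b 0) a b, cr (beside a b 0) a b⟩) edt him
    have h2 : Complex.arg ⟨dt (beside a b 0) a b, cr (beside a b 0) a b⟩ = Real.pi :=
      Complex.arg_eq_pi_iff.2 ⟨edt, him⟩
    have h3 : Tendsto (fun δ => (⟨dt (beside a b δ) a b, cr (beside a b δ) a b⟩ : ℂ)) (𝓝[>] 0)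
        (𝓝[{z | 0 ≤ z.im}] ⟨dt (beside a b 0) a b, cr (beside a b 0) a b⟩) := by
      refine tendsto_nhdsWithin_iff.2 ⟨(hc.tendsto _).comp (tendsto_beside a b), ?_⟩
      filter_upwards [self_mem_nhdsWithin] with δ hδ
      simp only [ecr]
      exact (mul_pos hδ hN).le
    have h4 := h1.tendsto.comp h3
    rw [h2] at h4
    exact h4
  · have h1 := Complex.tendsto_arg_nhdsWithin_im_neg_of_re_neg_of_im_zero
      (z := ⟨dt (beside a b 0) a b, cr (beside a b 0) a b⟩) edt him
    have h3 : Tendsto (fun δ => (⟨dt (beside a b (-δ)) a b, cr (beside a b (-δ)) a b⟩ : ℂ)) (𝓝[>] 0)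
        (𝓝[{z | z.im < 0}] ⟨dt (beside a b 0) a b, cr (beside a b 0) a b⟩) := by
      refine tendsto_nhdsWithin_iff.2 ⟨(hc.tendsto _).comp (tendsto_beside_neg a b), ?_⟩
      filter_upwards [self_mem_nhdsWithin] with δ hδ
      simp only [ecr]
      have := mul_pos hδ hN
      linarith
    exact h1.comp h3

end PseudoTriang
namespace PseudoTriang

/-! ### The two sides of a simple polygon -/

/-- The sector at `v` to the left (`σ = 1`) or to the right (`σ = -1`) of the path `avb`. -/
def Sec (σ : ℝ) (a v b : Plane) : Set Plane :=
  {z | (0 < σ * cr a v z ∧ 0 < σ * cr v b z) ∨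
    (σ * cr a v b < 0 ∧ (0 < σ * cr a v z ∨ 0 < σ * cr v b z))}

lemma continuous_cr (a b : Plane) : Continuous fun z : Plane => cr a b z := by
  unfold cr; fun_prop

lemma isOpen_cr (σ : ℝ) (a b : Plane) : IsOpen {z | 0 < σ * cr a b z} :=
  isOpen_lt continuous_const (continuous_const.mul (continuous_cr a b))

lemma convex_cr (σ : ℝ) (a b : Plane) : Convex ℝ {z | 0 < σ * cr a b z} := by
  intro x hx y hy s t hs ht hst
  have hx' : 0 < σ * cr a b x := hx
  have hy' : 0 < σ * cr a b y := hy
  have e : σ * cr a b (s • x + t • y) = s * (σ * cr a b x) + t * (σ * cr a b y) := by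
    have hs' : s = 1 - t := by linarith
    subst hs'
    unfold cr; simp; ring
  show 0 < σ * cr a b (s • x + t • y)
  rw [e]
  rcases hs.eq_or_lt with rfl | hs
  · have : t = 1 := by linarith
    subst this; linarith
  · have := mul_pos hs hx'
    have := mul_nonneg ht hy'.le
    linarith

/-- A convex sector is an intersection of half-planes with a disc. A reflex one is the union of two
half-discs, which share a point on the extension of the median of the triangle beyond `v`. -/
lemma isPreconnected_sec {σ : ℝ} {a v b : Plane} {ε : ℝ} (hσ : σ ≠ 0)
    (hD : cr a v b ≠ 0) (hε : 0 < ε) : IsPreconnected (Metric.ball v ε ∩ Sec σ a v b) := by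
  rcases lt_or_gt_of_ne (mul_ne_zero hσ hD) with h | h
  · have e : Metric.ball v ε ∩ Sec σ a v b =
        (Metric.ball v ε ∩ {z | 0 < σ * cr a v z}) ∪ (Metric.ball v ε ∩ {z | 0 < σ * cr v b z}) := by
      rw [← Set.inter_union_distrib_left]
      congr 1
      ext z
      simp only [Sec, Set.mem_ofPred_eq, Set.mem_union, h, true_and]
      tauto
    rw [e]
    have key : ∀ᶠ s in 𝓝[>] (0 : ℝ),
        AffineMap.lineMap v (AffineMap.lineMap a b (1 / 2 : ℝ)) (-s) ∈ Metric.ball v ε := by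
      apply Filter.Eventually.filter_mono nhdsWithin_le_nhds
      have : Tendsto (fun s : ℝ => (AffineMap.lineMap v (AffineMap.lineMap a b (1 / 2 : ℝ)) (-s) : Plane))
          (𝓝 0) (𝓝 (AffineMap.lineMap v (AffineMap.lineMap a b (1 / 2 : ℝ)) (-0 : ℝ))) :=
        Continuous.tendsto (AffineMap.lineMap_continuous.comp continuous_neg) _
      rw [neg_zero, AffineMap.lineMap_apply_zero] at this
      exact this.eventually (Metric.ball_mem_nhds v hε)
    obtain ⟨s, hs, hs0⟩ := (key.and self_mem_nhdsWithin).exists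
    have hs0 : 0 < s := hs0
    set z : Plane := AffineMap.lineMap v (AffineMap.lineMap a b (1 / 2 : ℝ)) (-s) with hz
    have h1 : cr a v z = - (s / 2) * cr a v b := by
      rw [hz]; unfold cr; simp only [lineMap_coord]; ring
    have h2 : cr v b z = - (s / 2) * cr a v b := by
      rw [hz]; unfold cr; simp only [lineMap_coord]; ring
    have h3 : 0 < σ * (- (s / 2) * cr a v b) := by
      have := mul_pos (half_pos hs0) (neg_pos.2 h)
      linarith
    refine IsPreconnected.union z ⟨hs, ?_⟩ ⟨hs, ?_⟩
      ((convex_ball v ε).inter (convex_cr σ a v)).isPreconnected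
      ((convex_ball v ε).inter (convex_cr σ v b)).isPreconnected
    · show 0 < σ * _; rw [h1]; exact h3
    · show 0 < σ * _; rw [h2]; exact h3
  · have e : Metric.ball v ε ∩ Sec σ a v b =
        Metric.ball v ε ∩ ({z | 0 < σ * cr a v z} ∩ {z | 0 < σ * cr v b z}) := by
      congr 1
      ext z
      have : ¬ (σ * cr a v b < 0) := not_lt.2 h.le
      simp only [Sec, Set.mem_ofPred_eq, Set.mem_inter_iff, this, false_and, or_false]
    rw [e]
    exact ((convex_ball v ε).inter ((convex_cr σ a v).inter (convex_cr σ v b))).isPreconnected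

lemma notMem_sec_right {σ : ℝ} {a v b : Plane} {t : ℝ} (ht : 0 ≤ t) :
    AffineMap.lineMap v b t ∉ Sec σ a v b := by
  rintro (⟨-, h⟩ | ⟨h, h' | h'⟩)
  · rw [cr_lineMap] at h; simp at h
  · rw [cr_lineMap] at h'
    simp at h'
    have := mul_nonneg ht (neg_pos.2 h).le
    linarith
  · rw [cr_lineMap] at h'; simp at h'

lemma notMem_sec_left {σ : ℝ} {a v b : Plane} {t : ℝ} (ht : 0 ≤ t) :
    AffineMap.lineMap v a t ∉ Sec σ a v b := by
  rintro (⟨h, -⟩ | ⟨h, h' | h'⟩)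
  · rw [cr_lineMap] at h; simp at h
  · rw [cr_lineMap] at h'; simp at h'
  · rw [cr_lineMap, cr_self_mid, mul_zero, zero_add, cr_rot] at h'
    have := mul_nonneg ht (neg_pos.2 h).le
    linarith

/-- Up to the factor `cr a v b`, the numbers `cr a v z` and `cr v b z` are the coordinates of `z -
v` along the two edges; the excluded rays are where one coordinate vanishes and the other is
nonnegative. -/
lemma mem_sec_or {a v b z : Plane} (hD : cr a v b ≠ 0)
    (hr : ∀ t : ℝ, 0 ≤ t → z ≠ AffineMap.lineMap v b t)
    (hl : ∀ t : ℝ, 0 ≤ t → z ≠ AffineMap.lineMap v a t) : z ∈ Sec 1 a v b ∨ z ∈ Sec (-1) a v b := by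
  have e0 : cr a v b * (z 0 - v 0) = cr a v z * (b 0 - v 0) + cr v b z * (a 0 - v 0) := by
    unfold cr; ring
  have e1 : cr a v b * (z 1 - v 1) = cr a v z * (b 1 - v 1) + cr v b z * (a 1 - v 1) := by
    unfold cr; ring
  have zr : cr v b z = 0 → cr a v z / cr a v b < 0 := by
    intro h
    by_contra hc
    rw [h] at e0 e1
    refine hr _ (not_lt.1 hc) (Plane.ext ?_ ?_) <;> simp only [lineMap_coord] <;> field_simp <;> linarith
  have zl : cr a v z = 0 → cr v b z / cr a v b < 0 := by
    intro h
    by_contra hc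
    rw [h] at e0 e1
    refine hl _ (not_lt.1 hc) (Plane.ext ?_ ?_) <;> simp only [lineMap_coord] <;> field_simp <;> linarith
  unfold Sec
  simp only [Set.mem_ofPred_eq, one_mul, neg_mul]
  rcases lt_or_gt_of_ne hD with h | h
  · have h2 : ¬ (-cr a v b < 0) := by linarith
    simp only [h, h2, false_and, or_false, true_and]
    by_contra hc
    push Not at hc
    obtain ⟨⟨-, h3, h4⟩, h5⟩ := hc
    rcases h3.eq_or_lt with h3 | h3
    · have := zl h3
      rw [div_neg_iff] at this
      rcases this with h | h <;> linarith
    · have := h5 (by linarith)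
      have h6 := zr (by linarith)
      rw [div_neg_iff] at h6
      rcases h6 with h | h <;> linarith
  · have h2 : ¬ (cr a v b < 0) := by linarith
    have h2' : -cr a v b < 0 := by linarith
    simp only [h2, h2', false_and, or_false, true_and]
    by_contra hc
    push Not at hc
    obtain ⟨h5, -, h3, h4⟩ := hc
    rcases h3.eq_or_lt with h3 | h3
    · have := zl (by linarith)
      rw [div_neg_iff] at this
      rcases this with h | h <;> linarith
    · have := h5 (by linarith)
      have h6 := zr (by linarith)
      rw [div_neg_iff] at h6
      rcases h6 with h | h <;> linarith

lemma exists_mem_side {a b x : Plane} {σ : ℝ} (hσ : σ ≠ 0) (hab : a ≠ b) (hx : cr a b x = 0)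
    {N : Set Plane} (hN : N ∈ 𝓝 x) : ∃ z ∈ N, 0 < σ * cr a b z := by
  have hc : Tendsto (fun δ : ℝ => x + δ • (beside a b σ - beside a b 0)) (𝓝[>] 0) (𝓝 x) := by
    have : Tendsto (fun δ : ℝ => x + δ • (beside a b σ - beside a b 0)) (𝓝 0)
        (𝓝 (x + (0 : ℝ) • (beside a b σ - beside a b 0))) := Continuous.tendsto (by fun_prop) _
    rw [zero_smul, add_zero] at this
    exact this.mono_left nhdsWithin_le_nhds
  obtain ⟨δ, h1, h2⟩ := ((hc.eventually hN).and self_mem_nhdsWithin).exists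
  refine ⟨_, h1, ?_⟩
  have e : cr a b (x + δ • (beside a b σ - beside a b 0)) = cr a b x + δ * (σ * dt a b b) := by
    simp [cr, dt, beside]; ring
  rw [e, hx, zero_add]
  have := mul_pos h2 (mul_pos (mul_self_pos.2 hσ) (dt_self_pos hab))
  linarith

section sides
variable {k : ℕ} {w : ZMod k → Plane}

lemma IsSimplePolygon.ne (hw : IsSimplePolygon w) (i : ZMod k) : w i ≠ w (i + 1) := by
  intro h
  have := hw.injective h
  have h1 : (1 : ZMod k) = 0 := by linear_combination -this
  have h3 := hw.three_le
  have : Fact (1 < k) := ⟨by omega⟩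
  exact one_ne_zero h1

lemma IsSimplePolygon.eq_vertex (hw : IsSimplePolygon w) {i j : ZMod k} (hij : j ≠ i) {z : Plane}
    (hi : z ∈ segment ℝ (w i) (w (i + 1))) (hj : z ∈ segment ℝ (w j) (w (j + 1))) :
    (z = w i ∧ i = j + 1) ∨ (z = w (i + 1) ∧ j = i + 1) := by
  by_cases h1 : j = i + 1
  · right
    subst h1
    have : z ∈ segment ℝ (w i) (w (i + 1)) ∩ segment ℝ (w (i + 1)) (w (i + 1 + 1)) := ⟨hi, hj⟩
    rw [hw.consecutive] at this
    exact ⟨this, rfl⟩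
  by_cases h2 : i = j + 1
  · left
    subst h2
    have : z ∈ segment ℝ (w j) (w (j + 1)) ∩ segment ℝ (w (j + 1)) (w (j + 1 + 1)) := ⟨hj, hi⟩
    rw [hw.consecutive] at this
    exact ⟨this, rfl⟩
  · exact absurd hj (Set.disjoint_left.1 (hw.nonconsecutive i j hij.symm h1 h2) hi)

lemma IsSimplePolygon.exists_ball [NeZero k] (hw : IsSimplePolygon w) (i : ZMod k) :
    ∃ ε > 0, ε ≤ dist (w i) (w (i + 1)) ∧ ε ≤ dist (w i) (w (i - 1)) ∧
      ∀ z ∈ Metric.ball (w i) ε, z ∈ polygonBoundary w →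
        z ∈ segment ℝ (w i) (w (i - 1)) ∨ z ∈ segment ℝ (w i) (w (i + 1)) := by
  have hF : IsClosed (⋃ j ∈ {j : ZMod k | j ≠ i ∧ j ≠ i - 1}, segment ℝ (w j) (w (j + 1))) :=
    Set.Finite.isClosed_biUnion (Set.toFinite _) fun _ _ => isClosed_segment _ _
  have hi : w i ∈ (⋃ j ∈ {j : ZMod k | j ≠ i ∧ j ≠ i - 1}, segment ℝ (w j) (w (j + 1)))ᶜ := by
    simp only [Set.mem_compl_iff, Set.mem_iUnion, not_exists]
    rintro j ⟨h1, h2⟩ h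
    rcases hw.eq_vertex h1 (left_mem_segment ℝ _ _) h with ⟨-, h⟩ | ⟨h, -⟩
    · exact h2 (by rw [h]; ring)
    · exact hw.ne i h
  obtain ⟨ε, hε, hsub⟩ := Metric.isOpen_iff.1 hF.isOpen_compl _ hi
  have d1 : 0 < dist (w i) (w (i + 1)) := dist_pos.2 (hw.ne i)
  have d2 : 0 < dist (w i) (w (i - 1)) := dist_pos.2 fun h => hw.ne (i - 1) (by rw [← h]; congr 1; ring)
  refine ⟨min ε (min (dist (w i) (w (i + 1))) (dist (w i) (w (i - 1)))), by positivity,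
    (min_le_right _ _).trans (min_le_left _ _), (min_le_right _ _).trans (min_le_right _ _), ?_⟩
  intro z hz hzB
  have hz' := hsub (Metric.ball_subset_ball (min_le_left _ _) hz)
  obtain ⟨j, hj⟩ := mem_boundary.1 hzB
  by_cases h1 : j = i
  · right; rwa [h1] at hj
  by_cases h2 : j = i - 1
  · left; rw [h2, sub_add_cancel] at hj; rwa [segment_symm]
  · exact absurd (Set.mem_biUnion (show j ∈ {j : ZMod k | j ≠ i ∧ j ≠ i - 1} from ⟨h1, h2⟩) hj) hz'

lemma IsSimplePolygon.exists_thickening [NeZero k] (hw : IsSimplePolygon w) (i : ZMod k) {t : ℝ} (h0 : 0 < t)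
    (h1 : t < 1 / 2) : ∃ η > 0, ∀ z ∈ Metric.thickening η (segment ℝ
      (AffineMap.lineMap (w i) (w (i + 1)) t : Plane) (AffineMap.lineMap (w i) (w (i + 1)) (1 - t))),
      z ∈ polygonBoundary w → z ∈ segment ℝ (w i) (w (i + 1)) := by
  have hF : IsClosed (⋃ j ∈ {j : ZMod k | j ≠ i}, segment ℝ (w j) (w (j + 1))) :=
    Set.Finite.isClosed_biUnion (Set.toFinite _) fun _ _ => isClosed_segment _ _
  have hK := isCompact_segment
    (AffineMap.lineMap (w i) (w (i + 1)) t : Plane) (AffineMap.lineMap (w i) (w (i + 1)) (1 - t))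
  obtain ⟨η, hη, hsub⟩ := hK.exists_thickening_subset_open hF.isOpen_compl (by
    intro z hz hz'
    simp only [Set.mem_iUnion] at hz'
    obtain ⟨j, hj, hzj⟩ := hz'
    obtain ⟨r, hr0, hr1, hr⟩ := mem_segment_iff_lineMap.1 hz
    have e : z = AffineMap.lineMap (w i) (w (i + 1)) ((1 - r) * t + r * (1 - t)) := by
      rw [hr]; apply Plane.ext <;> simp only [lineMap_coord] <;> ring
    have p1 : 0 < (1 - r) * t + r * (1 - t) := by nlinarith
    have p2 : (1 - r) * t + r * (1 - t) < 1 := by nlinarith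
    have hzi : z ∈ segment ℝ (w i) (w (i + 1)) := mem_segment_iff_lineMap.2 ⟨_, p1.le, p2.le, e⟩
    have hne := hw.ne i
    rcases hw.eq_vertex hj hzi hzj with ⟨h, -⟩ | ⟨h, -⟩
    · rw [h] at e
      have := (AffineMap.lineMap_injective ℝ hne) (a₁ := 0) (a₂ := (1 - r) * t + r * (1 - t)) (by
        rw [← e, AffineMap.lineMap_apply_zero])
      linarith
    · rw [h] at e
      have := (AffineMap.lineMap_injective ℝ hne) (a₁ := 1) (a₂ := (1 - r) * t + r * (1 - t)) (by
        rw [← e, AffineMap.lineMap_apply_one])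
      linarith)
  refine ⟨η, hη, fun z hz hzB => ?_⟩
  obtain ⟨j, hj⟩ := mem_boundary.1 hzB
  by_cases h : j = i
  · rwa [h] at hj
  · exact absurd (Set.mem_biUnion (show j ∈ {j : ZMod k | j ≠ i} from h) hj) (hsub hz)


/-- The complement of a simple polygon is covered by what can be reached from its two sides. -/
theorem IsSimplePolygon.exists_sides [NeZero k] (hw : IsSimplePolygon w)
    (hcr : ∀ i, cr (w (i - 1)) (w i) (w (i + 1)) ≠ 0) :
    ∃ S : ℝ → Set Plane, (∀ σ ≠ 0, IsPreconnected (S σ) ∧ S σ ⊆ (polygonBoundary w)ᶜ ∧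
      (∀ i, ∃ ε > 0, Metric.ball (w i) ε ∩ Sec σ (w (i - 1)) (w i) (w (i + 1)) ⊆ S σ) ∧
      (∀ i, ∀ᶠ z in 𝓝 (beside (w i) (w (i + 1)) 0), 0 < σ * cr (w i) (w (i + 1)) z → z ∈ S σ)) ∧
      ∀ z ∉ polygonBoundary w, ∃ C, IsPreconnected C ∧ C ⊆ (polygonBoundary w)ᶜ ∧ z ∈ C ∧
        ((C ∩ S 1).Nonempty ∨ (C ∩ S (-1)).Nonempty) := by
  choose ε hε hε1 hε2 hball using hw.exists_ball
  -- The parameter is small enough for the end pieces of each edge to lie in the discs around its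
  -- ends, and below one half so that a middle part remains.
  have ht : ∀ i, ∃ t : ℝ, 0 < t ∧ t < 1 / 2 ∧ t * dist (w i) (w (i + 1)) < ε i ∧
      t * dist (w i) (w (i + 1)) < ε (i + 1) := by
    intro i
    have hd : 0 < dist (w i) (w (i + 1)) := dist_pos.2 (hw.ne i)
    have hm : 0 < min (ε i) (ε (i + 1)) := lt_min (hε _) (hε _)
    refine ⟨min (1 / 3) (min (ε i) (ε (i + 1)) / (2 * dist (w i) (w (i + 1)))), by positivity,
      (min_le_left _ _).trans_lt (by norm_num), ?_⟩
    have : min (1 / 3) (min (ε i) (ε (i + 1)) / (2 * dist (w i) (w (i + 1)))) * dist (w i) (w (i + 1))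
        ≤ min (ε i) (ε (i + 1)) / 2 := by
      calc _ ≤ min (ε i) (ε (i + 1)) / (2 * dist (w i) (w (i + 1))) * dist (w i) (w (i + 1)) :=
            mul_le_mul_of_nonneg_right (min_le_right _ _) hd.le
        _ = _ := by field_simp
    exact ⟨by linarith [min_le_left (ε i) (ε (i + 1))], by linarith [min_le_right (ε i) (ε (i + 1))]⟩
  choose t ht0 ht1 ht2 ht3 using ht
  choose η hη hthick using fun i => hw.exists_thickening i (ht0 i) (ht1 i)
  -- On each side of the polygon, the sectors `A` of the vertex discs and the halves `P` of the
  -- tubes around the middle parts form a cyclic chain of preconnected sets, consecutive ones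
  -- overlapping.
  set K : ZMod k → Set Plane := fun i => Metric.thickening (η i) (segment ℝ
      (AffineMap.lineMap (w i) (w (i + 1)) (t i) : Plane)
      (AffineMap.lineMap (w i) (w (i + 1)) (1 - t i))) with hK
  set A : ℝ → ZMod k → Set Plane := fun σ i =>
    Metric.ball (w i) (ε i) ∩ Sec σ (w (i - 1)) (w i) (w (i + 1)) with hA
  set P : ℝ → ZMod k → Set Plane := fun σ i => K i ∩ {z | 0 < σ * cr (w i) (w (i + 1)) z} with hP
  have hKo : ∀ i, IsOpen (K i) := fun i => Metric.isOpen_thickening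
  have hKsub : ∀ i s, t i ≤ s → s ≤ 1 - t i → AffineMap.lineMap (w i) (w (i + 1)) s ∈ K i := by
    intro i s h1 h2
    refine Metric.self_subset_thickening (hη i) _ (mem_segment_iff_lineMap.2 ?_)
    have hpos : 0 < 1 - 2 * t i := by linarith [ht1 i]
    refine ⟨(s - t i) / (1 - 2 * t i), div_nonneg (by linarith) hpos.le,
      (div_le_one hpos).2 (by linarith), ?_⟩
    have : (s - t i) / (1 - 2 * t i) * (1 - 2 * t i) = s - t i := div_mul_cancel₀ _ hpos.ne'
    apply Plane.ext <;> simp only [lineMap_coord]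
    · linear_combination -(w (i + 1) 0 - w i 0) * this
    · linear_combination -(w (i + 1) 1 - w i 1) * this
  have hAsub : ∀ σ i, A σ i ⊆ (polygonBoundary w)ᶜ := by
    rintro σ i z ⟨hz1, hz2⟩ hzB
    rcases hball i z hz1 hzB with h | h <;> obtain ⟨s, hs0, -, rfl⟩ := mem_segment_iff_lineMap.1 h
    · exact notMem_sec_left hs0 hz2
    · exact notMem_sec_right hs0 hz2
  have hPsub : ∀ σ i, P σ i ⊆ (polygonBoundary w)ᶜ := by
    rintro σ i z ⟨hz1, hz2⟩ hzB
    have := cr_eq_zero_of_mem_segment (hthick i z hz1 hzB)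
    have hz2 : 0 < σ * cr (w i) (w (i + 1)) z := hz2
    rw [this, mul_zero] at hz2
    exact lt_irrefl _ hz2
  have secR : ∀ σ : ℝ, σ ≠ 0 → ∀ i, ∀ s : ℝ, 0 < s → ∀ᶠ z in 𝓝 (AffineMap.lineMap (w i) (w (i + 1)) s : Plane),
      0 < σ * cr (w i) (w (i + 1)) z → z ∈ Sec σ (w (i - 1)) (w i) (w (i + 1)) := by
    intro σ hσ i s hs
    rcases lt_or_gt_of_ne (mul_ne_zero hσ (hcr i)) with h | h
    · exact Filter.Eventually.of_forall fun z hz => Or.inr ⟨h, Or.inr hz⟩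
    · have : (AffineMap.lineMap (w i) (w (i + 1)) s : Plane) ∈ {z | 0 < σ * cr (w (i - 1)) (w i) z} := by
        show 0 < σ * _
        rw [cr_lineMap]; simp
        have := mul_pos hs h
        linarith
      filter_upwards [(isOpen_cr _ _ _).mem_nhds this] with z hz1 hz2
      exact Or.inl ⟨hz1, hz2⟩
  have secL : ∀ σ : ℝ, σ ≠ 0 → ∀ i, ∀ s : ℝ, 0 < s → ∀ᶠ z in 𝓝 (AffineMap.lineMap (w i) (w (i - 1)) s : Plane),
      0 < σ * cr (w (i - 1)) (w i) z → z ∈ Sec σ (w (i - 1)) (w i) (w (i + 1)) := by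
    intro σ hσ i s hs
    rcases lt_or_gt_of_ne (mul_ne_zero hσ (hcr i)) with h | h
    · exact Filter.Eventually.of_forall fun z hz => Or.inr ⟨h, Or.inl hz⟩
    · have : (AffineMap.lineMap (w i) (w (i - 1)) s : Plane) ∈ {z | 0 < σ * cr (w i) (w (i + 1)) z} := by
        show 0 < σ * _
        rw [cr_lineMap, cr_self_mid, cr_rot (w (i - 1))]
        have := mul_pos hs h
        linarith
      filter_upwards [(isOpen_cr _ _ _).mem_nhds this] with z hz1 hz2
      exact Or.inl ⟨hz2, hz1⟩
  have ballR : ∀ i, ∀ s : ℝ, 0 ≤ s → s ≤ t i →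
      (AffineMap.lineMap (w i) (w (i + 1)) s : Plane) ∈ Metric.ball (w i) (ε i) := by
    intro i s h1 h2
    rw [Metric.mem_ball, dist_lineMap_left, Real.norm_of_nonneg h1]
    exact (mul_le_mul_of_nonneg_right h2 dist_nonneg).trans_lt (ht2 i)
  have ballL : ∀ i, ∀ s : ℝ, 1 - t i ≤ s → s ≤ 1 →
      (AffineMap.lineMap (w i) (w (i + 1)) s : Plane) ∈ Metric.ball (w (i + 1)) (ε (i + 1)) := by
    intro i s h1 h2
    rw [Metric.mem_ball, dist_lineMap_right, Real.norm_of_nonneg (by linarith)]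
    exact (mul_le_mul_of_nonneg_right (by linarith) dist_nonneg).trans_lt (ht3 i)
  have cr0 : ∀ i, ∀ s : ℝ, cr (w i) (w (i + 1)) (AffineMap.lineMap (w i) (w (i + 1)) s : Plane) = 0 := by
    intro i s; rw [cr_lineMap]; simp
  have hAP : ∀ σ : ℝ, σ ≠ 0 → ∀ i, (A σ i ∩ P σ i).Nonempty := by
    intro σ hσ i
    obtain ⟨z, ⟨⟨h1, h2⟩, h3⟩, h4⟩ := exists_mem_side hσ (hw.ne i) (cr0 i (t i)) (Filter.inter_mem
      (Filter.inter_mem (Metric.isOpen_ball.mem_nhds (ballR i (t i) (ht0 i).le le_rfl))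
        ((hKo i).mem_nhds (hKsub i (t i) le_rfl (by linarith [ht1 i]))))
      (secR σ hσ i (t i) (ht0 i)))
    exact ⟨z, ⟨h1, h3 h4⟩, h2, h4⟩
  have hPA : ∀ σ : ℝ, σ ≠ 0 → ∀ i, (P σ i ∩ A σ (i + 1)).Nonempty := by
    intro σ hσ i
    have hsec := secL σ hσ (i + 1) (t i) (ht0 i)
    rw [add_sub_cancel_right] at hsec
    have e : (AffineMap.lineMap (w (i + 1)) (w i) (t i) : Plane) =
        AffineMap.lineMap (w i) (w (i + 1)) (1 - t i) := by
      apply Plane.ext <;> simp only [lineMap_coord] <;> ring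
    rw [e] at hsec
    obtain ⟨z, ⟨⟨h1, h2⟩, h3⟩, h4⟩ := exists_mem_side hσ (hw.ne i) (cr0 i (1 - t i)) (Filter.inter_mem
      (Filter.inter_mem (Metric.isOpen_ball.mem_nhds (ballL i (1 - t i) le_rfl (by linarith [ht0 i])))
        ((hKo i).mem_nhds (hKsub i (1 - t i) (by linarith [ht1 i]) le_rfl))) hsec)
    refine ⟨z, ⟨h2, h4⟩, h1, ?_⟩
    rw [add_sub_cancel_right]; exact h3 h4
  refine ⟨fun σ => ⋃ i, (A σ i ∪ P σ i), fun σ hσ => ⟨?_, ?_, fun i => ⟨ε i, hε i, ?_⟩, fun i => ?_⟩, ?_⟩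
  · refine IsPreconnected.iUnion_of_reflTransGen (fun i => ?_) fun i j => ?_
    · refine IsPreconnected.union' (hAP σ hσ i) (isPreconnected_sec hσ (hcr i) (hε i)) ?_
      exact (((convex_segment _ _).thickening _).inter (convex_cr _ _ _)).isPreconnected
    · have step : ∀ i, ((A σ i ∪ P σ i) ∩ (A σ (i + 1) ∪ P σ (i + 1))).Nonempty := fun i =>
        (hPA σ hσ i).mono (Set.inter_subset_inter Set.subset_union_right Set.subset_union_left)
      have many : ∀ n : ℕ, Relation.ReflTransGen
          (fun i j => ((A σ i ∪ P σ i) ∩ (A σ j ∪ P σ j)).Nonempty) i (i + n) := by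
        intro n
        induction n with
        | zero => simpa using Relation.ReflTransGen.refl
        | succ n ih =>
          refine ih.tail ?_
          have := step (i + n)
          rwa [add_assoc, ← Nat.cast_succ] at this
      have := many (j - i).val
      rwa [ZMod.natCast_zmod_val, add_sub_cancel] at this
  · exact Set.iUnion_subset fun i => Set.union_subset (hAsub σ i) (hPsub σ i)
  · exact Set.subset_iUnion_of_subset i Set.subset_union_left
  · have hmem : beside (w i) (w (i + 1)) 0 ∈ K i := by
      rw [beside_zero_mem]
      exact hKsub i _ (ht1 i).le (by linarith [ht1 i])
    filter_upwards [(hKo i).mem_nhds hmem] with z hz1 hz2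
    exact Set.mem_iUnion.2 ⟨i, Or.inr ⟨hz1, hz2⟩⟩
  · intro z hz
    -- The segment from `z` to a nearest boundary point `y` avoids the boundary before `y`, and near
    -- `y` it runs in one of the two sides.
    obtain ⟨y, hyB, hy⟩ := (isClosed_boundary (w := w)).exists_infDist_eq_dist
      ⟨_, vertex_mem_boundary 0⟩ z
    have hzy : z ≠ y := by rintro rfl; exact hz hyB
    have hfree : ∀ s : ℝ, 0 < s → s ≤ 1 → (AffineMap.lineMap y z s : Plane) ∉ polygonBoundary w := by
      intro s h0 h1 hB
      have h2 := Metric.infDist_le_dist_of_mem (x := z) hB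
      rw [hy, dist_comm z, dist_comm z, dist_lineMap_right, Real.norm_of_nonneg (by linarith)] at h2
      have h3 : 0 < dist y z := dist_pos.2 hzy.symm
      nlinarith
    have hlim : Tendsto (fun s : ℝ => (AffineMap.lineMap y z s : Plane)) (𝓝[>] 0) (𝓝 y) := by
      have : Tendsto (fun s : ℝ => (AffineMap.lineMap y z s : Plane)) (𝓝 0)
          (𝓝 (AffineMap.lineMap y z (0 : ℝ))) := AffineMap.lineMap_continuous.tendsto _
      rw [AffineMap.lineMap_apply_zero] at this
      exact this.mono_left nhdsWithin_le_nhds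
    have hI : ∀ᶠ s in 𝓝[>] (0 : ℝ), s ∈ Set.Ioc (0 : ℝ) 1 := Ioc_mem_nhdsGT zero_lt_one
    have finish : ∀ s ∈ Set.Ioc (0 : ℝ) 1, (∃ i, AffineMap.lineMap y z s ∈ A 1 i ∪ P 1 i) ∨
        (∃ i, AffineMap.lineMap y z s ∈ A (-1) i ∪ P (-1) i) →
        ∃ C, IsPreconnected C ∧ C ⊆ (polygonBoundary w)ᶜ ∧ z ∈ C ∧
        ((C ∩ ⋃ i, (A 1 i ∪ P 1 i)).Nonempty ∨ (C ∩ ⋃ i, (A (-1) i ∪ P (-1) i)).Nonempty) := by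
      rintro s ⟨hs0, hs1⟩ h
      refine ⟨segment ℝ (AffineMap.lineMap y z s) z, (convex_segment _ _).isPreconnected, ?_,
        right_mem_segment _ _ _, ?_⟩
      · rintro x hx
        obtain ⟨r, hr0, hr1, rfl⟩ := mem_segment_iff_lineMap.1 hx
        have : (AffineMap.lineMap (AffineMap.lineMap y z s) z r : Plane) =
            AffineMap.lineMap y z (s + r * (1 - s)) := by
          apply Plane.ext <;> simp only [lineMap_coord] <;> ring
        rw [this]
        exact hfree _ (by nlinarith) (by nlinarith)
      · refine h.imp ?_ ?_ <;> rintro ⟨i, hi⟩ <;>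
          exact ⟨_, left_mem_segment _ _ _, Set.mem_iUnion.2 ⟨i, hi⟩⟩
    by_cases hyb : ∃ i, y ∈ Metric.ball (w i) (ε i)
    · obtain ⟨i, hi⟩ := hyb
      obtain ⟨s, h1, h2⟩ := ((hlim.eventually (Metric.isOpen_ball.mem_nhds hi)).and hI).exists
      refine finish s h2 ?_
      have hnB := hfree s h2.1 h2.2
      have far : ∀ (b : Plane) (r : ℝ), ε i ≤ dist (w i) b → 0 ≤ r →
          AffineMap.lineMap y z s = (AffineMap.lineMap (w i) b r : Plane) → r ≤ 1 := by
        intro b r hb hr h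
        rw [h] at h1
        have h1 : dist (AffineMap.lineMap (w i) b r) (w i) < ε i := h1
        rw [dist_lineMap_left, Real.norm_of_nonneg hr] at h1
        by_contra hc
        have := hε i
        nlinarith
      have nr : ∀ r : ℝ, 0 ≤ r → AffineMap.lineMap y z s ≠ (AffineMap.lineMap (w i) (w (i + 1)) r : Plane) :=
        fun r hr h => hnB (mem_boundary.2
          ⟨i, mem_segment_iff_lineMap.2 ⟨r, hr, far _ r (hε1 i) hr h, h⟩⟩)
      have nl : ∀ r : ℝ, 0 ≤ r → AffineMap.lineMap y z s ≠ (AffineMap.lineMap (w i) (w (i - 1)) r : Plane) := by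
        refine fun r hr h => hnB (mem_boundary.2 ⟨i - 1, ?_⟩)
        rw [sub_add_cancel, segment_symm]
        exact mem_segment_iff_lineMap.2 ⟨r, hr, far _ r (hε2 i) hr h, h⟩
      rcases mem_sec_or (hcr i) nr nl with h | h
      · left; exact ⟨i, Or.inl ⟨h1, h⟩⟩
      · right; exact ⟨i, Or.inl ⟨h1, h⟩⟩
    · push Not at hyb
      obtain ⟨i, hi⟩ := mem_boundary.1 hyB
      obtain ⟨r, hr0, hr1, hr⟩ := mem_segment_iff_lineMap.1 hi
      have hr0' : t i ≤ r := by
        by_contra hc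
        exact hyb i (hr ▸ ballR i r hr0 (not_le.1 hc).le)
      have hr1' : r ≤ 1 - t i := by
        by_contra hc
        exact hyb (i + 1) (hr ▸ ballL i r (not_le.1 hc).le hr1)
      have hyK : y ∈ K i := hr ▸ hKsub i r hr0' hr1'
      obtain ⟨s, h1, h2⟩ := ((hlim.eventually ((hKo i).mem_nhds hyK)).and hI).exists
      refine finish s h2 ?_
      have hnB := hfree s h2.1 h2.2
      rcases lt_trichotomy (cr (w i) (w (i + 1)) (AffineMap.lineMap y z s)) 0 with h | h | h
      · right
        refine ⟨i, Or.inr ⟨h1, ?_⟩⟩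
        show (0 : ℝ) < -1 * cr (w i) (w (i + 1)) (AffineMap.lineMap y z s)
        linarith
      · exfalso
        -- then `z` lies on the line of the edge
        rw [cr_lineMap, hr, cr0, mul_zero, zero_add] at h
        have hz0 := (mul_eq_zero.1 h).resolve_left h2.1.ne'
        have hd := dt_self_pos (hw.ne i)
        set T := dt (w i) (w (i + 1)) z / dt (w i) (w (i + 1)) (w (i + 1)) with hT
        have hTd : T * dt (w i) (w (i + 1)) (w (i + 1)) = dt (w i) (w (i + 1)) z :=
          div_mul_cancel₀ _ hd.ne'
        have ez : z = AffineMap.lineMap (w i) (w (i + 1)) T := by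
          apply Plane.ext <;> simp only [lineMap_coord] <;> apply mul_left_cancel₀ hd.ne'
          · have e : dt (w i) (w (i + 1)) (w (i + 1)) * (z 0 - w i 0) =
              dt (w i) (w (i + 1)) z * (w (i + 1) 0 - w i 0) -
                cr (w i) (w (i + 1)) z * (w (i + 1) 1 - w i 1) := by unfold dt cr; ring
            rw [hz0, ← hTd] at e; linarith
          · have e : dt (w i) (w (i + 1)) (w (i + 1)) * (z 1 - w i 1) =
              dt (w i) (w (i + 1)) z * (w (i + 1) 1 - w i 1) +
                cr (w i) (w (i + 1)) z * (w (i + 1) 0 - w i 0) := by unfold dt cr; ring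
            rw [hz0, ← hTd] at e; linarith
        have hlim2 : Tendsto (fun s : ℝ => (1 - s) * r + s * T) (𝓝[>] 0) (𝓝 r) := by
          have : Tendsto (fun s : ℝ => (1 - s) * r + s * T) (𝓝 0) (𝓝 ((1 - 0) * r + 0 * T)) :=
            Continuous.tendsto (by fun_prop) _
          rw [sub_zero, one_mul, zero_mul, add_zero] at this
          exact this.mono_left nhdsWithin_le_nhds
        obtain ⟨s', h3, h4⟩ := ((hlim2.eventually (Icc_mem_nhds (show (0 : ℝ) < r by linarith [ht0 i])
          (show r < 1 by linarith [ht0 i]))).and hI).exists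
        refine hfree s' h4.1 h4.2 (mem_boundary.2 ⟨i, mem_segment_iff_lineMap.2
          ⟨(1 - s') * r + s' * T, h3.1, h3.2, ?_⟩⟩)
        rw [hr]; nth_rewrite 1 [ez]
        apply Plane.ext <;> simp only [lineMap_coord] <;> ring
      · left
        refine ⟨i, Or.inr ⟨h1, ?_⟩⟩
        show (0 : ℝ) < 1 * cr (w i) (w (i + 1)) (AffineMap.lineMap y z s)
        linarith

end sides
end PseudoTriang
-- The interior of a simple polygon.
namespace PseudoTriang

/-- The separating functional of the Hahn–Banach theorem, written in coordinates. -/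
lemma inHalfPlane_of_notMem_convexHull {S : Set Plane} (hS : S.Finite) {z : Plane}
    (hz : z ∉ convexHull ℝ S) : InHalfPlane z S := by
  obtain ⟨f, u, h1, h2⟩ := geometric_hahn_banach_point_closed (convex_convexHull ℝ S)
    (hS.isClosed_convexHull ℝ) hz
  have hf : ∀ y : Plane, f y = y 0 * f (EuclideanSpace.single 0 1) + y 1 * f (EuclideanSpace.single 1 1) := by
    intro y
    have : y = y 0 • EuclideanSpace.single 0 (1 : ℝ) + y 1 • EuclideanSpace.single 1 (1 : ℝ) := by
      apply Plane.ext <;> simp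
    conv_lhs => rw [this]
    simp
  refine ⟨f (EuclideanSpace.single 0 1), f (EuclideanSpace.single 1 1), fun c hc => ?_⟩
  have := h2 c (subset_convexHull ℝ S hc)
  rw [hf] at h1 this
  linarith

lemma exists_inHalfPlane {S : Set Plane} (hS : S.Finite) : ∃ z, InHalfPlane z S := by
  have hb : Bornology.IsBounded (convexHull ℝ S) := isBounded_convexHull.2 hS.isBounded
  by_contra hc
  push Not at hc
  have : convexHull ℝ S = Set.univ := by
    rw [Set.eq_univ_iff_forall]
    intro z
    by_contra hz
    exact hc z (inHalfPlane_of_notMem_convexHull hS hz)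
  rw [this] at hb
  exact NormedSpace.unbounded_univ ℝ Plane hb

section polygon
variable {k : ℕ} [NeZero k] {w : ZMod k → Plane}

/-- At the midpoint of an edge only the summand of that edge is discontinuous, so the difference of
the two sides tends to `2π`; being an integer multiple of `2π`, it equals its limit near the edge.
-/
lemma IsSimplePolygon.wind_jump (hw : IsSimplePolygon w)
    (hcr : ∀ i, cr (w (i - 1)) (w i) (w (i + 1)) ≠ 0) (i : ZMod k) :
    ∀ᶠ δ in 𝓝[>] 0, wind w (beside (w i) (w (i + 1)) δ) =
      wind w (beside (w i) (w (i + 1)) (-δ)) + 2 * Real.pi := by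
  have hne := hw.ne i
  have hoff : ∀ j, j ≠ i → beside (w i) (w (i + 1)) 0 ∉ segment ℝ (w j) (w (j + 1)) := by
    intro j hj hmem
    have hmid : beside (w i) (w (i + 1)) 0 ∈ segment ℝ (w i) (w (i + 1)) :=
      mem_segment_iff_lineMap.2 ⟨1 / 2, by norm_num, by norm_num, beside_zero_mem _ _⟩
    rw [beside_zero_mem] at *
    rcases hw.eq_vertex hj hmid hmem with ⟨h, -⟩ | ⟨h, -⟩
    · have := (AffineMap.lineMap_injective ℝ hne) (a₁ := 1 / 2) (a₂ := 0) (by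
        rw [h, AffineMap.lineMap_apply_zero])
      norm_num at this
    · have := (AffineMap.lineMap_injective ℝ hne) (a₁ := 1 / 2) (a₂ := 1) (by
        rw [h, AffineMap.lineMap_apply_one])
      norm_num at this
  have hlim : Tendsto (fun δ => wind w (beside (w i) (w (i + 1)) δ) -
      wind w (beside (w i) (w (i + 1)) (-δ))) (𝓝[>] 0) (𝓝 (2 * Real.pi)) := by
    have e : (2 * Real.pi) = ∑ j, if j = i then 2 * Real.pi else 0 := by simp
    unfold wind
    simp_rw [← Finset.sum_sub_distrib]
    rw [e]
    refine tendsto_finsetSum _ fun j _ => ?_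
    split_ifs with h
    · subst h
      have := (tendsto_ang_beside hne).1.sub (tendsto_ang_beside hne).2
      rwa [show Real.pi - -Real.pi = 2 * Real.pi by ring] at this
    · have hc := (continuousAt_ang (hoff j h)).tendsto
      have := (hc.comp (tendsto_beside _ _)).sub (hc.comp (tendsto_beside_neg _ _))
      rwa [sub_self] at this
  obtain ⟨S, hS, -⟩ := hw.exists_sides hcr
  have hN := dt_self_pos hne
  have in1 : ∀ᶠ δ in 𝓝[>] 0, beside (w i) (w (i + 1)) δ ∉ polygonBoundary w := by
    filter_upwards [(tendsto_beside _ _).eventually ((hS 1 one_ne_zero).2.2.2 i),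
      self_mem_nhdsWithin] with δ h1 h2
    refine (hS 1 one_ne_zero).2.1 (h1 ?_)
    rw [cr_beside, one_mul]; exact mul_pos h2 hN
  have in2 : ∀ᶠ δ in 𝓝[>] 0, beside (w i) (w (i + 1)) (-δ) ∉ polygonBoundary w := by
    have hm : (-1 : ℝ) ≠ 0 := by norm_num
    filter_upwards [(tendsto_beside_neg _ _).eventually ((hS _ hm).2.2.2 i),
      self_mem_nhdsWithin] with δ h1 h2
    refine (hS _ hm).2.1 (h1 ?_)
    rw [cr_beside]
    have := mul_pos h2 hN
    linarith
  have hpi := Real.pi_pos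
  filter_upwards [hlim.eventually (Ioo_mem_nhds (show Real.pi < 2 * Real.pi by linarith)
    (show 2 * Real.pi < 3 * Real.pi by linarith)), in1, in2] with δ h1 h2 h3
  obtain ⟨n, hn⟩ := wind_eq h2
  obtain ⟨m, hm⟩ := wind_eq h3
  rw [hn, hm] at h1 ⊢
  obtain ⟨h4, h5⟩ := h1
  have h6 : (0 : ℝ) < (n - m : ℤ) := by
    push_cast
    by_contra hc
    have := mul_nonneg hpi.le (neg_nonneg.2 (not_lt.1 hc))
    nlinarith
  have h7 : ((n - m : ℤ) : ℝ) < 2 := by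
    push_cast
    by_contra hc
    have := mul_nonneg hpi.le (sub_nonneg.2 (not_lt.1 hc))
    nlinarith
  have h8 : n - m = 1 := by
    have a : 0 < n - m := by exact_mod_cast h6
    have b : n - m < 2 := by exact_mod_cast h7
    omega
  have : (n : ℝ) = m + 1 := by
    have := congrArg (Int.cast (R := ℝ)) h8
    push_cast at this; linarith
  rw [this]; ring

/-- The winding number is constant on each side and jumps by `2π` between them. A point outside the
convex hull has winding number zero and is connected to one of the sides, which determines `β` up to
orientation. -/
lemma IsSimplePolygon.exists_wind_sides (hw : IsSimplePolygon w)
    (hcr : ∀ i, cr (w (i - 1)) (w i) (w (i + 1)) ≠ 0) :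
    ∃ (S : ℝ → Set Plane) (β : ℝ), (β = 0 ∨ β = - (2 * Real.pi)) ∧
      (∀ z ∈ S 1, wind w z = β + 2 * Real.pi) ∧ (∀ z ∈ S (-1), wind w z = β) ∧
      (∀ σ : ℝ, σ ≠ 0 → IsPreconnected (S σ) ∧ S σ ⊆ (polygonBoundary w)ᶜ ∧ (S σ).Nonempty ∧
      (∀ i, ∃ ε > 0, Metric.ball (w i) ε ∩ Sec σ (w (i - 1)) (w i) (w (i + 1)) ⊆ S σ) ∧
      (∀ i, ∀ᶠ z in 𝓝 (beside (w i) (w (i + 1)) 0), 0 < σ * cr (w i) (w (i + 1)) z → z ∈ S σ)) ∧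
      ∀ z ∉ polygonBoundary w, ∃ C, IsPreconnected C ∧ C ⊆ (polygonBoundary w)ᶜ ∧ z ∈ C ∧
        ((C ∩ S 1).Nonempty ∨ (C ∩ S (-1)).Nonempty) := by
  obtain ⟨S, hS, hcov⟩ := hw.exists_sides hcr
  have hm : (-1 : ℝ) ≠ 0 := by norm_num
  have hN := dt_self_pos (hw.ne 0)
  have in1 : ∀ᶠ δ in 𝓝[>] 0, beside (w 0) (w (0 + 1)) δ ∈ S 1 := by
    filter_upwards [(tendsto_beside _ _).eventually ((hS 1 one_ne_zero).2.2.2 0),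
      self_mem_nhdsWithin] with δ h1 h2
    refine h1 ?_
    rw [cr_beside, one_mul]; exact mul_pos h2 hN
  have in2 : ∀ᶠ δ in 𝓝[>] 0, beside (w 0) (w (0 + 1)) (-δ) ∈ S (-1) := by
    filter_upwards [(tendsto_beside_neg _ _).eventually ((hS _ hm).2.2.2 0),
      self_mem_nhdsWithin] with δ h1 h2
    refine h1 ?_
    rw [cr_beside]
    have := mul_pos h2 hN
    linarith
  obtain ⟨δ, ⟨h1, h2⟩, h3⟩ := ((in1.and in2).and (hw.wind_jump hcr 0)).exists
  set β := wind w (beside (w 0) (w (0 + 1)) (-δ)) with hβ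
  have w1 : ∀ z ∈ S 1, wind w z = β + 2 * Real.pi := fun z hz => by
    rw [← h3]; exact wind_const (hS 1 one_ne_zero).1 (hS 1 one_ne_zero).2.1 hz h1
  have w2 : ∀ z ∈ S (-1), wind w z = β := fun z hz =>
    wind_const (hS _ hm).1 (hS _ hm).2.1 hz h2
  refine ⟨S, β, ?_, w1, w2, fun σ hσ => ⟨(hS σ hσ).1, (hS σ hσ).2.1, ?_, (hS σ hσ).2.2⟩, hcov⟩
  · obtain ⟨z, hz⟩ := exists_inHalfPlane (Set.finite_range w)
    obtain ⟨hzB, hz0⟩ := wind_eq_zero hz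
    obtain ⟨C, hC, hCB, hzC, ⟨y, hyC, hy⟩ | ⟨y, hyC, hy⟩⟩ := hcov z hzB
    · right
      have := wind_const hC hCB hzC hyC
      rw [w1 y hy, hz0] at this
      linarith
    · left
      have := wind_const hC hCB hzC hyC
      rw [w2 y hy, hz0] at this
      exact this.symm
  · obtain ⟨z, hz1, hz2⟩ := exists_mem_side hσ (hw.ne 0)
      (show cr (w 0) (w (0 + 1)) (beside (w 0) (w (0 + 1)) 0) = 0 by rw [cr_beside, zero_mul])
      ((hS σ hσ).2.2.2 0)
    exact ⟨z, hz1 hz2⟩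

/-- The open region with winding number one. -/
def inner (w : ZMod k → Plane) : Set Plane := {z | z ∉ polygonBoundary w ∧ wind w z = 2 * Real.pi}

/-- A point of winding number `2π` plays the role of a counterclockwise orientation: it rules out `β
= -2π`. -/
lemma IsSimplePolygon.exists_pos_sides (hw : IsSimplePolygon w)
    (hcr : ∀ i, cr (w (i - 1)) (w i) (w (i + 1)) ≠ 0) (hpos : (inner w).Nonempty) :
    ∃ S : ℝ → Set Plane,
      (∀ z ∈ S 1, wind w z = 2 * Real.pi) ∧ (∀ z ∈ S (-1), wind w z = 0) ∧
      (∀ σ : ℝ, σ ≠ 0 → IsPreconnected (S σ) ∧ S σ ⊆ (polygonBoundary w)ᶜ ∧ (S σ).Nonempty ∧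
      (∀ i, ∃ ε > 0, Metric.ball (w i) ε ∩ Sec σ (w (i - 1)) (w i) (w (i + 1)) ⊆ S σ) ∧
      (∀ i, ∀ᶠ z in 𝓝 (beside (w i) (w (i + 1)) 0), 0 < σ * cr (w i) (w (i + 1)) z → z ∈ S σ)) ∧
      ∀ z ∉ polygonBoundary w, ∃ C, IsPreconnected C ∧ C ⊆ (polygonBoundary w)ᶜ ∧ z ∈ C ∧
        ((C ∩ S 1).Nonempty ∨ (C ∩ S (-1)).Nonempty) := by
  obtain ⟨S, β, hβ, h1, h2, h3, h4⟩ := hw.exists_wind_sides hcr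
  rcases hβ with rfl | rfl
  · exact ⟨S, by simpa using h1, h2, h3, h4⟩
  · exfalso
    obtain ⟨z, hzB, hz⟩ := hpos
    have hpi := Real.pi_pos
    obtain ⟨C, hC, hCB, hzC, ⟨y, hyC, hy⟩ | ⟨y, hyC, hy⟩⟩ := h4 z hzB
    · have := wind_const hC hCB hzC hyC
      rw [h1 y hy] at this; linarith
    · have := wind_const hC hCB hzC hyC
      rw [h2 y hy] at this; linarith

section pos
variable (hw : IsSimplePolygon w) (hcr : ∀ i, cr (w (i - 1)) (w i) (w (i + 1)) ≠ 0)
include hw hcr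

lemma wind_values : (∀ z ∉ polygonBoundary w, wind w z = 0 ∨ wind w z = 2 * Real.pi) ∨
    ((∃ z ∉ polygonBoundary w, wind w z = -(2 * Real.pi)) ∧
      ∀ z ∉ polygonBoundary w, wind w z = 0 ∨ wind w z = -(2 * Real.pi)) := by
  obtain ⟨S, β, hβ, h1, h2, h3, h4⟩ := hw.exists_wind_sides hcr
  have hm : (-1 : ℝ) ≠ 0 := by norm_num
  rcases hβ with rfl | rfl
  · left
    intro z hzB
    obtain ⟨C, hC, hCB, hzC, ⟨y, hyC, hy⟩ | ⟨y, hyC, hy⟩⟩ := h4 z hzB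
    · right; rw [wind_const hC hCB hzC hyC, h1 y hy]; ring
    · left; rw [wind_const hC hCB hzC hyC, h2 y hy]
  · right
    constructor
    · obtain ⟨y, hy⟩ := (h3 _ hm).2.2.1
      exact ⟨y, (h3 _ hm).2.1 hy, h2 y hy⟩
    intro z hzB
    obtain ⟨C, hC, hCB, hzC, ⟨y, hyC, hy⟩ | ⟨y, hyC, hy⟩⟩ := h4 z hzB
    · left; rw [wind_const hC hCB hzC hyC, h1 y hy]; ring
    · right; rw [wind_const hC hCB hzC hyC, h2 y hy]

variable (hpos : (inner w).Nonempty)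
include hpos

lemma wind_eq_zero_or {z : Plane} (hz : z ∉ polygonBoundary w) :
    wind w z = 0 ∨ wind w z = 2 * Real.pi := by
  obtain ⟨S, h1, h2, h3, h4⟩ := hw.exists_pos_sides hcr hpos
  obtain ⟨C, hC, hCB, hzC, ⟨y, hyC, hy⟩ | ⟨y, hyC, hy⟩⟩ := h4 z hz
  · right; rw [wind_const hC hCB hzC hyC, h1 y hy]
  · left; rw [wind_const hC hCB hzC hyC, h2 y hy]

lemma exists_ball_sec (i : ZMod k) : ∃ ε > 0, ∀ z ∈ Metric.ball (w i) ε,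
    (z ∈ Sec 1 (w (i - 1)) (w i) (w (i + 1)) → z ∈ inner w) ∧
    (z ∈ Sec (-1) (w (i - 1)) (w i) (w (i + 1)) → z ∉ polygonBoundary w ∧ wind w z = 0) := by
  obtain ⟨S, h1, h2, h3, h4⟩ := hw.exists_pos_sides hcr hpos
  have hm : (-1 : ℝ) ≠ 0 := by norm_num
  obtain ⟨ε, hε, hs⟩ := (h3 1 one_ne_zero).2.2.2.1 i
  obtain ⟨ε', hε', hs'⟩ := (h3 (-1) hm).2.2.2.1 i
  refine ⟨min ε ε', lt_min hε hε', fun z hz => ⟨fun h => ?_, fun h => ?_⟩⟩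
  · have := hs ⟨Metric.ball_subset_ball (min_le_left _ _) hz, h⟩
    exact ⟨(h3 1 one_ne_zero).2.1 this, h1 z this⟩
  · have := hs' ⟨Metric.ball_subset_ball (min_le_right _ _) hz, h⟩
    exact ⟨(h3 (-1) hm).2.1 this, h2 z this⟩

/-- Every point of winding number `2π` is joined off the boundary to the left side, which is
preconnected. This is the half of the Jordan curve theorem concerning the interior. -/
lemma inner_eq_component : ∀ x ∈ inner w, inner w = connectedComponentIn (polygonBoundary w)ᶜ x := by
  obtain ⟨S, h1, h2, h3, h4⟩ := hw.exists_pos_sides hcr hpos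
  have hpi := Real.pi_pos
  have hs := h3 1 one_ne_zero
  have key : ∀ x ∈ inner w, ∃ C, IsPreconnected C ∧ C ⊆ (polygonBoundary w)ᶜ ∧ x ∈ C ∧ S 1 ⊆ C := by
    rintro x ⟨hxB, hx⟩
    obtain ⟨C, hC, hCB, hzC, ⟨y, hyC, hy⟩ | ⟨y, hyC, hy⟩⟩ := h4 x hxB
    · exact ⟨C ∪ S 1, hC.union y hyC hy hs.1, Set.union_subset hCB hs.2.1, Or.inl hzC,
        Set.subset_union_right⟩
    · have := wind_const hC hCB hzC hyC
      rw [h2 y hy] at this; linarith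
  intro x hx
  obtain ⟨y, hy⟩ := hs.2.2.1
  obtain ⟨C, hC, hCB, hxC, hSC⟩ := key x hx
  apply Set.Subset.antisymm
  · intro z hz
    obtain ⟨C', hC', hCB', hzC', hSC'⟩ := key z hz
    exact (hC.union y (hSC hy) (hSC' hy) hC').subset_connectedComponentIn (Or.inl hxC)
      (Set.union_subset hCB hCB') (Or.inr hzC')
  · intro z hz
    have hsub := connectedComponentIn_subset (polygonBoundary w)ᶜ x
    refine ⟨hsub hz, ?_⟩
    rw [wind_const isPreconnected_connectedComponentIn hsub hz
      (mem_connectedComponentIn (show x ∈ (polygonBoundary w)ᶜ from hx.1)), hx.2]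

omit hw hcr hpos in
lemma inner_subset_convexHull : inner w ⊆ convexHull ℝ (Set.range w) := by
  intro z hz
  by_contra h
  have := (wind_eq_zero (inHalfPlane_of_notMem_convexHull (Set.finite_range w) h)).2
  rw [hz.2] at this
  linarith [Real.pi_pos]

lemma isInteriorOf_inner : IsInteriorOf (inner w) w := by
  obtain ⟨x, hx⟩ := hpos
  exact ⟨⟨x, hx.1, inner_eq_component hw hcr ⟨x, hx⟩ x hx⟩,
    (isBounded_convexHull.2 (Set.finite_range w).isBounded).subset inner_subset_convexHull⟩

lemma isOpen_inner : IsOpen (inner w) := by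
  obtain ⟨x, hx⟩ := hpos
  rw [inner_eq_component hw hcr ⟨x, hx⟩ x hx]
  exact isClosed_boundary.isOpen_compl.connectedComponentIn

/-- A component with winding number zero contains everything outside the convex hull of the vertices
and is therefore unbounded. -/
lemma IsInteriorOf.eq_inner {R : Set Plane} (hR : IsInteriorOf R w) : R = inner w := by
  obtain ⟨⟨x, hxB, rfl⟩, hbd⟩ := hR
  rcases wind_eq_zero_or hw hcr hpos hxB with h0 | h0
  · exfalso
    obtain ⟨S, h1, h2, h3, h4⟩ := hw.exists_pos_sides hcr hpos
    have hm : (-1 : ℝ) ≠ 0 := by norm_num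
    have hs := h3 (-1) hm
    have hpi := Real.pi_pos
    have key : ∀ x, x ∉ polygonBoundary w → wind w x = 0 →
        ∃ C, IsPreconnected C ∧ C ⊆ (polygonBoundary w)ᶜ ∧ x ∈ C ∧ S (-1) ⊆ C := by
      intro x hxB hx
      obtain ⟨C, hC, hCB, hzC, ⟨y, hyC, hy⟩ | ⟨y, hyC, hy⟩⟩ := h4 x hxB
      · have := wind_const hC hCB hzC hyC
        rw [h1 y hy] at this; linarith
      · exact ⟨C ∪ S (-1), hC.union y hyC hy hs.1, Set.union_subset hCB hs.2.1, Or.inl hzC,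
          Set.subset_union_right⟩
    obtain ⟨y, hy⟩ := hs.2.2.1
    obtain ⟨C, hC, hCB, hxC, hSC⟩ := key x hxB h0
    have hun : (Set.univ : Set Plane) ⊆
        connectedComponentIn (polygonBoundary w)ᶜ x ∪ convexHull ℝ (Set.range w) := by
      intro z _
      by_cases hz : z ∈ convexHull ℝ (Set.range w)
      · exact Or.inr hz
      · obtain ⟨hz1, hz2⟩ := wind_eq_zero (inHalfPlane_of_notMem_convexHull (Set.finite_range w) hz)
        obtain ⟨C', hC', hCB', hzC', hSC'⟩ := key z hz1 hz2
        exact Or.inl ((hC.union y (hSC hy) (hSC' hy) hC').subset_connectedComponentIn (Or.inl hxC)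
          (Set.union_subset hCB hCB') (Or.inr hzC'))
    exact NormedSpace.unbounded_univ ℝ Plane
      ((hbd.union (isBounded_convexHull.2 (Set.finite_range w).isBounded)).subset hun)
  · exact (inner_eq_component hw hcr hpos x ⟨hxB, h0⟩).symm

/-- Near a vertex the interior is the left sector, and the small positive combinations of the two
edge vectors lie in the left or in the right sector according to the sign of `cr`. -/
lemma isCorner_iff (i : ZMod k) :
    IsCorner (inner w) w i ↔ 0 < cr (w (i - 1)) (w i) (w (i + 1)) := by
  obtain ⟨ε, hε, hball⟩ := exists_ball_sec hw hcr hpos i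
  set a := w (i - 1)
  set v := w i
  set b := w (i + 1)
  have c1 : ∀ s t : ℝ, cr a v (v + s • (b - v) + t • (a - v)) = s * cr a v b := by
    intro s t; simp [cr]; ring
  have c2 : ∀ s t : ℝ, cr v b (v + s • (b - v) + t • (a - v)) = t * cr a v b := by
    intro s t; simp [cr]; ring
  have near : ∃ η > (0 : ℝ), ∀ s t : ℝ, 0 < s → s < η → 0 < t → t < η →
      v + s • (b - v) + t • (a - v) ∈ Metric.ball v ε := by
    have hc : ContinuousAt (fun q : ℝ × ℝ => v + q.1 • (b - v) + q.2 • (a - v)) (0, 0) := by fun_prop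
    have := hc.preimage_mem_nhds (t := Metric.ball v ε) (by simpa using Metric.ball_mem_nhds v hε)
    obtain ⟨η, hη, hsub⟩ := Metric.mem_nhds_iff.1 this
    refine ⟨η, hη, fun s t hs hs' ht ht' => @hsub (s, t) ?_⟩
    rw [Metric.mem_ball, Prod.dist_eq]
    simp [abs_of_pos hs, abs_of_pos ht, hs', ht']
  obtain ⟨η, hη, hn⟩ := near
  constructor
  · rintro ⟨θ, hθ, hc⟩
    by_contra hneg
    have hneg' := lt_of_le_of_ne (not_lt.1 hneg) (hcr i)
    set s := min η θ / 2
    have hs : 0 < s := half_pos (lt_min hη hθ)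
    have hsη : s < η := (half_lt_self (lt_min hη hθ)).trans_le (min_le_left _ _)
    have hsθ : s < θ := (half_lt_self (lt_min hη hθ)).trans_le (min_le_right _ _)
    have h1 := (hc s s hs hsθ hs hsθ).2
    have h2 := ((hball _ (hn s s hs hsη hs hsη)).2 (Or.inl ⟨?_, ?_⟩)).2
    · rw [h1] at h2; linarith [Real.pi_pos]
    · rw [c1]; have := mul_pos hs (neg_pos.2 hneg'); linarith
    · rw [c2]; have := mul_pos hs (neg_pos.2 hneg'); linarith
  · intro h
    refine ⟨η, hη, fun s t hs hs' ht ht' => (hball _ (hn s t hs hs' ht ht')).1 (Or.inl ⟨?_, ?_⟩)⟩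
    · rw [c1, one_mul]; exact mul_pos hs h
    · rw [c2, one_mul]; exact mul_pos ht h

/-- Just beyond an extreme vertex the whole polygon lies in a half-plane and the winding number is
zero. At a reflex vertex that point would belong to the left sector, where the winding number is
`2π`. -/
lemma corner_of_extreme {n m : ℝ} (hnm : 0 < n * n + m * m) {i : ZMod k}
    (hi : ∀ j, n * w j 0 + m * w j 1 ≤ n * w i 0 + m * w i 1) :
    0 < cr (w (i - 1)) (w i) (w (i + 1)) := by
  obtain ⟨ε, hε, hball⟩ := exists_ball_sec hw hcr hpos i
  by_contra hneg
  have hneg' := lt_of_le_of_ne (not_lt.1 hneg) (hcr i)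
  set q : ℝ → Plane := fun δ => w i + δ • !₂[n, m] with hq
  have hlim : Tendsto q (𝓝[>] 0) (𝓝 (w i)) := by
    have : Tendsto q (𝓝 0) (𝓝 (w i + (0 : ℝ) • !₂[n, m])) := Continuous.tendsto (by fun_prop) _
    rw [zero_smul, add_zero] at this
    exact this.mono_left nhdsWithin_le_nhds
  obtain ⟨δ, h1, h2⟩ := ((hlim.eventually (Metric.ball_mem_nhds _ hε)).and self_mem_nhdsWithin).exists
  have h2 : 0 < δ := h2
  have hf : n * q δ 0 + m * q δ 1 = n * w i 0 + m * w i 1 + δ * (n * n + m * m) := by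
    simp [hq]; ring
  have hpos' := mul_pos h2 hnm
  have hW := (wind_eq_zero (w := w) (z := q δ) ⟨-n, -m, by
    rintro _ ⟨j, rfl⟩
    have := hi j
    linarith⟩).2
  have hsec : q δ ∈ Sec 1 (w (i - 1)) (w i) (w (i + 1)) := by
    refine Or.inr ⟨by linarith, ?_⟩
    by_contra hc
    push Not at hc
    have e : cr (w (i - 1)) (w i) (w (i + 1)) * (n * q δ 0 + m * q δ 1 - (n * w i 0 + m * w i 1)) =
        cr (w (i - 1)) (w i) (q δ) * (n * w (i + 1) 0 + m * w (i + 1) 1 - (n * w i 0 + m * w i 1)) +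
        cr (w i) (w (i + 1)) (q δ) * (n * w (i - 1) 0 + m * w (i - 1) 1 - (n * w i 0 + m * w i 1)) := by
      unfold cr; ring
    have e1 := mul_nonneg (show 0 ≤ - cr (w (i - 1)) (w i) (q δ) by linarith [hc.1])
      (sub_nonneg.2 (hi (i + 1)))
    have e2 := mul_nonneg (show 0 ≤ - cr (w i) (w (i + 1)) (q δ) by linarith [hc.2])
      (sub_nonneg.2 (hi (i - 1)))
    have e3 := mul_pos (neg_pos.2 hneg') (show 0 < n * q δ 0 + m * q δ 1 - (n * w i 0 + m * w i 1) by
      linarith)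
    linarith
  have := ((hball _ h1).1 hsec).2
  rw [hW] at this
  linarith [Real.pi_pos]

/-- A linear functional with equal values at `w u` and `w v` is not constant on the vertices, so up
to sign its maximum is attained away from both. Repeated use yields three corners of any simple
polygon. -/
lemma exists_corner_ne (u v : ZMod k) :
    ∃ i, i ≠ u ∧ i ≠ v ∧ 0 < cr (w (i - 1)) (w i) (w (i + 1)) := by
  obtain ⟨n, m, hnm, huv⟩ : ∃ n m : ℝ, 0 < n * n + m * m ∧
      n * w u 0 + m * w u 1 = n * w v 0 + m * w v 1 := by
    by_cases huv : u = v
    · exact ⟨1, 0, by norm_num, by rw [huv]⟩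
    · refine ⟨-(w v 1 - w u 1), w v 0 - w u 0, ?_, by ring⟩
      have := dt_self_pos (hw.injective.ne huv)
      unfold dt at this; linarith
  have key : ∃ n m : ℝ, 0 < n * n + m * m ∧ n * w u 0 + m * w u 1 = n * w v 0 + m * w v 1 ∧
      ∃ j, n * w u 0 + m * w u 1 < n * w j 0 + m * w j 1 := by
    by_contra hc
    push Not at hc
    have h1 := hc n m hnm huv
    have h2 := hc (-n) (-m) (by linarith) (by linarith)
    have h3 : ∀ j, n * w j 0 + m * w j 1 = n * w u 0 + m * w u 1 := fun j =>
      le_antisymm (h1 j) (by have := h2 j; linarith)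
    have e1 := h3 (u - 1)
    have e2 := h3 (u + 1)
    apply hcr u
    have a1 : n * cr (w (u - 1)) (w u) (w (u + 1)) = 0 := by
      unfold cr
      linear_combination (w (u + 1) 1 - w (u - 1) 1) * (- e1) + (w u 1 - w (u - 1) 1) * (e1 - e2)
    have a2 : m * cr (w (u - 1)) (w u) (w (u + 1)) = 0 := by
      unfold cr
      linear_combination (w u 0 - w (u - 1) 0) * (e2 - e1) - (w (u + 1) 0 - w (u - 1) 0) * (- e1)
    by_contra hne
    have b1 := (mul_eq_zero.1 a1).resolve_right hne
    have b2 := (mul_eq_zero.1 a2).resolve_right hne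
    rw [b1, b2] at hnm; simp at hnm
  obtain ⟨n, m, hnm, huv, j, hj⟩ := key
  obtain ⟨i, hi⟩ := Finite.exists_max fun j : ZMod k => n * w j 0 + m * w j 1
  refine ⟨i, ?_, ?_, corner_of_extreme hw hcr hpos hnm hi⟩
  · rintro rfl; exact absurd (hi j) (not_le.2 hj)
  · rintro rfl; exact absurd (hi j) (not_le.2 (huv ▸ hj))

end pos
end polygon
end PseudoTriang
namespace PseudoTriang

/-! ### Cycles of a graph -/

section cycles
variable {V : Type*} {G : SimpleGraph V}

structure IsCyc (G : SimpleGraph V) {k : ℕ} (c : ZMod k → V) : Prop where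
  three_le : 3 ≤ k
  injective : Function.Injective c
  adj : ∀ i, G.Adj (c i) (c (i + 1))

/-- A cycle parametrized by natural numbers. -/
structure IsLoop (G : SimpleGraph V) (k : ℕ) (f : ℕ → V) : Prop where
  three_le : 3 ≤ k
  closed : f k = f 0
  inj : ∀ m n, m < k → n < k → f m = f n → m = n
  adj : ∀ n < k, G.Adj (f n) (f (n + 1))

/-- `x, y, z` are consecutive on the cycle. -/
def Turn {k : ℕ} (c : ZMod k → V) (x y z : V) : Prop :=
  ∃ h, c (h - 1) = x ∧ c h = y ∧ c (h + 1) = z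

/-- `uv` is an edge of the cycle. -/
def CycEdge {k : ℕ} (c : ZMod k → V) (u v : V) : Prop :=
  ∃ h, (u = c h ∧ v = c (h + 1)) ∨ (v = c h ∧ u = c (h + 1))

lemma CycEdge.symm {k : ℕ} {c : ZMod k → V} {u v : V} (h : CycEdge c u v) : CycEdge c v u := by
  obtain ⟨h, h'⟩ := h
  exact ⟨h, h'.symm⟩

/-- The cycle given by a loop. -/
def loopCyc (k : ℕ) (f : ℕ → V) : ZMod k → V := fun i => f i.val

section loop
variable {k : ℕ} [NeZero k] {f : ℕ → V}

lemma val_add_one_cases (i : ZMod k) (hk : 1 < k) :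
    (i.val + 1 < k ∧ (i + 1).val = i.val + 1) ∨ (i.val + 1 = k ∧ (i + 1).val = 0) := by
  have h1 : (1 : ZMod k).val = 1 := by
    have : Fact (1 < k) := ⟨hk⟩
    exact ZMod.val_one k
  have := ZMod.val_lt i
  have h2 := ZMod.val_add i 1
  rw [h1] at h2
  rcases Nat.lt_or_ge (i.val + 1) k with h | h
  · left; exact ⟨h, by rw [h2, Nat.mod_eq_of_lt h]⟩
  · right
    have : i.val + 1 = k := by omega
    exact ⟨this, by rw [h2, this, Nat.mod_self]⟩

variable (hf : IsLoop G k f)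
include hf

lemma IsLoop.apply_add_one (i : ZMod k) : loopCyc k f (i + 1) = f (i.val + 1) := by
  have := hf.three_le
  unfold loopCyc
  rcases val_add_one_cases i (by omega) with ⟨-, h⟩ | ⟨h, h'⟩
  · rw [h]
  · rw [h, h', hf.closed]

lemma IsLoop.isCyc : IsCyc G (loopCyc k f) := by
  refine ⟨hf.three_le, ?_, ?_⟩
  · intro i j h
    exact ZMod.val_injective k (hf.inj _ _ (ZMod.val_lt _) (ZMod.val_lt _) h)
  · intro i
    rw [hf.apply_add_one]
    exact hf.adj _ (ZMod.val_lt _)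

omit [NeZero k] hf in
lemma loopCyc_natCast {n : ℕ} (hn : n < k) : loopCyc k f (n : ZMod k) = f n := by
  unfold loopCyc; rw [ZMod.val_natCast_of_lt hn]

lemma IsLoop.sum_eq {M : Type*} [AddCommMonoid M] (F : V → V → M) :
    ∑ i, F (loopCyc k f i) (loopCyc k f (i + 1)) = ∑ n ∈ Finset.range k, F (f n) (f (n + 1)) := by
  refine Finset.sum_bij (fun i _ => i.val) (fun i _ => Finset.mem_range.2 (ZMod.val_lt i))
    (fun i _ j _ h => ZMod.val_injective k h)
    (fun n hn => ⟨(n : ZMod k), Finset.mem_univ _, ZMod.val_natCast_of_lt (Finset.mem_range.1 hn)⟩) ?_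
  intro i _
  rw [hf.apply_add_one]; rfl

lemma IsLoop.cycEdge_iff {u v : V} : CycEdge (loopCyc k f) u v ↔
    ∃ n < k, (u = f n ∧ v = f (n + 1)) ∨ (v = f n ∧ u = f (n + 1)) := by
  constructor
  · rintro ⟨h, h'⟩
    rw [hf.apply_add_one] at h'
    exact ⟨h.val, ZMod.val_lt h, h'⟩
  · rintro ⟨n, hn, h⟩
    refine ⟨n, ?_⟩
    rwa [hf.apply_add_one, loopCyc_natCast hn, ZMod.val_natCast_of_lt hn]

lemma IsLoop.mem_range_iff {v : V} : v ∈ Set.range (loopCyc k f) ↔ ∃ n ≤ k, f n = v := by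
  constructor
  · rintro ⟨i, rfl⟩; exact ⟨i.val, (ZMod.val_lt i).le, rfl⟩
  · rintro ⟨n, hn, rfl⟩
    rcases hn.lt_or_eq with h | rfl
    · exact ⟨n, loopCyc_natCast h⟩
    · exact ⟨0, by rw [hf.closed]; unfold loopCyc; rw [ZMod.val_zero]⟩

lemma IsLoop.turn_iff {x y z : V} : Turn (loopCyc k f) x y z ↔
    (∃ n, n + 1 < k ∧ x = f n ∧ y = f (n + 1) ∧ z = f (n + 2)) ∨
      (x = f (k - 1) ∧ y = f 0 ∧ z = f 1) := by
  have hk := hf.three_le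
  constructor
  · rintro ⟨h, rfl, rfl, rfl⟩
    rw [hf.apply_add_one]
    have e : loopCyc k f h = f ((h - 1).val + 1) := by
      rw [← hf.apply_add_one, sub_add_cancel]
    rcases val_add_one_cases (h - 1) (by omega) with ⟨h1, h2⟩ | ⟨h1, h2⟩
    · left
      rw [sub_add_cancel] at h2
      exact ⟨(h - 1).val, h1, rfl, e, by rw [h2]⟩
    · right
      rw [sub_add_cancel] at h2
      refine ⟨?_, ?_, ?_⟩
      · unfold loopCyc; congr 1; omega
      · unfold loopCyc; rw [h2]
      · rw [h2]
  · rintro (⟨n, hn, rfl, rfl, rfl⟩ | ⟨rfl, rfl, rfl⟩)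
    · refine ⟨((n + 1 : ℕ) : ZMod k), ?_, loopCyc_natCast hn, ?_⟩
      · push_cast; rw [add_sub_cancel_right]; exact loopCyc_natCast (by omega)
      · rw [hf.apply_add_one, ZMod.val_natCast_of_lt hn]
    · refine ⟨0, ?_, by unfold loopCyc; rw [ZMod.val_zero], ?_⟩
      · have : (0 - 1 : ZMod k) = ((k - 1 : ℕ) : ZMod k) := by
          rw [Nat.cast_sub (by omega)]; simp
        rw [this]; exact loopCyc_natCast (by omega)
      · rw [hf.apply_add_one, ZMod.val_zero]

end loop

/-- A cycle as a loop starting at a given vertex. -/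
lemma IsCyc.isLoop {k : ℕ} [NeZero k] {c : ZMod k → V} (hc : IsCyc G c) (i : ZMod k) :
    IsLoop G k (fun n => c (i + n)) := by
  refine ⟨hc.three_le, by simp, fun m n hm hn h => ?_, fun n _ => ?_⟩
  · have := add_left_cancel (hc.injective h)
    have h' := congrArg ZMod.val this
    rwa [ZMod.val_natCast_of_lt hm, ZMod.val_natCast_of_lt hn] at h'
  · have := hc.adj (i + n)
    rw [Nat.cast_add, Nat.cast_one, ← add_assoc]; exact this

variable (p : V → Plane)

/-- One loop follows `f` up to position `a` and returns along `g`; the other follows `g` and then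
the rest of `f`. If `g` is a single edge it must be a chord, since otherwise one of the loops would
have only two vertices. -/
lemma exists_split_loop {k a l : ℕ} {f g : ℕ → V} (hf : IsLoop G k f) (ha0 : 0 < a) (hak : a < k)
    (hl : 0 < l) (g0 : g 0 = f 0) (gl : g l = f a) (ginj : ∀ m n, m ≤ l → n ≤ l → g m = g n → m = n)
    (gadj : ∀ n < l, G.Adj (g n) (g (n + 1)))
    (goff : ∀ n, 0 < n → n < l → ∀ h < k, g n ≠ f h) (hchord : l = 1 → 1 < a ∧ a + 1 < k) :
    ∃ f1 f2 : ℕ → V, IsLoop G (a + l) f1 ∧ IsLoop G (l + (k - a)) f2 ∧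
      (∀ n ≤ a, f1 n = f n) ∧ (∀ r ≤ l, f1 (a + r) = g (l - r)) ∧
      (∀ n ≤ l, f2 n = g n) ∧ (∀ r ≤ k - a, f2 (l + r) = f (a + r)) := by
  set f1 : ℕ → V := fun n => if n ≤ a then f n else g (l - (n - a)) with hf1
  set f2 : ℕ → V := fun n => if n ≤ l then g n else f (a + (n - l)) with hf2
  have e1 : ∀ n ≤ a, f1 n = f n := fun n hn => by simp [hf1, hn]
  have e2 : ∀ r ≤ l, f1 (a + r) = g (l - r) := by
    intro r hr
    rcases Nat.eq_zero_or_pos r with rfl | h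
    · simp [hf1, gl]
    · have : ¬ (a + r ≤ a) := by omega
      simp only [hf1, this, if_false]
      congr 1; omega
  have e3 : ∀ n ≤ l, f2 n = g n := fun n hn => by simp [hf2, hn]
  have e4 : ∀ r ≤ k - a, f2 (l + r) = f (a + r) := by
    intro r hr
    rcases Nat.eq_zero_or_pos r with rfl | h
    · simp [hf2, gl]
    · have : ¬ (l + r ≤ l) := by omega
      simp only [hf2, this, if_false]
      congr 1; omega
  have hk := hf.three_le
  refine ⟨f1, f2, ⟨?_, ?_, ?_, ?_⟩, ⟨?_, ?_, ?_, ?_⟩, e1, e2, e3, e4⟩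
  · by_cases h : l = 1
    · have := hchord h; omega
    · omega
  · rw [e2 l le_rfl, Nat.sub_self, e1 0 (by omega), g0]
  · intro m n hm hn h
    have cross : ∀ m r, m ≤ a → 0 < r → r < l → f1 m ≠ f1 (a + r) := by
      intro m r hm h0 h1 h
      rw [e1 m hm, e2 r h1.le] at h
      exact goff (l - r) (by omega) (by omega) m (by omega) h.symm
    rcases Nat.lt_or_ge a m with h1 | h1 <;> rcases Nat.lt_or_ge a n with h2 | h2
    · obtain ⟨r, rfl⟩ := Nat.exists_eq_add_of_lt h1
      obtain ⟨s, rfl⟩ := Nat.exists_eq_add_of_lt h2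
      rw [add_assoc, add_assoc, e2 _ (by omega), e2 _ (by omega)] at h
      have := ginj _ _ (by omega) (by omega) h
      omega
    · obtain ⟨r, rfl⟩ := Nat.exists_eq_add_of_lt h1
      exact absurd h.symm (cross n (r + 1) h2 (by omega) (by omega))
    · obtain ⟨r, rfl⟩ := Nat.exists_eq_add_of_lt h2
      exact absurd h (cross m (r + 1) h1 (by omega) (by omega))
    · rw [e1 m h1, e1 n h2] at h
      exact hf.inj _ _ (by omega) (by omega) h
  · intro n hn
    rcases Nat.lt_or_ge n a with h | h
    · rw [e1 n h.le, e1 (n + 1) h]; exact hf.adj n (by omega)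
    · obtain ⟨r, rfl⟩ := Nat.exists_eq_add_of_le h
      rw [add_assoc, e2 r (by omega), e2 (r + 1) (by omega)]
      have := gadj (l - (r + 1)) (by omega)
      rw [show l - (r + 1) + 1 = l - r by omega] at this
      exact this.symm
  · by_cases h : l = 1
    · have := hchord h; omega
    · omega
  · rw [e4 _ le_rfl, show a + (k - a) = k by omega, hf.closed, e3 0 (by omega), g0]
  · intro m n hm hn h
    have cross : ∀ m r, m ≤ l → 0 < r → r < k - a → f2 m ≠ f2 (l + r) := by
      clear h hm
      intro m r hm h0 h1 h
      rw [e3 m hm, e4 r h1.le] at h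
      rcases Nat.eq_zero_or_pos m with rfl | hm0
      · rw [g0] at h
        have := hf.inj _ _ (by omega) (by omega) h; omega
      · rcases hm.lt_or_eq with hm | hml
        · exact goff m hm0 hm _ (by omega) h
        · rw [hml, gl] at h
          have := hf.inj _ _ (by omega) (by omega) h; omega
    rcases Nat.lt_or_ge l m with h1 | h1 <;> rcases Nat.lt_or_ge l n with h2 | h2
    · obtain ⟨r, rfl⟩ := Nat.exists_eq_add_of_lt h1
      obtain ⟨s, rfl⟩ := Nat.exists_eq_add_of_lt h2
      rw [add_assoc, add_assoc, e4 _ (by omega), e4 _ (by omega)] at h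
      have := hf.inj _ _ (by omega) (by omega) h
      omega
    · obtain ⟨r, rfl⟩ := Nat.exists_eq_add_of_lt h1
      exact absurd h.symm (cross n (r + 1) h2 (by omega) (by omega))
    · obtain ⟨r, rfl⟩ := Nat.exists_eq_add_of_lt h2
      exact absurd h (cross m (r + 1) h1 (by omega) (by omega))
    · rw [e3 m h1, e3 n h2] at h
      exact ginj _ _ h1 h2 h
  · intro n hn
    rcases Nat.lt_or_ge n l with h | h
    · rw [e3 n h.le, e3 (n + 1) h]; exact gadj n h
    · obtain ⟨r, rfl⟩ := Nat.exists_eq_add_of_le h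
      rw [add_assoc, e4 r (by omega), e4 (r + 1) (by omega)]
      exact hf.adj (a + r) (by omega)

/-- The two cycles into which a path `g` between two vertices `c i` and `c j` splits a cycle. -/
structure IsSplit (G : SimpleGraph V) {k k1 k2 : ℕ} [NeZero k] [NeZero k1] [NeZero k2] (c : ZMod k → V)
    (i j : ZMod k) (l : ℕ) (g : ℕ → V) (c1 : ZMod k1 → V) (c2 : ZMod k2 → V) : Prop where
  cyc1 : IsCyc G c1
  cyc2 : IsCyc G c2
  wind_eq : ∀ z, (∀ n < l, z ∉ segment ℝ (p (g n)) (p (g (n + 1)))) →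
    wind (fun i => p (c i)) z = wind (fun i => p (c1 i)) z + wind (fun i => p (c2 i)) z
  range_sub : ∀ h, c h ∈ Set.range c1 ∨ c h ∈ Set.range c2
  path1 : ∀ n ≤ l, g n ∈ Set.range c1
  path2 : ∀ n ≤ l, g n ∈ Set.range c2
  edge1 : ∀ u v, CycEdge c1 u v → CycEdge c u v ∨ ∃ n < l, s(u, v) = s(g n, g (n + 1))
  edge2 : ∀ u v, CycEdge c2 u v → CycEdge c u v ∨ ∃ n < l, s(u, v) = s(g n, g (n + 1))
  pathEdge1 : ∀ n < l, CycEdge c1 (g n) (g (n + 1))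
  pathEdge2 : ∀ n < l, CycEdge c2 (g n) (g (n + 1))
  turn1 : ∀ x y z, Turn c1 x y z → Turn c x y z ∨ ∃ n ≤ l, y = g n
  turn2 : ∀ x y z, Turn c2 x y z → Turn c x y z ∨ ∃ n ≤ l, y = g n
  common : ∀ v, v ∈ Set.range c1 → v ∈ Set.range c2 → ∃ n ≤ l, v = g n
  first1 : Turn c1 (g 1) (c i) (c (i + 1))
  first2 : Turn c2 (c (i - 1)) (c i) (g 1)
  last1 : Turn c1 (c (j - 1)) (c j) (g (l - 1))
  last2 : Turn c2 (g (l - 1)) (c j) (c (j + 1))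

/-- Cutting the cycle open at `c i` reduces this to loops. The two new cycles run through the path
in opposite directions, so off the path its contributions to the winding numbers cancel. -/
lemma IsCyc.exists_split {k : ℕ} [NeZero k] {c : ZMod k → V} (hc : IsCyc G c) {i j : ZMod k}
    (hij : i ≠ j) {l : ℕ} {g : ℕ → V} (hl : 0 < l) (g0 : g 0 = c i) (gl : g l = c j)
    (ginj : ∀ m n, m ≤ l → n ≤ l → g m = g n → m = n)
    (gadj : ∀ n < l, G.Adj (g n) (g (n + 1)))
    (goff : ∀ n, 0 < n → n < l → ∀ h, g n ≠ c h) (hchord : l = 1 → ¬ CycEdge c (c i) (c j)) :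
    ∃ (k1 k2 : ℕ) (_ : NeZero k1) (_ : NeZero k2) (c1 : ZMod k1 → V) (c2 : ZMod k2 → V),
      IsSplit p G c i j l g c1 c2 := by
  set f : ℕ → V := fun n => c (i + n) with hfdef
  have hf : IsLoop G k f := hc.isLoop i
  have hk := hc.three_le
  set a := (j - i).val with hadef
  have haj : ((a : ℕ) : ZMod k) = j - i := ZMod.natCast_zmod_val _
  have hak : a < k := ZMod.val_lt _
  have ha0 : 0 < a := by
    rw [Nat.pos_iff_ne_zero, Ne, hadef, ZMod.val_eq_zero, sub_eq_zero]; exact hij.symm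
  have fa : f a = c j := by simp only [hfdef]; rw [haj, add_sub_cancel]
  have f0 : f 0 = c i := by simp [hfdef]
  have fk : f k = c i := by simp [hfdef]
  have fc : ∀ h, c h = f (h - i).val := by
    intro h; simp only [hfdef]; rw [ZMod.natCast_zmod_val, add_sub_cancel]
  obtain ⟨f1, f2, hf1, hf2, e1, e2, e3, e4⟩ := exists_split_loop hf ha0 hak hl (by rw [g0, f0])
    (by rw [gl, fa]) ginj gadj (fun n h1 h2 h _ => goff n h1 h2 _) (by
      intro h1
      have hE := hchord h1
      constructor
      · by_contra hcon
        have : a = 1 := by omega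
        apply hE
        rw [this, Nat.cast_one] at haj
        exact ⟨i, Or.inl ⟨rfl, by rw [haj]; congr 1; ring⟩⟩
      · by_contra hcon
        have : a + 1 = k := by omega
        apply hE
        refine ⟨j, Or.inr ⟨rfl, ?_⟩⟩
        have h2 : ((a + 1 : ℕ) : ZMod k) = 0 := by rw [this]; exact ZMod.natCast_self k
        push_cast at h2
        rw [haj] at h2
        congr 1; linear_combination -h2)
  have : NeZero (a + l) := ⟨by omega⟩
  have : NeZero (l + (k - a)) := ⟨by omega⟩
  have fturn : ∀ n, Turn c (f n) (f (n + 1)) (f (n + 2)) := fun n =>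
    ⟨i + (n + 1 : ℕ), by simp only [hfdef]; push_cast; congr 1; ring, rfl, by
      simp only [hfdef]; push_cast; congr 1; ring⟩
  have fedge : ∀ n, CycEdge c (f n) (f (n + 1)) := fun n =>
    ⟨i + n, Or.inl ⟨rfl, by simp only [hfdef]; push_cast; congr 1; ring⟩⟩
  refine ⟨a + l, l + (k - a), inferInstance, inferInstance, loopCyc _ f1, loopCyc _ f2,
    hf1.isCyc, hf2.isCyc, ?_, ?_, ?_, ?_, ?_, ?_, ?_, ?_, ?_, ?_, ?_, ?_, ?_, ?_, ?_⟩
  · intro z hz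
    have w0 : wind (fun i => p (c i)) z = ∑ n ∈ Finset.range k, ang z (p (f n)) (p (f (n + 1))) := by
      rw [← hf.sum_eq fun u v => ang z (p u) (p v)]
      unfold wind
      refine Fintype.sum_equiv (Equiv.subRight i) _ _ fun h => ?_
      have e : ∀ h, loopCyc k f (h - i) = c h := fun h => (fc h).symm
      simp only [Equiv.subRight_apply]
      rw [e, show h - i + 1 = (h + 1) - i by ring, e]
    have w1 : wind (fun i => p (loopCyc (a + l) f1 i)) z =
        ∑ n ∈ Finset.range (a + l), ang z (p (f1 n)) (p (f1 (n + 1))) :=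
      hf1.sum_eq fun u v => ang z (p u) (p v)
    have w2 : wind (fun i => p (loopCyc (l + (k - a)) f2 i)) z =
        ∑ n ∈ Finset.range (l + (k - a)), ang z (p (f2 n)) (p (f2 (n + 1))) :=
      hf2.sum_eq fun u v => ang z (p u) (p v)
    have hka : k = a + (k - a) := by omega
    rw [w0, w1, w2, hka, Finset.sum_range_add, Finset.sum_range_add, ← hka, Finset.sum_range_add]
    have s1 : ∑ n ∈ Finset.range a, ang z (p (f1 n)) (p (f1 (n + 1))) =
        ∑ n ∈ Finset.range a, ang z (p (f n)) (p (f (n + 1))) := by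
      refine Finset.sum_congr rfl fun n hn => ?_
      have := Finset.mem_range.1 hn
      rw [e1 n (by omega), e1 (n + 1) (by omega)]
    have s2 : ∑ r ∈ Finset.range l, ang z (p (f1 (a + r))) (p (f1 (a + r + 1))) =
        - ∑ n ∈ Finset.range l, ang z (p (g n)) (p (g (n + 1))) := by
      rw [← Finset.sum_range_reflect, ← Finset.sum_neg_distrib]
      refine Finset.sum_congr rfl fun n hn => ?_
      have := Finset.mem_range.1 hn
      rw [← ang_swap (hz n this), add_assoc, e2 _ (by omega), e2 _ (by omega)]
      congr 3 <;> omega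
    have s3 : ∑ n ∈ Finset.range l, ang z (p (f2 n)) (p (f2 (n + 1))) =
        ∑ n ∈ Finset.range l, ang z (p (g n)) (p (g (n + 1))) := by
      refine Finset.sum_congr rfl fun n hn => ?_
      have := Finset.mem_range.1 hn
      rw [e3 n (by omega), e3 (n + 1) (by omega)]
    have s4 : ∑ r ∈ Finset.range (k - a), ang z (p (f2 (l + r))) (p (f2 (l + r + 1))) =
        ∑ r ∈ Finset.range (k - a), ang z (p (f (a + r))) (p (f (a + r + 1))) := by
      refine Finset.sum_congr rfl fun n hn => ?_
      have := Finset.mem_range.1 hn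
      rw [add_assoc, e4 n (by omega), e4 (n + 1) (by omega)]; rfl
    rw [s1, s2, s3, s4]; ring
  · intro h
    rw [hf1.mem_range_iff, hf2.mem_range_iff, fc h]
    have := ZMod.val_lt (h - i)
    rcases Nat.le_total (h - i).val a with h1 | h1
    · left; exact ⟨_, by omega, e1 _ h1⟩
    · right; exact ⟨l + ((h - i).val - a), by omega, by rw [e4 _ (by omega)]; congr 1; omega⟩
  · intro n hn
    rw [hf1.mem_range_iff]
    exact ⟨a + (l - n), by omega, by rw [e2 _ (by omega)]; congr 1; omega⟩
  · intro n hn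
    rw [hf2.mem_range_iff]
    exact ⟨n, by omega, e3 n hn⟩
  · intro u v huv
    rw [hf1.cycEdge_iff] at huv
    obtain ⟨n, hn, h⟩ := huv
    rcases Nat.lt_or_ge n a with hna | hna
    · left
      rw [e1 n hna.le, e1 (n + 1) hna] at h
      rcases h with ⟨rfl, rfl⟩ | ⟨rfl, rfl⟩
      · exact fedge n
      · exact (fedge n).symm
    · right
      obtain ⟨r, rfl⟩ := Nat.exists_eq_add_of_le hna
      rw [add_assoc, e2 r (by omega), e2 (r + 1) (by omega)] at h
      refine ⟨l - (r + 1), by omega, ?_⟩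
      rw [show l - (r + 1) + 1 = l - r by omega]
      rcases h with ⟨rfl, rfl⟩ | ⟨rfl, rfl⟩
      · exact Sym2.eq_swap
      · rfl
  · intro u v huv
    rw [hf2.cycEdge_iff] at huv
    obtain ⟨n, hn, h⟩ := huv
    rcases Nat.lt_or_ge n l with hna | hna
    · right
      rw [e3 n hna.le, e3 (n + 1) hna] at h
      refine ⟨n, hna, ?_⟩
      rcases h with ⟨rfl, rfl⟩ | ⟨rfl, rfl⟩
      · rfl
      · exact Sym2.eq_swap
    · left
      obtain ⟨r, rfl⟩ := Nat.exists_eq_add_of_le hna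
      rw [add_assoc, e4 r (by omega), e4 (r + 1) (by omega)] at h
      rcases h with ⟨rfl, rfl⟩ | ⟨rfl, rfl⟩
      · exact fedge (a + r)
      · exact (fedge (a + r)).symm
  · intro n hn
    rw [hf1.cycEdge_iff]
    refine ⟨a + (l - (n + 1)), by omega, Or.inr ⟨?_, ?_⟩⟩
    · rw [e2 _ (by omega)]; congr 1; omega
    · rw [add_assoc, e2 _ (by omega)]; congr 1; omega
  · intro n hn
    rw [hf2.cycEdge_iff]
    exact ⟨n, by omega, Or.inl ⟨(e3 n hn.le).symm, (e3 (n + 1) hn).symm⟩⟩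
  · intro x y z h
    rw [hf1.turn_iff] at h
    rcases h with ⟨n, hn, rfl, rfl, rfl⟩ | ⟨rfl, rfl, rfl⟩
    · rcases Nat.lt_or_ge (n + 1) a with hna | hna
      · left
        rw [e1 n (by omega), e1 (n + 1) hna.le, e1 (n + 2) (by omega)]
        exact fturn n
      · right
        refine ⟨l - (n + 1 - a), by omega, ?_⟩
        rw [← e2 _ (by omega)]; congr 1; omega
    · right; exact ⟨0, by omega, by rw [e1 0 (by omega), g0, f0]⟩
  · intro x y z h
    rw [hf2.turn_iff] at h
    rcases h with ⟨n, hn, rfl, rfl, rfl⟩ | ⟨rfl, rfl, rfl⟩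
    · rcases Nat.lt_or_ge l (n + 1) with hna | hna
      · left
        obtain ⟨r, rfl⟩ : ∃ r, n = l + r := ⟨n - l, by omega⟩
        rw [add_assoc l r 1, add_assoc l r 2, e4 r (by omega), e4 (r + 1) (by omega),
          e4 (r + 2) (by omega)]
        exact fturn (a + r)
      · right
        exact ⟨n + 1, hna, e3 _ hna⟩
    · right; exact ⟨0, by omega, by rw [e3 0 (by omega)]⟩
  · intro v h1 h2
    rw [hf1.mem_range_iff] at h1
    obtain ⟨n, hn, rfl⟩ := h1
    rcases Nat.lt_or_ge n a with hna | hna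
    · rw [hf2.mem_range_iff] at h2
      obtain ⟨m, hm, h⟩ := h2
      rcases Nat.lt_or_ge l m with hml | hml
      · obtain ⟨r, rfl⟩ := Nat.exists_eq_add_of_lt hml
        rw [add_assoc, e4 _ (by omega), e1 n hna.le] at h
        have hr : a + (r + 1) = k := by
          by_contra hne
          have := hf.inj _ _ (by omega) (by omega) h
          omega
        refine ⟨0, by omega, ?_⟩
        rw [e1 n hna.le, ← h, hr, g0, fk]
      · exact ⟨m, hml, by rw [← h, e3 m hml]⟩
    · exact ⟨l - (n - a), by omega, by rw [← e2 _ (by omega)]; congr 1; omega⟩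
  · rw [hf1.turn_iff]; right
    refine ⟨?_, ?_, ?_⟩
    · rw [show a + l - 1 = a + (l - 1) by omega, e2 _ (by omega)]; congr 1; omega
    · rw [e1 0 (by omega), f0]
    · rw [e1 1 (by omega)]; simp [hfdef]
  · rw [hf2.turn_iff]; right
    refine ⟨?_, ?_, ?_⟩
    · rw [show l + (k - a) - 1 = l + (k - a - 1) by omega, e4 _ (by omega)]
      simp only [hfdef]
      rw [show a + (k - a - 1) = k - 1 by omega, Nat.cast_sub (by omega)]
      simp [sub_eq_add_neg]
    · rw [e3 0 (by omega), g0]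
    · rw [e3 1 (by omega)]
  · rw [hf1.turn_iff]; left
    refine ⟨a - 1, by omega, ?_, ?_, ?_⟩
    · rw [e1 _ (by omega)]
      simp only [hfdef]
      rw [Nat.cast_sub (by omega), haj]
      congr 1; push_cast; ring
    · rw [show a - 1 + 1 = a by omega, e1 _ le_rfl, fa]
    · rw [show a - 1 + 2 = a + 1 by omega, e2 _ (by omega)]
  · rw [hf2.turn_iff]; left
    refine ⟨l - 1, by omega, ?_, ?_, ?_⟩
    · rw [e3 _ (by omega)]
    · rw [show l - 1 + 1 = l by omega, e3 _ le_rfl, gl]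
    · rw [show l - 1 + 2 = l + 1 by omega, e4 _ (by omega)]
      simp only [hfdef]
      push_cast; rw [haj]; congr 1; ring

end cycles
end PseudoTriang
namespace PseudoTriang

/-! ### Polygons of cycles in a non-crossing graph. -/

section
variable {V : Type*} {p : V → Plane} {T : SimpleGraph V} {k : ℕ} {c : ZMod k → V}

/-- The polygon of a cycle. -/
def poly (p : V → Plane) (c : ZMod k → V) : ZMod k → Plane := fun i => p (c i)

lemma IsCyc.ne_add_one {G : SimpleGraph V} (hc : IsCyc G c) (i : ZMod k) : c i ≠ c (i + 1) :=
  (hc.adj i).ne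

lemma IsCyc.sub_ne_add {G : SimpleGraph V} (hc : IsCyc G c) (i : ZMod k) : c (i - 1) ≠ c (i + 1) := by
  intro h
  have h1 := hc.injective h
  have h2 : ((2 : ℕ) : ZMod k) = 0 := by push_cast; linear_combination -h1
  rw [ZMod.natCast_eq_zero_iff] at h2
  have := Nat.le_of_dvd (by norm_num) h2
  have := hc.three_le
  omega

lemma IsCyc.adj_sub {G : SimpleGraph V} (hc : IsCyc G c) (i : ZMod k) : G.Adj (c i) (c (i - 1)) := by
  have := hc.adj (i - 1)
  rw [sub_add_cancel] at this
  exact this.symm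

lemma IsCyc.not_cycEdge {G : SimpleGraph V} (hc : IsCyc G c) {i : ZMod k} {v : V}
    (h1 : v ≠ c (i + 1)) (h2 : v ≠ c (i - 1)) : ¬ CycEdge c (c i) v := by
  rintro ⟨h, ⟨e1, e2⟩ | ⟨e1, e2⟩⟩
  · rw [hc.injective e1] at h1; exact h1 e2
  · rw [hc.injective e2, add_sub_cancel_right] at h2; exact h2 e1

lemma beside_zero_comm (a b : Plane) : beside a b 0 = beside b a 0 := by
  apply Plane.ext <;> simp [beside] <;> ring

lemma beside_zero_mem_segment (a b : Plane) : beside a b 0 ∈ segment ℝ a b :=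
  mem_segment_iff_lineMap.2 ⟨1 / 2, by norm_num, by norm_num, beside_zero_mem _ _⟩

lemma beside_zero_ne {a b : Plane} (h : a ≠ b) : beside a b 0 ≠ a ∧ beside a b 0 ≠ b := by
  rw [beside_zero_mem]
  constructor <;> intro h'
  · have := (AffineMap.lineMap_injective ℝ h) (a₁ := 1 / 2) (a₂ := 0) (by
      rw [h', AffineMap.lineMap_apply_zero])
    norm_num at this
  · have := (AffineMap.lineMap_injective ℝ h) (a₁ := 1 / 2) (a₂ := 1) (by
      rw [h', AffineMap.lineMap_apply_one])
    norm_num at this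

lemma mem_drawing {G : SimpleGraph V} {z : Plane} : z ∈ drawing p G ↔
    (∃ v, p v = z) ∨ ∃ i j, G.Adj i j ∧ z ∈ segment ℝ (p i) (p j) := by
  simp [drawing]

variable [Finite V] (hp : Function.Injective p) (hgp : GeneralPosition p) (hT : IsNonCrossing p T)

include hgp in
lemma beside_zero_ne_vertex {u v : V} (hp : Function.Injective p) (huv : u ≠ v) (w : V) :
    beside (p u) (p v) 0 ≠ p w := by
  intro h
  have hm := beside_zero_mem_segment (p u) (p v)
  have hn := beside_zero_ne (hp.ne huv)
  rw [h] at hm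
  rcases hgp.eq_of_mem_segment huv hm with rfl | rfl
  · exact hn.1 h
  · exact hn.2 h

include hp hgp hT in
-- Near the midpoint of an edge the drawing consists of that edge only, since the other edges and
-- the vertices form a closed set that misses it.
lemma eventually_beside_notMem_drawing {u v : V} (huv : T.Adj u v) :
    ∀ᶠ δ in 𝓝[>] (0 : ℝ), beside (p u) (p v) δ ∉ drawing p T ∧ beside (p u) (p v) (-δ) ∉ drawing p T := by
  set E : Set (V × V) := {e | T.Adj e.1 e.2 ∧ s(e.1, e.2) ≠ s(u, v)} with hE
  have hF : IsClosed (Set.range p ∪ ⋃ e ∈ E, segment ℝ (p e.1) (p e.2)) :=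
    (Set.finite_range p).isClosed.union
      (Set.Finite.isClosed_biUnion (Set.toFinite _) fun _ _ => isClosed_segment _ _)
  have hm : beside (p u) (p v) 0 ∈ (Set.range p ∪ ⋃ e ∈ E, segment ℝ (p e.1) (p e.2))ᶜ := by
    rintro (⟨w, hw⟩ | h)
    · exact beside_zero_ne_vertex hgp hp huv.ne w hw.symm
    · simp only [Set.mem_iUnion] at h
      obtain ⟨e, ⟨he1, he2⟩, h⟩ := h
      apply he2
      rcases edge_unique hgp hT huv he1 (beside_zero_mem_segment _ _) h
        (beside_zero_ne_vertex hgp hp huv.ne) with ⟨h1, h2⟩ | ⟨h1, h2⟩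
      · rw [h1, h2]
      · rw [h1, h2]; exact Sym2.eq_swap
  have key : ∀ z, z ∈ (Set.range p ∪ ⋃ e ∈ E, segment ℝ (p e.1) (p e.2))ᶜ → cr (p u) (p v) z ≠ 0 →
      z ∉ drawing p T := by
    intro z hz hcr hd
    rcases mem_drawing.1 hd with ⟨w, rfl⟩ | ⟨i, j, hij, hs⟩
    · exact hz (Or.inl ⟨w, rfl⟩)
    · by_cases h : s(i, j) = s(u, v)
      · rw [Sym2.eq_iff] at h
        rcases h with ⟨rfl, rfl⟩ | ⟨rfl, rfl⟩
        · exact hcr (cr_eq_zero_of_mem_segment hs)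
        · rw [segment_symm] at hs; exact hcr (cr_eq_zero_of_mem_segment hs)
      · exact hz (Or.inr (Set.mem_biUnion (show (i, j) ∈ E from ⟨hij, h⟩) hs))
  have hN := dt_self_pos (hp.ne huv.ne)
  have hn := hF.isOpen_compl.mem_nhds hm
  filter_upwards [(tendsto_beside _ _).eventually hn, (tendsto_beside_neg _ _).eventually hn,
    self_mem_nhdsWithin] with δ h1 h2 h3
  have := mul_pos h3 hN
  refine ⟨key _ h1 ?_, key _ h2 ?_⟩
  · rw [cr_beside]; exact this.ne'
  · rw [cr_beside]; linarith

section cyc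
variable (hc : IsCyc T c)
include hp hgp hT hc

omit [Finite V] hT in
lemma IsCyc.cr_ne (i : ZMod k) : cr (poly p c (i - 1)) (poly p c i) (poly p c (i + 1)) ≠ 0 :=
  hgp.cr_ne (hc.adj_sub i).ne' (hc.sub_ne_add i) (hc.ne_add_one i)

omit [Finite V] in
lemma IsCyc.isSimplePolygon : IsSimplePolygon (poly p c) := by
  refine ⟨hc.three_le, fun i j h => hc.injective (hp h), ?_, ?_⟩
  · intro i
    apply Set.Subset.antisymm
    · rintro z ⟨h1, h2⟩
      obtain ⟨t, ht0, ht1, rfl⟩ := mem_segment_iff_lineMap.1 h2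
      have h0 := cr_eq_zero_of_mem_segment h1
      rw [cr_lineMap, cr_self_right, mul_zero, zero_add] at h0
      have := hc.cr_ne hp hgp (i + 1)
      rw [add_sub_cancel_right] at this
      rw [(mul_eq_zero.1 h0).resolve_right this, AffineMap.lineMap_apply_zero]
      rfl
    · rintro z rfl
      exact ⟨right_mem_segment _ _ _, left_mem_segment _ _ _⟩
  · intro i j h1 h2 h3
    refine hT _ _ _ _ (hc.adj i) (hc.adj j) ?_ ?_ ?_ ?_ <;> intro h <;> have h := hc.injective h
    · exact h1 h
    · exact h3 h
    · exact h2 h.symm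
    · exact h1 (add_right_cancel h)

omit hp [Finite V] hT in
lemma IsCyc.vertex_mem_boundary_iff {v : V} (hp : Function.Injective p) :
    p v ∈ polygonBoundary (poly p c) ↔ v ∈ Set.range c := by
  rw [mem_boundary]
  constructor
  · rintro ⟨i, hi⟩
    rcases hgp.eq_of_mem_segment (hc.ne_add_one i) hi with rfl | rfl
    · exact ⟨_, rfl⟩
    · exact ⟨_, rfl⟩
  · rintro ⟨i, rfl⟩; exact ⟨i, left_mem_segment _ _ _⟩

omit hp hgp hT [Finite V] in
lemma IsCyc.boundary_subset_drawing : polygonBoundary (poly p c) ⊆ drawing p T := by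
  intro z hz
  obtain ⟨i, hi⟩ := mem_boundary.1 hz
  exact mem_drawing.2 (Or.inr ⟨_, _, hc.adj i, hi⟩)

omit hp [Finite V] in
lemma IsCyc.eq_of_mem_boundary (hp : Function.Injective p) {u v : V} (huv : T.Adj u v) (hE : ¬ CycEdge c u v) {s : Plane}
    (hs : s ∈ segment ℝ (p u) (p v)) (hB : s ∈ polygonBoundary (poly p c)) : s = p u ∨ s = p v := by
  by_cases hv : ∃ w, s = p w
  · obtain ⟨w, rfl⟩ := hv
    rcases hgp.eq_of_mem_segment huv.ne hs with rfl | rfl <;> simp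
  · push Not at hv
    obtain ⟨i, hi⟩ := mem_boundary.1 hB
    exfalso
    apply hE
    rcases edge_unique hgp hT (hc.adj i) huv hi hs hv with ⟨rfl, rfl⟩ | ⟨rfl, rfl⟩
    · exact ⟨i, Or.inl ⟨rfl, rfl⟩⟩
    · exact ⟨i, Or.inr ⟨rfl, rfl⟩⟩

variable [NeZero k]

omit hp [Finite V] in
-- An edge that is not on the cycle meets it at most in its own ends, so its interior stays on one
-- side. This is why testing an edge at its midpoint suffices.
lemma IsCyc.wind_segment (hp : Function.Injective p) {u v : V} (huv : T.Adj u v) (hE : ¬ CycEdge c u v) {s s' : Plane}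
    (hs : s ∈ segment ℝ (p u) (p v)) (hB : s ∉ polygonBoundary (poly p c))
    (hs' : s' ∈ segment ℝ (p u) (p v)) (hB' : s' ∉ polygonBoundary (poly p c)) :
    wind (poly p c) s = wind (poly p c) s' := by
  refine wind_const (convex_segment s s').isPreconnected (fun x hx hxB => ?_)
    (left_mem_segment _ _ _) (right_mem_segment _ _ _)
  have hxuv := (convex_segment (p u) (p v)).segment_subset hs hs' hx
  obtain ⟨t, ht0, ht1, rfl⟩ := mem_segment_iff_lineMap.1 hs
  obtain ⟨t', ht0', ht1', rfl⟩ := mem_segment_iff_lineMap.1 hs'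
  obtain ⟨r, hr0, hr1, rfl⟩ := mem_segment_iff_lineMap.1 hx
  have hne := hp.ne huv.ne
  have e : (AffineMap.lineMap (AffineMap.lineMap (p u) (p v) t) (AffineMap.lineMap (p u) (p v) t') r : Plane) =
      AffineMap.lineMap (p u) (p v) ((1 - r) * t + r * t') := by
    apply Plane.ext <;> simp only [lineMap_coord] <;> ring
  have ends : ∀ q : ℝ, (q = 0 ∨ q = 1) → (1 - r) * t + r * t' = q → t = q ∨ t' = q := by
    intro q hq h
    by_contra hcon
    push Not at hcon
    rcases hq with rfl | rfl
    · have h1 : 0 < t := lt_of_le_of_ne ht0 hcon.1.symm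
      have h2 : 0 < t' := lt_of_le_of_ne ht0' hcon.2.symm
      rcases hr0.eq_or_lt with rfl | hr0
      · linarith
      · have := mul_pos hr0 h2
        have := mul_nonneg (sub_nonneg.2 hr1) h1.le
        linarith
    · have h1 : t < 1 := lt_of_le_of_ne ht1 hcon.1
      have h2 : t' < 1 := lt_of_le_of_ne ht1' hcon.2
      rcases hr0.eq_or_lt with rfl | hr0
      · linarith
      · have := mul_pos hr0 (sub_pos.2 h2)
        have := mul_nonneg (sub_nonneg.2 hr1) (sub_pos.2 h1).le
        linarith
  have hcase := hc.eq_of_mem_boundary hgp hT hp huv hE hxuv hxB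
  rw [e] at hxB hcase
  rcases hcase with h | h
  · have : (1 - r) * t + r * t' = 0 := (AffineMap.lineMap_injective ℝ hne) (by
      rw [h, AffineMap.lineMap_apply_zero])
    rw [this] at hxB
    rcases ends 0 (Or.inl rfl) this with rfl | rfl
    · exact hB hxB
    · exact hB' hxB
  · have : (1 - r) * t + r * t' = 1 := (AffineMap.lineMap_injective ℝ hne) (by
      rw [h, AffineMap.lineMap_apply_one])
    rw [this] at hxB
    rcases ends 1 (Or.inr rfl) this with rfl | rfl
    · exact hB hxB
    · exact hB' hxB

end cyc

/-- The edges of `T` that run inside the polygon of `c`. -/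
def innerGraph (p : V → Plane) (T : SimpleGraph V) [NeZero k] (c : ZMod k → V) : SimpleGraph V where
  Adj u v := T.Adj u v ∧ beside (p u) (p v) 0 ∈ inner (poly p c)
  symm := ⟨fun u v h => ⟨h.1.symm, by rw [beside_zero_comm]; exact h.2⟩⟩
  loopless := ⟨fun u h => h.1.ne rfl⟩

section inn
variable [NeZero k] (hc : IsCyc T c)

omit [Finite V] in
lemma innerGraph_not_cycEdge {u v : V} (h : (innerGraph p T c).Adj u v) : ¬ CycEdge c u v := by
  rintro ⟨i, ⟨rfl, rfl⟩ | ⟨rfl, rfl⟩⟩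
  · exact h.2.1 (mem_boundary.2 ⟨i, beside_zero_mem_segment _ _⟩)
  · refine h.2.1 (mem_boundary.2 ⟨i, ?_⟩)
    rw [beside_zero_comm]
    exact beside_zero_mem_segment _ _

include hp hgp hT hc

omit [Finite V] in
lemma IsCyc.beside_notMem {u v : V} (huv : T.Adj u v) (hE : ¬ CycEdge c u v) :
    beside (p u) (p v) 0 ∉ polygonBoundary (poly p c) := by
  intro h
  have hn := beside_zero_ne (hp.ne huv.ne)
  rcases hc.eq_of_mem_boundary hgp hT hp huv hE (beside_zero_mem_segment _ _) h with h | h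
  · exact hn.1 h
  · exact hn.2 h

omit [Finite V] in
/-- Off its endpoints on the cycle, an edge inside the cycle lies inside. -/
lemma IsCyc.mem_inner_of_adj {u v : V} (h : (innerGraph p T c).Adj u v) {s : Plane}
    (hs : s ∈ segment ℝ (p u) (p v)) (hB : s ∉ polygonBoundary (poly p c)) : s ∈ inner (poly p c) := by
  refine ⟨hB, ?_⟩
  rw [hc.wind_segment hgp hT hp h.1 (innerGraph_not_cycEdge h) hs hB (beside_zero_mem_segment _ _) h.2.1]
  exact h.2.2

omit [Finite V] in
lemma IsCyc.innerGraph_vertex {u v : V} (h : (innerGraph p T c).Adj u v) :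
    u ∈ Set.range c ∨ p u ∈ inner (poly p c) := by
  by_cases hu : u ∈ Set.range c
  · exact Or.inl hu
  · right
    refine hc.mem_inner_of_adj hp hgp hT h (left_mem_segment _ _ _) ?_
    rwa [hc.vertex_mem_boundary_iff hgp hp]

omit [Finite V] in
lemma IsCyc.innerGraph_adj_of_mem_inner {u v : V} (huv : T.Adj u v) (hu : p u ∈ inner (poly p c)) :
    (innerGraph p T c).Adj u v := by
  have hE : ¬ CycEdge c u v := by
    rintro ⟨i, ⟨rfl, -⟩ | ⟨-, rfl⟩⟩
    · exact hu.1 (vertex_mem_boundary (w := poly p c) i)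
    · exact hu.1 (vertex_mem_boundary (w := poly p c) (i + 1))
  have hB := hc.beside_notMem hp hgp hT huv hE
  refine ⟨huv, hB, ?_⟩
  rw [← hc.wind_segment hgp hT hp huv hE (left_mem_segment _ _ _) hu.1 (beside_zero_mem_segment _ _) hB]
  exact hu.2

omit [Finite V] in
/-- The edges inside a positively oriented cycle at a vertex of the cycle are those in its sector. -/
lemma IsCyc.innerGraph_adj_iff (hpos : (inner (poly p c)).Nonempty) {i : ZMod k} {v : V} (hv : T.Adj (c i) v)
    (h1 : v ≠ c (i + 1)) (h2 : v ≠ c (i - 1)) :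
    (innerGraph p T c).Adj (c i) v ↔
      ccwAngle (p (c i)) (p (c (i + 1))) (p v) < ccwAngle (p (c i)) (p (c (i + 1))) (p (c (i - 1))) := by
  have hw := hc.isSimplePolygon hp hgp hT
  have hcr := hc.cr_ne hp hgp
  have hE := hc.not_cycEdge h1 h2
  have hB := hc.beside_notMem hp hgp hT hv hE
  obtain ⟨ε, hε, hball⟩ := exists_ball_sec hw hcr hpos i
  have nb := (hc.adj i).ne'
  have na := (hc.adj_sub i).ne'
  have nv := hv.ne'
  -- a point of the edge near `c i`
  have hlim : Tendsto (fun s : ℝ => (AffineMap.lineMap (p (c i)) (p v) s : Plane)) (𝓝[>] 0) (𝓝 (p (c i))) := by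
    have : Tendsto (fun s : ℝ => (AffineMap.lineMap (p (c i)) (p v) s : Plane)) (𝓝 0)
        (𝓝 (AffineMap.lineMap (p (c i)) (p v) (0 : ℝ))) := AffineMap.lineMap_continuous.tendsto _
    rw [AffineMap.lineMap_apply_zero] at this
    exact this.mono_left nhdsWithin_le_nhds
  have hI : ∀ᶠ s in 𝓝[>] (0 : ℝ), s ∈ Set.Ioo (0 : ℝ) 1 := Ioo_mem_nhdsGT zero_lt_one
  obtain ⟨s, hs1, hs2⟩ := ((hlim.eventually (Metric.ball_mem_nhds _ hε)).and hI).exists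
  set z : Plane := AffineMap.lineMap (p (c i)) (p v) s with hz
  have hzs : z ∈ segment ℝ (p (c i)) (p v) := mem_segment_iff_lineMap.2 ⟨s, hs2.1.le, hs2.2.le, rfl⟩
  have hzB : z ∉ polygonBoundary (poly p c) := by
    intro h
    rcases hc.eq_of_mem_boundary hgp hT hp hv hE hzs h with h | h
    · have : s = 0 := (AffineMap.lineMap_injective ℝ (hp.ne hv.ne)) (by
        rw [← hz, h, AffineMap.lineMap_apply_zero])
      exact hs2.1.ne' this
    · have : s = 1 := (AffineMap.lineMap_injective ℝ (hp.ne hv.ne)) (by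
        rw [← hz, h, AffineMap.lineMap_apply_one])
      exact hs2.2.ne this
  have hwz := hc.wind_segment hgp hT hp hv hE hzs hzB (beside_zero_mem_segment _ _) hB
  have e1 : cr (p (c (i - 1))) (p (c i)) z = s * cr (p (c (i - 1))) (p (c i)) (p v) := by
    rw [hz, cr_lineMap, cr_self_right, mul_zero, zero_add]
  have e2 : cr (p (c i)) (p (c (i + 1))) z = s * cr (p (c i)) (p (c (i + 1))) (p v) := by
    rw [hz, cr_lineMap, cr_self_mid, mul_zero, zero_add]
  have n1 : cr (p (c (i - 1))) (p (c i)) (p v) ≠ 0 := hgp.cr_ne na h2.symm nv.symm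
  have n2 : cr (p (c i)) (p (c (i + 1))) (p v) ≠ 0 := hgp.cr_ne nb.symm nv.symm h1.symm
  have l1 := ccwAngle_lt_pi_iff (hp.ne nb) (hp.ne nv)
  have l2 := ccwAngle_lt_pi_iff (hp.ne nv) (hp.ne na)
  have l3 := ccwAngle_lt_pi_iff (hp.ne nb) (hp.ne na)
  rw [show cr (p (c i)) (p v) (p (c (i - 1))) = cr (p (c (i - 1))) (p (c i)) (p v) by unfold cr; ring] at l2
  rw [show cr (p (c i)) (p (c (i + 1))) (p (c (i - 1))) = cr (p (c (i - 1))) (p (c i)) (p (c (i + 1))) by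
    unfold cr; ring] at l3
  have t3 := ccwAngle_lt_two_pi hp hgp nb na (hc.sub_ne_add i).symm
  have t0 := ccwAngle_pos (p (c i)) (p v) (p (c (i - 1)))
  have t1 := ccwAngle_pos (p (c i)) (p (c (i + 1))) (p (c (i - 1)))
  have t2 := ccwAngle_le (p (c i)) (p v) (p (c (i - 1)))
  have hpi3 := ccwAngle_ne_pi hp hgp nb na
  have hadd := ccwAngle_add (p (c i)) (p (c (i + 1))) (p v) (p (c (i - 1)))
  constructor
  · intro h
    by_contra hge
    have hsum : ccwAngle (p (c i)) (p (c (i + 1))) (p v) + ccwAngle (p (c i)) (p v) (p (c (i - 1))) =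
        ccwAngle (p (c i)) (p (c (i + 1))) (p (c (i - 1))) + 2 * Real.pi := by
      rcases hadd with h | h <;> linarith
    have hsec : z ∈ Sec (-1) (p (c (i - 1))) (p (c i)) (p (c (i + 1))) := by
      rcases lt_or_gt_of_ne hpi3 with hlt | hgt
      · refine Or.inr ⟨by linarith [l3.1 hlt], ?_⟩
        have : Real.pi < ccwAngle (p (c i)) (p (c (i + 1))) (p v) ∨
            Real.pi < ccwAngle (p (c i)) (p v) (p (c (i - 1))) := by
          by_contra hcon; push Not at hcon; linarith [hcon.1, hcon.2]
        rcases this with h' | h'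
        · right
          have : ¬ 0 < cr (p (c i)) (p (c (i + 1))) (p v) := fun h => by linarith [l1.2 h]
          have := lt_of_le_of_ne (not_lt.1 this) n2
          rw [e2]; have := mul_pos hs2.1 (neg_pos.2 this); linarith
        · left
          have : ¬ 0 < cr (p (c (i - 1))) (p (c i)) (p v) := fun h => by linarith [l2.2 h]
          have := lt_of_le_of_ne (not_lt.1 this) n1
          rw [e1]; have := mul_pos hs2.1 (neg_pos.2 this); linarith
      · have u2 := ccwAngle_le (p (c i)) (p (c (i + 1))) (p v)
        have a1 : ¬ 0 < cr (p (c i)) (p (c (i + 1))) (p v) := fun h => by linarith [l1.2 h]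
        have a2 : ¬ 0 < cr (p (c (i - 1))) (p (c i)) (p v) := fun h => by linarith [l2.2 h]
        have b1 := lt_of_le_of_ne (not_lt.1 a1) n2
        have b2 := lt_of_le_of_ne (not_lt.1 a2) n1
        refine Or.inl ⟨?_, ?_⟩
        · rw [e1]; have := mul_pos hs2.1 (neg_pos.2 b2); linarith
        · rw [e2]; have := mul_pos hs2.1 (neg_pos.2 b1); linarith
    have := ((hball z hs1).2 hsec).2
    rw [hwz, h.2.2] at this
    linarith [Real.pi_pos]
  · intro hlt
    have hsum : ccwAngle (p (c i)) (p (c (i + 1))) (p v) + ccwAngle (p (c i)) (p v) (p (c (i - 1))) =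
        ccwAngle (p (c i)) (p (c (i + 1))) (p (c (i - 1))) := by
      rcases hadd with h | h <;> linarith
    have u1 := ccwAngle_pos (p (c i)) (p (c (i + 1))) (p v)
    have hsec : z ∈ Sec 1 (p (c (i - 1))) (p (c i)) (p (c (i + 1))) := by
      rcases lt_or_gt_of_ne hpi3 with hlt' | hgt
      · refine Or.inl ⟨?_, ?_⟩
        · rw [e1, one_mul]; exact mul_pos hs2.1 (l2.1 (by linarith))
        · rw [e2, one_mul]; exact mul_pos hs2.1 (l1.1 (by linarith))
      · have hneg : cr (p (c (i - 1))) (p (c i)) (p (c (i + 1))) < 0 := by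
          refine lt_of_le_of_ne (not_lt.1 fun h => ?_) (hcr i)
          linarith [l3.2 h]
        refine Or.inr ⟨by linarith, ?_⟩
        have : ccwAngle (p (c i)) (p (c (i + 1))) (p v) < Real.pi ∨
            ccwAngle (p (c i)) (p v) (p (c (i - 1))) < Real.pi := by
          by_contra hcon; push Not at hcon; linarith [hcon.1, hcon.2]
        rcases this with h' | h'
        · right; rw [e2, one_mul]; exact mul_pos hs2.1 (l1.1 h')
        · left; rw [e1, one_mul]; exact mul_pos hs2.1 (l2.1 h')
    have := ((hball z hs1).1 hsec).2
    exact ⟨hv, hB, by rw [← hwz, this]⟩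

end inn
end
end PseudoTriang
namespace PseudoTriang

/-! ### Splitting a cycle along an inner path. -/

section split
variable {V : Type*} {p : V → Plane} {T : SimpleGraph V} {k k1 k2 : ℕ} [NeZero k] [NeZero k1] [NeZero k2]
  {c : ZMod k → V} {c1 : ZMod k1 → V} {c2 : ZMod k2 → V} {i j : ZMod k} {l : ℕ} {g : ℕ → V}

/-- Reversing the path exchanges the two cycles, so properties need to be proved for the first one
only. -/
lemma IsSplit.symm (hl : 0 < l) (hs : IsSplit p T c i j l g c1 c2) : IsSplit p T c j i l (fun n => g (l - n)) c2 c1 where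
  cyc1 := hs.cyc2
  cyc2 := hs.cyc1
  wind_eq z hz := by
    rw [add_comm]
    refine hs.wind_eq z fun n hn => ?_
    have := hz (l - (n + 1)) (by omega)
    rw [show l - (l - (n + 1)) = n + 1 by omega, show l - (l - (n + 1) + 1) = n by omega,
      segment_symm] at this
    exact this
  range_sub h := (hs.range_sub h).symm
  path1 n _ := hs.path2 _ (by omega)
  path2 n _ := hs.path1 _ (by omega)
  edge1 u v h := by
    refine (hs.edge2 u v h).imp_right ?_
    rintro ⟨n, hn, h⟩
    refine ⟨l - (n + 1), by omega, ?_⟩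
    rw [show l - (l - (n + 1)) = n + 1 by omega, show l - (l - (n + 1) + 1) = n by omega, h]
    exact Sym2.eq_swap
  edge2 u v h := by
    refine (hs.edge1 u v h).imp_right ?_
    rintro ⟨n, hn, h⟩
    refine ⟨l - (n + 1), by omega, ?_⟩
    rw [show l - (l - (n + 1)) = n + 1 by omega, show l - (l - (n + 1) + 1) = n by omega, h]
    exact Sym2.eq_swap
  pathEdge1 n hn := by
    have := (hs.pathEdge2 (l - (n + 1)) (by omega)).symm
    rwa [show l - (n + 1) + 1 = l - n by omega] at this
  pathEdge2 n hn := by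
    have := (hs.pathEdge1 (l - (n + 1)) (by omega)).symm
    rwa [show l - (n + 1) + 1 = l - n by omega] at this
  turn1 x y z h := by
    refine (hs.turn2 x y z h).imp_right ?_
    rintro ⟨n, hn, h⟩
    exact ⟨l - n, by omega, by rw [h]; congr 1; omega⟩
  turn2 x y z h := by
    refine (hs.turn1 x y z h).imp_right ?_
    rintro ⟨n, hn, h⟩
    exact ⟨l - n, by omega, by rw [h]; congr 1; omega⟩
  common v h1 h2 := by
    obtain ⟨n, hn, h⟩ := hs.common v h2 h1
    exact ⟨l - n, by omega, by rw [h]; congr 1; omega⟩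
  first1 := hs.last2
  first2 := hs.last1
  last1 := by rw [show l - (l - 1) = 1 by omega]; exact hs.first2
  last2 := by rw [show l - (l - 1) = 1 by omega]; exact hs.first1

variable [Finite V] (hp : Function.Injective p) (hgp : GeneralPosition p) (hT : IsNonCrossing p T)
  (hc : IsCyc T c) (hpos : (inner (poly p c)).Nonempty) (hs : IsSplit p T c i j l g c1 c2)
  (hl : 0 < l) (hpath : ∀ n < l, (innerGraph p T c).Adj (g n) (g (n + 1)))
include hp hgp hT hc hs

omit hp hgp hT hc [Finite V] in
lemma IsSplit.wind_eq_of_notMem_drawing {z : Plane} (hz : z ∉ drawing p T)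
    (hpath : ∀ n < l, (innerGraph p T c).Adj (g n) (g (n + 1))) :
    wind (poly p c) z = wind (poly p c1) z + wind (poly p c2) z :=
  hs.wind_eq z fun n hn h => hz (mem_drawing.2 (Or.inr ⟨_, _, (hpath n hn).1, h⟩))

include hpos hl hpath

/-- Otherwise the first cycle has winding numbers at most zero. Close to an edge of the path, on
both of its sides, the total is `2π`, so the second cycle would have winding number at least `2π` on
both sides, although it jumps by `2π` there and never exceeds that value. -/
lemma IsSplit.inner_nonempty : (inner (poly p c1)).Nonempty := by
  by_contra hne
  have hw1 := hs.cyc1.isSimplePolygon hp hgp hT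
  have hcr1 := hs.cyc1.cr_ne hp hgp
  have hw2 := hs.cyc2.isSimplePolygon hp hgp hT
  have hcr2 := hs.cyc2.cr_ne hp hgp
  have hpi := Real.pi_pos
  have hle1 : ∀ z ∉ polygonBoundary (poly p c1), wind (poly p c1) z ≤ 0 := by
    intro z hz
    rcases wind_values hw1 hcr1 with h | ⟨-, h⟩
    · rcases h z hz with h | h
      · exact h.le
      · exact absurd ⟨z, hz, h⟩ hne
    · rcases h z hz with h | h <;> linarith
  have hle2 : ∀ z ∉ polygonBoundary (poly p c2), wind (poly p c2) z ≤ 2 * Real.pi := by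
    intro z hz
    rcases wind_values hw2 hcr2 with h | ⟨-, h⟩ <;> rcases h z hz with h | h <;> linarith
  obtain ⟨h, hh⟩ : ∃ h, beside (poly p c2 h) (poly p c2 (h + 1)) 0 ∈ inner (poly p c) := by
    obtain ⟨h, ⟨h1, h2⟩ | ⟨h1, h2⟩⟩ := hs.pathEdge2 0 hl
    · refine ⟨h, ?_⟩
      have := (hpath 0 hl).2
      rwa [h1, h2] at this
    · refine ⟨h, ?_⟩
      have := (hpath 0 hl).2
      rwa [h1, h2, beside_zero_comm] at this
  have hopen := (isOpen_inner (hc.isSimplePolygon hp hgp hT) (hc.cr_ne hp hgp) hpos).mem_nhds hh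
  obtain ⟨δ, ⟨⟨h1, h2⟩, h3, h4⟩, h5⟩ := ((((tendsto_beside _ _).eventually hopen).and
    ((tendsto_beside_neg _ _).eventually hopen)).and
    (eventually_beside_notMem_drawing hp hgp hT (hs.cyc2.adj h)) |>.and (hw2.wind_jump hcr2 h)).exists
  have e1 := hs.wind_eq_of_notMem_drawing h3 hpath
  have e2 := hs.wind_eq_of_notMem_drawing h4 hpath
  have w1 := h1.2
  have w2 := h2.2
  simp only [poly] at *
  rw [w1] at e1
  rw [w2] at e2
  have a1 := hle1 _ fun h => h3 (hs.cyc1.boundary_subset_drawing h)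
  have a2 := hle1 _ fun h => h4 (hs.cyc1.boundary_subset_drawing h)
  have a3 := hle2 _ fun h => h3 (hs.cyc2.boundary_subset_drawing h)
  linarith

omit hl hc hpos hpath [Finite V] in
lemma IsSplit.mem_inner_or {z : Plane} (hz : z ∈ inner (poly p c))
    (h1 : (inner (poly p c1)).Nonempty)
    (hz1 : z ∉ polygonBoundary (poly p c1)) (hz2 : z ∉ polygonBoundary (poly p c2))
    (hzp : ∀ n < l, z ∉ segment ℝ (p (g n)) (p (g (n + 1)))) :
    z ∈ inner (poly p c1) ∨ z ∈ inner (poly p c2) := by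
  have e := hs.wind_eq z hzp
  have e0 : wind (fun i => p (c i)) z = 2 * Real.pi := hz.2
  rw [e0] at e
  have hpi := Real.pi_pos
  rcases wind_eq_zero_or (hs.cyc1.isSimplePolygon hp hgp hT) (hs.cyc1.cr_ne hp hgp) h1 hz1 with h | h
  · right
    refine ⟨hz2, ?_⟩
    have h : wind (fun i => p (c1 i)) z = 0 := h
    rw [h, zero_add] at e
    exact e.symm
  · exact Or.inl ⟨hz1, h⟩

/-- Makes the dissection terminate. Off the drawing, winding number `2π` for `c1` forces `2π` for
`c`; this excludes edges of `c` from the inside of `c1`, because `c` has different winding numbers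
on the two sides of its edges. The inclusion is strict since the path runs inside `c` but on `c1`.
-/
lemma IsSplit.innerGraph_lt (h1 : (inner (poly p c1)).Nonempty) (h2 : (inner (poly p c2)).Nonempty) :
    innerGraph p T c1 < innerGraph p T c := by
  have hw := hc.isSimplePolygon hp hgp hT
  have hcr := hc.cr_ne hp hgp
  have hw1 := hs.cyc1.isSimplePolygon hp hgp hT
  have hcr1 := hs.cyc1.cr_ne hp hgp
  have hw2 := hs.cyc2.isSimplePolygon hp hgp hT
  have hcr2 := hs.cyc2.cr_ne hp hgp
  have hpi := Real.pi_pos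
  have hedge : ∀ u v, (innerGraph p T c1).Adj u v → ¬ CycEdge c u v := by
    rintro u v huv ⟨h, hh⟩
    have hmid : beside (poly p c h) (poly p c (h + 1)) 0 ∈ inner (poly p c1) := by
      have := huv.2
      rcases hh with ⟨rfl, rfl⟩ | ⟨rfl, rfl⟩
      · exact this
      · rwa [beside_zero_comm] at this
    have hopen := (isOpen_inner hw1 hcr1 h1).mem_nhds hmid
    obtain ⟨δ, ⟨⟨b1, b2⟩, b3, b4⟩, b5⟩ := ((((tendsto_beside _ _).eventually hopen).and
      ((tendsto_beside_neg _ _).eventually hopen)).and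
      (eventually_beside_notMem_drawing hp hgp hT (hc.adj h)) |>.and (hw.wind_jump hcr h)).exists
    have key : ∀ z, z ∉ drawing p T → z ∈ inner (poly p c1) → wind (poly p c) z = 2 * Real.pi := by
      intro z hz hzi
      have e := hs.wind_eq_of_notMem_drawing hz hpath
      rw [hzi.2] at e
      rcases wind_eq_zero_or hw2 hcr2 h2 (fun h => hz (hs.cyc2.boundary_subset_drawing h)) with h | h <;>
      rcases wind_eq_zero_or hw hcr hpos (fun h => hz (hc.boundary_subset_drawing h)) with h' | h' <;>
      linarith
    have w1 := key _ b3 b1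
    have w2 := key _ b4 b2
    simp only [poly] at *
    linarith
  refine lt_of_le_of_ne ?_ ?_
  · intro u v huv
    have hE1 := innerGraph_not_cycEdge huv
    have hE := hedge u v huv
    have hpne : ∀ n < l, s(u, v) ≠ s(g n, g (n + 1)) := by
      intro n hn h
      apply hE1
      rw [Sym2.eq_iff] at h
      rcases h with ⟨rfl, rfl⟩ | ⟨rfl, rfl⟩
      · exact hs.pathEdge1 n hn
      · exact (hs.pathEdge1 n hn).symm
    have hE2 : ¬ CycEdge c2 u v := by
      intro h
      rcases hs.edge2 u v h with h | ⟨n, hn, h⟩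
      · exact hE h
      · exact hpne n hn h
    have hB := hc.beside_notMem hp hgp hT huv.1 hE
    have hB2 := hs.cyc2.beside_notMem hp hgp hT huv.1 hE2
    refine ⟨huv.1, hB, ?_⟩
    have e : wind (poly p c) (beside (p u) (p v) 0) = wind (poly p c1) (beside (p u) (p v) 0) +
        wind (poly p c2) (beside (p u) (p v) 0) := hs.wind_eq (beside (p u) (p v) 0) (by
      intro n hn h
      apply hpne n hn
      rcases edge_unique hgp hT (hpath n hn).1 huv.1 h (beside_zero_mem_segment _ _)
        (beside_zero_ne_vertex hgp hp huv.1.ne) with ⟨a, b⟩ | ⟨a, b⟩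
      · rw [a, b]
      · rw [a, b]; exact Sym2.eq_swap)
    have e1 := huv.2.2
    have e2 := wind_eq_zero_or hw2 hcr2 h2 hB2
    have e3 := wind_eq_zero_or hw hcr hpos hB
    rcases e2 with e2 | e2 <;> rcases e3 with e3 | e3 <;> linarith
  · intro h
    have h3 := hpath 0 hl
    rw [← h] at h3
    exact innerGraph_not_cycEdge h3 (hs.pathEdge1 0 hl)

end split
end PseudoTriang
namespace PseudoTriang

/-! ### Cycles whose vertices are not joined inside. -/

section unsplit
variable {V : Type*} {p : V → Plane} {T : SimpleGraph V} {k : ℕ} {c : ZMod k → V}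

lemma before_of_min {v b a : V} (hb : T.Adj v b)
    (ha : ∀ x, T.Adj v x → ccwAngle (p v) (p b) (p a) ≤ ccwAngle (p v) (p b) (p x)) :
    Before p T v b (p a) := by
  refine ⟨hb, fun x hx => ?_⟩
  have h1 := ha x hx
  have h2 := ccwAngle_le (p v) (p b) (p x)
  have h3 := ccwAngle_pos (p v) (p x) (p a)
  rcases ccwAngle_add (p v) (p b) (p x) (p a) with h | h <;> linarith

lemma exists_next [Finite V] {v b : V} (hb : T.Adj v b) : ∃ a, T.Adj v a ∧ Before p T v b (p a) ∧
    ∀ x, T.Adj v x → ccwAngle (p v) (p b) (p a) ≤ ccwAngle (p v) (p b) (p x) := by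
  obtain ⟨a, ha, hmin⟩ := Set.exists_min_image {x | T.Adj v x} (fun x => ccwAngle (p v) (p b) (p x))
    (Set.toFinite _) ⟨b, hb⟩
  exact ⟨a, ha, before_of_min hb hmin, hmin⟩

lemma exists_faceStep [Finite V] {d : V × V} (hd : T.Adj d.1 d.2) : ∃ e, FaceStep p T d e := by
  obtain ⟨a, ha, h, -⟩ := exists_next (p := p) hd
  exact ⟨(a, d.1), ha, h, rfl⟩

lemma FaceStep.injective (hp : Function.Injective p) (hgp : GeneralPosition p) {d d' e : V × V}
    (h : FaceStep p T d e) (h' : FaceStep p T d' e) : d = d' := by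
  obtain ⟨h1, h2, h3⟩ := h
  obtain ⟨h1', h2', h3'⟩ := h'
  have h := h3.symm.trans h3'
  refine Prod.ext h (h2.unique hp hgp ?_)
  rwa [h]

lemma convexDart_of_lt [Finite V] {v b x : V} (hb : T.Adj v b) (hx : T.Adj v x)
    (h : ccwAngle (p v) (p b) (p x) < Real.pi) : ConvexDart p T (v, b) := by
  obtain ⟨a, ha, h1, h2⟩ := exists_next (p := p) hb
  exact ⟨a, ha, h1, (h2 x hx).trans_lt h⟩

variable [Finite V] [NeZero k] (hp : Function.Injective p) (hgp : GeneralPosition p) (hT : IsNonCrossing p T)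
  (hc : IsCyc T c) (hpos : (inner (poly p c)).Nonempty)
  {e : ZMod k → V} (he : ∀ i, Before p T (c i) (e i) (p (c (i - 1))))

include hp hgp hT hc hpos

omit [Finite V] in
-- Counterclockwise around `c i`, the edge to `c (i + 1)` is followed by the inner edges and then by
-- the edge to `c (i - 1)`; the successor of a member of this list other than the last is again a
-- member.
lemma IsCyc.next_mem {i : ZMod k} {b x : V} (hb : b = c (i + 1) ∨ (innerGraph p T c).Adj (c i) b)
    (hx : T.Adj (c i) x) (h : Before p T (c i) b (p x)) :
    x = c (i - 1) ∨ (innerGraph p T c).Adj (c i) x := by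
  by_contra hcon
  push Not at hcon
  obtain ⟨hx1, hx2⟩ := hcon
  have hm := hc.adj_sub i
  have hle : ccwAngle (p (c i)) (p (c (i + 1))) (p (c (i - 1))) ≤
      ccwAngle (p (c i)) (p (c (i + 1))) (p x) := by
    by_cases hxp : x = c (i + 1)
    · rw [hxp, ccwAngle_self]; exact ccwAngle_le _ _ _
    · rw [hc.innerGraph_adj_iff hp hgp hT hpos hx hxp hx1] at hx2
      exact not_lt.1 hx2
  have h1 := h.2 _ hm
  have h2 := ccwAngle_lt_two_pi hp hgp hm.ne' hx.ne' (Ne.symm hx1)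
  have h3 := ccwAngle_pos (p (c i)) (p (c (i + 1))) (p (c (i - 1)))
  have h4 := ccwAngle_le (p (c i)) (p b) (p x)
  have h5 : b = c (i + 1) ∨ ccwAngle (p (c i)) (p (c (i + 1))) (p b) <
      ccwAngle (p (c i)) (p (c (i + 1))) (p (c (i - 1))) := by
    refine hb.imp_right fun hb => ?_
    refine (hc.innerGraph_adj_iff hp hgp hT hpos hb.1 ?_ ?_).1 hb
    · rintro rfl; exact innerGraph_not_cycEdge hb ⟨i, Or.inl ⟨rfl, rfl⟩⟩
    · rintro rfl; exact innerGraph_not_cycEdge hb ⟨i - 1, Or.inr ⟨rfl, by simp⟩⟩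
  rcases h5 with rfl | h5
  · rcases ccwAngle_add (p (c i)) (p (c (i + 1))) (p (c (i - 1))) (p x) with h | h <;> linarith
  · rcases ccwAngle_add (p (c i)) (p (c (i + 1))) (p (c (i - 1))) (p x) with h | h <;>
    rcases ccwAngle_add (p (c i)) (p (c (i + 1))) (p b) (p x) with h' | h' <;> linarith

omit [Finite V] in
lemma IsCyc.prev_mem {i : ZMod k} {b x : V} (hx : x = c (i - 1) ∨ (innerGraph p T c).Adj (c i) x)
    (h : Before p T (c i) b (p x)) : b = c (i + 1) ∨ (innerGraph p T c).Adj (c i) b := by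
  by_contra hcon
  push Not at hcon
  obtain ⟨hb1, hb2⟩ := hcon
  have hle : ccwAngle (p (c i)) (p (c (i + 1))) (p (c (i - 1))) ≤
      ccwAngle (p (c i)) (p (c (i + 1))) (p b) := by
    by_cases hbm : b = c (i - 1)
    · rw [hbm]
    · rw [hc.innerGraph_adj_iff hp hgp hT hpos h.1 hb1 hbm] at hb2
      exact not_lt.1 hb2
  have h5 : ccwAngle (p (c i)) (p (c (i + 1))) (p x) ≤
      ccwAngle (p (c i)) (p (c (i + 1))) (p (c (i - 1))) := by
    rcases hx with rfl | hx
    · rfl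
    · refine ((hc.innerGraph_adj_iff hp hgp hT hpos hx.1 ?_ ?_).1 hx).le
      · rintro rfl; exact innerGraph_not_cycEdge hx ⟨i, Or.inl ⟨rfl, rfl⟩⟩
      · rintro rfl; exact innerGraph_not_cycEdge hx ⟨i - 1, Or.inr ⟨rfl, by simp⟩⟩
  have h1 := h.2 _ (hc.adj i)
  have h2 := ccwAngle_lt_two_pi hp hgp (hc.adj i).ne' h.1.ne' (Ne.symm hb1)
  have h3 := ccwAngle_pos (p (c i)) (p b) (p x)
  rcases ccwAngle_add (p (c i)) (p (c (i + 1))) (p b) (p x) with h | h <;> linarith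

/-- The darts whose sectors lie inside the cycle at the vertices that are connected inside the
cycle to its vertex `c i`. -/
def zone (p : V → Plane) (T : SimpleGraph V) (c : ZMod k → V) (i : ZMod k) : Set (V × V) :=
  {d | T.Adj d.1 d.2 ∧ (innerGraph p T c).Reachable (c i) d.1 ∧
    (d.1 = c i → d.2 = c (i + 1) ∨ (innerGraph p T c).Adj d.1 d.2)}

omit [Finite V] hp hgp hT hpos in
lemma IsCyc.fst_mem_zone (i : ZMod k) : (c i, c (i + 1)) ∈ zone p T c i :=
  ⟨hc.adj i, SimpleGraph.Reachable.refl _, fun _ => Or.inl rfl⟩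

omit [Finite V] in
include he in
lemma IsCyc.last_mem_zone (i : ZMod k) : (c i, e i) ∈ zone p T c i :=
  ⟨(he i).1, SimpleGraph.Reachable.refl _, fun _ => hc.prev_mem hp hgp hT hpos (Or.inl rfl) (he i)⟩

variable (hun : ∀ i j, (innerGraph p T c).Reachable (c i) (c j) → i = j)
include hun

omit [Finite V] hpos in
lemma IsCyc.eq_or_mem_inner {i : ZMod k} {v : V} (h : (innerGraph p T c).Reachable (c i) v) :
    v = c i ∨ p v ∈ inner (poly p c) := by
  by_cases hv : v = c i
  · exact Or.inl hv
  right
  obtain ⟨w⟩ := h.symm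
  cases w with
  | nil => exact absurd rfl hv
  | cons ha _ =>
    rcases hc.innerGraph_vertex hp hgp hT ha with ⟨j, rfl⟩ | h'
    · exact absurd (by rw [hun _ _ h]) hv
    · exact h'

include he

omit [Finite V] in
-- Since `hun` forbids reaching another cycle vertex through the inside, the boundary walk leaves
-- the zone only from its last sector, along the cycle edge to `c (i - 1)`. The walk thus runs
-- through the zones in decreasing order of indices.
lemma IsCyc.zone_step {i : ZMod k} {d f : V × V} (hd : d ∈ zone p T c i) (h : FaceStep p T d f) :
    f ∈ zone p T c i ∨ (d = (c i, e i) ∧ f = (c (i - 1), c (i - 1 + 1))) := by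
  obtain ⟨d1, d2⟩ := d
  obtain ⟨f1, f2⟩ := f
  obtain ⟨hd1, hd2, hd3⟩ := hd
  obtain ⟨h1, h2, h3⟩ := h
  simp only at hd1 hd2 hd3 h1 h2 h3
  subst h3
  rcases hc.eq_or_mem_inner hp hgp hT hun hd2 with rfl | hin
  · rcases hc.next_mem hp hgp hT hpos (hd3 rfl) h1 h2 with rfl | h4
    · right
      simp only [sub_add_cancel, and_true]
      rw [h2.unique hp hgp (he i)]
    · exact Or.inl ⟨h1.symm, h4.reachable, fun h => Or.inr h4.symm⟩
  · have h4 := hc.innerGraph_adj_of_mem_inner hp hgp hT h1 hin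
    exact Or.inl ⟨h1.symm, hd2.trans h4.reachable, fun _ => Or.inr h4.symm⟩

omit [Finite V] in
lemma IsCyc.zone_step_back {i : ZMod k} {d f : V × V} (hf : f ∈ zone p T c i) (h : FaceStep p T d f) :
    d ∈ zone p T c i ∨ (f = (c i, c (i + 1)) ∧ d = (c (i + 1), e (i + 1))) := by
  obtain ⟨d1, d2⟩ := d
  obtain ⟨f1, f2⟩ := f
  obtain ⟨hf1, hf2, hf3⟩ := hf
  obtain ⟨h1, h2, h3⟩ := h
  simp only at hf1 hf2 hf3 h1 h2 h3
  subst h3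
  rcases hc.eq_or_mem_inner hp hgp hT hun hf2 with rfl | hin
  · rcases hf3 rfl with rfl | h4
    · right
      have := he (i + 1)
      rw [add_sub_cancel_right] at this
      rw [h2.unique hp hgp this]
      exact ⟨rfl, rfl⟩
    · exact Or.inl ⟨h2.1, hf2.trans h4.reachable, fun h => absurd h h1.ne⟩
  · have h4 := hc.innerGraph_adj_of_mem_inner hp hgp hT h1.symm hin
    refine Or.inl ⟨h2.1, hf2.trans h4.reachable, ?_⟩
    rintro (rfl : f2 = c i)
    exact hc.prev_mem hp hgp hT hpos (Or.inr h4.symm) h2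

/-- If the boundary walk entering a zone never reached its last sector, the face step would be an
injective self-map of a finite set of sectors of the zone. Being then surjective, it would give the
first sector a predecessor in the zone, but that predecessor lies at `c (i + 1)`. -/
lemma IsCyc.exists_sWalk (b i : ZMod k) :
    ∃ l, SWalk p T (c b, c (b + 1)) (c i, c (i + 1)) l := by
  set R : Set (V × V) := {d | ∃ l, SWalk p T (c b, c (b + 1)) d l} with hR
  have hRstep : ∀ d ∈ R, ∀ f, FaceStep p T d f → f ∈ R := by
    rintro d ⟨l, hl⟩ f hf
    exact ⟨_, hl.step (Or.inl (hf.rStep hT))⟩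
  have key : ∀ i, (c i, c (i + 1)) ∈ R → (c (i - 1), c (i - 1 + 1)) ∈ R := by
    intro i hi
    suffices h : (c i, e i) ∈ R by
      refine hRstep _ h _ ⟨hc.adj_sub i, he i, ?_⟩
      simp
    by_contra hE
    have hex : ∀ d : V × V, ∃ f, d ∈ R ∩ zone p T c i → FaceStep p T d f := by
      intro d
      by_cases hd : d ∈ R ∩ zone p T c i
      · obtain ⟨f, hf⟩ := exists_faceStep (p := p) hd.2.1
        exact ⟨f, fun _ => hf⟩
      · exact ⟨d, fun h => absurd h hd⟩
    choose φ hφ using hex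
    have hmaps : Set.MapsTo φ (R ∩ zone p T c i) (R ∩ zone p T c i) := by
      intro d hd
      refine ⟨hRstep d hd.1 _ (hφ d hd), ?_⟩
      rcases hc.zone_step hp hgp hT hpos he hun hd.2 (hφ d hd) with h | ⟨rfl, -⟩
      · exact h
      · exact absurd hd.1 hE
    have hinj : Set.InjOn φ (R ∩ zone p T c i) := by
      intro d hd d' hd' h
      have h1 := hφ d hd
      rw [h] at h1
      exact h1.injective hp hgp (hφ d' hd')
    have hsurj := ((Set.toFinite (R ∩ zone p T c i)).injOn_iff_bijOn_of_mapsTo hmaps).1 hinj |>.surjOn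
    obtain ⟨y, hy, hyD⟩ := hsurj ⟨hi, hc.fst_mem_zone i⟩
    have h1 := hφ y hy
    rw [hyD] at h1
    have h2 : y.1 = c (i + 1) := h1.2.2.symm
    have h3 := hy.2.2.1
    rw [h2] at h3
    have := hun _ _ h3
    have h4 := hc.ne_add_one i
    rw [← this] at h4
    exact h4 rfl
  have hall : ∀ n : ℕ, (c (b - n), c (b - n + 1)) ∈ R := by
    intro n
    induction n with
    | zero => rw [Nat.cast_zero, sub_zero]; exact ⟨0, SWalk.refl _⟩
    | succ n ih =>
      have := key _ ih
      rwa [show b - (n : ZMod k) - 1 = b - ((n + 1 : ℕ) : ZMod k) by push_cast; ring] at this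
  have := hall (b - i).val
  rw [ZMod.natCast_zmod_val, sub_sub_cancel] at this
  exact this

omit [NeZero k] hgp hT he hun hpos in
lemma IsCyc.convexDart_fst {i : ZMod k} (h : 0 < cr (poly p c (i - 1)) (poly p c i) (poly p c (i + 1))) :
    ConvexDart p T (c i, c (i + 1)) := by
  refine convexDart_of_lt (hc.adj i) (hc.adj_sub i) ?_
  rw [ccwAngle_lt_pi_iff (hp.ne (hc.adj i).ne') (hp.ne (hc.adj_sub i).ne'), cr_rot]
  exact h

omit [NeZero k] hp hgp hT [Finite V] hun hpos in
lemma IsCyc.convexDart_last_of_lt {i : ZMod k} {x : V} (hx : T.Adj (c i) x)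
    (h : ccwAngle (p (c i)) (p x) (p (c (i - 1))) < Real.pi) :
    ConvexDart p T (c i, e i) :=
  ⟨c (i - 1), hc.adj_sub i, he i, ((he i).2 x hx).trans_lt h⟩

omit [Finite V] hun hpos in
lemma IsCyc.convexDart_last {i : ZMod k} (h : 0 < cr (poly p c (i - 1)) (poly p c i) (poly p c (i + 1))) :
    ConvexDart p T (c i, e i) := by
  refine hc.convexDart_last_of_lt he (hc.adj i) ?_
  rw [ccwAngle_lt_pi_iff (hp.ne (hc.adj i).ne') (hp.ne (hc.adj_sub i).ne'), cr_rot]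
  exact h

variable (hiso : ∀ v, ∃ x, T.Adj v x)
    (hmax : ∀ x y, x ≠ y → FreeSeg p T x y →
      (IsPointed p T x → IsPointed p (T ⊔ SimpleGraph.edge x y) x) →
      (IsPointed p T y → IsPointed p (T ⊔ SimpleGraph.edge x y) y) → T.Adj x y)
include hiso hmax

/-- Combinatorial form of `no_convex_separation`, with `s` the first sector at the corner `b`. The
set `X` is the union of the zones over `N` without the first sectors over `A` and the last sectors
over `B`; these are convex because they lie in the angle of a corner, and `h1`, `h2` say that the
boundary walk leaves `X` only through convex sectors other than `s`. -/
lemma IsCyc.zone_separation {N A B : Set (ZMod k)} {b i0 : ZMod k} {t : V × V}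
    (hcor : 0 < cr (poly p c (b - 1)) (poly p c b) (poly p c (b + 1))) (hb : b ∉ N)
    (ht : ConvexDart p T t) (hi0 : i0 ∈ N)
    (ht0 : t = (c i0, c (i0 + 1)) ∨ t = (c i0, e i0))
    (htA : i0 ∈ A → t ≠ (c i0, c (i0 + 1))) (htB : i0 ∈ B → t ≠ (c i0, e i0))
    (hA : ∀ i ∈ A, 0 < cr (poly p c (i - 1)) (poly p c i) (poly p c (i + 1)))
    (hB : ∀ i ∈ B, 0 < cr (poly p c (i - 1)) (poly p c i) (poly p c (i + 1)))
    (h1 : ∀ i ∈ N, i ∉ A → i + 1 ∈ N)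
    (h2 : ∀ i ∈ N, i ∉ B → i - 1 ∈ N ∨
      (0 < cr (poly p c (i - 1 - 1)) (poly p c (i - 1)) (poly p c (i - 1 + 1)) ∧ i - 1 ≠ b)) : False := by
  set X : Set (V × V) := {d | ∃ i ∈ N, d ∈ zone p T c i ∧ (i ∈ A → d ≠ (c i, c (i + 1))) ∧
    (i ∈ B → d ≠ (c i, e i))} with hX
  have hne : ∀ i x, i ≠ b → (c i, x) ≠ (c b, c (b + 1)) := by
    intro i x hi h
    exact hi (hc.injective (congrArg Prod.fst h))
  have hNb : ∀ i ∈ N, i ≠ b := fun i hi h => hb (h ▸ hi)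
  have hmem : ∀ i ∈ N, ∀ d ∈ zone p T c i, d ∈ X ∨ (ConvexDart p T d ∧ d ≠ (c b, c (b + 1))) := by
    intro i hi d hd
    by_cases hdA : i ∈ A ∧ d = (c i, c (i + 1))
    · right
      rw [hdA.2]
      exact ⟨hc.convexDart_fst hp (hA i hdA.1), hne i _ (hNb i hi)⟩
    by_cases hdB : i ∈ B ∧ d = (c i, e i)
    · right
      rw [hdB.2]
      exact ⟨hc.convexDart_last hp hgp hT he (hB i hdB.1), hne i _ (hNb i hi)⟩
    exact Or.inl ⟨i, hi, hd, fun h h' => hdA ⟨h, h'⟩, fun h h' => hdB ⟨h, h'⟩⟩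
  obtain ⟨L, hL⟩ : ∃ l, SWalk p T (c b, c (b + 1)) t l := by
    rcases ht0 with rfl | rfl
    · exact hc.exists_sWalk hp hgp hT hpos he hun b i0
    · obtain ⟨l, hl⟩ := hc.exists_sWalk hp hgp hT hpos he hun b (i0 - 1)
      have hE : FaceStep p T (c i0, e i0) (c (i0 - 1), c (i0 - 1 + 1)) :=
        ⟨hc.adj_sub i0, he i0, by simp⟩
      exact ⟨_, hl.step (Or.inr (hE.rStep hT))⟩
  have ht1 : t ∈ zone p T c i0 := by
    rcases ht0 with rfl | rfl
    · exact hc.fst_mem_zone i0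
    · exact hc.last_mem_zone hp hgp hT hpos he i0
  refine no_convex_separation hp hgp hT hiso hmax (hc.convexDart_fst hp hcor) ht hL
    (X := X) ⟨i0, hi0, ht1, htA, htB⟩ ?_ ?_
  · rintro ⟨i, hi, hd, -⟩
    exact hNb i hi (hun _ _ hd.2.1)
  · rintro d ⟨i, hi, hd, hdA, hdB⟩ f (hf | hf)
    · rcases hc.zone_step hp hgp hT hpos he hun hd hf with h | ⟨rfl, rfl⟩
      · exact hmem i hi _ h
      · have hiB : i ∉ B := fun h => hdB h rfl
        rcases h2 i hi hiB with h | ⟨h, h'⟩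
        · exact hmem _ h _ (hc.fst_mem_zone _)
        · exact Or.inr ⟨hc.convexDart_fst hp h, hne _ _ h'⟩
    · rcases hc.zone_step_back hp hgp hT hpos he hun hd hf with h | ⟨rfl, rfl⟩
      · exact hmem i hi _ h
      · exact hmem _ (h1 i hi fun h => hdA h rfl) _ (hc.last_mem_zone hp hgp hT hpos he _)

omit he hp hgp hT hpos hun hiso hmax in
lemma IsCyc.exists_before_sub : ∃ e : ZMod k → V, ∀ i, Before p T (c i) (e i) (p (c (i - 1))) := by
  have : ∀ i, ∃ b, Before p T (c i) b (p (c (i - 1))) := fun i => exists_before ⟨_, hc.adj i⟩ _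
  exact Classical.axiom_of_choice this

/-- The convex sector at `o` and the one at `y` are separated by the corner `x` on one arc and by
the corner `z` on the other. Accordingly `N` is the arc from just after `z` through `o` to `x`. -/
lemma IsCyc.false_of_three_corners {o x y z : ZMod k} {t : V × V} (ht : ConvexDart p T t)
    (ht0 : t = (c o, c (o + 1)) ∨ t = (c o, e o))
    (hxo : x ≠ o) (hxy : (x - o).val < (y - o).val) (hyz : (y - o).val < (z - o).val)
    (hx : 0 < cr (poly p c (x - 1)) (poly p c x) (poly p c (x + 1)))
    (hy : 0 < cr (poly p c (y - 1)) (poly p c y) (poly p c (y + 1)))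
    (hz : 0 < cr (poly p c (z - 1)) (poly p c z) (poly p c (z + 1))) : False := by
  have hk := hc.three_le
  have h0 : (o - o).val = 0 := by simp
  have hinj : ∀ i j : ZMod k, (i - o).val = (j - o).val → i = j := fun i j h =>
    sub_left_injective (ZMod.val_injective k h)
  refine hc.zone_separation hp hgp hT hpos he hun hiso hmax
    (N := {i | (i - o).val ≤ (x - o).val ∨ (z - o).val < (i - o).val}) (A := {x}) (B := ∅) (b := y)
    (i0 := o) hy ?_ ht ?_ ht0 ?_ ?_ ?_ ?_ ?_ ?_
  · simp only [Set.mem_ofPred_eq]; omega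
  · simp only [Set.mem_ofPred_eq]; omega
  · intro h; exact absurd (Set.mem_singleton_iff.1 h).symm hxo
  · simp
  · rintro i rfl; exact hx
  · simp
  · intro i hi hne
    have hne : (i - o).val ≠ (x - o).val := fun h => hne (hinj _ _ h)
    have := val_add_one_cases (i - o) (by omega)
    rw [show i - o + 1 = i + 1 - o by ring] at this
    simp only [Set.mem_ofPred_eq] at hi ⊢
    omega
  · intro i hi _
    by_cases hiz : i - 1 = z
    · right
      rw [hiz]
      exact ⟨hz, fun h => by rw [h] at hyz; exact lt_irrefl _ hyz⟩
    left
    have hne : (i - 1 - o).val ≠ (z - o).val := fun h => hiz (hinj _ _ h)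
    have := val_add_one_cases (i - 1 - o) (by omega)
    rw [show i - 1 - o + 1 = i - o by ring] at this
    have hzk := ZMod.val_lt (z - o)
    simp only [Set.mem_ofPred_eq] at hi ⊢
    omega

lemma IsCyc.false_of_three_corners' {o x y z : ZMod k} {t : V × V} (ht : ConvexDart p T t)
    (ht0 : t = (c o, c (o + 1)) ∨ t = (c o, e o))
    (hxo : x ≠ o) (hyo : y ≠ o) (hzo : z ≠ o) (hxy : x ≠ y) (hxz : x ≠ z) (hyz : y ≠ z)
    (hx : 0 < cr (poly p c (x - 1)) (poly p c x) (poly p c (x + 1)))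
    (hy : 0 < cr (poly p c (y - 1)) (poly p c y) (poly p c (y + 1)))
    (hz : 0 < cr (poly p c (z - 1)) (poly p c z) (poly p c (z + 1))) : False := by
  have hinj : ∀ i j : ZMod k, i ≠ j → (i - o).val ≠ (j - o).val := fun i j h h' =>
    h (sub_left_injective (ZMod.val_injective k h'))
  have F := fun x y z => hc.false_of_three_corners hp hgp hT hpos he hun hiso hmax (o := o)
    (x := x) (y := y) (z := z) ht ht0
  rcases lt_or_gt_of_ne (hinj _ _ hxy) with h1 | h1 <;>
  rcases lt_or_gt_of_ne (hinj _ _ hxz) with h2 | h2 <;>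
  rcases lt_or_gt_of_ne (hinj _ _ hyz) with h3 | h3
  · exact F x y z hxo h1 h3 hx hy hz
  · exact F x z y hxo h2 h3 hx hz hy
  · exact lt_irrefl _ (h1.trans (h3.trans h2))
  · exact F z x y hzo h2 h1 hz hx hy
  · exact F y x z hyo h1 h2 hy hx hz
  · exact lt_irrefl _ (h1.trans (h2.trans h3))
  · exact F y z x hyo h3 h2 hy hz hx
  · exact F z y x hzo h3 h1 hz hy hx

/-- By `hDE` the first and the last sector at the corner `o` differ, and both are convex. So `o`
counts twice: its first sector is separated from that of `y` by its own last sector and by `x`. -/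
lemma IsCyc.false_of_corner_ne {o x y : ZMod k} (hDE : e o ≠ c (o + 1))
    (hxo : x ≠ o) (hxy : (x - o).val < (y - o).val)
    (ho : 0 < cr (poly p c (o - 1)) (poly p c o) (poly p c (o + 1)))
    (hx : 0 < cr (poly p c (x - 1)) (poly p c x) (poly p c (x + 1)))
    (hy : 0 < cr (poly p c (y - 1)) (poly p c y) (poly p c (y + 1))) : False := by
  have hk := hc.three_le
  have h0 : (o - o).val = 0 := by simp
  have hinj : ∀ i j : ZMod k, (i - o).val = (j - o).val → i = j := fun i j h =>
    sub_left_injective (ZMod.val_injective k h)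
  refine hc.zone_separation hp hgp hT hpos he hun hiso hmax
    (N := {i | (i - o).val ≤ (x - o).val}) (A := {x}) (B := {o}) (b := y)
    (i0 := o) hy ?_ (hc.convexDart_fst hp ho) ?_ (Or.inl rfl) ?_ ?_ ?_ ?_ ?_ ?_
  · simp only [Set.mem_ofPred_eq]; omega
  · simp only [Set.mem_ofPred_eq]; omega
  · intro h; exact absurd (Set.mem_singleton_iff.1 h).symm hxo
  · intro _ h; exact hDE (congrArg Prod.snd h).symm
  · rintro i rfl; exact hx
  · rintro i rfl; exact ho
  · intro i hi hne
    have hne : (i - o).val ≠ (x - o).val := fun h => hne (hinj _ _ h)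
    have := val_add_one_cases (i - o) (by omega)
    rw [show i - o + 1 = i + 1 - o by ring] at this
    simp only [Set.mem_ofPred_eq] at hi ⊢
    omega
  · intro i hi hne
    have hne : (i - o).val ≠ (o - o).val := fun h => hne (hinj _ _ h)
    left
    have := val_add_one_cases (i - 1 - o) (by omega)
    rw [show i - 1 - o + 1 = i - o by ring] at this
    simp only [Set.mem_ofPred_eq] at hi ⊢
    omega

omit he in
/-- If no two vertices of a cycle are connected inside it, nothing is attached to it from inside. -/
lemma IsCyc.not_innerGraph_adj (o : ZMod k) (v : V) : ¬ (innerGraph p T c).Adj (c o) v := by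
  intro hv
  have hw := hc.isSimplePolygon hp hgp hT
  have hcr := hc.cr_ne hp hgp
  obtain ⟨e, he⟩ := hc.exists_before_sub
  have hv1 : v ≠ c (o + 1) := by
    rintro rfl; exact innerGraph_not_cycEdge hv ⟨o, Or.inl ⟨rfl, rfl⟩⟩
  have hv2 : v ≠ c (o - 1) := by
    rintro rfl; exact innerGraph_not_cycEdge hv ⟨o - 1, Or.inr ⟨rfl, by simp⟩⟩
  have hlt := (hc.innerGraph_adj_iff hp hgp hT hpos hv.1 hv1 hv2).1 hv
  have h0 := ccwAngle_pos (p (c o)) (p v) (p (c (o - 1)))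
  have hadd : ccwAngle (p (c o)) (p (c (o + 1))) (p v) + ccwAngle (p (c o)) (p v) (p (c (o - 1))) =
      ccwAngle (p (c o)) (p (c (o + 1))) (p (c (o - 1))) := by
    have h1 := ccwAngle_le (p (c o)) (p v) (p (c (o - 1)))
    rcases ccwAngle_add (p (c o)) (p (c (o + 1))) (p v) (p (c (o - 1))) with h | h <;> linarith
  obtain ⟨x, hxo, -, hx⟩ := exists_corner_ne hw hcr hpos o o
  obtain ⟨y, hyo, hyx, hy⟩ := exists_corner_ne hw hcr hpos o x
  by_cases ho : 0 < cr (poly p c (o - 1)) (poly p c o) (poly p c (o + 1))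
  · have hDE : e o ≠ c (o + 1) := by
      intro h
      have := (he o).2 v hv.1
      rw [h] at this
      have := ccwAngle_pos (p (c o)) (p (c (o + 1))) (p v)
      linarith
    have hne : (x - o).val ≠ (y - o).val := fun h =>
      hyx (sub_left_injective (ZMod.val_injective k h)).symm
    rcases lt_or_gt_of_ne hne with h | h
    · exact hc.false_of_corner_ne hp hgp hT hpos he hun hiso hmax hDE hxo h ho hx hy
    · exact hc.false_of_corner_ne hp hgp hT hpos he hun hiso hmax hDE hyo h ho hy hx
  · obtain ⟨z, hzx, hzy, hz⟩ := exists_corner_ne hw hcr hpos x y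
    have hzo : z ≠ o := by rintro rfl; exact ho hz
    have h2 := ccwAngle_lt_two_pi hp hgp (hc.adj o).ne' (hc.adj_sub o).ne' (hc.sub_ne_add o).symm
    -- The interior angle at `o` is below `2π`, so the inner edge leaves an angle below `π` on at
    -- least one of its sides.
    obtain ⟨t, ht, ht0⟩ : ∃ t, ConvexDart p T t ∧ (t = (c o, c (o + 1)) ∨ t = (c o, e o)) := by
      rcases lt_or_gt_of_ne (ccwAngle_ne_pi hp hgp (hc.adj o).ne' hv.1.ne') with h | h
      · exact ⟨_, convexDart_of_lt (hc.adj o) hv.1 h, Or.inl rfl⟩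
      · exact ⟨_, hc.convexDart_last_of_lt he hv.1 (by linarith), Or.inr rfl⟩
    exact hc.false_of_three_corners' hp hgp hT hpos he hun hiso hmax ht ht0 hxo hyo hzo hyx.symm
      hzx.symm hzy.symm hx hy hz

omit he in
/-- If no two vertices of a cycle are connected inside it, it has exactly three corners. -/
lemma IsCyc.ncard_corner :
    {i | 0 < cr (poly p c (i - 1)) (poly p c i) (poly p c (i + 1))}.ncard = 3 := by
  have hw := hc.isSimplePolygon hp hgp hT
  have hcr := hc.cr_ne hp hgp
  obtain ⟨e, he⟩ := hc.exists_before_sub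
  obtain ⟨x, -, -, hx⟩ := exists_corner_ne hw hcr hpos 0 0
  obtain ⟨y, hyx, -, hy⟩ := exists_corner_ne hw hcr hpos x x
  obtain ⟨z, hzx, hzy, hz⟩ := exists_corner_ne hw hcr hpos x y
  refine Set.ncard_eq_three.2 ⟨x, y, z, hyx.symm, hzx.symm, hzy.symm, ?_⟩
  ext o
  simp only [Set.mem_ofPred_eq, Set.mem_insert_iff, Set.mem_singleton_iff]
  constructor
  · intro ho
    by_contra hcon
    push Not at hcon
    exact hc.false_of_three_corners' hp hgp hT hpos he hun hiso hmax (hc.convexDart_fst hp ho)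
      (Or.inl rfl) hcon.1.symm hcon.2.1.symm hcon.2.2.symm hyx.symm hzx.symm hzy.symm hx hy hz
  · rintro (rfl | rfl | rfl) <;> assumption

end unsplit
end PseudoTriang
namespace PseudoTriang

/-! ### Dissection of a cycle into empty pseudo-triangles. -/

section cells
variable {V : Type*} {p : V → Plane} {T : SimpleGraph V}

/-- The region inside the cycle is dissected into empty pseudo-triangles. -/
def Dissected (p : V → Plane) (T : SimpleGraph V) (S : Set Plane) : Prop :=
  ∀ z ∈ S, z ∈ drawing p T ∨ ∃ (k : ℕ) (_ : NeZero k) (c : ZMod k → V), IsCyc T c ∧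
    z ∈ inner (poly p c) ∧ (∀ y ∈ inner (poly p c), y ∉ drawing p T) ∧
    {i | 0 < cr (poly p c (i - 1)) (poly p c i) (poly p c (i + 1))}.ncard = 3

/-- The vertices on and inside the cycle stay connected when any vertex is deleted. -/
def Biconnected (p : V → Plane) (T : SimpleGraph V) {k : ℕ} [NeZero k] (c : ZMod k → V) : Prop :=
  ∀ q u v, u ≠ q → v ≠ q → (u ∈ Set.range c ∨ p u ∈ inner (poly p c)) →
    (v ∈ Set.range c ∨ p v ∈ inner (poly p c)) → (T.deleteIncidenceSet q).Reachable u v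

variable {k : ℕ} [NeZero k] {c : ZMod k → V}

/-- A cycle without one of its vertices is a path; `h` is a position such that all the other ones
avoid `q`. -/
lemma IsCyc.reachable_avoid (hc : IsCyc T c) {q u v : V} (hu : u ≠ q) (hv : v ≠ q)
    (hu' : u ∈ Set.range c) (hv' : v ∈ Set.range c) : (T.deleteIncidenceSet q).Reachable u v := by
  have hk := hc.three_le
  obtain ⟨h, hh⟩ : ∃ h, ∀ i ≠ h, c i ≠ q := by
    by_cases hq : ∃ h, c h = q
    · obtain ⟨h, rfl⟩ := hq
      exact ⟨h, fun i hi h' => hi (hc.injective h')⟩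
    · exact ⟨0, fun i _ h' => hq ⟨i, h'⟩⟩
  have hne : ∀ n : ℕ, 0 < n → n < k → h + (n : ZMod k) ≠ h := by
    intro n h0 hn h'
    have h' : (n : ZMod k) = 0 := by simpa using h'
    have := congrArg ZMod.val h'
    rw [ZMod.val_natCast_of_lt hn, ZMod.val_zero] at this
    omega
  have key : ∀ n : ℕ, n + 1 < k →
      (T.deleteIncidenceSet q).Reachable (c (h + 1)) (c (h + ((n + 1 : ℕ) : ZMod k))) := by
    intro n
    induction n with
    | zero => intro _; simp
    | succ n ih =>
      intro hn
      refine (ih (by omega)).trans (SimpleGraph.Adj.reachable ?_)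
      rw [SimpleGraph.deleteIncidenceSet_adj]
      refine ⟨?_, hh _ (hne _ (by omega) (by omega)), hh _ (hne _ (by omega) hn)⟩
      have := hc.adj (h + ((n + 1 : ℕ) : ZMod k))
      rwa [add_assoc, ← Nat.cast_add_one] at this
  have all : ∀ u ≠ q, u ∈ Set.range c → (T.deleteIncidenceSet q).Reachable (c (h + 1)) u := by
    rintro u hu ⟨i, rfl⟩
    by_cases hi : i = h
    · subst hi
      refine (SimpleGraph.Adj.reachable ?_).symm
      rw [SimpleGraph.deleteIncidenceSet_adj]
      refine ⟨hc.adj i, hu, hh _ ?_⟩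
      have := hne 1 one_pos (by omega)
      simpa using this
    · have h1 : 0 < (i - h).val := by
        rw [Nat.pos_iff_ne_zero, Ne, ZMod.val_eq_zero, sub_eq_zero]; exact hi
      have h2 := ZMod.val_lt (i - h)
      have := key ((i - h).val - 1) (by omega)
      rwa [Nat.sub_add_cancel h1, ZMod.natCast_zmod_val, add_sub_cancel] at this
  exact (all u hu hu').symm.trans (all v hv hv')

variable [Finite V] (hp : Function.Injective p) (hgp : GeneralPosition p) (hT : IsNonCrossing p T)
  (hc : IsCyc T c) (hpos : (inner (poly p c)).Nonempty)
include hp hgp hT hc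

omit [Finite V] in
-- A walk from a vertex inside to the cycle stays inside until it arrives at a cycle vertex, and it
-- arrives there along an inner edge.
lemma IsCyc.vertex_notMem_inner (hconn : T.Connected) (h : ∀ o v, ¬ (innerGraph p T c).Adj (c o) v)
    (u : V) : p u ∉ inner (poly p c) := by
  intro hu
  obtain ⟨w⟩ := hconn.preconnected u (c 0)
  generalize hv : c 0 = v at w
  induction w with
  | nil =>
    subst hv
    exact hu.1 (vertex_mem_boundary _)
  | cons ha _ ih =>
    have ha' := hc.innerGraph_adj_of_mem_inner hp hgp hT ha hu
    rcases hc.innerGraph_vertex hp hgp hT ha'.symm with ⟨o, rfl⟩ | h'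
    · exact h _ _ ha'.symm
    · exact ih h' hv

omit [Finite V] in
lemma IsCyc.inner_notMem_drawing (hconn : T.Connected) (h : ∀ o v, ¬ (innerGraph p T c).Adj (c o) v)
    {z : Plane} (hz : z ∈ inner (poly p c)) : z ∉ drawing p T := by
  intro hzd
  have hin := hc.vertex_notMem_inner hp hgp hT hconn h
  rcases mem_drawing.1 hzd with ⟨v, rfl⟩ | ⟨a, b, hab, hs⟩
  · exact hin v hz
  · have hE : ¬ CycEdge c a b := by
      rintro ⟨i, ⟨rfl, rfl⟩ | ⟨rfl, rfl⟩⟩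
      · exact hz.1 (mem_boundary.2 ⟨i, hs⟩)
      · exact hz.1 (mem_boundary.2 ⟨i, by rw [segment_symm]; exact hs⟩)
    have hB := hc.beside_notMem hp hgp hT hab hE
    have hI : (innerGraph p T c).Adj a b := by
      refine ⟨hab, hB, ?_⟩
      rw [hc.wind_segment hgp hT hp hab hE (beside_zero_mem_segment _ _) hB hs hz.1]
      exact hz.2
    rcases hc.innerGraph_vertex hp hgp hT hI with ⟨o, rfl⟩ | h'
    · exact h _ _ hI
    · exact hin _ h'

end cells

section cells
variable {V : Type*} {p : V → Plane} {T : SimpleGraph V} [Finite V] (hp : Function.Injective p)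
  (hgp : GeneralPosition p) (hT : IsNonCrossing p T)
include hp hgp hT

omit [Finite V] hp hgp hT in
-- A shortest inner walk between two distinct cycle vertices is a path, and a further cycle vertex
-- on it would give a shorter walk.
lemma IsCyc.exists_inner_path {k : ℕ} {c : ZMod k → V} [NeZero k] (hc : IsCyc T c) (h : ∃ i j, i ≠ j ∧ (innerGraph p T c).Reachable (c i) (c j)) :
    ∃ (i j : ZMod k) (l : ℕ) (g : ℕ → V), i ≠ j ∧ 0 < l ∧ g 0 = c i ∧ g l = c j ∧
      (∀ m n, m ≤ l → n ≤ l → g m = g n → m = n) ∧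
      (∀ n < l, (innerGraph p T c).Adj (g n) (g (n + 1))) ∧
      (∀ n, 0 < n → n < l → ∀ h, g n ≠ c h) := by
  classical
  have hex : ∃ l, ∃ i j, i ≠ j ∧ ∃ w : (innerGraph p T c).Walk (c i) (c j), w.length = l := by
    obtain ⟨i, j, hij, ⟨w⟩⟩ := h
    exact ⟨_, i, j, hij, w, rfl⟩
  obtain ⟨i, j, hij, w, hw⟩ := Nat.find_spec hex
  have hmin := fun l => Nat.find_min (H := hex) (m := l)
  rw [← hw] at hmin
  have hpath : w.IsPath := by
    have h1 : ¬ w.bypass.length < w.length := fun h => hmin _ h ⟨i, j, hij, _, rfl⟩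
    have := w.bypass_eq_self_of_length_le_length_bypass (not_lt.1 h1)
    rw [← this]
    exact w.bypass_isPath
  have ginj : ∀ m n, m ≤ w.length → n ≤ w.length → w.getVert m = w.getVert n → m = n :=
    fun m n hm hn h => hpath.getVert_injOn hm hn h
  have h0 : c i ≠ c j := hc.injective.ne hij
  refine ⟨i, j, w.length, w.getVert, hij, ?_, w.getVert_zero, w.getVert_length, ginj,
    fun n hn => w.adj_getVert_succ hn, ?_⟩
  · rw [Nat.pos_iff_ne_zero]
    intro h
    exact h0 (SimpleGraph.Walk.eq_of_length_eq_zero h)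
  · intro n hn0 hn h hh
    by_cases hi : h = i
    · subst hi
      have := ginj n 0 hn.le (Nat.zero_le _) (by rw [hh, w.getVert_zero])
      omega
    · refine hmin n hn ⟨i, h, Ne.symm hi, (w.take n).copy rfl hh, ?_⟩
      simp [SimpleGraph.Walk.take_length, hn.le]

/-- Cutting a graph to which no edge can be added without destroying pointedness along its cycles. -/
theorem IsCyc.dissected (hconn : T.Connected) (hiso : ∀ v, ∃ x, T.Adj v x)
    (hmax : ∀ x y, x ≠ y → FreeSeg p T x y →
      (IsPointed p T x → IsPointed p (T ⊔ SimpleGraph.edge x y) x) →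
      (IsPointed p T y → IsPointed p (T ⊔ SimpleGraph.edge x y) y) → T.Adj x y)
    {k : ℕ} [NeZero k] {c : ZMod k → V} (hc : IsCyc T c) (hpos : (inner (poly p c)).Nonempty) :
    Dissected p T (inner (poly p c)) ∧ Biconnected p T c := by
  generalize hI : innerGraph p T c = I
  induction I using WellFoundedLT.induction generalizing k with
  | ind I ih =>
  subst hI
  -- With no inner connection the geodesic argument makes the cycle itself an empty pseudo-triangle;
  -- otherwise an inner path splits it into two cycles with smaller inner graphs.
  by_cases hun : ∀ i j, (innerGraph p T c).Reachable (c i) (c j) → i = j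
  · have hno := hc.not_innerGraph_adj hp hgp hT hpos hun hiso hmax
    refine ⟨fun z hz => Or.inr ⟨k, inferInstance, c, hc, hz, fun y hy =>
      hc.inner_notMem_drawing hp hgp hT hconn hno hy,
      hc.ncard_corner hp hgp hT hpos hun hiso hmax⟩, ?_⟩
    intro q u v hu hv hu' hv'
    exact hc.reachable_avoid hu hv (hu'.resolve_right (hc.vertex_notMem_inner hp hgp hT hconn hno u))
      (hv'.resolve_right (hc.vertex_notMem_inner hp hgp hT hconn hno v))
  · push Not at hun
    obtain ⟨i0, j0, hr, hij0⟩ := hun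
    obtain ⟨i, j, l, g, hij, hl, g0, gl, ginj, gadj, goff⟩ :=
      hc.exists_inner_path ⟨i0, j0, hij0, hr⟩
    obtain ⟨k1, k2, _, _, c1, c2, hs⟩ := hc.exists_split p hij hl g0 gl ginj
      (fun n hn => (gadj n hn).1) goff (by
        rintro rfl
        have := gadj 0 one_pos
        rw [g0, zero_add, gl] at this
        exact innerGraph_not_cycEdge this)
    have hs' := hs.symm hl
    have gadj' : ∀ n < l, (innerGraph p T c).Adj (g (l - n)) (g (l - (n + 1))) := by
      intro n hn
      have := (gadj (l - (n + 1)) (by omega)).symm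
      rwa [show l - (n + 1) + 1 = l - n by omega] at this
    have h1 := hs.inner_nonempty hp hgp hT hc hpos hl gadj
    have h2 := hs'.inner_nonempty hp hgp hT hc hpos hl gadj'
    obtain ⟨a1, b1⟩ := ih _ (hs.innerGraph_lt hp hgp hT hc hpos hl gadj h1 h2) hs.cyc1 h1 rfl
    obtain ⟨a2, b2⟩ := ih _ (hs'.innerGraph_lt hp hgp hT hc hpos hl gadj' h2 h1) hs.cyc2 h2 rfl
    constructor
    · intro z hz
      by_cases hzd : z ∈ drawing p T
      · exact Or.inl hzd
      rcases hs.mem_inner_or hp hgp hT hz h1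
        (fun h => hzd (hs.cyc1.boundary_subset_drawing h))
        (fun h => hzd (hs.cyc2.boundary_subset_drawing h))
        (fun n hn h => hzd (mem_drawing.2 (Or.inr ⟨_, _, (gadj n hn).1, h⟩))) with h | h
      · exact a1 z h
      · exact a2 z h
    · have hcl : ∀ u, (u ∈ Set.range c ∨ p u ∈ inner (poly p c)) →
          (u ∈ Set.range c1 ∨ p u ∈ inner (poly p c1)) ∨
          (u ∈ Set.range c2 ∨ p u ∈ inner (poly p c2)) := by
        rintro u (⟨h, rfl⟩ | hu)
        · exact (hs.range_sub h).imp Or.inl Or.inl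
        by_cases hu1 : u ∈ Set.range c1
        · exact Or.inl (Or.inl hu1)
        by_cases hu2 : u ∈ Set.range c2
        · exact Or.inr (Or.inl hu2)
        refine (hs.mem_inner_or hp hgp hT hu h1
          (fun h => hu1 ((hs.cyc1.vertex_mem_boundary_iff hgp hp).1 h))
          (fun h => hu2 ((hs.cyc2.vertex_mem_boundary_iff hgp hp).1 h)) ?_).imp Or.inr Or.inr
        intro n hn h
        rcases hgp.eq_of_mem_segment (gadj n hn).ne h with rfl | rfl
        · exact hu1 (hs.path1 n hn.le)
        · exact hu1 (hs.path1 (n + 1) hn)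
      intro q u v hu hv hu' hv'
      -- The two cycles share both ends of the path, and at least one of the ends survives the
      -- deletion of `q`.
      obtain ⟨x, hxq, hx1, hx2⟩ : ∃ x, x ≠ q ∧ x ∈ Set.range c1 ∧ x ∈ Set.range c2 := by
        by_cases h : g 0 = q
        · refine ⟨g l, fun h' => ?_, hs.path1 l le_rfl, hs.path2 l le_rfl⟩
          have := ginj 0 l (Nat.zero_le _) le_rfl (h.trans h'.symm)
          omega
        · exact ⟨g 0, h, hs.path1 0 (Nat.zero_le _), hs.path2 0 (Nat.zero_le _)⟩
      have key : ∀ u, u ≠ q → (u ∈ Set.range c ∨ p u ∈ inner (poly p c)) →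
          (T.deleteIncidenceSet q).Reachable u x := by
        intro u hu hu'
        rcases hcl u hu' with h | h
        · exact b1 q u x hu hxq h (Or.inl hx1)
        · exact b2 q u x hu hxq h (Or.inl hx2)
      exact (key u hu hu').trans (key v hv hv').symm

end cells
end PseudoTriang
namespace PseudoTriang

/-! ### The convex hull cycle. -/

section hull
variable {V : Type*} {p : V → Plane} {T : SimpleGraph V}

/-- `i j` is a counterclockwise edge of the convex hull of the points. -/
def HullEdge (p : V → Plane) (i j : V) : Prop :=
  i ≠ j ∧ ∀ x, x ≠ i → x ≠ j → 0 < cr (p i) (p j) (p x)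

lemma convex_left (a b : Plane) : Convex ℝ ({z | 0 < cr a b z} ∪ segment ℝ a b) := by
  have h0 : ∀ z ∈ {z | 0 < cr a b z} ∪ segment ℝ a b, 0 ≤ cr a b z := by
    rintro z (h | h)
    · exact le_of_lt h
    · exact (cr_eq_zero_of_mem_segment h).ge
  have hlin : ∀ x y : Plane, ∀ s t : ℝ, s + t = 1 → cr a b (s • x + t • y) = s * cr a b x + t * cr a b y := by
    intro x y s t hst
    obtain rfl : t = 1 - s := by linarith
    simp only [cr, PiLp.add_apply, PiLp.smul_apply, smul_eq_mul]
    ring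
  intro x hx y hy s t hs ht hst
  have hx0 := h0 x hx
  have hy0 := h0 y hy
  rcases hs.eq_or_lt with rfl | hs'
  · obtain rfl : t = 1 := by linarith
    simpa using hy
  rcases ht.eq_or_lt with rfl | ht'
  · obtain rfl : s = 1 := by linarith
    simpa using hx
  rcases hx with hx | hx
  · left
    change 0 < cr a b x at hx
    change 0 < cr a b (s • x + t • y)
    rw [hlin _ _ _ _ hst]; positivity
  rcases hy with hy | hy
  · left
    change 0 < cr a b y at hy
    change 0 < cr a b (s • x + t • y)
    rw [hlin _ _ _ _ hst]; positivity
  · exact Or.inr (convex_segment a b hx hy hs ht hst)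

lemma HullEdge.mem_left {i j : V} (h : HullEdge p i j) (x : V) :
    p x ∈ {z | 0 < cr (p i) (p j) z} ∪ segment ℝ (p i) (p j) := by
  by_cases hi : x = i
  · rw [hi]; exact Or.inr (left_mem_segment _ _ _)
  by_cases hj : x = j
  · rw [hj]; exact Or.inr (right_mem_segment _ _ _)
  exact Or.inl (h.2 x hi hj)

lemma HullEdge.left_of_mem_convexHull {i j : V} (h : HullEdge p i j) {z : Plane}
    (hz : z ∈ convexHull ℝ (Set.range p)) : 0 < cr (p i) (p j) z ∨ z ∈ segment ℝ (p i) (p j) :=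
  convexHull_min (by rintro _ ⟨x, rfl⟩; exact h.mem_left x) (convex_left _ _) hz

lemma HullEdge.freeSeg {i j : V} (h : HullEdge p i j) : FreeSeg p T i j := by
  intro u v _ hui huj hvi hvj
  rw [Set.disjoint_left]
  intro s hs hs'
  have h1 := h.2 u hui huj
  have h2 := h.2 v hvi hvj
  obtain ⟨t, h0, h1', rfl⟩ := mem_segment_iff_lineMap.1 hs
  have h3 := cr_eq_zero_of_mem_segment hs'
  rw [cr_lineMap] at h3
  rcases h0.eq_or_lt with rfl | h0
  · linarith
  · nlinarith

variable (hp : Function.Injective p)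
include hp

lemma HullEdge.inHalfPlane [Finite V] {i j : V} (h : HullEdge p i j) :
    InHalfPlane (p i) (p '' {x | x ≠ i}) := by
  refine inHalfPlane_of_left (b := p j) (Set.toFinite _) ?_
  rintro _ ⟨x, hx, rfl⟩
  by_cases hj : x = j
  · subst hj
    right
    exact ⟨by unfold cr; ring, dt_self_pos (hp.ne h.1)⟩
  · exact Or.inl (h.2 x hx hj)

lemma HullEdge.isPointed [Finite V] {i j : V} (h : HullEdge p i j) (G : SimpleGraph V) :
    IsPointed p G i := by
  rw [isPointed_iff hp]
  exact (h.inHalfPlane hp).mono (Set.image_mono fun x hx => (G.ne_of_adj hx).symm)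

omit hp in
lemma HullEdge.left_unique {i i' j : V} (h : HullEdge p i j) (h' : HullEdge p i' j) : i = i' := by
  by_contra hne
  have h1 := h.2 i' (Ne.symm hne) h'.1
  have h2 := h'.2 i hne h.1
  unfold cr at h1 h2
  linarith

variable [Finite V] (hgp : GeneralPosition p)
include hgp

/-- Gift wrapping: seen from `j`, all other points make an angle above `π` with the direction of
`i`, and the smallest of these angles determines the next hull vertex. -/
lemma HullEdge.exists_next {i j x : V} (h : HullEdge p i j) (hxi : x ≠ i) (hxj : x ≠ j) :
    ∃ l, HullEdge p j l := by
  obtain ⟨l, ⟨hli, hlj⟩, hmin⟩ := Set.exists_min_image {x | x ≠ i ∧ x ≠ j}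
    (fun x => ccwAngle (p j) (p i) (p x)) (Set.toFinite _) ⟨x, hxi, hxj⟩
  have hpi := Real.pi_pos
  have hl : Real.pi < ccwAngle (p j) (p i) (p l) := by
    refine pi_lt_ccwAngle_of_neg (hp.ne h.1) (hp.ne hlj) ?_
    have := h.2 l hli hlj
    rw [cr_swap']; linarith
  refine ⟨l, Ne.symm hlj, fun c hcj hcl => ?_⟩
  rw [← ccwAngle_lt_pi_iff (hp.ne hlj) (hp.ne hcj)]
  have h1 := ccwAngle_lt_two_pi hp hgp hlj hcj (Ne.symm hcl)
  by_cases hci : c = i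
  · subst hci
    have := ccwAngle_add_swap hp hgp hcj hlj (Ne.symm hli)
    linarith
  · have h2 := hmin c ⟨hci, hcj⟩
    have h3 := ccwAngle_le (p j) (p i) (p c)
    have h4 := ccwAngle_pos (p j) (p i) (p l)
    rcases ccwAngle_add (p j) (p i) (p l) (p c) with h | h <;> linarith

/-- A point farthest from the origin is pointed even in the complete graph, and the edge that ends
its large free angle has all other points on its left. -/
lemma exists_hullEdge [Nontrivial V] : ∃ i j, HullEdge p i j := by
  obtain ⟨i, -, hi⟩ := Set.exists_max_image (Set.univ : Set V)
    (fun x => p x 0 * p x 0 + p x 1 * p x 1) (Set.toFinite _) Set.univ_nonempty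
  have hpt : IsPointed p ⊤ i := by
    rw [isPointed_iff hp]
    refine ⟨-(p i 0), -(p i 1), ?_⟩
    rintro _ ⟨x, hx, rfl⟩
    have h1 := hi x (Set.mem_univ _)
    have h2 := dt_self_pos (hp.ne hx)
    unfold dt at h2
    nlinarith
  rcases hpt with h | ⟨a, b, ha, hb, hmin, hlt⟩
  · obtain ⟨j, hj⟩ := exists_ne i
    exact absurd hj.symm (h j)
  refine ⟨i, b, hb, fun c hci hcb => ?_⟩
  rw [← ccwAngle_lt_pi_iff (hp.ne hb.ne') (hp.ne hci)]
  have h1 := ccwAngle_lt_two_pi hp hgp hb.ne' hci (Ne.symm hcb)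
  have h2 := hmin c hci.symm
  have h3 := ccwAngle_le (p i) (p a) (p c)
  rcases ccwAngle_add (p i) (p a) (p b) (p c) with h | h <;> linarith

/-- The convex hull polygon. -/
lemma exists_hull_cycle (h3 : ∀ i j : V, ∃ x, x ≠ i ∧ x ≠ j) [Nonempty V]
    (hT : ∀ i j, HullEdge p i j → T.Adj i j) :
    ∃ (k : ℕ) (_ : NeZero k) (c : ZMod k → V), IsCyc T c ∧ ∀ i, HullEdge p (c i) (c (i + 1)) := by
  have : Nontrivial V := by
    obtain ⟨i⟩ := ‹Nonempty V›
    obtain ⟨x, hx, -⟩ := h3 i i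
    exact ⟨x, i, hx⟩
  have hex : ∀ i : {i // ∃ j, HullEdge p i j}, ∃ j : {i // ∃ j, HullEdge p i j}, HullEdge p i j := by
    rintro ⟨i, j, h⟩
    obtain ⟨x, hxi, hxj⟩ := h3 i j
    exact ⟨⟨j, h.exists_next hp hgp hxi hxj⟩, h⟩
  choose f hf using hex
  have hinj : Function.Injective f := by
    intro i i' h
    have h1 := hf i
    rw [h] at h1
    exact Subtype.ext (h1.left_unique (hf i'))
  obtain ⟨i, hi⟩ := exists_hullEdge hp hgp
  set s : {i // ∃ j, HullEdge p i j} := ⟨i, hi⟩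
  -- The successor map is injective on a finite set, so the orbit of any hull vertex closes up.
  have hper := hinj.mem_periodicPts s
  set k := Function.minimalPeriod f s with hk
  have hk0 : 0 < k := Function.minimalPeriod_pos_of_mem_periodicPts hper
  have hclosed : f^[k] s = s := Function.iterate_minimalPeriod
  have hstep : ∀ n, HullEdge p (f^[n] s).1 (f^[n + 1] s).1 := by
    intro n
    rw [Function.iterate_succ_apply']
    exact hf _
  -- With period two, a third point would lie to the left of both orientations of the same edge.
  have hk3 : 3 ≤ k := by
    by_contra hlt
    have h0 := hstep 0
    obtain h | h : k = 1 ∨ k = 2 := by omega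
    · rw [h] at hclosed
      rw [zero_add, hclosed] at h0
      exact h0.1 rfl
    · have h1 := hstep 1
      rw [h] at hclosed
      rw [show 1 + 1 = 2 from rfl, hclosed] at h1
      simp only [Function.iterate_zero, id, zero_add] at h0 h1
      obtain ⟨x, hx1, hx2⟩ := h3 s.1 (f^[1] s).1
      have e1 := h0.2 x hx1 hx2
      have e2 := h1.2 x hx2 hx1
      rw [cr_swap'] at e2
      linarith
  have hloop : IsLoop T k fun n => (f^[n] s).1 := by
    refine ⟨hk3, by simp [hclosed], fun m n hm hn h => ?_, fun n _ => hT _ _ (hstep n)⟩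
    exact Function.iterate_injOn_Iio_minimalPeriod (f := f) (x := s) hm hn (Subtype.ext h)
  have : NeZero k := ⟨hk0.ne'⟩
  refine ⟨k, this, _, hloop.isCyc, fun i => ?_⟩
  rw [hloop.apply_add_one]
  exact hstep _

/-- A hull edge crosses nothing, and both of its ends start a hull edge, which makes them pointed in
every graph. -/
lemma hullEdge_adj (h3 : ∀ i j : V, ∃ x, x ≠ i ∧ x ≠ j)
    (hmax : ∀ x y, x ≠ y → FreeSeg p T x y →
      (IsPointed p T x → IsPointed p (T ⊔ SimpleGraph.edge x y) x) →
      (IsPointed p T y → IsPointed p (T ⊔ SimpleGraph.edge x y) y) → T.Adj x y)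
    (i j : V) (h : HullEdge p i j) : T.Adj i j := by
  obtain ⟨x, hxi, hxj⟩ := h3 i j
  obtain ⟨l, hl⟩ := h.exists_next hp hgp hxi hxj
  exact hmax i j h.1 h.freeSeg (fun _ => h.isPointed hp _) (fun _ => hl.isPointed hp _)

omit hgp

variable {k : ℕ} [NeZero k] {c : ZMod k → V} (hc : IsCyc T c) (hT : IsNonCrossing p T)
  (hull : ∀ i, HullEdge p (c i) (c (i + 1)))
include hc hT hull hgp

omit [Finite V] hull in
-- Every edge is seen from `z` under a positive angle, so the winding number is positive, and `2π`
-- is the only positive value possible.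
lemma IsCyc.mem_inner_of_left {z : Plane} (hz : ∀ i, 0 < cr (p (c i)) (p (c (i + 1))) z) :
    z ∈ inner (poly p c) := by
  have hB : z ∉ polygonBoundary (poly p c) := by
    intro h
    obtain ⟨i, hi⟩ := mem_boundary.1 h
    have := cr_eq_zero_of_mem_segment hi
    exact (hz i).ne' this
  have hpos : 0 < wind (poly p c) z := by
    refine Finset.sum_pos (fun i _ => ?_) Finset.univ_nonempty
    have h1 : 0 < cr z (poly p c i) (poly p c (i + 1)) := by
      rw [← cr_rot]; exact hz i
    have h2 : 0 ≤ ang z (poly p c i) (poly p c (i + 1)) := by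
      unfold ang
      rw [Complex.arg_nonneg_iff]
      exact h1.le
    refine lt_of_le_of_ne h2 fun h => ?_
    have := (Complex.arg_eq_zero_iff.1 h.symm).2
    exact h1.ne' this
  refine ⟨hB, ?_⟩
  have hpi := Real.pi_pos
  rcases wind_values (hc.isSimplePolygon hp hgp hT) (hc.cr_ne hp hgp) with h | ⟨-, h⟩ <;>
  rcases h z hB with h | h <;> linarith

omit [Finite V] in
lemma IsCyc.mem_range_or_inner (v : V) : v ∈ Set.range c ∨ p v ∈ inner (poly p c) := by
  by_cases hv : v ∈ Set.range c
  · exact Or.inl hv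
  · refine Or.inr (hc.mem_inner_of_left hp hgp hT fun i => (hull i).2 v ?_ ?_)
    · rintro rfl; exact hv ⟨_, rfl⟩
    · rintro rfl; exact hv ⟨_, rfl⟩

omit [Finite V] in
lemma IsCyc.mem_drawing_or_inner {z : Plane} (hz : z ∈ convexHull ℝ (Set.range p)) :
    z ∈ drawing p T ∨ z ∈ inner (poly p c) := by
  by_cases hd : z ∈ drawing p T
  · exact Or.inl hd
  · refine Or.inr (hc.mem_inner_of_left hp hgp hT fun i => ?_)
    refine ((hull i).left_of_mem_convexHull hz).resolve_right fun h => hd ?_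
    exact mem_drawing.2 (Or.inr ⟨_, _, hc.adj i, h⟩)

omit [Finite V] in
-- The witness is the centroid of three consecutive vertices: none of them is to the right of a hull
-- edge, and at most two lie on its line.
lemma IsCyc.hull_inner_nonempty : (inner (poly p c)).Nonempty := by
  have h0 : ∀ i v, 0 ≤ cr (p (c i)) (p (c (i + 1))) (p v) := by
    intro i v
    rcases (hull i).mem_left v with h | h
    · exact le_of_lt h
    · exact (cr_eq_zero_of_mem_segment h).ge
  refine ⟨WithLp.toLp 2 ![(p (c (0 - 1)) 0 + p (c 0) 0 + p (c (0 + 1)) 0) / 3,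
    (p (c (0 - 1)) 1 + p (c 0) 1 + p (c (0 + 1)) 1) / 3], hc.mem_inner_of_left hp hgp hT fun i => ?_⟩
  have hsum : 0 < cr (p (c i)) (p (c (i + 1))) (p (c (0 - 1))) + cr (p (c i)) (p (c (i + 1))) (p (c 0)) +
      cr (p (c i)) (p (c (i + 1))) (p (c (0 + 1))) := by
    have h1 := h0 i (c (0 - 1))
    have h2 := h0 i (c 0)
    have h3 := h0 i (c (0 + 1))
    by_contra hle
    have e1 := hgp.eq_of_cr_eq_zero (hull i).1 (v := c (0 - 1)) (by linarith)
    have e2 := hgp.eq_of_cr_eq_zero (hull i).1 (v := c 0) (by linarith)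
    have e3 := hgp.eq_of_cr_eq_zero (hull i).1 (v := c (0 + 1)) (by linarith)
    have n1 := (hc.adj_sub 0).ne
    have n2 := (hc.adj 0).ne
    have n3 := hc.sub_ne_add 0
    rcases e1 with e1 | e1 <;> rcases e2 with e2 | e2 <;> rcases e3 with e3 | e3 <;>
      simp_all
  unfold cr at hsum ⊢
  simp only [Matrix.cons_val_zero, Matrix.cons_val_one]
  refine lt_of_lt_of_eq (div_pos hsum (by norm_num : (0 : ℝ) < 3)) ?_
  ring

end hull
end PseudoTriang
namespace PseudoTriang

/-! ### Bounded faces, and pseudo-triangulations from saturation. -/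

section faces
variable {V : Type*} {p : V → Plane} {T : SimpleGraph V}

lemma drawing_subset_convexHull : drawing p T ⊆ convexHull ℝ (Set.range p) := by
  intro z hz
  rcases mem_drawing.1 hz with ⟨v, rfl⟩ | ⟨i, j, -, h⟩
  · exact subset_convexHull _ _ ⟨v, rfl⟩
  · exact (convex_convexHull ℝ _).segment_subset (subset_convexHull _ _ (Set.mem_range_self i))
      (subset_convexHull _ _ (Set.mem_range_self j)) h

/-- From a point outside the convex hull, a ray in the direction away from the hull avoids the
drawing, so the face of that point is unbounded. -/
lemma IsBoundedFace.subset_convexHull [Finite V] [Nonempty V] {F : Set Plane} (hF : IsBoundedFace p T F) :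
    F ⊆ convexHull ℝ (Set.range p) := by
  intro y hy
  by_contra hyn
  obtain ⟨⟨x, hx, rfl⟩, hb⟩ := hF
  obtain ⟨n, m, hnm⟩ := inHalfPlane_of_notMem_convexHull (Set.finite_range p) hyn
  obtain ⟨v⟩ := ‹Nonempty V›
  set d : Plane := WithLp.toLp 2 ![n, m] with hd
  have hd0 : d 0 = n := rfl
  have hd1 : d 1 = m := rfl
  have hdne : d ≠ 0 := by
    intro h
    have h1 : n = 0 := by rw [← hd0, h]; rfl
    have h2 : m = 0 := by rw [← hd1, h]; rfl
    have := hnm (p v) ⟨v, rfl⟩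
    rw [h1, h2] at this
    linarith
  set R : Set Plane := (fun t : ℝ => y - t • d) '' Set.Ici 0 with hR
  have hRconn : IsPreconnected R :=
    isPreconnected_Ici.image _ (Continuous.continuousOn (by fun_prop))
  have hyR : y ∈ R := ⟨0, Set.self_mem_Ici, by simp⟩
  have hRsub : R ⊆ (drawing p T)ᶜ := by
    rintro _ ⟨t, ht, rfl⟩ hzd
    have ht : 0 ≤ t := ht
    have hsub : convexHull ℝ (Set.range p) ⊆ {z : Plane | n * y 0 + m * y 1 < n * z 0 + m * z 1} := by
      refine convexHull_min ?_ ?_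
      · rintro _ ⟨w, rfl⟩
        have := hnm (p w) ⟨w, rfl⟩
        change n * y 0 + m * y 1 < n * p w 0 + m * p w 1
        linarith
      · refine convex_halfSpace_gt (f := fun z : Plane => n * z 0 + m * z 1) ⟨?_, ?_⟩ _
        · intro a b; simp only [PiLp.add_apply]; ring
        · intro a b; simp only [PiLp.smul_apply, smul_eq_mul]; ring
    have h := hsub (drawing_subset_convexHull hzd)
    change _ < n * (y - t • d) 0 + m * (y - t • d) 1 at h
    simp only [PiLp.sub_apply, PiLp.smul_apply, smul_eq_mul, hd0, hd1] at h
    nlinarith [mul_nonneg ht (mul_self_nonneg n), mul_nonneg ht (mul_self_nonneg m)]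
  have hRF : R ⊆ connectedComponentIn (drawing p T)ᶜ x := by
    have h1 := hRconn.subset_connectedComponentIn hyR hRsub
    rwa [connectedComponentIn_eq hy]
  obtain ⟨M, hM⟩ := (hb.subset hRF).exists_norm_le
  have hdpos : 0 < ‖d‖ := norm_pos_iff.2 hdne
  have hM0 : 0 ≤ M := (norm_nonneg _).trans (hM y hyR)
  have ht : 0 ≤ (M + ‖y‖ + 1) / ‖d‖ := by positivity
  have h1 := hM _ ⟨(M + ‖y‖ + 1) / ‖d‖, ht, rfl⟩
  have h2 := norm_sub_norm_le (((M + ‖y‖ + 1) / ‖d‖) • d) y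
  rw [norm_smul, Real.norm_of_nonneg ht, div_mul_cancel₀ _ hdpos.ne', norm_sub_rev] at h2
  linarith

variable (hp : Function.Injective p) (hgp : GeneralPosition p)
  (hT : IsNonCrossing p T)
include hp hgp hT

lemma IsCyc.component_eq_inner {k : ℕ} [NeZero k] {c : ZMod k → V} (hc : IsCyc T c)
    (hE : ∀ y ∈ inner (poly p c), y ∉ drawing p T) {z : Plane} (hz : z ∈ inner (poly p c)) :
    connectedComponentIn (drawing p T)ᶜ z = inner (poly p c) := by
  have h := inner_eq_component (hc.isSimplePolygon hp hgp hT) (hc.cr_ne hp hgp) ⟨z, hz⟩ z hz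
  refine Set.Subset.antisymm ?_ ?_
  · rw [h]
    exact connectedComponentIn_mono _ (Set.compl_subset_compl.2 hc.boundary_subset_drawing)
  · refine IsPreconnected.subset_connectedComponentIn ?_ hz hE
    rw [h]
    exact isPreconnected_connectedComponentIn

variable [Finite V] [Nonempty V] (hconn : T.Connected)

omit hp hgp [Finite V] in
include hconn in
-- With at most two points the drawing of a connected graph is the whole convex hull, and there is
-- no bounded face.
lemma isPseudoTriangulation_of_small [Finite V] {i j : V} (h3 : ∀ x, x = i ∨ x = j) :
    IsPseudoTriangulation p T := by
  have hr : Set.range p = {p i, p j} := by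
    ext z
    constructor
    · rintro ⟨x, rfl⟩
      rcases h3 x with rfl | rfl
      · exact Or.inl rfl
      · exact Or.inr rfl
    · rintro (rfl | rfl) <;> exact ⟨_, rfl⟩
  have hd : drawing p T = convexHull ℝ (Set.range p) := by
    refine Set.Subset.antisymm drawing_subset_convexHull ?_
    rw [hr, convexHull_pair]
    intro z hz
    by_cases hij : i = j
    · subst hij
      rw [segment_same] at hz
      exact mem_drawing.2 (Or.inl ⟨i, hz.symm⟩)
    · obtain ⟨x, hx⟩ : ∃ x, T.Adj i x := by
        have : Nontrivial V := ⟨i, j, hij⟩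
        exact hconn.preconnected.exists_adj_of_nontrivial i
      rcases h3 x with rfl | rfl
      · exact absurd rfl hx.ne
      · exact mem_drawing.2 (Or.inr ⟨_, _, hx, hz⟩)
  have hno : ∀ F, ¬ IsBoundedFace p T F := by
    intro F hF
    have h1 := hF.subset_convexHull
    obtain ⟨⟨x, hx, rfl⟩, -⟩ := hF
    have := h1 (mem_connectedComponentIn hx)
    rw [← hd] at this
    exact hx this
  refine ⟨hT, hconn, ?_, fun F hF => absurd hF (hno F)⟩
  rw [hd, Set.union_eq_left]
  rintro z ⟨F, hF, -⟩
  exact absurd hF (hno F)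

variable (hmax : ∀ x y, x ≠ y → FreeSeg p T x y →
      (IsPointed p T x → IsPointed p (T ⊔ SimpleGraph.edge x y) x) →
      (IsPointed p T y → IsPointed p (T ⊔ SimpleGraph.edge x y) y) → T.Adj x y)
include hconn hmax

/-- The hull cycle carries or encloses all vertices, so the biconnectedness obtained for cycles
covers the whole graph. -/
lemma biconnected_of_maximal (h3 : ∀ i j : V, ∃ x, x ≠ i ∧ x ≠ j) {q u v : V} (hu : u ≠ q) (hv : v ≠ q) :
    (T.deleteIncidenceSet q).Reachable u v := by
  have : Nontrivial V := ⟨u, q, hu⟩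
  obtain ⟨k, _, c, hc, hull⟩ := exists_hull_cycle hp hgp h3 (hullEdge_adj hp hgp h3 hmax)
  have hB := (hc.dissected hp hgp hT hconn hconn.preconnected.exists_adj_of_nontrivial hmax
    (hc.hull_inner_nonempty hp hgp hT hull)).2
  exact hB q u v hu hv (hc.mem_range_or_inner hp hgp hT hull u) (hc.mem_range_or_inner hp hgp hT hull v)

/-- A point of the convex hull off the drawing lies inside the hull cycle, hence in an empty
pseudo-triangle of the dissection; being empty, this cell is the entire face of the point. -/
theorem isPseudoTriangulation_of_maximal : IsPseudoTriangulation p T := by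
  by_cases h3 : ∀ i j : V, ∃ x, x ≠ i ∧ x ≠ j
  · have : Nontrivial V := by
      obtain ⟨i⟩ := ‹Nonempty V›
      obtain ⟨x, hx, -⟩ := h3 i i
      exact ⟨x, i, hx⟩
    obtain ⟨k, _, c, hc, hull⟩ := exists_hull_cycle hp hgp h3 (hullEdge_adj hp hgp h3 hmax)
    have hA := (hc.dissected hp hgp hT hconn hconn.preconnected.exists_adj_of_nontrivial hmax
      (hc.hull_inner_nonempty hp hgp hT hull)).1
    have key : ∀ z ∈ convexHull ℝ (Set.range p), z ∉ drawing p T →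
        ∃ (k : ℕ) (c : ZMod k → V), (∀ i, T.Adj (c i) (c (i + 1))) ∧
          IsPseudoTriangle (connectedComponentIn (drawing p T)ᶜ z) (fun i => p (c i)) := by
      intro z hz hzd
      rcases hA z ((hc.mem_drawing_or_inner hp hgp hT hull hz).resolve_left hzd) with
        h | ⟨k', _, c', hc', hz', hE, h3⟩
      · exact absurd h hzd
      have hw := hc'.isSimplePolygon hp hgp hT
      have hcr := hc'.cr_ne hp hgp
      refine ⟨k', c', hc'.adj, hw, ?_, ?_⟩
      · rw [hc'.component_eq_inner hp hgp hT hE hz']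
        exact isInteriorOf_inner hw hcr ⟨z, hz'⟩
      · rw [hc'.component_eq_inner hp hgp hT hE hz', ← h3]
        congr 1
        ext i
        exact isCorner_iff hw hcr ⟨z, hz'⟩ i
    refine ⟨hT, hconn, Set.Subset.antisymm ?_ ?_, ?_⟩
    · refine Set.union_subset drawing_subset_convexHull (Set.sUnion_subset fun F hF => ?_)
      exact hF.subset_convexHull
    · intro z hz
      by_cases hzd : z ∈ drawing p T
      · exact Or.inl hzd
      obtain ⟨k', c', -, -, hint, -⟩ := key z hz hzd
      exact Or.inr ⟨_, ⟨⟨z, hzd, rfl⟩, hint.2⟩, mem_connectedComponentIn hzd⟩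
    · intro F hF
      have hFs := hF.subset_convexHull
      obtain ⟨⟨z, hz, rfl⟩, -⟩ := hF
      exact key z (hFs (mem_connectedComponentIn hz)) hz
  · push Not at h3
    obtain ⟨i, j, h3⟩ := h3
    exact isPseudoTriangulation_of_small hT hconn (i := i) (j := j)
      fun x => or_iff_not_imp_left.2 (h3 x)

end faces
end PseudoTriang
namespace PseudoTriang

/-! ### Maximal graphs are pseudo-triangulations. -/

section maximal
variable {V : Type*} [Finite V] {p : V → Plane} {T : SimpleGraph V} (hp : Function.Injective p)
include hp

lemma isPointed_congr {G H : SimpleGraph V} {v : V} (h : ∀ x, G.Adj v x ↔ H.Adj v x) :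
    IsPointed p G v ↔ IsPointed p H v := by
  rw [isPointed_iff hp, isPointed_iff hp]
  simp only [h]

lemma isPointed_sup_edge {G : SimpleGraph V} {x y : V}
    (hx : IsPointed p G x → IsPointed p (G ⊔ SimpleGraph.edge x y) x)
    (hy : IsPointed p G y → IsPointed p (G ⊔ SimpleGraph.edge x y) y) :
    {v | IsPointed p (G ⊔ SimpleGraph.edge x y) v} = {v | IsPointed p G v} := by
  ext v
  simp only [Set.mem_ofPred_eq]
  refine ⟨IsPointed.anti hp le_sup_left, fun h => ?_⟩
  by_cases hvx : v = x
  · subst hvx; exact hx h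
  by_cases hvy : v = y
  · subst hvy; exact hy h
  refine (isPointed_congr hp fun z => ?_).1 h
  rw [SimpleGraph.sup_adj, SimpleGraph.edge_adj]
  tauto

omit [Finite V] hp in
lemma adj_of_sup_edge_le {G : SimpleGraph V} {x y : V} (hxy : x ≠ y) (h : G ⊔ SimpleGraph.edge x y ≤ G) :
    G.Adj x y :=
  h (by rw [SimpleGraph.sup_adj, SimpleGraph.edge_adj]; exact Or.inr ⟨Or.inl ⟨rfl, rfl⟩, hxy⟩)

variable (hgp : GeneralPosition p) [Nonempty V]
include hgp

/-- A non-crossing graph that is maximal under inclusion contains all visible segments. -/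
lemma exists_connected_ge (hT : IsNonCrossing p T) :
    ∃ G, T ≤ G ∧ IsNonCrossing p G ∧ G.Connected := by
  obtain ⟨G, hTG, hG⟩ := Set.Finite.exists_le_maximal (Set.toFinite {G | IsNonCrossing p G}) hT
  refine ⟨G, hTG, hG.prop, connected_of_full hp hgp hG.prop fun x y hxy hf => ?_⟩
  exact adj_of_sup_edge_le hxy (hG.le_of_ge (hG.prop.sup_edge hf) le_sup_left)

omit hgp in
/-- The edges at a vertex that is pointed in a subgraph can be thinned out to make it pointed. -/
lemma exists_pointed_thinning {G : SimpleGraph V} (hTG : T ≤ G) {q : V} (hq : IsPointed p T q)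
    (hnq : ¬ IsPointed p G q)
    (hbi : ∀ u v, u ≠ q → v ≠ q → (G.deleteIncidenceSet q).Reachable u v) :
    ∃ H, T ≤ H ∧ H ≤ G ∧ H.Connected ∧ IsPointed p H q := by
  obtain ⟨S, hSG, ⟨s, hs⟩, hTS, hS⟩ : ∃ S : Set V, (∀ x ∈ S, G.Adj q x) ∧ S.Nonempty ∧
      (∀ x, T.Adj q x → x ∈ S) ∧ InHalfPlane (p q) (p '' S) := by
    by_cases h : ∃ x, T.Adj q x
    · exact ⟨{x | T.Adj q x}, fun x hx => hTG hx, h, fun x hx => hx, (isPointed_iff hp T q).1 hq⟩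
    · obtain ⟨x, hx⟩ : ∃ x, G.Adj q x := by
        by_contra hno
        push Not at hno
        exact hnq (Or.inl hno)
      push Not at h
      -- If `q` is isolated in `T`, one edge of `G` is retained to keep the graph connected; a
      -- single edge always lies in a half-plane, with its own direction as normal.
      refine ⟨{x}, ?_, ⟨x, rfl⟩, fun y hy => absurd hy (h y), p x 0 - p q 0, p x 1 - p q 1, ?_⟩
      · rintro _ rfl; exact hx
      · rintro _ ⟨_, rfl, rfl⟩
        exact dt_self_pos (hp.ne hx.ne)
  let H : SimpleGraph V :=
    { Adj := fun a b => G.Adj a b ∧ (a = q → b ∈ S) ∧ (b = q → a ∈ S)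
      symm := ⟨fun a b h => ⟨h.1.symm, h.2.2, h.2.1⟩⟩
      loopless := ⟨fun a h => h.1.ne rfl⟩ }
  have hle : G.deleteIncidenceSet q ≤ H := by
    intro a b hab
    rw [SimpleGraph.deleteIncidenceSet_adj] at hab
    exact ⟨hab.1, fun h => absurd h hab.2.1, fun h => absurd h hab.2.2⟩
  have hqs : H.Adj q s := ⟨hSG s hs, fun _ => hs, fun h => absurd h (hSG s hs).ne'⟩
  refine ⟨H, ?_, fun a b h => h.1, ?_, ?_⟩
  · intro a b hab
    refine ⟨hTG hab, ?_, ?_⟩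
    · rintro rfl; exact hTS _ hab
    · rintro rfl; exact hTS _ hab.symm
  · have key : ∀ u, H.Reachable u s := by
      intro u
      by_cases hu : u = q
      · subst hu; exact hqs.reachable
      · exact (hbi u s hu hqs.ne').mono hle
    exact ⟨fun u v => (key u).trans (key v).symm⟩
  · rw [isPointed_iff hp]
    refine hS.mono (Set.image_mono ?_)
    intro x hx
    exact hx.2.1 rfl

/-- The graph `G` is chosen in two stages, first for the number of pointed vertices and then for
inclusion. The second stage gives saturation, and the first one shows that no pointed vertex of `T`
is lost. -/
theorem IsPseudoTriangulation.of_maximal (hT : IsNonCrossing p T)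
    (h : Maximal (fun H : SimpleGraph V => IsNonCrossing p H ∧
        {v | IsPointed p H v} = {v | IsPointed p T v}) T) : IsPseudoTriangulation p T := by
  obtain ⟨G0, hG0, hG0'⟩ := exists_connected_ge hp hgp hT
  obtain ⟨G1, ⟨hG1a, hG1b, hG1c⟩, hG1max⟩ := Set.exists_max_image
    {G | T ≤ G ∧ IsNonCrossing p G ∧ G.Connected} (fun G => {v | IsPointed p G v}.ncard)
    (Set.toFinite _) ⟨G0, hG0, hG0'⟩
  obtain ⟨G, -, hG⟩ := Set.Finite.exists_le_maximal
    (Set.toFinite {G | (T ≤ G ∧ IsNonCrossing p G ∧ G.Connected) ∧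
      {v | IsPointed p G v}.ncard = {v | IsPointed p G1 v}.ncard}) (a := G1)
    ⟨⟨hG1a, hG1b, hG1c⟩, rfl⟩
  obtain ⟨⟨hTG, hGnc, hGc⟩, hGcard⟩ := hG.prop
  have hmax : ∀ x y, x ≠ y → FreeSeg p G x y →
      (IsPointed p G x → IsPointed p (G ⊔ SimpleGraph.edge x y) x) →
      (IsPointed p G y → IsPointed p (G ⊔ SimpleGraph.edge x y) y) → G.Adj x y := by
    intro x y hxy hf hx hy
    refine adj_of_sup_edge_le hxy (hG.le_of_ge ⟨⟨hTG.trans le_sup_left, hGnc.sup_edge hf,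
      hGc.mono le_sup_left⟩, ?_⟩ le_sup_left)
    rw [isPointed_sup_edge hp hx hy, hGcard]
  have hpt : ∀ q, IsPointed p T q → IsPointed p G q := by
    intro q hq
    by_contra hnq
    -- With at most two vertices every vertex has at most one neighbour and is pointed.
    have h3 : ∀ i j : V, ∃ x, x ≠ i ∧ x ≠ j := by
      by_contra hcon
      push Not at hcon
      obtain ⟨i, j, hij⟩ := hcon
      apply hnq
      rw [isPointed_iff hp]
      by_cases hqi : q = i
      · refine ⟨p j 0 - p q 0, p j 1 - p q 1, ?_⟩
        rintro _ ⟨x, hx, rfl⟩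
        have hx : G.Adj q x := hx
        have hxj : x = j := hij x (hqi ▸ hx.ne')
        rw [hxj] at hx ⊢
        exact dt_self_pos (hp.ne hx.ne)
      · have hqj := hij q hqi
        refine ⟨p i 0 - p q 0, p i 1 - p q 1, ?_⟩
        rintro _ ⟨x, hx, rfl⟩
        have hx : G.Adj q x := hx
        have hxi : x = i := by
          by_contra hne
          exact hx.ne (hqj.trans (hij x hne).symm)
        rw [hxi] at hx ⊢
        exact dt_self_pos (hp.ne hx.ne)
    -- Thinning the edges at `q` keeps all vertices pointed that were pointed in `G` and adds `q`,
    -- against the choice of the number of pointed vertices.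
    obtain ⟨H, hTH, hHG, hHc, hHq⟩ := exists_pointed_thinning hp hTG hq hnq fun u v hu hv =>
      biconnected_of_maximal hp hgp hGnc hGc hmax h3 hu hv
    have h1 := hG1max H ⟨hTH, hGnc.anti hHG, hHc⟩
    rw [← hGcard] at h1
    refine absurd h1 (not_le.2 (Set.ncard_lt_ncard ⟨fun v hv => hv.anti hp hHG, fun hsub => ?_⟩
      (Set.toFinite _)))
    exact hnq (hsub hHq)
  have hGT : G ≤ T := h.le_of_ge ⟨hGnc, Set.Subset.antisymm (fun v hv => hv.anti hp hTG)
    fun v hv => hpt v hv⟩ hTG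
  obtain rfl := le_antisymm hTG hGT
  exact isPseudoTriangulation_of_maximal hp hgp hT hGc hmax

end maximal
end PseudoTriang
namespace PseudoTriang

/-! ### Orienting the boundary of a pseudo-triangle. -/

section reversal
variable {V : Type*} {p : V → Plane} {T : SimpleGraph V} {k : ℕ} {c : ZMod k → V}

lemma IsCyc.reverse (hc : IsCyc T c) : IsCyc T fun i => c (-i) := by
  refine ⟨hc.three_le, fun i j h => neg_injective (hc.injective h), fun i => ?_⟩
  have := (hc.adj (-(i + 1))).symm
  rwa [show -(i + 1) + 1 = -i by ring] at this

lemma boundary_reverse (w : ZMod k → Plane) : polygonBoundary (fun i => w (-i)) = polygonBoundary w := by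
  ext z
  rw [mem_boundary, mem_boundary]
  constructor
  · rintro ⟨i, h⟩
    refine ⟨-(i + 1), ?_⟩
    rw [show -(i + 1) + 1 = -i by ring, segment_symm]
    exact h
  · rintro ⟨i, h⟩
    refine ⟨-(i + 1), ?_⟩
    rw [show -(-(i + 1) + 1) = i by ring, neg_neg, segment_symm]
    exact h

variable [NeZero k]

lemma wind_reverse {w : ZMod k → Plane} {z : Plane} (hz : z ∉ polygonBoundary w) :
    wind (fun i => w (-i)) z = -wind w z := by
  unfold wind
  rw [← Finset.sum_neg_distrib]
  refine Fintype.sum_equiv ((Equiv.neg (ZMod k)).trans (Equiv.subRight 1)) _ _ fun i => ?_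
  simp only [Equiv.trans_apply, Equiv.neg_apply, Equiv.subRight_apply]
  rw [sub_add_cancel, show -(i + 1) = -i - 1 by ring]
  refine ang_swap fun h => hz (mem_boundary.2 ⟨-i - 1, ?_⟩)
  rw [sub_add_cancel]; exact h

omit [NeZero k] in
lemma isCorner_reverse (R : Set Plane) (w : ZMod k → Plane) (i : ZMod k) :
    IsCorner R (fun i => w (-i)) i ↔ IsCorner R w (-i) := by
  unfold IsCorner
  beta_reduce
  rw [show -(i + 1) = -i - 1 by ring, show -(i - 1) = -i + 1 by ring]
  constructor
  · rintro ⟨ε, hε, h⟩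
    refine ⟨ε, hε, fun s t hs hs' ht ht' => ?_⟩
    have := h t s ht ht' hs hs'
    rwa [add_right_comm] at this
  · rintro ⟨ε, hε, h⟩
    refine ⟨ε, hε, fun s t hs hs' ht ht' => ?_⟩
    have := h t s ht ht' hs hs'
    rwa [add_right_comm] at this

variable [Finite V] (hp : Function.Injective p) (hgp : GeneralPosition p) (hT : IsNonCrossing p T)
include hp hgp hT

/-- A pseudo-triangle bounded by a cycle of a graph is the interior of a counterclockwise cycle. -/
lemma IsPseudoTriangle.exists_cyc {R : Set Plane} (hadj : ∀ i, T.Adj (c i) (c (i + 1)))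
    (hR : IsPseudoTriangle R (fun i => p (c i))) : ∃ c' : ZMod k → V, IsCyc T c' ∧ R = inner (poly p c') ∧
      {i | 0 < cr (poly p c' (i - 1)) (poly p c' i) (poly p c' (i + 1))}.ncard = 3 := by
  obtain ⟨hw, hint, h3⟩ := hR
  have hc : IsCyc T c := ⟨hw.three_le, fun i j h => hw.injective (congrArg p h), hadj⟩
  have hcr := hc.cr_ne hp hgp
  have hpi := Real.pi_pos
  have aux : ∀ c' : ZMod k → V, IsCyc T c' → IsInteriorOf R (poly p c') →
      {i | IsCorner R (poly p c') i}.ncard = 3 → (inner (poly p c')).Nonempty →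
      R = inner (poly p c') ∧
      {i | 0 < cr (poly p c' (i - 1)) (poly p c' i) (poly p c' (i + 1))}.ncard = 3 := by
    intro c' hc' hint h3 hpos
    have hw' := hc'.isSimplePolygon hp hgp hT
    have hcr' := hc'.cr_ne hp hgp
    have e := IsInteriorOf.eq_inner hw' hcr' hpos hint
    refine ⟨e, ?_⟩
    rw [← h3]
    congr 1
    ext i
    rw [e]
    exact (isCorner_iff hw' hcr' hpos i).symm
  rcases wind_values hw hcr with h | ⟨⟨z, hz, hz'⟩, -⟩
  · have hpos : (inner (poly p c)).Nonempty := by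
      -- If the value `2π` did not occur, the winding number would vanish on both sides of an edge,
      -- against its jump there.
      by_contra hno
      have h0 : ∀ z ∉ polygonBoundary (poly p c), wind (poly p c) z = 0 := fun z hz =>
        (h z hz).resolve_right fun h' => hno ⟨z, hz, h'⟩
      obtain ⟨δ, h1, h2, h4⟩ := ((hw.wind_jump hcr 0).and
        (eventually_beside_notMem_drawing hp hgp hT (hc.adj 0))).exists
      have e1 := h0 _ fun h => h2 (hc.boundary_subset_drawing h)
      have e2 := h0 _ fun h => h4 (hc.boundary_subset_drawing h)
      unfold poly at e1 e2
      linarith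
    exact ⟨c, hc, aux c hc hint h3 hpos⟩
  · have hB : polygonBoundary (poly p fun i => c (-i)) = polygonBoundary (poly p c) :=
      boundary_reverse (poly p c)
    refine ⟨fun i => c (-i), hc.reverse, aux _ hc.reverse ?_ ?_ ⟨z, ?_, ?_⟩⟩
    · unfold IsInteriorOf
      rw [hB]; exact hint
    · rw [← h3, ← Set.ncard_image_of_injective _ (neg_injective (G := ZMod k))]
      congr 1
      ext i
      rw [Set.mem_image]
      constructor
      · rintro ⟨j, hj, rfl⟩
        exact (isCorner_reverse R (poly p c) j).1 hj
      · intro hi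
        refine ⟨-i, (isCorner_reverse R (poly p c) (-i)).2 ?_, neg_neg i⟩
        rw [neg_neg]; exact hi
    · rw [hB]; exact hz
    · have e : wind (poly p fun i => c (-i)) z = -wind (poly p c) z := wind_reverse hz
      have hz' : wind (poly p c) z = -(2 * Real.pi) := hz'
      rw [e, hz', neg_neg]

end reversal

/-! ### Counting corners: pseudo-triangulations are maximal. -/

section corners
variable {V : Type*} {p : V → Plane} {k : ℕ} {c : ZMod k → V}

/-- The vertices of a cycle with an interior angle smaller than `π`. -/
def cornerSet (p : V → Plane) (c : ZMod k → V) : Set V :=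
  {y | ∃ x z, Turn c x y z ∧ 0 < cr (p x) (p y) (p z)}

lemma cornerSet_eq_image : cornerSet p c =
    c '' {i | 0 < cr (poly p c (i - 1)) (poly p c i) (poly p c (i + 1))} := by
  ext y
  constructor
  · rintro ⟨x, z, ⟨h, rfl, rfl, rfl⟩, h'⟩
    exact ⟨h, h', rfl⟩
  · rintro ⟨h, h', rfl⟩
    exact ⟨_, _, ⟨h, rfl, rfl, rfl⟩, h'⟩

lemma Turn.cr_pos {T : SimpleGraph V} (hc : IsCyc T c) {x y z : V} (h : Turn c x y z) (hy : y ∈ cornerSet p c) :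
    0 < cr (p x) (p y) (p z) := by
  obtain ⟨x', z', ⟨i, rfl, rfl, rfl⟩, hcr⟩ := hy
  obtain ⟨j, rfl, e, rfl⟩ := h
  obtain rfl := hc.injective e
  exact hcr

lemma ncard_eq_diff_pair [Finite V] (S : Set V) {u v : V} (huv : u ≠ v) [Decidable (u ∈ S)]
    [Decidable (v ∈ S)] :
    S.ncard = (S \ {u, v}).ncard + (if u ∈ S then 1 else 0) + (if v ∈ S then 1 else 0) := by
  have h : ∀ (S : Set V) w [Decidable (w ∈ S)], S.ncard = (S \ {w}).ncard + if w ∈ S then 1 else 0 := by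
    intro S w _
    split_ifs with h
    · exact (Set.ncard_sdiff_singleton_add_one h (Set.toFinite _)).symm
    · rw [Set.sdiff_singleton_eq_self h, add_zero]
  classical
  have h2 := h (S \ {u}) v
  rw [Set.sdiff_sdiff, Set.singleton_union] at h2
  have h3 : v ∈ S \ {u} ↔ v ∈ S := by simp [huv.symm]
  simp only [h3] at h2
  rw [h S u, h2]
  ring

variable [Finite V] [NeZero k] {T H : SimpleGraph V} (hp : Function.Injective p) (hgp : GeneralPosition p)
include hp hgp

omit [Finite V] in
lemma IsCyc.three_le_ncard_cornerSet (hT : IsNonCrossing p T) (hc : IsCyc T c)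
    (hpos : (inner (poly p c)).Nonempty) : 3 ≤ (cornerSet p c).ncard := by
  have hw := hc.isSimplePolygon hp hgp hT
  have hcr := hc.cr_ne hp hgp
  obtain ⟨x, -, -, hx⟩ := exists_corner_ne hw hcr hpos 0 0
  obtain ⟨y, hyx, -, hy⟩ := exists_corner_ne hw hcr hpos x x
  obtain ⟨z, hzx, hzy, hz⟩ := exists_corner_ne hw hcr hpos x y
  rw [cornerSet_eq_image, Set.ncard_image_of_injective _ hc.injective,
    ← Set.ncard_eq_three.2 ⟨x, y, z, hyx.symm, hzx.symm, hzy.symm, rfl⟩]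
  refine Set.ncard_le_ncard ?_ (Set.toFinite _)
  rintro _ (rfl | rfl | rfl)
  · exact hx
  · exact hy
  · exact hz

/-- An edge inside an empty face that keeps a reflex vertex of the face pointed has a reflex angle
on one side there. -/
lemma IsCyc.corner_of_corners (hT : IsNonCrossing p T) (hc : IsCyc T c)
    (hpos : (inner (poly p c)).Nonempty) (hE : ∀ y ∈ inner (poly p c), y ∉ drawing p T)
    (hTH : T ≤ H) {i : ZMod k} {v : V} (hv : H.Adj (c i) v)
    (hpt : IsPointed p T (c i) → IsPointed p H (c i))
    (h1 : 0 < cr (p v) (p (c i)) (p (c (i + 1)))) (h2 : 0 < cr (p (c (i - 1))) (p (c i)) (p v)) :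
    0 < cr (p (c (i - 1))) (p (c i)) (p (c (i + 1))) := by
  by_contra hle
  have hlt : cr (p (c (i - 1))) (p (c i)) (p (c (i + 1))) < 0 :=
    lt_of_le_of_ne (not_lt.1 hle) (hc.cr_ne hp hgp i)
  -- The face is empty, so its reflex angle at `c i` contains no edge of `T` and serves as the free
  -- angle.
  have hT' : IsPointed p T (c i) := by
    refine Or.inr ⟨c (i + 1), c (i - 1), hc.adj i, hc.adj_sub i, fun w hw => ?_, ?_⟩
    · by_cases hw1 : w = c (i + 1)
      · rw [hw1, ccwAngle_self]; exact ccwAngle_le _ _ _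
      by_cases hw2 : w = c (i - 1)
      · rw [hw2]
      have := (hc.innerGraph_adj_iff hp hgp hT hpos hw hw1 hw2).not.1 fun h =>
        hE _ h.2 (mem_drawing.2 (Or.inr ⟨_, _, h.1, beside_zero_mem_segment _ _⟩))
      exact not_lt.1 this
    · refine pi_lt_ccwAngle_of_neg (hp.ne (hc.adj i).ne') (hp.ne (hc.adj_sub i).ne') ?_
      rwa [cr_rot]
  obtain ⟨n, m, hnm⟩ := (isPointed_iff hp H _).1 (hpt hT')
  have a1 := hnm _ ⟨_, hTH (hc.adj i), rfl⟩
  have a2 := hnm _ ⟨_, hTH (hc.adj_sub i), rfl⟩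
  have a3 := hnm _ ⟨_, hv, rfl⟩
  -- The edges to `c (i + 1)`, `v` and `c (i - 1)` make consecutive angles below `π` all the way
  -- round, so they fit into no half-plane.
  have key := three_dir n m (p (c i)) (p (c (i + 1))) (p v) (p (c (i - 1)))
  have b1 : 0 < cr (p (c i)) (p v) (p (c (i - 1))) := by rw [cr_rot]; exact h2
  have b2 : 0 < cr (p (c i)) (p (c (i - 1))) (p (c (i + 1))) := by
    rw [cr_swap, cr_rot]; linarith
  have b3 : 0 < cr (p (c i)) (p (c (i + 1))) (p v) := by rw [cr_rot]; exact h1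
  have := mul_pos a1 b1
  have := mul_pos a3 b2
  have := mul_pos a2 b3
  linarith

/-- No edge inside an empty pseudo-triangle keeps the pointed vertices pointed. -/
lemma IsCyc.not_adj_inside (hH : IsNonCrossing p H) (hTH : T ≤ H) (hc : IsCyc T c)
    (hE : ∀ y ∈ inner (poly p c), y ∉ drawing p T)
    (h3 : {i | 0 < cr (poly p c (i - 1)) (poly p c i) (poly p c (i + 1))}.ncard = 3)
    (hpt : ∀ v, IsPointed p T v → IsPointed p H v) (u v : V) : ¬ (innerGraph p H c).Adj u v := by
  classical
  intro huv
  have hT : IsNonCrossing p T := hH.anti hTH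
  have hpos : (inner (poly p c)).Nonempty := ⟨_, huv.2⟩
  have hcH : IsCyc H c := ⟨hc.three_le, hc.injective, fun i => hTH (hc.adj i)⟩
  have hrange : ∀ {u v}, (innerGraph p H c).Adj u v → u ∈ Set.range c := fun h =>
    (hcH.innerGraph_vertex hp hgp hH h).resolve_right fun h' => hE _ h' (mem_drawing.2 (Or.inl ⟨_, rfl⟩))
  obtain ⟨i, rfl⟩ := hrange huv
  obtain ⟨j, rfl⟩ := hrange huv.symm
  set g : ℕ → V := fun n => if n = 0 then c i else c j with hg
  have gadj : ∀ n < 1, (innerGraph p H c).Adj (g n) (g (n + 1)) := by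
    intro n hn
    obtain rfl : n = 0 := by omega
    exact huv
  have hij : i ≠ j := fun h => huv.ne (congrArg c h)
  obtain ⟨k1, k2, _, _, c1, c2, hs⟩ := hcH.exists_split p hij one_pos (g := g) rfl rfl (by
      intro m n hm hn h
      have hm : m = 0 ∨ m = 1 := by omega
      have hn : n = 0 ∨ n = 1 := by omega
      rcases hm with rfl | rfl <;> rcases hn with rfl | rfl
      · rfl
      · exact absurd h huv.ne
      · exact absurd h huv.ne'
      · rfl) (fun n hn => (gadj n hn).1) (by omega) (fun _ => innerGraph_not_cycEdge huv)
  have hs' := hs.symm one_pos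
  have gadj' : ∀ n < 1, (innerGraph p H c).Adj (g (1 - n)) (g (1 - (n + 1))) := by
    intro n hn
    obtain rfl : n = 0 := by omega
    exact huv.symm
  have n1 := hs.cyc1.three_le_ncard_cornerSet hp hgp hH
    (hs.inner_nonempty hp hgp hH hcH hpos one_pos gadj)
  have n2 := hs.cyc2.three_le_ncard_cornerSet hp hgp hH
    (hs'.inner_nonempty hp hgp hH hcH hpos one_pos gadj')
  have n0 : (cornerSet p c).ncard = 3 := by
    rw [cornerSet_eq_image, Set.ncard_image_of_injective _ hc.injective, h3]
  have hend : ∀ y, (∃ n ≤ 1, y = g n) → y ∈ ({c i, c j} : Set V) := by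
    rintro y ⟨n, hn, rfl⟩
    obtain rfl | rfl : n = 0 ∨ n = 1 := by omega
    · exact Or.inl rfl
    · exact Or.inr rfl
  have sub1 : cornerSet p c1 \ {c i, c j} ⊆ cornerSet p c \ {c i, c j} := by
    rintro y ⟨⟨x, z, ht, h⟩, hy⟩
    exact ⟨⟨x, z, (hs.turn1 x y z ht).resolve_right fun h => hy (hend y h), h⟩, hy⟩
  have sub2 : cornerSet p c2 \ {c i, c j} ⊆ cornerSet p c \ {c i, c j} := by
    rintro y ⟨⟨x, z, ht, h⟩, hy⟩
    exact ⟨⟨x, z, (hs.turn2 x y z ht).resolve_right fun h => hy (hend y h), h⟩, hy⟩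
  have hdisj : Disjoint (cornerSet p c1 \ {c i, c j}) (cornerSet p c2 \ {c i, c j}) := by
    rw [Set.disjoint_left]
    rintro y ⟨⟨x, z, ⟨h, -, hy1, -⟩, -⟩, hy⟩ ⟨⟨x', z', ⟨h', -, hy2, -⟩, -⟩, -⟩
    exact hy (hend y (hs.common y ⟨h, hy1⟩ ⟨h', hy2⟩))
  have n3 := Set.ncard_union_eq hdisj (Set.toFinite _) (Set.toFinite _)
  have n4 := Set.ncard_le_ncard (Set.union_subset sub1 sub2) (Set.toFinite _)
  have q1 : c i ∈ cornerSet p c1 → c i ∈ cornerSet p c2 → c i ∈ cornerSet p c := fun h1 h2 =>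
    ⟨_, _, ⟨i, rfl, rfl, rfl⟩, hc.corner_of_corners hp hgp hT hpos hE hTH huv.1 (hpt _)
      (hs.first1.cr_pos hs.cyc1 h1) (hs.first2.cr_pos hs.cyc2 h2)⟩
  have q2 : c j ∈ cornerSet p c1 → c j ∈ cornerSet p c2 → c j ∈ cornerSet p c := fun h1 h2 =>
    ⟨_, _, ⟨j, rfl, rfl, rfl⟩, hc.corner_of_corners hp hgp hT hpos hE hTH huv.1.symm (hpt _)
      (hs.last2.cr_pos hs.cyc2 h2) (hs.last1.cr_pos hs.cyc1 h1)⟩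
  have m1 := ncard_eq_diff_pair (cornerSet p c1) huv.ne
  have m2 := ncard_eq_diff_pair (cornerSet p c2) huv.ne
  have m3 := ncard_eq_diff_pair (cornerSet p c) huv.ne
  -- Each part has at least three corners, while away from the ends the parts share out the corners
  -- of `c`, and each end contributes at most one more to the two parts than to `c`. This would give
  -- `6 ≤ 3 + 2`.
  split_ifs at m1 m2 m3 <;> first | omega | (exfalso; tauto)

theorem IsPseudoTriangulation.maximal [Nonempty V] (h : IsPseudoTriangulation p T) :
    Maximal (fun H : SimpleGraph V => IsNonCrossing p H ∧
        {v | IsPointed p H v} = {v | IsPointed p T v}) T := by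
  refine ⟨⟨h.nonCrossing, rfl⟩, ?_⟩
  rintro H ⟨hH, hHT⟩ hTH u v huv
  by_contra hnT
  -- The midpoint of the new edge lies in the convex hull but off the drawing of `T`, hence in a
  -- bounded face, for which the new edge is a chord.
  have hm : beside (p u) (p v) 0 ∉ drawing p T := by
    intro hd
    rcases mem_drawing.1 hd with ⟨w, hw⟩ | ⟨a, b, hab, hs⟩
    · exact beside_zero_ne_vertex hgp hp huv.ne w hw.symm
    · rcases edge_unique hgp hH huv (hTH hab) (beside_zero_mem_segment _ _) hs
        (beside_zero_ne_vertex hgp hp huv.ne) with ⟨rfl, rfl⟩ | ⟨rfl, rfl⟩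
      · exact hnT hab
      · exact hnT hab.symm
  have hcov : beside (p u) (p v) 0 ∈ convexHull ℝ (Set.range p) :=
    (convex_convexHull ℝ _).segment_subset (subset_convexHull _ _ (Set.mem_range_self u))
      (subset_convexHull _ _ (Set.mem_range_self v)) (beside_zero_mem_segment _ _)
  rw [← h.covers] at hcov
  obtain ⟨F, hF, hmF⟩ := hcov.resolve_left hm
  obtain ⟨k, c, hadj, hpt⟩ := h.faces F hF
  have : NeZero k := ⟨by have := hpt.1.three_le; omega⟩
  obtain ⟨c', hc', rfl, h3⟩ := hpt.exists_cyc hp hgp h.nonCrossing hadj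
  obtain ⟨⟨x, -, hx⟩, -⟩ := hF
  refine hc'.not_adj_inside hp hgp hH hTH ?_ h3 (fun w hw => ?_) u v ⟨huv, hmF⟩
  · intro y hy
    rw [hx] at hy
    exact connectedComponentIn_subset _ _ hy
  · have : w ∈ {v | IsPointed p T v} := hw
    rw [← hHT] at this
    exact this

end corners
end PseudoTriang

theorem mainTheorem10 {V : Type*} [Finite V] [Nonempty V]
    (p : V → PseudoTriang.Plane) (hp : Function.Injective p)
    (hgp : PseudoTriang.GeneralPosition p)
    (T : SimpleGraph V) (hT : PseudoTriang.IsNonCrossing p T) :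
    PseudoTriang.IsPseudoTriangulation p T ↔
      Maximal (fun H : SimpleGraph V => PseudoTriang.IsNonCrossing p H ∧
        {v | PseudoTriang.IsPointed p H v} = {v | PseudoTriang.IsPointed p T v}) T := by
  exact ⟨fun h => h.maximal hp hgp, PseudoTriang.IsPseudoTriangulation.of_maximal hp hgp hT⟩
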